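/- A sub-Riemannian manifold is a connected smooth manifold $M$ with a smooth subbundle $HM\subset TM$ (the horizontal bundle) that is bracket generating (the iterated brackets of at most $s$ sections of $HM$ span $TM$ at every point, for some $s$) and a smooth positive definite form $g$ on $HM$. It carries the Carnot--Carath\'eodory distance $$d(x,y)=\inf\{\delta>0 : \exists\,\gamma\in C^\infty([0,1];M),\ \gamma(0)=x,\ \gamma(1)=y,\ \dot\gamma\in HM,\ |\dot\gamma|_g\le\delta\}.$$ Function spaces. Fix a smooth volume $\mathrm{vol}$ on $M$, and let $\Omega\subset M$ be open. For a smooth $g$-orthonormal frame $X_1,\dots,X_s$ of $HM$ on an open set $U\subset\Omega$ and $I=(i_1,\dots,i_m)$ write $X^I=X_{i_1}\cdots X_{i_m}$ and $|I|=m$. * $u\in C^{k,\alpha}_{\mathrm H,\mathrm{loc}}(\Omega)$ if, for all such $U$ and all such frames, the derivatives $X^Iu$, $|I|\le k$ (taken along the flows of the fields), exist and are continuous on $U$, and for every compact $K\subset U$ $$\sup_{K}\sum_{|I|\le k-1}|X^Iu|^2+\sup_{x\ne y\in K}\frac{\sum_{|I|=k}|X^Iu(x)-X^Iu(y)|^2}{d(x,y)^{2\alpha}}<\infty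 .$$ * $u\in W^{k,p}_{\mathrm H,\mathrm{loc}}(\Omega)$ if, for all such $U$ and all such frames and all $\phi\in C_c^\infty(U)$, the distributional derivatives $X^I(u\phi)$, $|I|\le k$, are in $L^p(U,\mathrm{vol})$. ACC maps. Let $Q\in[1,\infty)$ (for example the Hausdorff dimension of $(M,d)$, if $\dim M\geq 1$ and that dimension is finite). A map $f:M\to N$ between sub-Riemannian manifolds is absolutely continuous on curves ($\mathrm{ACC}_Q$) if the family of those nonconstant compact rectifiable curves $\gamma$ of $M$, parametrized by arc length, along which $f\circ\gamma$ is not absolutely continuous has $Q$-modulus zero (with respect to $\mathrm{vol}$). Rectifiability, arc length and absolute continuity refer to the Carnot--Carath\'eodory distances of $M$ and $N$. **Proposition.** Let $M$ and $N$ be sub-Riemannian manifolds, $M$ endowed with a smooth volume, let $n=\dim N$ and let $r$ be the rank of $HN$. Let $f:M\to N$ be a continuous $\mathrm{ACC}_Q$ map, $Q\in[1,\infty)$. Let $y^1,\dots,y^n$ be smooth coordinates on an open set $V\subset N$ whose first $r$ components are horizontal, i.e. for some smooth frame $Y_1,\dots,Y_r$ of $HN$ on $V$ the matrix $(Y_iy^j)_{i,j=1}^r$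 is invertible at every point of $V$. Let $\Omega\subset M$ be open with $f(\Omega)\subset V$ ($\Omega=M$ if $f(M)\subset V$), and put $f^i=y^i\circ f$ on $\Omega$. Let $k\ge1$ be an integer, $\alpha\in(0,1)$ and $p\in[1,\infty)$. 1. If $f^1,\dots,f^r\in C^{k,\alpha}_{\mathrm H,\mathrm{loc}}(\Omega)$, then $f^1,\dots,f^n\in C^{k,\alpha}_{\mathrm H,\mathrm{loc}}(\Omega)$. 2. If $f^1,\dots,f^r\in W^{k,p}_{\mathrm H,\mathrm{loc}}(\Omega)$, then $f^1,\dots,f^n\in W^{k,p}_{\mathrm H,\mathrm{loc}}(\Omega)$. -/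

import Mathlib

open scoped Manifold ContDiff ENNReal NNReal Topology
open MeasureTheory Set

namespace SubRiem

section Structure

/-- Smoothness, on a set `U`, of a vector field on an `n`-dimensional manifold. -/
def SmoothFieldOn {n : ℕ} {M : Type*} [TopologicalSpace M]
    [ChartedSpace (EuclideanSpace ℝ (Fin n)) M] [IsManifold (𝓡 n) ∞ M]
    (X : ∀ q : M, TangentSpace (𝓡 n) q) (U : Set M) : Prop :=
  ContMDiffOn (𝓡 n) (𝓡 n).tangent ∞ (fun q => (⟨q, X q⟩ : TangentBundle (𝓡 n) M)) U

variable {n : ℕ} {M : Type*} [TopologicalSpace M]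
  [ChartedSpace (EuclideanSpace ℝ (Fin n)) M] [IsManifold (𝓡 n) ∞ M]

/-- `X₁, …, X_r` is a smooth frame, on `U`, of the distribution `H`. -/
def IsFrameOf {r : ℕ} (H : ∀ q : M, Submodule ℝ (TangentSpace (𝓡 n) q)) (U : Set M)
    (X : Fin r → ∀ q : M, H q) : Prop :=
  (∀ i, SmoothFieldOn (fun q => (X i q : TangentSpace (𝓡 n) q)) U) ∧
    ∀ q ∈ U, LinearIndependent ℝ (fun i => X i q) ∧
      Submodule.span ℝ (range fun i => X i q) = ⊤

/-- `IsIteratedBracket H l Z`: the field `Z` is an iterated bracket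
`[Y₁, [Y₂, [… [Y_{l-1}, Y_l]]]]` of `l` smooth sections `Y₁, …, Y_l` of the distribution `H`. -/
inductive IsIteratedBracket (H : ∀ q : M, Submodule ℝ (TangentSpace (𝓡 n) q)) :
    ℕ → (∀ q : M, TangentSpace (𝓡 n) q) → Prop
  | base (Y : ∀ q : M, TangentSpace (𝓡 n) q) (hY : SmoothFieldOn Y univ)
      (hH : ∀ q, Y q ∈ H q) : IsIteratedBracket H 1 Y
  | step (l : ℕ) (Y Z : ∀ q : M, TangentSpace (𝓡 n) q) (hY : SmoothFieldOn Y univ)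
      (hH : ∀ q, Y q ∈ H q) (hZ : IsIteratedBracket H l Z) :
      IsIteratedBracket H (l + 1) (VectorField.mlieBracket (𝓡 n) Y Z)

end Structure

/-- A sub-Riemannian structure of rank `r` on an `n`-dimensional smooth manifold `M`: a smooth
bracket generating subbundle of rank `r` of the tangent bundle, with a smooth positive definite
form on it. -/
structure SubRiemannian (n r : ℕ) (M : Type*) [TopologicalSpace M]
    [ChartedSpace (EuclideanSpace ℝ (Fin n)) M] [IsManifold (𝓡 n) ∞ M] where
  /-- the horizontal bundle -/
  H : ∀ q : M, Submodule ℝ (TangentSpace (𝓡 n) q)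
  exists_frame : ∀ p : M, ∃ U : Set M, IsOpen U ∧ p ∈ U ∧
    ∃ X : Fin r → ∀ q : M, H q, IsFrameOf H U X
  bracket_generating : ∃ s : ℕ, ∀ q : M,
    Submodule.span ℝ {v : TangentSpace (𝓡 n) q | ∃ l ≤ s, ∃ Z : ∀ q : M, TangentSpace (𝓡 n) q,
      IsIteratedBracket H l Z ∧ Z q = v} = ⊤
  /-- the sub-Riemannian metric -/
  g : ∀ q : M, H q →ₗ[ℝ] H q →ₗ[ℝ] ℝ
  g_symm : ∀ (q : M) (v w : H q), g q v w = g q w v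
  g_pos : ∀ (q : M) (v : H q), v ≠ 0 → 0 < g q v v
  g_smooth : ∀ (U : Set M) (X Y : ∀ q : M, H q), IsOpen U →
    SmoothFieldOn (fun q => (X q : TangentSpace (𝓡 n) q)) U →
    SmoothFieldOn (fun q => (Y q : TangentSpace (𝓡 n) q)) U →
    ContMDiffOn (𝓡 n) 𝓘(ℝ, ℝ) ∞ (fun q => g q (X q) (Y q)) U

section Basic

variable {n r : ℕ} {M : Type*} [TopologicalSpace M]
  [ChartedSpace (EuclideanSpace ℝ (Fin n)) M] [IsManifold (𝓡 n) ∞ M]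

/-- The rank of the horizontal bundle is at most the dimension. -/
theorem SubRiemannian.rank_le [Nonempty M] (S : SubRiemannian n r M) : r ≤ n := by
  obtain ⟨U, -, hp, X, -, hX⟩ := S.exists_frame (Classical.arbitrary M)
  have h := (hX _ hp).1.map' (S.H (Classical.arbitrary M)).subtype (Submodule.ker_subtype _)
  let v : Fin r → EuclideanSpace ℝ (Fin n) := fun i =>
    (X i (Classical.arbitrary M) : TangentSpace (𝓡 n) (Classical.arbitrary M))
  have h2 : LinearIndependent ℝ v := h
  simpa using h2.fintype_card_le_finrank

/-- A smooth frame of the horizontal bundle on `U` that is orthonormal at each point of `U`. -/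
def SubRiemannian.IsOrthonormalFrame (S : SubRiemannian n r M) (U : Set M)
    (X : Fin r → ∀ q : M, S.H q) : Prop :=
  IsFrameOf S.H U X ∧
    ∀ q ∈ U, ∀ i j, S.g q (X i q) (X j q) = if i = j then 1 else 0

/-- The Carnot–Carathéodory distance (it is `⊤` for points that no horizontal curve joins): the
infimum of the `δ` for which a smooth horizontal curve `γ` on `[0, 1]` with `|γ'| ≤ δ` goes
from `x` to `y`. -/
noncomputable def SubRiemannian.ccDist (S : SubRiemannian n r M) (x y : M) : ℝ≥0∞ :=
  ⨅ δ ∈ {δ : ℝ≥0 | ∃ γ : ℝ → M, ContMDiffOn 𝓘(ℝ, ℝ) (𝓡 n) ∞ γ (Icc 0 1) ∧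
      γ 0 = x ∧ γ 1 = y ∧ ∀ t ∈ Icc (0 : ℝ) 1, ∃ v : S.H (γ t),
        HasMFDerivWithinAt 𝓘(ℝ, ℝ) (𝓡 n) γ (Icc 0 1) t
          ((1 : ℝ →L[ℝ] ℝ).smulRight (v : TangentSpace (𝓡 n) (γ t))) ∧
        S.g (γ t) v v ≤ (δ : ℝ) ^ 2},
    (δ : ℝ≥0∞)

/-- The derivative `(X w)(q)` of a smooth function `w` along a vector field. -/
noncomputable def dirDeriv (X : ∀ q : M, TangentSpace (𝓡 n) q) (w : M → ℝ) (q : M) : ℝ :=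
  mfderiv (𝓡 n) 𝓘(ℝ, ℝ) w q (X q)

/-- The coordinates `y = (y¹, …, yⁿ)` are such that `y¹, …, y^r` are horizontal with respect to
the frame `X₁, …, X_r` on the domain of `y`: the matrix `(X_i y^j)`, `i, j ≤ r`, is invertible
at each point. -/
def SubRiemannian.IsHorizontalCoordinates [Nonempty M] (S : SubRiemannian n r M)
    (y : OpenPartialHomeomorph M (EuclideanSpace ℝ (Fin n)))
    (X : Fin r → ∀ q : M, S.H q) : Prop :=
  IsFrameOf S.H y.source X ∧
    ∀ q ∈ y.source, IsUnit (Matrix.of fun i j : Fin r =>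
      dirDeriv (fun q => (X i q : TangentSpace (𝓡 n) q))
        (fun q' => y q' (Fin.castLE S.rank_le j)) q)

/-- `μ` is a smooth volume: in every smooth coordinate system it has a smooth positive density
with respect to Lebesgue measure. -/
def IsSmoothVolume [MeasurableSpace M] (μ : Measure M) : Prop :=
  ∀ e ∈ IsManifold.maximalAtlas (𝓡 n) ∞ M, ∃ dens : EuclideanSpace ℝ (Fin n) → ℝ,
    ContDiffOn ℝ ∞ dens e.target ∧ (∀ x ∈ e.target, 0 < dens x) ∧
      (μ.restrict e.source).map e =
        (volume.restrict e.target).withDensity fun x => ENNReal.ofReal (dens x)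

end Basic

section Curves

/-- The length of the curve `γ` on `[a, b]` for the distance `d`. -/
noncomputable def curveLength {M : Type*} (d : M → M → ℝ≥0∞) (γ : ℝ → M) (a b : ℝ) : ℝ≥0∞ :=
  ⨆ (m : ℕ) (t : ℕ → ℝ) (_ : Monotone t ∧ ∀ i, t i ∈ Icc a b),
    ∑ i ∈ Finset.range m, d (γ (t i)) (γ (t (i + 1)))

/-- `γ : [0, L] → M` is a (nonconstant, compact) rectifiable curve parametrized by arc length. -/
def IsArcLengthCurve {M : Type*} (d : M → M → ℝ≥0∞) (L : ℝ) (γ : ℝ → M) : Prop :=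
  0 < L ∧ ∀ a b : ℝ, 0 ≤ a → a ≤ b → b ≤ L → curveLength d γ a b = ENNReal.ofReal (b - a)

/-- Absolute continuity of `γ : [0, L] → M` for the distance `d`. -/
def IsAbsolutelyContinuous {M : Type*} (d : M → M → ℝ≥0∞) (L : ℝ) (γ : ℝ → M) : Prop :=
  ∀ ε : ℝ, 0 < ε → ∃ δ : ℝ, 0 < δ ∧ ∀ (m : ℕ) (a b : Fin m → ℝ),
    (∀ i, 0 ≤ a i ∧ a i ≤ b i ∧ b i ≤ L) →
    (∀ i j, i ≠ j → Disjoint (Ioo (a i) (b i)) (Ioo (a j) (b j))) →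
    ∑ i, (b i - a i) < δ → ∑ i, d (γ (a i)) (γ (b i)) < ENNReal.ofReal ε

/-- The `Q`-modulus of a family of curves `γ : [0, L] → M` parametrized by arc length. -/
noncomputable def modulus {M : Type*} [MeasurableSpace M] (μ : Measure M) (Q : ℝ)
    (Γ : Set (ℝ × (ℝ → M))) : ℝ≥0∞ :=
  ⨅ ρ ∈ {ρ : M → ℝ≥0∞ | Measurable ρ ∧ ∀ c ∈ Γ, 1 ≤ ∫⁻ s in Icc 0 c.1, ρ (c.2 s)},
    ∫⁻ q, ρ q ^ Q ∂μ

variable {m k n r : ℕ} {M N : Type*}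
  [TopologicalSpace M] [ChartedSpace (EuclideanSpace ℝ (Fin m)) M] [IsManifold (𝓡 m) ∞ M]
  [TopologicalSpace N] [ChartedSpace (EuclideanSpace ℝ (Fin n)) N] [IsManifold (𝓡 n) ∞ N]

/-- `f` is absolutely continuous on curves (`ACC_Q`): apart from a family of `Q`-modulus zero, `f`
is absolutely continuous along each compact rectifiable curve, parametrized by arc length. Lengths
and absolute continuity refer to the Carnot–Carathéodory distances of `M` and `N`. -/
def IsACC [MeasurableSpace M] (S : SubRiemannian m k M) (T : SubRiemannian n r N)
    (μ : Measure M) (Q : ℝ) (f : M → N) : Prop :=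
  modulus μ Q {c | IsArcLengthCurve S.ccDist c.1 c.2 ∧
    ¬ IsAbsolutelyContinuous T.ccDist c.1 (f ∘ c.2)} = 0

end Curves

section FunctionSpaces

variable {n r : ℕ} {M : Type*} [TopologicalSpace M]
  [ChartedSpace (EuclideanSpace ℝ (Fin n)) M] [IsManifold (𝓡 n) ∞ M]

/-- The function `u`, not necessarily smooth, has at `p` the derivative `c` along (the flow of)
the vector field `X`. -/
def HasDerivAlong (X : ∀ q : M, TangentSpace (𝓡 n) q) (u : M → ℝ) (p : M) (c : ℝ) : Prop :=
  ∀ γ : ℝ → M, γ 0 = p → IsMIntegralCurveAt γ X 0 → HasDerivAt (u ∘ γ) c 0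

/-- The class `C^{k,α}_{H,loc}(Ω)`. For a local orthonormal frame `X` on an open `U ⊆ Ω`,
`v [i₁, …, i_m]` is the derivative `X_{i₁} ⋯ X_{i_m} u`. These derivatives are to be continuous for
`m ≤ k`, and on compact sets those with `m ≤ k - 1` bounded and those with `m = k` Hölder
continuous of exponent `α` for the Carnot–Carathéodory distance. -/
def SubRiemannian.MemHolderLoc (S : SubRiemannian n r M) (k : ℕ) (α : ℝ) (Ω : Set M)
    (u : M → ℝ) : Prop :=
  ∀ (U : Set M) (X : Fin r → ∀ q : M, S.H q), IsOpen U → U ⊆ Ω → S.IsOrthonormalFrame U X →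
    ∃ v : List (Fin r) → M → ℝ, v [] = u ∧
      (∀ I : List (Fin r), I.length < k → ∀ i, ∀ p ∈ U,
        HasDerivAlong (fun q => (X i q : TangentSpace (𝓡 n) q)) (v I) p (v (i :: I) p)) ∧
      (∀ I : List (Fin r), I.length ≤ k → ContinuousOn (v I) U) ∧
      ∀ K : Set M, IsCompact K → K ⊆ U → ∃ C : ℝ≥0,
        (∀ I : List (Fin r), I.length + 1 ≤ k → ∀ p ∈ K, |v I p| ≤ C) ∧
        ∀ I : List (Fin r), I.length = k → ∀ p ∈ K, ∀ q ∈ K,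
          ENNReal.ofReal |v I p - v I q| ≤ C * S.ccDist p q ^ α

/-- `φ ∈ C^∞_c(U)`. -/
def IsTestFunction (U : Set M) (φ : M → ℝ) : Prop :=
  ContMDiff (𝓡 n) 𝓘(ℝ, ℝ) ∞ φ ∧ HasCompactSupport φ ∧ tsupport φ ⊆ U

/-- `v = X u` on `U` in the sense of distributions: `∫ u X^*φ = ∫ v φ` for `φ ∈ C^∞_c(U)`. Here
`ψ = X^*φ` is the function in `C^∞_c(U)` determined by `∫ ψ w = ∫ φ X w` for all
`w ∈ C^∞_c(U)`. -/
def HasWeakDeriv [MeasurableSpace M] (μ : Measure M) (U : Set M)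
    (X : ∀ q : M, TangentSpace (𝓡 n) q) (u v : M → ℝ) : Prop :=
  ∀ φ ψ : M → ℝ, IsTestFunction (n := n) U φ → IsTestFunction (n := n) U ψ →
    (∀ w : M → ℝ, IsTestFunction (n := n) U w →
      ∫ q, ψ q * w q ∂μ = ∫ q, φ q * dirDeriv X w q ∂μ) →
    ∫ q, u q * ψ q ∂μ = ∫ q, v q * φ q ∂μ

/-- The space `W^{k,p}_H(U)` with respect to a frame `X` on `U`: the distributional derivatives
`v [i₁, …, i_m] = X_{i₁} ⋯ X_{i_m} u` with `m ≤ k` are in `L^p(U)`. -/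
def SubRiemannian.MemSobolev [MeasurableSpace M] (S : SubRiemannian n r M) (μ : Measure M)
    (k : ℕ) (p : ℝ) (U : Set M) (X : Fin r → ∀ q : M, S.H q) (u : M → ℝ) : Prop :=
  ∃ v : List (Fin r) → M → ℝ, v [] = u ∧
    (∀ I : List (Fin r), I.length < k → ∀ i,
      HasWeakDeriv μ U (fun q => (X i q : TangentSpace (𝓡 n) q)) (v I) (v (i :: I))) ∧
    ∀ I : List (Fin r), I.length ≤ k → MemLp (v I) (ENNReal.ofReal p) (μ.restrict U)

/-- The space `W^{k,p}_{H,loc}(Ω)`: for each local orthonormal frame `X` on an open `U ⊆ Ω` and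
each `φ ∈ C^∞_c(U)` the product `u φ` is in `W^{k,p}_H(U)`. -/
def SubRiemannian.MemSobolevLoc [MeasurableSpace M] (S : SubRiemannian n r M) (μ : Measure M)
    (k : ℕ) (p : ℝ) (Ω : Set M) (u : M → ℝ) : Prop :=
  ∀ (U : Set M) (X : Fin r → ∀ q : M, S.H q), IsOpen U → U ⊆ Ω → S.IsOrthonormalFrame U X →
    ∀ φ : M → ℝ, IsTestFunction (n := n) U φ → S.MemSobolev μ k p U X (fun q => u q * φ q)

end FunctionSpaces

end SubRiem

/-!
On the horizontal bundle of `N` the differentials of all coordinates are combinations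
`dy^j = ∑_{l ≤ r} G_{jl} dy^l` with smooth coefficients, because the matrix `Y_i y^l` is invertible
(`SubRiemannian.IsHorizontalCoordinates.exists_coeff`). The theorem follows once these relations
are pulled back by `f` to
`X_i f^j = ∑_{l ≤ r} (G_{jl} ∘ f) X_i f^l`   (1)
for every frame field `X_i` of `M`: the right side has as many derivatives as
`f^1, …, f^r` allow and as `f^1, …, f^n` are already known to have, so the regularity of all
components is raised one order at a time (`CalculusRules.tower_of_horizontal`). A `Tower` consists
of iterated derivatives, each in the class that belongs to its order; the induction needs only that
these classes obey the rules of calculus collected in `CalculusRules`.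

*The relation (1).* A function that satisfies `dy^j = ∑ G_{jl} dy^l` on `HN` has, between points at
small Carnot–Carathéodory distance `d`, an increment that differs from `∑ G_{jl} Δy^l` by at most a
constant times `d^2` (`SubRiemannian.IsHorizontalCombination.exists_abs_sub_sum_le`). Along a curve
on which `f` is absolutely continuous for the Carnot–Carathéodory distance this becomes an integral
identity for `y^j ∘ f` (`SubRiemannian.IsHorizontalCombination.sub_eq_integral`). Integral curves of
an orthonormal frame are parametrised by arc length (`isArcLengthCurve_of_integralCurve`), and a
family of them that starts from a set of positive measure has positive `Q`-modulus; hence `f` is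
absolutely continuous on almost all flow lines (`IsACC.ae_isAbsolutelyContinuous`). Integration over
the flow gives (1) for weak derivatives (`FlowBox.weakDeriv_of_horizontal`), and by continuity for
derivatives along the flow (`IsACC.hasDerivAlong_of_horizontal`).

*Hölder classes.* A function with continuous horizontal derivatives is locally Lipschitz for
the distance (`exists_abs_sub_le_ccDist`), which makes `C^{k,α}_H` closed under products.

*Sobolev classes.* Products require the intermediate derivatives of a bounded function with `k`
derivatives in `L^p`: those of order `a` are in `L^{kp/a}`. The Gagliardo–Nirenberg
inequality behind this comes from the flow of a single field: `X u` differs from a difference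
quotient of `u` along the flow by at most an average of `X² u` (`IsFlow.exists_eLpNorm_le`).
A Jacobi iteration turns this interpolation between consecutive orders into the full scale without
assuming beforehand that its norms are finite (`lt_top_of_interpolation`, `LpLoc.of_family`).
The product and chain rules for weak derivatives rest on Friedrichs' lemma
(`WeakDeriv.tendsto_fderiv_mollify`). All this takes place in charts;
`FlowBox.weakDeriv_of_hasWeakDeriv` and `FlowBox.hasWeakDeriv_chartLift` translate from and to the
manifold, and a partition of unity globalises.
-/


open Filter Metric
open ENNReal (mul_lt_top coe_lt_top add_lt_top toReal_mono toReal_mul toReal_nonneg ofReal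
  ofReal_lt_top mul_ne_top ofReal_ne_top toReal_ofReal toReal_pos ofReal_le_ofReal ofReal_toReal
  ofReal_mul toReal_le_of_le_ofReal ofReal_add coe_ne_top ofReal_pos one_rpow
  ofReal_rpow_of_nonneg toReal_inv mul_top mul_rpow_of_nonneg inv_le_inv toReal_lt_toReal
  ofReal_coe_nnreal)
open Finset (mul_sum sum_congr single_le_sum sum_mul sum_nonneg sum_comm sum_sub_distrib
  sum_le_sum sum_range_sub)
open Real (sq_sqrt mul_rpow zero_rpow div_rpow rpow_add exp exp_pos norm_eq_abs norm_of_nonneg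
  dist_eq volume_Icc rpow_nonneg toNNReal)
open intervalIntegral (continuousOn_primitive_interval' integral_of_le integral_mono_on
  integral_add_adjacent_intervals integral_same integral_interval_sub_left integral_congr
  integral_congr_ae_restrict)

namespace SubRiem

/-! ### Towers of iterated derivatives -/

section Tower

variable {ι α : Type*}

/-- `Tower D P t a u`: the function `u` has iterated derivatives of every order `≤ t` with respect
to the relations `D i` ("`u'` is the derivative of `u` along the `i`-th field"), and those of order
`l` satisfy `P (a + l)`. The index `a` is the order that `u` itself is counted with. -/
def Tower (D : ι → (α → ℝ) → (α → ℝ) → Prop) (P : ℕ → (α → ℝ) → Prop) :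
    ℕ → ℕ → (α → ℝ) → Prop
  | 0, a, u => P a u
  | t + 1, a, u => P a u ∧ ∀ i, ∃ u', D i u u' ∧ Tower D P t (a + 1) u'

variable {D : ι → (α → ℝ) → (α → ℝ) → Prop} {P : ℕ → (α → ℝ) → Prop}

theorem Tower.base {t a : ℕ} {u : α → ℝ} (h : Tower D P t a u) : P a u := by
  cases t with
  | zero => exact h
  | succ t => exact h.1

theorem Tower.of_succ {t a : ℕ} {u : α → ℝ} (h : Tower D P (t + 1) a u) : Tower D P t a u := by
  induction t generalizing a u with
  | zero => exact h.1
  | succ t ih =>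
    refine ⟨h.1, fun i => ?_⟩
    obtain ⟨u', h1, h2⟩ := h.2 i
    exact ⟨u', h1, ih h2⟩

theorem Tower.of_le {t t' a : ℕ} {u : α → ℝ} (htt : t ≤ t') (h : Tower D P t' a u) :
    Tower D P t a u := by
  induction htt with
  | refl => exact h
  | step _ ih => exact ih h.of_succ

theorem Tower.imp {D' : ι → (α → ℝ) → (α → ℝ) → Prop} {P' : ℕ → (α → ℝ) → Prop}
    {t a : ℕ} {u : α → ℝ} (h : Tower D P t a u)
    (hD : ∀ i u u', D i u u' → D' i u u') (hP : ∀ l u, a ≤ l → l ≤ a + t → P l u → P' l u) :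
    Tower D' P' t a u := by
  induction t generalizing a u with
  | zero => exact hP a u le_rfl le_rfl h
  | succ t ih =>
    refine ⟨hP a u le_rfl (by omega) h.1, fun i => ?_⟩
    obtain ⟨u', h1, h2⟩ := h.2 i
    exact ⟨u', hD _ _ _ h1, ih h2 fun l w h3 h4 => hP l w (by omega) (by omega)⟩

/-- A tower amounts to a family of functions indexed by words. -/
theorem Tower.exists_family {t a : ℕ} {u : α → ℝ} (h : Tower D P t a u) :
    ∃ v : List ι → α → ℝ, v [] = u ∧
      (∀ I : List ι, I.length < t → ∀ i, D i (v I) (v (i :: I))) ∧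
      ∀ I : List ι, I.length ≤ t → P (a + I.length) (v I) := by
  induction t generalizing a u with
  | zero =>
    refine ⟨fun _ => u, rfl, by simp, fun I hI => ?_⟩
    have : I.length = 0 := by omega
    simpa [this, Tower] using h
  | succ t ih =>
    choose w hw1 hw2 using h.2
    choose v hv0 hvD hvP using fun i => ih (hw2 i)
    -- the last letter of a word is the first field to be applied
    let V : List ι → α → ℝ := fun I =>
      if hI : I = [] then u else v (I.getLast hI) I.dropLast
    have hV : ∀ (I : List ι) (i : ι), V (I ++ [i]) = v i I := by
      intro I i
      simp [V]
    refine ⟨V, by simp [V], fun I hI i => ?_, fun I hI => ?_⟩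
    · rcases List.eq_nil_or_concat' I with rfl | ⟨I', l, rfl⟩
      · have h1 : V [i] = v i [] := hV [] i
        have h2 : V [] = u := by simp [V]
        rw [h1, h2, hv0]
        exact hw1 i
      · rw [← List.cons_append, hV, hV]
        apply hvD
        simpa using hI
    · rcases List.eq_nil_or_concat' I with rfl | ⟨I', l, rfl⟩
      · have h2 : V [] = u := by simp [V]
        rw [h2]
        exact h.1
      · rw [hV]
        have h3 := hvP l I' (by simpa using hI)
        simp only [List.length_append, List.length_singleton]
        rwa [show a + (I'.length + 1) = a + 1 + I'.length by omega]

theorem Tower.of_family {t a : ℕ} (v : List ι → α → ℝ)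
    (hD : ∀ I : List ι, I.length < t → ∀ i, D i (v I) (v (i :: I)))
    (hP : ∀ I : List ι, I.length ≤ t → P (a + I.length) (v I)) : Tower D P t a (v []) := by
  induction t generalizing a v with
  | zero => simpa [Tower] using hP [] (by simp)
  | succ t ih =>
    refine ⟨by simpa using hP [] (by simp), fun i => ⟨v [i], hD [] (by simp) i, ?_⟩⟩
    have := ih (a := a + 1) (fun I => v (I ++ [i])) (fun I hI l => ?_) (fun I hI => ?_)
    · simpa using this
    · simpa using hD (I ++ [i]) (by simpa using hI) l
    · have h3 := hP (I ++ [i]) (by simpa using hI)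
      simp only [List.length_append, List.length_singleton] at h3
      rwa [show a + 1 + I.length = a + (I.length + 1) by omega]

/-- The rules of calculus that make the functions with towers of height `≤ k` an algebra: sums,
products and their derivatives. The class `P a` is the one of functions of order `a`, so that a
product of functions of orders `a` and `b` has order `a + b`. -/
structure CalculusRules (D : ι → (α → ℝ) → (α → ℝ) → Prop) (P : ℕ → (α → ℝ) → Prop) (k : ℕ) :
    Prop where
  zero : ∀ a ≤ k, P a 0
  add : ∀ a ≤ k, ∀ u w, P a u → P a w → P a (u + w)
  mul : ∀ a b, a + b ≤ k → ∀ u w, P a u → P b w → P (a + b) (u * w)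
  deriv_zero : ∀ i, D i 0 0
  deriv_add : ∀ i a, a + 1 ≤ k → ∀ u w u' w', P a u → P a w → P (a + 1) u' → P (a + 1) w' →
    D i u u' → D i w w' → D i (u + w) (u' + w')
  deriv_mul : ∀ i a b, a + b + 1 ≤ k → ∀ u w u' w', P a u → P b w → P (a + 1) u' →
    P (b + 1) w' → D i u u' → D i w w' → D i (u * w) (u' * w + u * w')

variable {k : ℕ}

theorem CalculusRules.tower_zero (R : CalculusRules D P k) {t a : ℕ} (h : a + t ≤ k) :
    Tower D P t a 0 := by
  induction t generalizing a with
  | zero => exact R.zero a (by omega)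
  | succ t ih => exact ⟨R.zero a (by omega), fun i => ⟨0, R.deriv_zero i, ih (by omega)⟩⟩

theorem CalculusRules.tower_add (R : CalculusRules D P k) {t a : ℕ} (h : a + t ≤ k)
    {u w : α → ℝ} (hu : Tower D P t a u) (hw : Tower D P t a w) : Tower D P t a (u + w) := by
  induction t generalizing a u w with
  | zero => exact R.add a (by omega) u w hu hw
  | succ t ih =>
    refine ⟨R.add a (by omega) u w hu.1 hw.1, fun i => ?_⟩
    obtain ⟨u', hu1, hu2⟩ := hu.2 i
    obtain ⟨w', hw1, hw2⟩ := hw.2 i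
    exact ⟨u' + w', R.deriv_add i a (by omega) u w u' w' hu.1 hw.1 hu2.base hw2.base hu1 hw1,
      ih (by omega) hu2 hw2⟩

theorem CalculusRules.tower_sum (R : CalculusRules D P k) {t a : ℕ} (h : a + t ≤ k)
    {κ : Type*} (s : Finset κ) {u : κ → α → ℝ} (hu : ∀ l ∈ s, Tower D P t a (u l)) :
    Tower D P t a (∑ l ∈ s, u l) := by
  classical
  induction s using Finset.induction_on with
  | empty => simpa using R.tower_zero h
  | insert l s hl ih =>
    rw [Finset.sum_insert hl]
    exact R.tower_add h (hu l (by simp)) (ih fun l' hl' => hu l' (by simp [hl']))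

theorem CalculusRules.tower_mul (R : CalculusRules D P k) {t a b : ℕ} (h : a + b + t ≤ k)
    {u w : α → ℝ} (hu : Tower D P t a u) (hw : Tower D P t b w) :
    Tower D P t (a + b) (u * w) := by
  induction t generalizing a b u w with
  | zero => exact R.mul a b (by omega) u w hu hw
  | succ t ih =>
    refine ⟨R.mul a b (by omega) u w hu.1 hw.1, fun i => ?_⟩
    obtain ⟨u', hu1, hu2⟩ := hu.2 i
    obtain ⟨w', hw1, hw2⟩ := hw.2 i
    refine ⟨u' * w + u * w',
      R.deriv_mul i a b (by omega) u w u' w' hu.1 hw.1 hu2.base hw2.base hu1 hw1,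
      R.tower_add (by omega) ?_ ?_⟩
    · have := ih (a := a + 1) (b := b) (by omega) hu2 hw.of_succ
      rwa [show a + 1 + b = a + b + 1 by omega] at this
    · exact ih (a := a) (b := b + 1) (by omega) hu.of_succ hw2

/-- If the derivatives of all the `f j` are combinations, with coefficients in a class `𝒞` of
"smooth functions of `f`", of the derivatives of the `f (J l)`, then the `f j` inherit the
towers of the `f (J l)`. The height of the towers of the `f j` is raised one step at a time. -/
theorem CalculusRules.tower_of_horizontal (R : CalculusRules D P k) {n r : ℕ}
    (f : Fin n → α → ℝ) (J : Fin r → Fin n) (𝒞 : Set (α → ℝ))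
    (h𝒞 : ∀ c ∈ 𝒞, P 0 c ∧ ∃ c' : Fin n → α → ℝ, (∀ m, c' m ∈ 𝒞) ∧
      ∀ i, ∀ g : Fin n → α → ℝ, 1 ≤ k → (∀ m, D i (f m) (g m) ∧ P 1 (g m)) →
        D i c (∑ m, c' m * g m))
    (hf : ∀ j, P 0 (f j)) (G : Fin n → Fin r → α → ℝ) (hG : ∀ j l, G j l ∈ 𝒞)
    (hder : ∀ i, ∀ g : Fin r → α → ℝ, 1 ≤ k → (∀ l, D i (f (J l)) (g l) ∧ P 1 (g l)) →
      ∀ j, D i (f j) (∑ l, G j l * g l))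
    (hbase : ∀ l, Tower D P k 0 (f (J l))) (j : Fin n) : Tower D P k 0 (f j) := by
  have hcomp : ∀ t ≤ k, (∀ m, Tower D P t 0 (f m)) → ∀ c ∈ 𝒞, Tower D P t 0 c := by
    intro t
    induction t with
    | zero => exact fun _ _ c hc => (h𝒞 c hc).1
    | succ t ih =>
      intro ht hfm c hc
      obtain ⟨h0, c', hc', hD⟩ := h𝒞 c hc
      refine ⟨h0, fun i => ?_⟩
      choose g hg1 hg2 using fun m => (hfm m).2 i
      refine ⟨∑ m, c' m * g m, hD i g (by omega) fun m => ⟨hg1 m, (hg2 m).base⟩,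
        R.tower_sum (by omega) _ fun m _ => ?_⟩
      have := R.tower_mul (a := 0) (b := 1) (by omega)
        (ih (by omega) (fun m => (hfm m).of_succ) (c' m) (hc' m)) (hg2 m)
      simpa using this
  have main : ∀ t ≤ k, ∀ j, Tower D P t 0 (f j) := by
    intro t
    induction t with
    | zero => exact fun _ j => hf j
    | succ t ih =>
      intro ht j
      refine ⟨hf j, fun i => ?_⟩
      have hb : ∀ l, Tower D P (t + 1) 0 (f (J l)) := fun l => (hbase l).of_le ht
      choose g hg1 hg2 using fun l => (hb l).2 i
      refine ⟨∑ l, G j l * g l, hder i g (by omega) (fun l => ⟨hg1 l, (hg2 l).base⟩) j,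
        R.tower_sum (by omega) _ fun l _ => ?_⟩
      have := R.tower_mul (a := 0) (b := 1) (by omega)
        (hcomp t (by omega) (fun m => ih (by omega) m) (G j l) (hG j l)) (hg2 l)
      simpa using this
  exact main k le_rfl j

end Tower

/-! ### Interpolation along a chain of inequalities -/

section Chain

/-- The sum of a chain of interpolation inequalities: a term is at most a small multiple of the
next one. -/
theorem exists_le_mul_succ_add (D M : ℝ) (hD : 0 ≤ D) (j : ℕ) :
    ∀ ε > 0, ∃ C : ℝ, ∀ x : ℕ → ℝ, (∀ i, 0 ≤ x i) → x 0 ≤ M →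
      (∀ i < j, x (i + 1) ≤ D * (√(x i * x (i + 2)) + x i)) → x j ≤ ε * x (j + 1) + C := by
  induction j with
  | zero =>
    intro ε hε
    exact ⟨M, fun x hx hM _ => by nlinarith [mul_nonneg hε.le (hx 1)]⟩
  | succ j ih =>
    intro ε hε
    set B : ℝ := D ^ 2 / (2 * ε) + D with hB
    have hB0 : 0 ≤ B := by positivity
    obtain ⟨C, hC⟩ := ih (1 / (2 * (B + 1))) (by positivity)
    refine ⟨2 * B * |C|, fun x hx hM hstep => ?_⟩
    have h1 := hC x hx hM fun i hi => hstep i (by omega)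
    have h2 := hstep j (by omega)
    have h3 : D * √(x j * x (j + 2)) ≤ ε / 2 * x (j + 2) + D ^ 2 / (2 * ε) * x j := by
      rw [Real.sqrt_mul (hx j)]
      have ha := sq_sqrt (hx j)
      have hb := sq_sqrt (hx (j + 2))
      have hsq := sq_nonneg (ε * √(x (j + 2)) - D * √(x j))
      have : ε / 2 * x (j + 2) + D ^ 2 / (2 * ε) * x j - D * (√(x j) * √(x (j + 2)))
          = (ε * √(x (j + 2)) - D * √(x j)) ^ 2 / (2 * ε) := by
        rw [sub_sq, mul_pow, mul_pow, ha, hb]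
        field_simp
        ring
      have h4 : 0 ≤ (ε * √(x (j + 2)) - D * √(x j)) ^ 2 / (2 * ε) := by positivity
      linarith
    have h4 : x (j + 1) ≤ ε / 2 * x (j + 2) + B * x j := by
      rw [hB]
      linarith
    have h5 : B * (1 / (2 * (B + 1)) * x (j + 1)) ≤ 1 / 2 * x (j + 1) := by
      rw [← mul_assoc]
      apply mul_le_mul_of_nonneg_right _ (hx _)
      rw [mul_one_div, div_le_div_iff₀ (by positivity) (by norm_num)]
      linarith
    have h6 : B * x j ≤ B * (1 / (2 * (B + 1)) * x (j + 1)) + B * |C| := by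
      rw [← mul_add]
      exact mul_le_mul_of_nonneg_left (h1.trans (by linarith [le_abs_self C])) hB0
    have h7 : x (j + 1) ≤ ε * x (j + 2) + 2 * B * |C| := by linarith
    exact h7

theorem exists_bound_of_chain (D M T : ℝ) (hD : 0 ≤ D) (k : ℕ) :
    ∃ R : ℝ, ∀ x : ℕ → ℝ, (∀ i, 0 ≤ x i) → x 0 ≤ M → x k ≤ T →
      (∀ i, i + 2 ≤ k → x (i + 1) ≤ D * (√(x i * x (i + 2)) + x i)) → ∀ j ≤ k, x j ≤ R := by
  choose C hC using fun j => exists_le_mul_succ_add D M hD j 1 one_pos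
  refine ⟨T + ∑ j ∈ Finset.range k, |C j|, fun x hx hM hT hstep => ?_⟩
  have key : ∀ d ≤ k, x (k - d) ≤ T + ∑ j ∈ Finset.Ico (k - d) k, |C j| := by
    intro d
    induction d with
    | zero => intro _; simpa using hT
    | succ d ih =>
      intro hd
      have h1 := hC (k - (d + 1)) x hx hM fun i hi => hstep i (by omega)
      have h2 := ih (by omega)
      rw [show k - (d + 1) + 1 = k - d by omega] at h1
      rw [← Finset.add_sum_Ioo_eq_sum_Ico (a := k - (d + 1)) (by omega)]
      have h3 : Finset.Ioo (k - (d + 1)) k = Finset.Ico (k - d) k := by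
        ext i; simp only [Finset.mem_Ioo, Finset.mem_Ico]; omega
      rw [h3]
      linarith [le_abs_self (C (k - (d + 1)))]
  intro j hj
  have h1 := key (k - j) (by omega)
  rw [show k - (k - j) = j by omega] at h1
  refine h1.trans ?_
  gcongr
  intro i
  simp only [Finset.mem_Ico, Finset.mem_range]
  omega

/-- Jacobi iteration for the reciprocal exponents: the `i`-th iterate at `j`. -/
noncomputable def jacobi (q : ℝ) (k : ℕ) : ℕ → ℕ → ℝ
  | 0, j => if j = 0 then 0 else q
  | i + 1, j => if j = 0 then 0 else if k ≤ j then q else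
      (jacobi q k i (j - 1) + jacobi q k i (j + 1)) / 2

section

variable {q : ℝ} {k : ℕ}

theorem jacobi_zero_right (i : ℕ) : jacobi q k i 0 = 0 := by
  cases i <;> simp [jacobi]

theorem jacobi_of_le (hk : 1 ≤ k) (i : ℕ) {j : ℕ} (hj : k ≤ j) : jacobi q k i j = q := by
  have : j ≠ 0 := by omega
  cases i <;> simp [jacobi, this, hj]

theorem jacobi_step (i : ℕ) {j : ℕ} (hj : j + 2 ≤ k) :
    jacobi q k (i + 1) (j + 1) = (jacobi q k i j + jacobi q k i (j + 2)) / 2 := by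
  have : ¬ k ≤ j + 1 := by omega
  simp [jacobi, this]

theorem jacobi_mono (hq : 0 < q) (hk : 1 ≤ k) (i : ℕ) : Monotone (jacobi q k i) ∧
    (∀ j, 0 ≤ jacobi q k i j) ∧ (∀ j, jacobi q k i j ≤ q) ∧ ∀ j, 1 ≤ j → 0 < jacobi q k i j := by
  induction i with
  | zero =>
    refine ⟨monotone_nat_of_le_succ fun j => ?_, fun j => ?_, fun j => ?_, fun j hj => ?_⟩
    · simp only [jacobi]; split_ifs <;> simp_all; linarith
    · simp only [jacobi]; split_ifs <;> linarith
    · simp only [jacobi]; split_ifs <;> linarith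
    · simp only [jacobi]; split_ifs; exacts [absurd hj (by omega), hq]
  | succ i ih =>
    obtain ⟨hm, h0, h1, hp⟩ := ih
    have hb0 : ∀ j, 0 ≤ jacobi q k (i + 1) j := by
      intro j; simp only [jacobi]; split_ifs
      · exact le_rfl
      · exact hq.le
      · linarith [h0 (j - 1), h0 (j + 1)]
    have hb1 : ∀ j, jacobi q k (i + 1) j ≤ q := by
      intro j; simp only [jacobi]; split_ifs
      · exact hq.le
      · exact le_rfl
      · linarith [h1 (j - 1), h1 (j + 1)]
    refine ⟨monotone_nat_of_le_succ fun j => ?_, hb0, hb1, fun j hj => ?_⟩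
    · rcases Nat.eq_zero_or_pos j with rfl | hj
      · rw [jacobi_zero_right]; exact hb0 1
      by_cases hjk : k ≤ j + 1
      · rw [jacobi_of_le hk (i + 1) hjk]; exact hb1 j
      · obtain ⟨j, rfl⟩ : ∃ j', j = j' + 1 := ⟨j - 1, by omega⟩
        rw [jacobi_step i (by omega), jacobi_step i (by omega)]
        have := hm (show j ≤ j + 1 by omega)
        have := hm (show j + 2 ≤ j + 1 + 2 by omega)
        linarith
    · simp only [jacobi]; split_ifs
      · omega
      · exact hq
      · linarith [h0 (j - 1), hp (j + 1) (by omega)]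

theorem jacobi_antitone (hq : 0 < q) (hk : 1 ≤ k) (j : ℕ) : Antitone fun i => jacobi q k i j := by
  have key : ∀ i, ∀ j, jacobi q k (i + 1) j ≤ jacobi q k i j := by
    intro i
    induction i with
    | zero =>
      intro j
      rcases Nat.eq_zero_or_pos j with rfl | hj
      · simp [jacobi_zero_right]
      · refine ((jacobi_mono hq hk 1).2.2.1 j).trans ?_
        have : j ≠ 0 := by omega
        simp [jacobi, this]
    | succ i ih =>
      intro j
      rcases Nat.eq_zero_or_pos j with rfl | hj
      · simp [jacobi_zero_right]
      by_cases hjk : k ≤ j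
      · simp [jacobi_of_le hk _ hjk]
      obtain ⟨j, rfl⟩ : ∃ j', j = j' + 1 := ⟨j - 1, by omega⟩
      rw [jacobi_step (i + 1) (by omega), jacobi_step (q := q) i (j := j) (by omega)]
      linarith [ih j, ih (j + 2)]
  exact antitone_nat_of_succ_le fun i => key i j

theorem tendsto_jacobi (hq : 0 < q) (hk : 1 ≤ k) {j : ℕ} (hj : j ≤ k) :
    Tendsto (fun i => jacobi q k i j) atTop (𝓝 (j * q / k)) := by
  have hlim : ∀ j, Tendsto (fun i => jacobi q k i j) atTop
      (𝓝 (⨅ i, jacobi q k i j)) := fun j =>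
    tendsto_atTop_ciInf (jacobi_antitone hq hk j)
      ⟨0, by rintro _ ⟨i, rfl⟩; exact (jacobi_mono hq hk i).2.1 j⟩
  set L : ℕ → ℝ := fun j => ⨅ i, jacobi q k i j with hL
  have hL0 : L 0 = 0 := by simp [hL, jacobi_zero_right]
  have hLk : L k = q := by simp [hL, jacobi_of_le hk]
  have hLs : ∀ j, j + 2 ≤ k → L (j + 1) = (L j + L (j + 2)) / 2 := by
    intro j hj
    have h1 := (hlim (j + 1)).comp (tendsto_add_atTop_nat 1)
    have h2 := ((hlim j).add (hlim (j + 2))).div_const 2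
    refine tendsto_nhds_unique h1 (h2.congr fun i => ?_)
    simp [jacobi_step i hj]
  -- a discretely harmonic sequence is affine
  have hlin : ∀ j, j + 1 ≤ k → L (j + 1) - L j = L 1 := by
    intro j
    induction j with
    | zero => intro _; simp [hL0]
    | succ j ih => intro hj'; linarith [ih (by omega), hLs j (by omega)]
  have hlin' : ∀ j, j ≤ k → L j = j * L 1 := by
    intro j
    induction j with
    | zero => intro _; simp [hL0]
    | succ j ih => intro hj'; push_cast; linarith [ih (by omega), hlin j (by omega)]
  have h1 := hlin' k le_rfl
  rw [hLk] at h1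
  have hk0 : (k : ℝ) ≠ 0 := by positivity
  have h2 : L j = j * q / k := by rw [hlin' j hj, h1]; field_simp
  rw [← h2]
  exact hlim j

end

/-- Think of `N j θ` as the norm in `L^{1/θ}` of the derivatives of order `j` of a bounded function.
From the interpolation inequality between consecutive orders, from norms in `L^{1/q}` for all orders
`1, …, k` one gets the norm of the derivatives of order `j` with the exponent `θ = j q / k`. The
exponents are improved by Jacobi iteration, along which the norms stay bounded. -/
theorem lt_top_of_interpolation (N : ℕ → ℝ → ℝ≥0∞) {k : ℕ} (hk : 1 ≤ k) {q : ℝ} (hq : 0 < q)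
    (hq1 : q ≤ 1) (C : ℝ≥0)
    (hstep : ∀ j, j + 2 ≤ k → ∀ α β : ℝ, 0 ≤ α → (1 ≤ j → 0 < α) → (j = 0 → α = 0) → α ≤ β →
      0 < β → β ≤ 1 →
      N (j + 1) ((α + β) / 2) ≤
        C * (N j α ^ (1 / 2 : ℝ) * N (j + 2) β ^ (1 / 2 : ℝ) + N j α))
    (hmono : ∀ j, 1 ≤ j → j ≤ k → ∀ θ θ' : ℝ, 0 < θ → θ ≤ θ' → θ' ≤ 1 → N j θ' ≤ C * N j θ)
    (hfatou : ∀ j, 1 ≤ j → j ≤ k → ∀ (θ : ℕ → ℝ) (θ' : ℝ) (R : ℝ≥0∞), 0 < θ' →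
      Tendsto θ atTop (𝓝 θ') → (∀ i, 0 < θ i) → (∀ i, N j (θ i) ≤ R) → N j θ' ≤ R)
    (h0 : N 0 0 < ⊤) (hq' : ∀ j, 1 ≤ j → j ≤ k → N j q < ⊤) {j : ℕ} (hj : 1 ≤ j) (hjk : j ≤ k) :
    N j (j * q / k) < ⊤ := by
  have hk1 := hk
  have hfin : ∀ i, ∀ j ≤ k, N j (jacobi q k i j) < ⊤ := by
    intro i
    induction i with
    | zero =>
      intro j hj
      rcases Nat.eq_zero_or_pos j with rfl | hj0
      · simpa [jacobi] using h0
      · have : j ≠ 0 := by omega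
        simpa [jacobi, this] using hq' j hj0 hj
    | succ i ih =>
      intro j hj
      rcases Nat.eq_zero_or_pos j with rfl | hj0
      · simpa [jacobi] using h0
      by_cases hjk : k ≤ j
      · rw [jacobi_of_le hk _ hjk]; exact hq' j hj0 hj
      obtain ⟨j, rfl⟩ : ∃ j', j = j' + 1 := ⟨j - 1, by omega⟩
      obtain ⟨hm, hn, hle, hpos⟩ := jacobi_mono (k := k) hq hk i
      rw [jacobi_step i (by omega)]
      refine (hstep j (by omega) _ _ (hn j) (hpos j) (fun h => by rw [h, jacobi_zero_right])
        (hm (by omega)) (hpos _ (by omega))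
        ((hle _).trans hq1)).trans_lt ?_
      have h1 := ih j (by omega)
      have h2 := ih (j + 2) (by omega)
      refine mul_lt_top coe_lt_top (ENNReal.add_lt_top.2
        ⟨mul_lt_top ?_ ?_, h1⟩) <;>
      exact ENNReal.rpow_lt_top_of_nonneg (by norm_num) (by assumption : _ < ⊤).ne
  obtain ⟨R, hR⟩ := exists_bound_of_chain ((C : ℝ) * C) (N 0 0).toReal (N k q).toReal
    (by positivity) k
  have hbd : ∀ i, ∀ j ≤ k, (N j (jacobi q k i j)).toReal ≤ R := by
    intro i
    obtain ⟨hm, hn, hle, hpos⟩ := jacobi_mono (k := k) hq hk i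
    -- beyond `k` the sequence is cut off
    have := hR (fun j => if j ≤ k then (N j (jacobi q k i j)).toReal else 0)
      (fun j => by split_ifs <;> positivity)
      (by simp [jacobi_zero_right]) (by simp [jacobi_of_le hk]) ?_
    · intro j hj
      simpa [hj] using this j hj
    intro j hj
    have e0 : j ≤ k := by omega
    have e1 : j + 1 ≤ k := by omega
    simp only [e0, e1, hj, if_true]
    have h1 := hfin i j (by omega)
    have h2 := hfin i (j + 2) (by omega)
    have hav : (jacobi q k i j + jacobi q k i (j + 2)) / 2 ≤ jacobi q k i (j + 1) := by
      rw [← jacobi_step i hj]; exact jacobi_antitone hq hk (j + 1) (Nat.le_succ i)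
    have h3 := hmono (j + 1) (by omega) (by omega) _ _
      (by linarith [hn j, hpos (j + 2) (by omega)]) hav ((hle _).trans hq1)
    have h4 := hstep j (by omega) _ _ (hn j) (hpos j) (fun h => by rw [h, jacobi_zero_right])
        (hm (by omega)) (hpos _ (by omega)) ((hle (j + 2)).trans hq1)
    have h5 := h3.trans (mul_le_mul_right h4 _)
    have e : ((C : ℝ≥0∞) * (C * (N j (jacobi q k i j) ^ (1 / 2 : ℝ) *
        N (j + 2) (jacobi q k i (j + 2)) ^ (1 / 2 : ℝ) + N j (jacobi q k i j)))) ≠ ⊤ := by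
      refine (mul_lt_top coe_lt_top (mul_lt_top coe_lt_top
        (ENNReal.add_lt_top.2 ⟨mul_lt_top ?_ ?_, h1⟩))).ne <;>
      exact ENNReal.rpow_lt_top_of_nonneg (by norm_num) (by assumption : _ < ⊤).ne
    have h6 := toReal_mono e h5
    rw [toReal_mul, toReal_mul, ENNReal.toReal_add, toReal_mul,
      ← ENNReal.toReal_rpow, ← ENNReal.toReal_rpow, ← mul_rpow toReal_nonneg
      toReal_nonneg, ← Real.sqrt_eq_rpow] at h6
    · simpa [mul_assoc] using h6
    · refine (mul_lt_top ?_ ?_).ne <;>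
      exact ENNReal.rpow_lt_top_of_nonneg (by norm_num) (by assumption : _ < ⊤).ne
    · exact h1.ne
  have hk0 : (0 : ℝ) < k := by positivity
  have hj0 : (0 : ℝ) < j := by positivity
  refine (hfatou j hj hjk (fun i => jacobi q k i j) _ (ofReal R) (by positivity)
    (tendsto_jacobi hq hk hjk) (fun i => (jacobi_mono hq hk i).2.2.2 j hj) fun i => ?_).trans_lt
    ofReal_lt_top
  exact (ENNReal.le_ofReal_iff_toReal_le (hfin i j hjk).ne
    (ENNReal.toReal_nonneg.trans (hbd i j hjk))).2 (hbd i j hjk)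

end Chain

/-! ### An interpolation inequality on an interval -/

section Interval

/-- `V` is a primitive of `Z` on `[a, b]`. -/
def IsPrimitiveOn (a b : ℝ) (V Z : ℝ → ℝ) : Prop :=
  IntervalIntegrable Z volume a b ∧
    ∀ x ∈ Icc a b, ∀ y ∈ Icc a b, V y - V x = ∫ s in x..y, Z s

variable {a b : ℝ} {W V Z : ℝ → ℝ}

theorem IsPrimitiveOn.mono {a' b' : ℝ} (h : IsPrimitiveOn a b V Z) (ha : a ≤ a') (hab : a' ≤ b')
    (hb : b' ≤ b) : IsPrimitiveOn a' b' V Z :=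
  ⟨h.1.mono_set (by rw [uIcc_of_le hab, uIcc_of_le (by linarith)]; exact Icc_subset_Icc ha hb),
    fun x hx y hy => h.2 x ⟨ha.trans hx.1, hx.2.trans hb⟩ y ⟨ha.trans hy.1, hy.2.trans hb⟩⟩

theorem IsPrimitiveOn.neg (h : IsPrimitiveOn a b V Z) :
    IsPrimitiveOn a b (fun x => -V x) (fun x => -Z x) :=
  ⟨h.1.neg, fun x hx y hy => by
    have := h.2 x hx y hy
    rw [intervalIntegral.integral_neg]; linarith⟩

theorem IsPrimitiveOn.continuousOn (h : IsPrimitiveOn a b V Z) (hab : a ≤ b) :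
    ContinuousOn V (Icc a b) := by
  have h1 := continuousOn_primitive_interval' h.1 (left_mem_uIcc)
  rw [uIcc_of_le hab] at h1
  refine (h1.const_add (V a)).congr fun x hx => ?_
  have := h.2 a (left_mem_Icc.2 hab) x hx
  simp only
  linarith

theorem IsPrimitiveOn.intervalIntegrable (h : IsPrimitiveOn a b V Z) (hab : a ≤ b) :
    IntervalIntegrable V volume a b := by
  apply ContinuousOn.intervalIntegrable
  rw [uIcc_of_le hab]
  exact h.continuousOn hab

/-- The derivative `V` of `W` is bounded on an interval by the mean of `|W|` and the integral of
`|V'|`: if `V` is larger than its oscillation, then `W` has a slope. -/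
theorem IsPrimitiveOn.abs_le (hab : a < b) (hV : IsPrimitiveOn a b V Z)
    (hW : IsPrimitiveOn a b W V) {x : ℝ} (hx : x ∈ Icc a b) :
    |V x| ≤ 4 / (b - a) ^ 2 * (∫ s in a..b, |W s|) + ∫ s in a..b, |Z s| := by
  have key : ∀ {W V Z : ℝ → ℝ}, IsPrimitiveOn a b V Z → IsPrimitiveOn a b W V →
      V x ≤ 4 / (b - a) ^ 2 * (∫ s in a..b, |W s|) + ∫ s in a..b, |Z s| := by
    intro W V Z hV hW
    have hWc := hW.continuousOn hab.le
    have hVi := hV.intervalIntegrable hab.le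
    set D := ∫ s in a..b, |Z s|
    have hD : ∀ y ∈ Icc a b, V x - D ≤ V y := by
      intro y hy
      have h1 : |∫ s in x..y, Z s| ≤ D := by
        have hsubset : uIoc x y ⊆ Ioc a b :=
          fun s hs => ⟨(le_min hx.1 hy.1).trans_lt hs.1, hs.2.trans (max_le hx.2 hy.2)⟩
        refine (intervalIntegral.norm_integral_le_integral_norm_uIoc (f := Z)).trans ?_
        rw [show D = ∫ s in Ioc a b, |Z s| from integral_of_le hab.le]
        refine setIntegral_mono_set hV.1.1.abs (ae_of_all _ fun s => abs_nonneg _)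
          hsubset.eventuallyLE
      have h2 := hV.2 x hx y hy
      linarith [neg_abs_le (∫ s in x..y, Z s)]
    set c := V x - D
    have hslope : ∀ y ∈ Icc a b, ∀ z ∈ Icc a b, y ≤ z → c * (z - y) ≤ W z - W y := by
      intro y hy z hz hyz
      rw [hW.2 y hy z hz]
      have : c * (z - y) = ∫ s in y..z, c := by simp [mul_comm]
      rw [this]
      refine integral_mono_on hyz (by simp)
        (hVi.mono_set ?_) fun s hs => hD s ⟨hy.1.trans hs.1, hs.2.trans hz.2⟩
      rw [uIcc_of_le hyz, uIcc_of_le hab.le]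
      exact Icc_subset_Icc hy.1 hz.2
    set m := (b - a) / 2 with hm
    have hm0 : 0 < m := by rw [hm]; linarith
    have hWi : ∀ y ∈ Icc a b, ∀ z ∈ Icc a b, y ≤ z → IntervalIntegrable W volume y z := by
      intro y hy z hz hyz
      apply ContinuousOn.intervalIntegrable
      rw [uIcc_of_le hyz]
      exact hWc.mono (Icc_subset_Icc hy.1 hz.2)
    have ha' : a ∈ Icc a b := left_mem_Icc.2 hab.le
    have hb' : b ∈ Icc a b := right_mem_Icc.2 hab.le
    have hm' : a + m ∈ Icc a b := ⟨by linarith, by rw [hm]; linarith⟩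
    have hi1 := hWi a ha' _ hm' (by linarith)
    have hi2 := hWi _ hm' b hb' (by rw [hm]; linarith)
    have h1 : (∫ s in a..a + m, |W s|) + ∫ s in a + m..b, |W s| = ∫ s in a..b, |W s| :=
      integral_add_adjacent_intervals hi1.abs hi2.abs
    have h2 : -(∫ s in a..a + m, W s) ≤ ∫ s in a..a + m, |W s| := by
      rw [← intervalIntegral.integral_neg]
      exact integral_mono_on (by linarith) hi1.neg hi1.abs
        fun s _ => neg_le_abs _
    have h3 : ∫ s in a + m..b, W s ≤ ∫ s in a + m..b, |W s| :=
      integral_mono_on (by rw [hm]; linarith) hi2 hi2.abs fun s _ => le_abs_self _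
    have h4 : ∫ s in a + m..b, W s = ∫ s in a..a + m, W (s + m) := by
      rw [intervalIntegral.integral_comp_add_right (fun s => W s)]
      congr 1
      rw [hm]; ring
    have hi3 : IntervalIntegrable (fun s => W (s + m)) volume a (a + m) := by
      apply ContinuousOn.intervalIntegrable
      rw [uIcc_of_le (by linarith)]
      refine hWc.comp (by fun_prop) fun s hs => ⟨by linarith [hs.1], ?_⟩
      have := hs.2
      rw [hm] at this ⊢
      linarith
    have h5 : ∫ s in a..a + m, c * m ≤ ∫ s in a..a + m, (W (s + m) - W s) := by
      refine integral_mono_on (by linarith) (by simp) (hi3.sub hi1) fun s hs => ?_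
      have h6 : s + m ≤ b := by
        have := hs.2
        rw [hm] at this ⊢
        linarith
      have := hslope s ⟨hs.1, by linarith⟩ (s + m) ⟨by linarith [hs.1], h6⟩ (by linarith)
      simpa using this
    rw [intervalIntegral.integral_sub hi3 hi1, intervalIntegral.integral_const] at h5
    simp only [add_sub_cancel_left, smul_eq_mul] at h5
    have h6 : m * (c * m) ≤ ∫ s in a..b, |W s| := by rw [← h1]; linarith
    have h7 : c ≤ 4 / (b - a) ^ 2 * ∫ s in a..b, |W s| := by
      rw [div_mul_eq_mul_div, le_div_iff₀ (by nlinarith)]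
      rw [hm] at h6
      linarith
    linarith
  rw [_root_.abs_le]
  refine ⟨?_, key hV hW⟩
  have := key hV.neg hW.neg
  simp only [abs_neg] at this
  linarith

/-- Hölder's inequality for two sums of two terms. -/
theorem rpow_mul_rpow_add_le {p q x₁ x₂ y₁ y₂ : ℝ} (hp : 0 ≤ p) (hq : 0 < q) (hpq : p + q = 1)
    (hx₁ : 0 ≤ x₁) (hx₂ : 0 ≤ x₂) (hy₁ : 0 ≤ y₁) (hy₂ : 0 ≤ y₂) :
    x₁ ^ p * y₁ ^ q + x₂ ^ p * y₂ ^ q ≤ (x₁ + x₂) ^ p * (y₁ + y₂) ^ q := by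
  rcases hp.eq_or_lt with rfl | hp
  · have : q = 1 := by linarith
    simp [this]
  rcases (add_nonneg hx₁ hx₂).eq_or_lt with hX | hX
  · have h1 : x₁ = 0 := by linarith
    have h2 : x₂ = 0 := by linarith
    simp [h1, h2, zero_rpow hp.ne']
  rcases (add_nonneg hy₁ hy₂).eq_or_lt with hY | hY
  · have h1 : y₁ = 0 := by linarith
    have h2 : y₂ = 0 := by linarith
    simp [h1, h2, zero_rpow hq.ne']
  have e1 := Real.geom_mean_le_arith_mean2_weighted hp.le hq.le (div_nonneg hx₁ hX.le)
    (div_nonneg hy₁ hY.le) hpq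
  have e2 := Real.geom_mean_le_arith_mean2_weighted hp.le hq.le (div_nonneg hx₂ hX.le)
    (div_nonneg hy₂ hY.le) hpq
  rw [div_rpow hx₁ hX.le, div_rpow hy₁ hY.le, div_mul_div_comm] at e1
  rw [div_rpow hx₂ hX.le, div_rpow hy₂ hY.le, div_mul_div_comm] at e2
  have e3 : p * (x₁ / (x₁ + x₂)) + q * (y₁ / (y₁ + y₂)) +
      (p * (x₂ / (x₁ + x₂)) + q * (y₂ / (y₁ + y₂))) = 1 := by
    rw [← hpq]; field_simp; ring
  have e4 := add_le_add e1 e2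
  rw [e3, ← add_div, div_le_one (by positivity)] at e4
  exact e4

/-- On the subintervals of `[0, 2]` the integral of `|W|` is bounded as by Hölder's inequality if
`W` is at most `M` times the `γ`-th power of `h`. -/
def HolderControl (M γ : ℝ) (W h : ℝ → ℝ) : Prop :=
  ∀ s t, 0 ≤ s → s < t → t ≤ 2 →
    ∫ x in s..t, |W x| ≤ M * (t - s) ^ (1 - γ) * (∫ x in s..t, h x) ^ γ

/-- The interpolation inequality on `[0, 2]`, with the norm of `V` on the half of the interval. The
bounds of `W` and `Z` in `L^{1/α}` and `L^{1/β}` enter through Hölder's inequality, which makes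
sense of `α = 0`. The interval is covered, from left to right, by intervals on which the two
terms that bound `V` balance. -/
theorem integral_rpow_le_of_isPrimitiveOn {α β M : ℝ} {g h : ℝ → ℝ} (hα : 0 ≤ α) (hαβ : α ≤ β)
    (hβ : 0 < β) (hβ1 : β ≤ 1) (hM : 0 ≤ M) (hg0 : ∀ s, 0 ≤ g s) (hh0 : ∀ s, 0 ≤ h s)
    (hg : IntervalIntegrable g volume 0 2) (hh : IntervalIntegrable h volume 0 2)
    (hV : IsPrimitiveOn 0 2 V Z) (hW : IsPrimitiveOn 0 2 W V)
    (H1 : HolderControl M α W h) (H2 : HolderControl 1 β Z g) :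
    ∫ x in (0 : ℝ)..1, |V x| ^ (2 / (α + β)) ≤
      8 ^ (2 / (α + β)) * (M ^ (1 / (α + β)) * ((∫ x in (0 : ℝ)..2, h x) ^ (α / (α + β)) *
        (∫ x in (0 : ℝ)..2, g x) ^ (β / (α + β))) +
        (M * (∫ x in (0 : ℝ)..2, h x) ^ α) ^ (2 / (α + β))) := by
  set e := 2 / (α + β) with he
  have hab0 : 0 < α + β := by linarith
  have he0 : 0 < e := by positivity
  set A : ℝ → ℝ → ℝ := fun s t => ∫ x in s..t, h x with hA
  set B : ℝ → ℝ → ℝ := fun s t => ∫ x in s..t, g x with hB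
  have hsub : ∀ {F : ℝ → ℝ}, IntervalIntegrable F volume 0 2 → ∀ {s t : ℝ}, 0 ≤ s → s ≤ t →
      t ≤ 2 → IntervalIntegrable F volume s t := by
    intro F hF s t h0 h1 h2
    refine hF.mono_set ?_
    rw [uIcc_of_le h1, uIcc_of_le (by norm_num)]
    exact Icc_subset_Icc h0 h2
  have hA0 : ∀ s t, s ≤ t → 0 ≤ A s t := fun s t hst =>
    intervalIntegral.integral_nonneg hst fun x _ => hh0 x
  have hB0 : ∀ s t, s ≤ t → 0 ≤ B s t := fun s t hst =>
    intervalIntegral.integral_nonneg hst fun x _ => hg0 x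
  have hAadd : ∀ s t u, 0 ≤ s → s ≤ t → t ≤ u → u ≤ 2 → A s t + A t u = A s u :=
    fun s t u h0 h1 h2 h3 => integral_add_adjacent_intervals
      (hsub hh h0 h1 (h2.trans h3)) (hsub hh (h0.trans h1) h2 h3)
  have hBadd : ∀ s t u, 0 ≤ s → s ≤ t → t ≤ u → u ≤ 2 → B s t + B t u = B s u :=
    fun s t u h0 h1 h2 h3 => integral_add_adjacent_intervals
      (hsub hg h0 h1 (h2.trans h3)) (hsub hg (h0.trans h1) h2 h3)
  have hVc := hV.continuousOn (by norm_num)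
  have hVe : ContinuousOn (fun x => |V x| ^ e) (Icc 0 2) :=
    hVc.abs.rpow_const fun x _ => Or.inr he0.le
  have hVi : ∀ {s t : ℝ}, 0 ≤ s → s ≤ t → t ≤ 2 →
      IntervalIntegrable (fun x => |V x| ^ e) volume s t := by
    intro s t h0 h1 h2
    apply ContinuousOn.intervalIntegrable
    rw [uIcc_of_le h1]
    exact hVe.mono (Icc_subset_Icc h0 h2)
  -- the two terms of the bound of `V` on `[s, t]`
  set T₁ : ℝ → ℝ → ℝ := fun s t => M * (t - s) ^ (-1 - α) * A s t ^ α with hT₁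
  set T₂ : ℝ → ℝ → ℝ := fun s t => (t - s) ^ (1 - β) * B s t ^ β with hT₂
  have hbound : ∀ s t, 0 ≤ s → s < t → t ≤ 2 → ∀ x ∈ Icc s t, |V x| ≤ 4 * T₁ s t + T₂ s t := by
    intro s t h0 h1 h2 x hx
    refine (IsPrimitiveOn.abs_le h1 (hV.mono h0 h1.le h2) (hW.mono h0 h1.le h2) hx).trans ?_
    refine add_le_add ?_ ((H2 s t h0 h1 h2).trans_eq (by rw [one_mul]))
    have hp : 0 < t - s := by linarith
    refine (mul_le_mul_of_nonneg_left (H1 s t h0 h1 h2) (by positivity)).trans_eq ?_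
    simp only [hT₁, hA]
    rw [show (1 - α) = (-1 - α) + (2 : ℕ) by push_cast; ring, Real.rpow_add_natCast hp.ne']
    field_simp
  have hpiece : ∀ s t c, 0 ≤ s → s ≤ t → t ≤ 2 → 0 ≤ c → (∀ x ∈ Icc s t, |V x| ≤ c) →
      ∫ x in s..t, |V x| ^ e ≤ (t - s) * c ^ e := by
    intro s t c h0 h1 h2 hc hx
    have : (t - s) * c ^ e = ∫ x in s..t, c ^ e := by simp
    rw [this]
    exact integral_mono_on h1 (hVi h0 h1 h2) (by simp) fun x hx' =>
      Real.rpow_le_rpow (abs_nonneg _) (hx x hx') he0.le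
  have hpq : α / (α + β) + β / (α + β) = 1 := by field_simp
  have hβe : 1 ≤ β * e := by
    rw [he, mul_div_assoc', le_div_iff₀ hab0]; linarith
  set K := 8 ^ e * (M * A 0 2 ^ α) ^ e with hK
  have hK0 : 0 ≤ K := by have := hA0 0 2 (by norm_num); positivity
  have hT₁0 : ∀ s t, s ≤ t → 0 ≤ T₁ s t := fun s t hst => by
    have h1 := hA0 s t hst
    have h2 : 0 ≤ t - s := by linarith
    positivity
  have hT₂0 : ∀ s t, s ≤ t → 0 ≤ T₂ s t := fun s t hst => by
    have h1 := hB0 s t hst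
    have h2 : 0 ≤ t - s := by linarith
    positivity
  have hpiece₂ : ∀ s t, 0 ≤ s → s < t → t ≤ 2 → T₁ s t ≤ T₂ s t →
      ∫ x in s..t, |V x| ^ e ≤ (t - s) * (8 * T₂ s t) ^ e := by
    intro s t h0 h1 h2 hle
    have := hT₂0 s t h1.le
    exact hpiece s t _ h0 h1.le h2 (by positivity) fun x hx =>
      (hbound s t h0 h1 h2 x hx).trans (by linarith)
  set F : ℝ → ℝ → ℝ → ℝ := fun δ s t => 8 ^ e * M ^ (1 / (α + β)) *
    (A s t ^ (α / (α + β)) * B s t ^ (β / (α + β))) +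
    8 ^ e * δ ^ (1 + (1 - β) * e) * B s t ^ (β * e) with hF
  have hF0 : ∀ δ s t, 0 ≤ δ → s ≤ t → 0 ≤ F δ s t := fun δ s t hδ hst => by
    have h1 := hA0 s t hst
    have h2 := hB0 s t hst
    positivity
  have main : ∀ δ : ℝ, 0 < δ → δ ≤ 1 → ∀ n : ℕ, ∀ s : ℝ, 0 ≤ s → s ≤ 1 → 1 - s ≤ n * δ →
      ∫ x in s..1, |V x| ^ e ≤ F δ s 2 + K := by
    intro δ hδ hδ1 n
    induction n with
    | zero =>
      intro s hs0 hs1 hsn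
      have : s = 1 := by simp at hsn; linarith
      subst this
      rw [integral_same]
      exact add_nonneg (hF0 δ 1 2 hδ.le (by norm_num)) hK0
    | succ n ih =>
      intro s hs0 hs1 hsn
      have hAs := hA0 s 2 (by linarith)
      have hBs := hB0 s 2 (by linarith)
      -- to go on from `t`, it is enough to bound the integral over `[s, t]`
      have hgo : ∀ t, s + δ ≤ t → t ≤ 2 → ∫ x in s..t, |V x| ^ e ≤ F δ s t →
          ∫ x in s..1, |V x| ^ e ≤ F δ s 2 + K := by
        intro t hst ht2 hle
        have hst' : s ≤ t := by linarith
        have eA := hAadd s t 2 hs0 hst' ht2 le_rfl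
        have eB := hBadd s t 2 hs0 hst' ht2 le_rfl
        have hAt := hA0 t 2 ht2
        have hBt := hB0 t 2 ht2
        have hAst := hA0 s t hst'
        have hBst := hB0 s t hst'
        by_cases ht1 : t ≤ 1
        · have hih := ih t (by linarith) ht1 (by push_cast at hsn; linarith)
          rw [← integral_add_adjacent_intervals (hVi hs0 hst' ht2)
            (hVi (hs0.trans hst') ht1 (by norm_num))]
          have e1 : A s t ^ (α / (α + β)) * B s t ^ (β / (α + β)) +
              A t 2 ^ (α / (α + β)) * B t 2 ^ (β / (α + β)) ≤
              A s 2 ^ (α / (α + β)) * B s 2 ^ (β / (α + β)) := by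
            rw [← eA, ← eB]
            exact rpow_mul_rpow_add_le (by positivity) (by positivity) hpq hAst hAt hBst hBt
          have e2 : B s t ^ (β * e) + B t 2 ^ (β * e) ≤ B s 2 ^ (β * e) := by
            rw [← eB]
            exact Real.add_rpow_le_rpow_add hBst hBt hβe
          have e3 := mul_le_mul_of_nonneg_left e1
            (show 0 ≤ 8 ^ e * M ^ (1 / (α + β)) by positivity)
          have e4 := mul_le_mul_of_nonneg_left e2
            (show 0 ≤ 8 ^ e * δ ^ (1 + (1 - β) * e) by positivity)
          simp only [hF] at hih hle ⊢
          linarith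
        · have e0 : ∫ x in s..1, |V x| ^ e ≤ ∫ x in s..t, |V x| ^ e := by
            rw [← integral_add_adjacent_intervals (hVi hs0 hs1 (by norm_num))
              (hVi (by norm_num) (not_le.1 ht1).le ht2)]
            have : 0 ≤ ∫ x in (1 : ℝ)..t, |V x| ^ e :=
              intervalIntegral.integral_nonneg (not_le.1 ht1).le fun x _ => by positivity
            linarith
          have e1 : A s t ≤ A s 2 := by linarith
          have e2 : B s t ≤ B s 2 := by linarith
          refine (e0.trans hle).trans ?_
          refine le_trans ?_ (le_add_of_nonneg_right hK0)
          simp only [hF]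
          gcongr
      have hsδ : s < s + δ := by linarith
      by_cases hcase : T₁ s (s + δ) ≤ T₂ s (s + δ)
      · refine hgo (s + δ) le_rfl (by linarith) ?_
        refine (hpiece₂ s (s + δ) hs0 hsδ (by linarith) hcase).trans ?_
        have hBst := hB0 s (s + δ) hsδ.le
        have hAst := hA0 s (s + δ) hsδ.le
        have e2 : (s + δ - s) * (8 * T₂ s (s + δ)) ^ e =
            8 ^ e * δ ^ (1 + (1 - β) * e) * B s (s + δ) ^ (β * e) := by
          simp only [hT₂, add_sub_cancel_left]
          rw [mul_rpow (by norm_num) (by positivity), mul_rpow (by positivity)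
            (by positivity), ← Real.rpow_mul hδ.le, ← Real.rpow_mul hBst, rpow_add hδ,
            Real.rpow_one]
          ring
        rw [e2]
        exact le_add_of_nonneg_left (by positivity)
      · rw [not_le] at hcase
        by_cases hcase2 : T₂ s 2 ≤ T₁ s 2
        · have e1 := hpiece s 1 (8 * T₁ s 2) hs0 hs1 (by norm_num)
            (by have := hT₁0 s 2 (by linarith); positivity)
            fun x hx => (hbound s 2 hs0 (by linarith) le_rfl x ⟨hx.1, by linarith [hx.2]⟩).trans (by
              have := hT₁0 s 2 (by linarith)
              linarith)
          have e2 : T₁ s 2 ≤ M * A 0 2 ^ α := by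
            have e3 : A s 2 ≤ A 0 2 := by
              have := hAadd 0 s 2 le_rfl hs0 (by linarith) le_rfl
              linarith [hA0 0 s hs0]
            have e4 : (2 - s) ^ (-1 - α) ≤ 1 :=
              Real.rpow_le_one_of_one_le_of_nonpos (by linarith) (by linarith)
            calc T₁ s 2 ≤ M * 1 * A 0 2 ^ α := by
                  simp only [hT₁]
                  gcongr
              _ = M * A 0 2 ^ α := by ring
          have e5 : (1 - s) * (8 * T₁ s 2) ^ e ≤ K := by
            rw [hK, ← mul_rpow (by norm_num) (by have := hA0 0 2 (by norm_num); positivity)]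
            have e6 := hT₁0 s 2 (by linarith)
            calc (1 - s) * (8 * T₁ s 2) ^ e ≤ 1 * (8 * (M * A 0 2 ^ α)) ^ e := by
                  gcongr
                  linarith
              _ = _ := one_mul _
          linarith [hF0 δ s 2 hδ.le (by linarith)]
        · rw [not_le] at hcase2
          -- the two terms balance at some `t`
          obtain ⟨t, ht, hteq⟩ : ∃ t ∈ Icc (s + δ) 2, T₁ s t - T₂ s t = 0 := by
            have hcont : ContinuousOn (fun t => T₁ s t - T₂ s t) (Icc (s + δ) 2) := by
              have hc : ∀ {f : ℝ → ℝ}, IntervalIntegrable f volume 0 2 →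
                  ContinuousOn (fun t => ∫ x in s..t, f x) (Icc (s + δ) 2) := fun hf => by
                have := continuousOn_primitive_interval'
                  (hsub hf hs0 (by linarith) le_rfl) left_mem_uIcc
                rw [uIcc_of_le (by linarith)] at this
                exact this.mono (Icc_subset_Icc hsδ.le le_rfl)
              have hl : ContinuousOn (fun t : ℝ => t - s) (Icc (s + δ) 2) := by fun_prop
              refine ContinuousOn.sub (ContinuousOn.mul (continuousOn_const.mul
                (hl.rpow_const fun x hx => Or.inl ?_)) ((hc hh).rpow_const fun x _ => Or.inr hα))
                (ContinuousOn.mul (hl.rpow_const fun x hx => Or.inr (by linarith))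
                  ((hc hg).rpow_const fun x _ => Or.inr hβ.le))
              have := hx.1
              exact (by linarith : 0 < x - s).ne'
            have := intermediate_value_Icc' (by linarith) hcont
            obtain ⟨t, ht, h0⟩ := this (show (0 : ℝ) ∈ Icc _ _ from
              ⟨by linarith, by linarith⟩)
            exact ⟨t, ht, h0⟩
          have hst : s < t := by linarith [ht.1]
          refine hgo t ht.1 ht.2 ?_
          refine (hpiece₂ s t hs0 hst ht.2 (by linarith)).trans ?_
          have hBst := hB0 s t hst.le
          have hAst := hA0 s t hst.le
          have hl : 0 < t - s := by linarith
          have e2 : (t - s) * (8 * T₂ s t) ^ e = 8 ^ e * M ^ (1 / (α + β)) *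
              (A s t ^ (α / (α + β)) * B s t ^ (β / (α + β))) := by
            have h2 := hT₂0 s t hst.le
            have e3 : T₂ s t ^ e = T₁ s t ^ (1 / (α + β)) * T₂ s t ^ (1 / (α + β)) := by
              rw [show T₁ s t = T₂ s t by linarith, ← Real.rpow_add' h2 (by positivity)]
              congr 1
              rw [he]; ring
            rw [mul_rpow (by norm_num) h2, e3]
            simp only [hT₁, hT₂]
            rw [mul_rpow (by positivity) (by positivity),
              mul_rpow (by positivity) (by positivity),
              mul_rpow (by positivity) (by positivity), ← Real.rpow_mul hl.le,
              ← Real.rpow_mul hl.le, ← Real.rpow_mul hAst, ← Real.rpow_mul hBst]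
            have e4 : (t - s) * ((t - s) ^ ((-1 - α) * (1 / (α + β))) *
                (t - s) ^ ((1 - β) * (1 / (α + β)))) = 1 := by
              rw [← rpow_add hl, show (-1 - α) * (1 / (α + β)) + (1 - β) * (1 / (α + β)) = -1 by
                field_simp; ring, Real.rpow_neg_one, mul_inv_cancel₀ hl.ne']
            rw [show α * (1 / (α + β)) = α / (α + β) by ring,
              show β * (1 / (α + β)) = β / (α + β) by ring]
            linear_combination (8 ^ e * M ^ (1 / (α + β)) *
              (A s t ^ (α / (α + β)) * B s t ^ (β / (α + β)))) * e4
          rw [e2]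
          exact le_add_of_nonneg_right (by positivity)
  have hexp : 0 < 1 + (1 - β) * e := by nlinarith
  have hlim : Tendsto (fun δ => F δ 0 2 + K) (𝓝[>] 0) (𝓝 (F 0 0 2 + K)) := by
    apply Tendsto.mono_left _ nhdsWithin_le_nhds
    refine ((((Real.continuousAt_rpow_const 0 _ (Or.inr hexp.le)).tendsto.const_mul _).mul_const
      _).const_add _).add_const _
  have := ge_of_tendsto hlim (b := ∫ x in (0 : ℝ)..1, |V x| ^ e) (by
    filter_upwards [Ioc_mem_nhdsGT (show (0 : ℝ) < 1 by norm_num)] with δ hδ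
    obtain ⟨n, hn⟩ := exists_nat_ge (1 / δ)
    refine main δ hδ.1 hδ.2 n 0 le_rfl zero_le_one ?_
    rw [div_le_iff₀ hδ.1] at hn
    linarith)
  refine this.trans_eq ?_
  simp only [hF, hK, zero_rpow hexp.ne']
  ring

end Interval

/-! ### Flows of Lipschitz vector fields -/

section Flow

/-- `Φ` is the flow of the bounded `K`-Lipschitz vector field `b`. -/
structure IsFlow {E : Type*} [NormedAddCommGroup E] [NormedSpace ℝ E] (K : ℝ≥0) (b : E → E)
    (Φ : ℝ → E → E) : Prop where
  lip : LipschitzWith K b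
  bdd : ∃ L : ℝ≥0, ∀ x, ‖b x‖ ≤ L
  zero : ∀ x, Φ 0 x = x
  deriv : ∀ x t, HasDerivAt (fun s => Φ s x) (b (Φ t x)) t

variable {E : Type*} [NormedAddCommGroup E] [NormedSpace ℝ E] {K : ℝ≥0} {b : E → E}
  {Φ : ℝ → E → E}

theorem exists_isFlow [CompleteSpace E] {L : ℝ≥0} (hb : LipschitzWith K b)
    (hL : ∀ x, ‖b x‖ ≤ L) : ∃ Φ, IsFlow K b Φ := by
  have hex : ∀ (x : E) (T : ℝ), 0 < T → ∃ α : ℝ → E, α 0 = x ∧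
      ∀ t ∈ Ioo (-T) T, HasDerivAt α (b (α t)) t := by
    intro x T hT
    have hpl : IsPicardLindelof (fun _ => b) (tmin := -T) (tmax := T)
        ⟨0, by constructor <;> linarith⟩
        x (L * ⟨T, hT.le⟩) 0 L K :=
      IsPicardLindelof.of_time_independent (fun x _ => hL x) (hb.lipschitzOnWith)
        (by simpa using le_of_eq (show (L : ℝ) * T = ↑(L * ⟨T, hT.le⟩ : ℝ≥0) from rfl))
    obtain ⟨α, h0, hα⟩ := hpl.exists_eq_forall_mem_Icc_hasDerivWithinAt₀
    exact ⟨α, h0, fun t ht => (hα t (Ioo_subset_Icc_self ht)).hasDerivAt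
      (Icc_mem_nhds ht.1 ht.2)⟩
  choose α hα0 hα using fun x (n : ℝ) => hex x (|n| + 1) (by positivity)
  have huniq : ∀ x n n', |n| ≤ |n'| → EqOn (α x n) (α x n') (Ioo (-(|n| + 1)) (|n| + 1)) := by
    intro x n n' hnn
    refine ODE_solution_unique_of_mem_Ioo (v := fun _ => b) (s := fun _ => univ) (K := K) (t₀ := 0)
      (fun t _ => hb.lipschitzOnWith) ?_ (fun t ht => ⟨hα x n t ht, trivial⟩)
      (fun t ht => ⟨hα x n' t ⟨by linarith [ht.1], by linarith [ht.2]⟩, trivial⟩) ?_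
    · constructor <;> [(have := abs_nonneg n; linarith); positivity]
    · rw [hα0, hα0]
  refine ⟨fun t x => α x t t, hb, ⟨L, hL⟩, fun x => hα0 x 0, fun x t => ?_⟩
  have h1 : HasDerivAt (α x (|t| + 1)) (b (α x (|t| + 1) t)) t := by
    apply hα
    rw [abs_of_nonneg (by positivity)]
    exact ⟨by linarith [neg_abs_le t], by linarith [le_abs_self t]⟩
  have h2 : ∀ s, |s| < |t| + 1 → α x s s = α x (|t| + 1) s := by
    intro s hs
    apply huniq x s (|t| + 1)
    · rw [abs_of_nonneg (by positivity : 0 ≤ |t| + 1)]; exact hs.le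
    · exact ⟨by linarith [neg_abs_le s], by linarith [le_abs_self s]⟩
  have h3 : (fun s => α x s s) =ᶠ[𝓝 t] α x (|t| + 1) := by
    have : ∀ᶠ s in 𝓝 t, |s| < |t| + 1 :=
      (continuous_abs.tendsto t).eventually (gt_mem_nhds (by linarith))
    filter_upwards [this] with s hs using h2 s hs
  rw [h2 t (by linarith)]
  exact h1.congr_of_eventuallyEq h3

namespace IsFlow

theorem eq_of_hasDerivAt (h : IsFlow K b Φ) {γ : ℝ → E} (hγ : ∀ t, HasDerivAt γ (b (γ t)) t)
    (t : ℝ) : γ t = Φ t (γ 0) := by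
  have := ODE_solution_unique_univ (v := fun _ => b) (s := fun _ => univ) (K := K) (t₀ := 0)
    (f := γ) (g := fun t => Φ t (γ 0)) (fun t => h.lip.lipschitzOnWith)
    (fun t => ⟨hγ t, trivial⟩) (fun t => ⟨h.deriv _ t, trivial⟩) (by simp [h.zero])
  exact congrFun this t

theorem add (h : IsFlow K b Φ) (s t : ℝ) (x : E) : Φ (s + t) x = Φ s (Φ t x) := by
  have := h.eq_of_hasDerivAt (γ := fun s => Φ (s + t) x)
    (fun s => (h.deriv x (s + t)).comp_add_const s t) s
  simpa using this

theorem neg_self (h : IsFlow K b Φ) (t : ℝ) (x : E) : Φ (-t) (Φ t x) = x := by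
  rw [← h.add, neg_add_cancel, h.zero]

theorem self_neg (h : IsFlow K b Φ) (t : ℝ) (x : E) : Φ t (Φ (-t) x) = x := by
  rw [← h.add, add_neg_cancel, h.zero]

theorem neg (h : IsFlow K b Φ) : IsFlow K (fun x => -b x) fun t => Φ (-t) where
  lip := h.lip.neg
  bdd := by simpa using h.bdd
  zero x := by simp [h.zero]
  deriv x t := by
    have := (h.deriv x (-t)).scomp t (hasDerivAt_neg t)
    simpa [Function.comp_def] using this

theorem continuous_left (h : IsFlow K b Φ) (x : E) : Continuous fun t => Φ t x :=
  continuous_iff_continuousAt.2 fun t => (h.deriv x t).continuousAt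

theorem dist_le (h : IsFlow K b Φ) (t : ℝ) (x y : E) :
    dist (Φ t x) (Φ t y) ≤ exp (K * |t|) * dist x y := by
  have key : ∀ {b : E → E} {Φ : ℝ → E → E}, IsFlow K b Φ → ∀ t, 0 ≤ t →
      dist (Φ t x) (Φ t y) ≤ exp (K * t) * dist x y := by
    intro b Φ h t ht
    have := dist_le_of_trajectories_ODE (v := fun _ => b) (K := K) (a := 0) (b := t)
      (f := fun t => Φ t x) (g := fun t => Φ t y) (δ := dist x y) (fun _ => h.lip)
      (h.continuous_left x).continuousOn (fun s _ => (h.deriv x s).hasDerivWithinAt)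
      (h.continuous_left y).continuousOn (fun s _ => (h.deriv y s).hasDerivWithinAt)
      (by simp [h.zero]) t ⟨ht, le_rfl⟩
    simpa [mul_comm] using this
  rcases le_total 0 t with ht | ht
  · rw [abs_of_nonneg ht]; exact key h t ht
  · rw [abs_of_nonpos ht]
    have := key h.neg (-t) (by linarith)
    simpa using this

theorem lipschitzWith (h : IsFlow K b Φ) (t : ℝ) :
    LipschitzWith (exp (K * |t|)).toNNReal (Φ t) :=
  LipschitzWith.of_dist_le_mul fun x y => by
    rw [Real.coe_toNNReal _ (exp_pos _).le]; exact h.dist_le t x y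

theorem norm_sub_le (h : IsFlow K b Φ) {L : ℝ≥0} (hL : ∀ x, ‖b x‖ ≤ L) (s t : ℝ) (x : E) :
    ‖Φ t x - Φ s x‖ ≤ L * |t - s| := by
  have := Convex.norm_image_sub_le_of_norm_hasDerivWithin_le (s := univ)
    (f := fun t => Φ t x) (fun t _ => (h.deriv x t).hasDerivWithinAt) (fun t _ => hL _)
    convex_univ (mem_univ s) (mem_univ t)
  simpa using this

theorem continuous (h : IsFlow K b Φ) : Continuous fun p : ℝ × E => Φ p.1 p.2 := by
  obtain ⟨L, hL⟩ := h.bdd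
  refine continuous_iff_continuousAt.2 fun ⟨t, x⟩ => ?_
  rw [ContinuousAt, tendsto_iff_dist_tendsto_zero]
  have hle : ∀ p : ℝ × E, dist (Φ p.1 p.2) (Φ t x) ≤
      exp (K * |p.1|) * dist p.2 x + L * |p.1 - t| := fun p =>
    (dist_triangle _ (Φ p.1 x) _).trans
      (add_le_add (h.dist_le _ _ _) (by rw [dist_eq_norm]; exact h.norm_sub_le hL t p.1 x))
  have hc : Continuous fun p : ℝ × E =>
      exp (K * |p.1|) * dist p.2 x + L * |p.1 - t| := by fun_prop
  refine squeeze_zero (fun _ => dist_nonneg) hle ?_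
  have := hc.tendsto (t, x)
  simpa using this

theorem continuous_right (h : IsFlow K b Φ) (t : ℝ) : Continuous (Φ t) :=
  (h.lipschitzWith t).continuous

variable [MeasurableSpace E] [BorelSpace E] [FiniteDimensional ℝ E]

end IsFlow

theorem addHaar_image_le_of_lipschitzWith [MeasurableSpace E] [BorelSpace E]
    [FiniteDimensional ℝ E] (μ : Measure E) [μ.IsAddHaarMeasure] {C : ℝ≥0} {f : E → E}
    (hf : LipschitzWith C f) (s : Set E) : μ (f '' s) ≤ C ^ Module.finrank ℝ E * μ s := by
  have h1 := μ.isAddLeftInvariant_eq_smul (Measure.hausdorffMeasure (Module.finrank ℝ E : ℝ))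
  have h2 := hf.hausdorffMeasure_image_le (d := Module.finrank ℝ E) (by positivity) s
  rw [h1]
  simp only [Measure.smul_apply, ENNReal.smul_def, smul_eq_mul]
  rw [← ENNReal.rpow_natCast, mul_left_comm]
  gcongr

namespace IsFlow

variable [MeasurableSpace E] [BorelSpace E] [FiniteDimensional ℝ E]
  {μ : Measure E} [μ.IsAddHaarMeasure]

/-- The distortion of the volume by the flow. -/
noncomputable def distortion (E : Type*) [NormedAddCommGroup E] [NormedSpace ℝ E] (K : ℝ≥0)
    (t : ℝ) : ℝ :=
  exp (Module.finrank ℝ E * (K * |t|))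

theorem map_le (h : IsFlow K b Φ) (t : ℝ) :
    μ.map (Φ t) ≤ ofReal (distortion E K t) • μ := by
  refine Measure.le_iff.2 fun s hs => ?_
  rw [Measure.map_apply (h.continuous_right t).measurable hs, Measure.smul_apply, smul_eq_mul]
  have h1 : Φ t ⁻¹' s ⊆ Φ (-t) '' s := fun x hx => ⟨Φ t x, hx, h.neg_self t x⟩
  refine (measure_mono h1).trans ((addHaar_image_le_of_lipschitzWith μ
    (h.lipschitzWith (-t)) s).trans_eq ?_)
  congr 1
  rw [distortion, abs_neg, Real.exp_nat_mul, ENNReal.ofReal_pow (exp_pos _).le]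
  rfl

theorem lintegral_comp_le (h : IsFlow K b Φ) (t : ℝ) {F : E → ℝ≥0∞} (hF : AEMeasurable F μ) :
    ∫⁻ x, F (Φ t x) ∂μ ≤ ofReal (distortion E K t) * ∫⁻ x, F x ∂μ := by
  have h1 : μ.map (Φ t) ≪ μ := (h.map_le t).absolutelyContinuous.trans
    (Measure.smul_absolutelyContinuous)
  rw [← lintegral_map' (hF.mono_ac h1) (h.continuous_right t).aemeasurable]
  refine (lintegral_mono' (h.map_le t) le_rfl).trans_eq ?_
  rw [lintegral_smul_measure, smul_eq_mul]

theorem le_lintegral_comp (h : IsFlow K b Φ) (t : ℝ) {F : E → ℝ≥0∞} (hF : AEMeasurable F μ) :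
    ∫⁻ x, F x ∂μ ≤ ofReal (distortion E K t) * ∫⁻ x, F (Φ t x) ∂μ := by
  have h1 : μ.map (Φ t) ≪ μ := (h.map_le t).absolutelyContinuous.trans
    (Measure.smul_absolutelyContinuous)
  have := h.lintegral_comp_le (μ := μ) (-t) (F := fun x => F (Φ t x))
    ((hF.mono_ac h1).comp_aemeasurable (h.continuous_right t).aemeasurable)
  simpa [h.self_neg, distortion] using this

theorem quasiMeasurePreserving (h : IsFlow K b Φ) (t : ℝ) :
    Measure.QuasiMeasurePreserving (Φ t) μ μ :=
  ⟨(h.continuous_right t).measurable, (h.map_le t).absolutelyContinuous.trans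
    (Measure.smul_absolutelyContinuous)⟩

theorem integrable_comp (h : IsFlow K b Φ) (t : ℝ) {F : E → ℝ} (hF : Integrable F μ) :
    Integrable (fun x => F (Φ t x)) μ := by
  refine ⟨hF.1.comp_quasiMeasurePreserving (h.quasiMeasurePreserving t), ?_⟩
  refine (h.lintegral_comp_le t hF.1.enorm).trans_lt ?_
  exact mul_lt_top ofReal_lt_top hF.2

theorem integral_comp_le (h : IsFlow K b Φ) (t : ℝ) {F : E → ℝ} (hF : Integrable F μ)
    (h0 : ∀ x, 0 ≤ F x) : ∫ x, F (Φ t x) ∂μ ≤ distortion E K t * ∫ x, F x ∂μ := by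
  have h1 := h.lintegral_comp_le t (μ := μ) (F := fun x => ofReal (F x))
    hF.1.aemeasurable.ennreal_ofReal
  rw [integral_eq_lintegral_of_nonneg_ae (ae_of_all _ h0) hF.1,
    integral_eq_lintegral_of_nonneg_ae (ae_of_all _ fun x => h0 _) (h.integrable_comp t hF).1]
  have h2 : ∫⁻ x, ofReal (F x) ∂μ ≠ ⊤ := hF.lintegral_lt_top.ne
  have h3 := toReal_mono (mul_ne_top ofReal_ne_top h2) h1
  rwa [toReal_mul, toReal_ofReal (by rw [distortion]; positivity)] at h3

/-- The flow changes integrals by at most a factor close to `1`. -/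
theorem abs_integral_comp_sub_le (h : IsFlow K b Φ) (t : ℝ) {F : E → ℝ} (hF : Integrable F μ) :
    |(∫ x, F (Φ t x) ∂μ) - ∫ x, F x ∂μ| ≤ 2 * (distortion E K t - 1) * ∫ x, |F x| ∂μ := by
  have hd : 1 ≤ distortion E K t := by
    rw [distortion]; exact Real.one_le_exp (by positivity)
  have key : ∀ {F : E → ℝ}, Integrable F μ → (∀ x, 0 ≤ F x) →
      |(∫ x, F (Φ t x) ∂μ) - ∫ x, F x ∂μ| ≤ (distortion E K t - 1) * ∫ x, F x ∂μ := by
    intro F hF h0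
    have h1 := h.integral_comp_le t hF h0
    have h2 := h.integral_comp_le (-t) (h.integrable_comp t hF) fun x => h0 _
    simp only [h.self_neg] at h2
    rw [show distortion E K (-t) = distortion E K t by simp [distortion]] at h2
    have h3 : 0 ≤ ∫ x, F x ∂μ := integral_nonneg h0
    have h4 : 0 ≤ ∫ x, F (Φ t x) ∂μ := integral_nonneg fun x => h0 _
    rw [abs_le]
    constructor
    · nlinarith
    · linarith
  have hp := key hF.pos_part fun x => le_max_right _ _
  have hn := key hF.neg_part fun x => le_max_right _ _
  have e : ∀ x, F x = max (F x) 0 - max (-F x) 0 := fun x => by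
    rcases le_total 0 (F x) with h | h
    · rw [max_eq_left h, max_eq_right (by linarith), sub_zero]
    · rw [max_eq_right h, max_eq_left (by linarith)]; ring
  have e1 : ∫ x, F x ∂μ = (∫ x, max (F x) 0 ∂μ) - ∫ x, max (-F x) 0 ∂μ := by
    rw [← integral_sub hF.pos_part hF.neg_part]; exact integral_congr_ae (ae_of_all _ e)
  have e2 : ∫ x, F (Φ t x) ∂μ = (∫ x, max (F (Φ t x)) 0 ∂μ) - ∫ x, max (-F (Φ t x)) 0 ∂μ := by
    rw [← integral_sub (h.integrable_comp t hF.pos_part) (h.integrable_comp t hF.neg_part)]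
    exact integral_congr_ae (ae_of_all _ fun x => e _)
  have e3 : ∫ x, max (F x) 0 ∂μ ≤ ∫ x, |F x| ∂μ :=
    integral_mono hF.pos_part hF.abs fun x => max_le (le_abs_self _) (abs_nonneg _)
  have e4 : ∫ x, max (-F x) 0 ∂μ ≤ ∫ x, |F x| ∂μ :=
    integral_mono hF.neg_part hF.abs fun x => max_le (neg_le_abs _) (abs_nonneg _)
  rw [e1, e2, show ∀ a b c d : ℝ, a - b - (c - d) = (a - c) - (b - d) by intros; ring]
  refine (abs_sub _ _).trans ?_
  have hd' : 0 ≤ distortion E K t - 1 := by linarith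
  nlinarith [mul_le_mul_of_nonneg_left e3 hd', mul_le_mul_of_nonneg_left e4 hd']

end IsFlow

end Flow

/-! ### Weak derivatives along a vector field and mollification -/

section Weak

/-- Euclidean space of dimension `m`, the model space of an `m`-dimensional manifold. -/
abbrev Euc (m : ℕ) := EuclideanSpace ℝ (Fin m)

/-- The divergence of a vector field. -/
noncomputable def divergence {m : ℕ} (b : Euc m → Euc m) (x : Euc m) : ℝ :=
  ∑ i, fderiv ℝ b x (EuclideanSpace.single i 1) i

/-- The formal adjoint, for Lebesgue measure, of the derivative along `b`. -/
noncomputable def adjointDeriv {m : ℕ} (b : Euc m → Euc m) (φ : Euc m → ℝ) (x : Euc m) : ℝ :=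
  -fderiv ℝ φ x (b x) - divergence b x * φ x

/-- `φ ∈ C^∞_c(W)`. -/
def IsTest {m : ℕ} (W : Set (Euc m)) (φ : Euc m → ℝ) : Prop :=
  ContDiff ℝ ∞ φ ∧ HasCompactSupport φ ∧ tsupport φ ⊆ W

/-- `v` is the weak derivative of `u` along `b` on `W`, with respect to Lebesgue measure. -/
def WeakDeriv {m : ℕ} (b : Euc m → Euc m)
    (W : Set (Euc m)) (u v : Euc m → ℝ) : Prop :=
  ∀ φ, IsTest W φ → ∫ x, u x * adjointDeriv b φ x = ∫ x, v x * φ x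

variable {m : ℕ}

variable {b : Euc m → Euc m}

theorem continuous_divergence (hb : ContDiff ℝ 1 b) : Continuous (divergence b) := by
  have h1 : Continuous (fderiv ℝ b) := hb.continuous_fderiv one_ne_zero
  unfold divergence
  refine continuous_finsetSum _ fun i _ => ?_
  have h2 : Continuous fun x => fderiv ℝ b x (EuclideanSpace.single i 1) :=
    h1.clm_apply continuous_const
  exact (EuclideanSpace.proj (𝕜 := ℝ) i).continuous.comp h2

theorem continuous_adjointDeriv (hb : ContDiff ℝ 1 b) {φ : Euc m → ℝ} (hφ : ContDiff ℝ 1 φ) :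
    Continuous (adjointDeriv b φ) := by
  have h1 : Continuous (fderiv ℝ φ) := hφ.continuous_fderiv one_ne_zero
  exact ((h1.clm_apply hb.continuous).neg).sub ((continuous_divergence hb).mul hφ.continuous)

theorem tsupport_adjointDeriv_subset (φ : Euc m → ℝ) :
    tsupport (adjointDeriv b φ) ⊆ tsupport φ := by
  refine closure_minimal (fun x hx => ?_) (isClosed_tsupport φ)
  by_contra h
  refine hx ?_
  have h1 : fderiv ℝ φ x = 0 := by
    by_contra h2
    exact h (support_fderiv_subset ℝ h2)
  simp [adjointDeriv, h1, image_eq_zero_of_notMem_tsupport h]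

theorem adjointDeriv_eq_zero {φ : Euc m → ℝ} {x : Euc m} (hx : x ∉ tsupport φ) :
    adjointDeriv b φ x = 0 :=
  image_eq_zero_of_notMem_tsupport fun h => hx (tsupport_adjointDeriv_subset φ h)

theorem hasCompactSupport_adjointDeriv {φ : Euc m → ℝ} (hφ : HasCompactSupport φ) :
    HasCompactSupport (adjointDeriv b φ) :=
  hφ.of_isClosed_subset (isClosed_tsupport _) (tsupport_adjointDeriv_subset φ)

theorem integral_fderiv_eq_zero {F : Euc m → ℝ} (hF : ContDiff ℝ 1 F) (hFc : HasCompactSupport F)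
    (v : Euc m) : ∫ x, fderiv ℝ F x v = 0 := by
  have h1 : Continuous fun x => fderiv ℝ F x v :=
    (hF.continuous_fderiv one_ne_zero).clm_apply continuous_const
  have h2 : HasCompactSupport fun x => fderiv ℝ F x v := hFc.fderiv_apply (𝕜 := ℝ) v
  have := integral_mul_fderiv_eq_neg_fderiv_mul_of_integrable (μ := (volume : Measure (Euc m)))
    (f := fun _ : Euc m => (1 : ℝ)) (g := F) (v := v) (by simp)
    (by simpa using h1.integrable_of_hasCompactSupport h2)
    (by simpa using hF.continuous.integrable_of_hasCompactSupport hFc)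
    (fun x _ => differentiableAt_const _)
    (fun x _ => (hF.differentiable one_ne_zero) x)
  simpa using this

theorem integral_divergence_eq_zero {F : Euc m → Euc m} (hF : ContDiff ℝ 1 F)
    (hFc : HasCompactSupport F) : ∫ x, divergence F x = 0 := by
  unfold divergence
  have key : ∀ i : Fin m, ∀ x, fderiv ℝ F x (EuclideanSpace.single i 1) i =
      fderiv ℝ (fun y => F y i) x (EuclideanSpace.single i 1) := by
    intro i x
    have h1 : HasFDerivAt F (fderiv ℝ F x) x := (hF.differentiable one_ne_zero x).hasFDerivAt
    have h2 := (EuclideanSpace.proj i : Euc m →L[ℝ] ℝ).hasFDerivAt.comp x h1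
    have h3 : fderiv ℝ (fun y => F y i) x = _ := h2.fderiv
    rw [h3]
    rfl
  have hFi : ∀ i : Fin m, ContDiff ℝ 1 fun y => F y i := fun i =>
    (EuclideanSpace.proj i : Euc m →L[ℝ] ℝ).contDiff.comp hF
  have hFic : ∀ i : Fin m, HasCompactSupport fun y => F y i := fun i =>
    hFc.comp_left (g := fun z : Euc m => z i) (by simp)
  simp_rw [key]
  rw [integral_finsetSum]
  · exact Finset.sum_eq_zero fun i _ => integral_fderiv_eq_zero (hFi i) (hFic i) _
  · intro i _
    have h1 : Continuous fun x => fderiv ℝ (fun y => F y i) x (EuclideanSpace.single i 1) :=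
      ((hFi i).continuous_fderiv one_ne_zero).clm_apply continuous_const
    exact h1.integrable_of_hasCompactSupport ((hFic i).fderiv_apply (𝕜 := ℝ) _)

theorem sum_apply_single (L : Euc m →L[ℝ] ℝ) (v : Euc m) :
    ∑ i, v i * L (EuclideanSpace.single i 1) = L v := by
  conv_rhs => rw [← (EuclideanSpace.basisFun (Fin m) ℝ).sum_repr v]
  simp [map_sum]

theorem divergence_smul {g : Euc m → ℝ} {x : Euc m} (hg : DifferentiableAt ℝ g x)
    (hb : DifferentiableAt ℝ b x) :
    divergence (fun y => g y • b y) x = fderiv ℝ g x (b x) + g x * divergence b x := by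
  unfold divergence
  rw [fderiv_fun_smul hg hb, ← sum_apply_single (fderiv ℝ g x) (b x), mul_sum,
    ← Finset.sum_add_distrib]
  refine sum_congr rfl fun i _ => ?_
  simp
  ring

/-- Integration by parts along `b`. -/
theorem integral_mul_adjointDeriv (hb : ContDiff ℝ 1 b) {w φ : Euc m → ℝ} (hw : ContDiff ℝ 1 w)
    (hφ : ContDiff ℝ 1 φ) (hφc : HasCompactSupport φ) :
    ∫ x, w x * adjointDeriv b φ x = ∫ x, fderiv ℝ w x (b x) * φ x := by
  have h1 := integral_divergence_eq_zero (F := fun x => (w x * φ x) • b x)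
    ((hw.mul hφ).smul hb) (HasCompactSupport.smul_right (f := fun x => w x * φ x) hφc.mul_left)
  have h2 : ∀ x, divergence (fun x => (w x * φ x) • b x) x =
      fderiv ℝ w x (b x) * φ x - w x * adjointDeriv b φ x := by
    intro x
    have hwx := hw.differentiable one_ne_zero x
    have hφx := hφ.differentiable one_ne_zero x
    rw [divergence_smul (g := fun x => w x * φ x) (hwx.mul hφx) (hb.differentiable one_ne_zero x)]
    rw [fderiv_fun_mul hwx hφx, adjointDeriv]
    simp
    ring
  simp_rw [h2] at h1
  rw [integral_sub] at h1
  · linarith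
  · refine Continuous.integrable_of_hasCompactSupport ?_ hφc.mul_left
    exact ((hw.continuous_fderiv one_ne_zero).clm_apply hb.continuous).mul hφ.continuous
  · refine Continuous.integrable_of_hasCompactSupport ?_
      (hasCompactSupport_adjointDeriv hφc).mul_left
    exact hw.continuous.mul (continuous_adjointDeriv hb hφ)

/-! #### Kernels concentrated near the diagonal -/

/-- A family of integral kernels that live at distance `≤ ε` from the diagonal, of size `ε^{-m}`,
and with the integral `c` in the second variable. -/
structure IsApproxKernel (k : ℝ → Euc m → Euc m → ℝ) (C c : ℝ) : Prop where
  nonneg : 0 ≤ C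
  cont : ∀ ε > 0, Continuous fun p : Euc m × Euc m => k ε p.1 p.2
  bound : ∀ ε > 0, ∀ x y, |k ε x y| ≤ C * (volume (closedBall (0 : Euc m) ε)).toReal⁻¹
  supp : ∀ ε > 0, ∀ x y, k ε x y ≠ 0 → dist x y ≤ ε
  integral : ∀ ε > 0, ε ≤ 1 → ∀ x, ∫ y, k ε x y = c

variable {k : ℝ → Euc m → Euc m → ℝ} {C c : ℝ}

theorem volume_closedBall_pos {ε : ℝ} (hε : 0 < ε) (x : Euc m) :
    0 < (volume (closedBall x ε)).toReal :=
  toReal_pos (measure_closedBall_pos volume x hε).ne'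
    measure_closedBall_lt_top.ne

theorem volume_closedBall_eq (ε : ℝ) (x : Euc m) :
    volume (closedBall x ε) = volume (closedBall (0 : Euc m) ε) :=
  Measure.addHaar_closedBall_center volume x ε

namespace IsApproxKernel

theorem integrable_mul (hk : IsApproxKernel k C c) {ε : ℝ} (hε : 0 < ε) (x : Euc m)
    {u : Euc m → ℝ} (hu : LocallyIntegrable u) : Integrable fun y => k ε x y * u y := by
  refine hu.integrable_smul_left_of_hasCompactSupport
    ((hk.cont ε hε).comp (by fun_prop : Continuous fun y : Euc m => (x, y)))
    (HasCompactSupport.of_support_subset_isCompact (isCompact_closedBall x ε) fun y hy => ?_)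
  rw [mem_closedBall, dist_comm]
  exact hk.supp ε hε x y hy

theorem integrable_left (hk : IsApproxKernel k C c) {ε : ℝ} (hε : 0 < ε) (x : Euc m) :
    Integrable (k ε x) := by
  simpa using hk.integrable_mul hε x (locallyIntegrable_const (1 : ℝ))

theorem lintegral_le (hk : IsApproxKernel k C c) {ε : ℝ} (hε : 0 < ε) (y : Euc m) :
    ∫⁻ x, ‖k ε x y‖ₑ ≤ ofReal C ∧ ∫⁻ x, ‖k ε y x‖ₑ ≤ ofReal C := by
  have key : ∀ f : Euc m → ℝ, (∀ x, |f x| ≤ C * (volume (closedBall (0 : Euc m) ε)).toReal⁻¹) →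
      (∀ x, f x ≠ 0 → x ∈ closedBall y ε) → ∫⁻ x, ‖f x‖ₑ ≤ ofReal C := by
    intro f hf hs
    set V := volume (closedBall (0 : Euc m) ε) with hV
    have hV0 : 0 < V.toReal := volume_closedBall_pos hε 0
    have hle : ∀ x, ‖f x‖ₑ ≤ (closedBall y ε).indicator
        (fun _ => ofReal (C * V.toReal⁻¹)) x := by
      intro x
      by_cases hx : x ∈ closedBall y ε
      · rw [indicator_of_mem hx, ← ofReal_norm, norm_eq_abs]
        exact ofReal_le_ofReal (hf x)
      · have : f x = 0 := by
          by_contra h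
          exact hx (hs x h)
        simp [this]
    refine (lintegral_mono hle).trans ?_
    rw [lintegral_indicator measurableSet_closedBall, setLIntegral_const, volume_closedBall_eq,
      ← hV, ← ofReal_toReal (a := V) measure_closedBall_lt_top.ne,
      ← ofReal_mul (by have := hk.nonneg; positivity),
      toReal_ofReal hV0.le, mul_assoc, inv_mul_cancel₀ hV0.ne', mul_one]
  refine ⟨key _ (fun x => hk.bound ε hε x y) fun x hx => hk.supp ε hε x y hx,
    key _ (fun x => hk.bound ε hε y x) fun x hx => ?_⟩
  rw [mem_closedBall, dist_comm]
  exact hk.supp ε hε y x hx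

/-- Where `u` oscillates little, the kernel approximates `c u`. -/
theorem abs_sub_le (hk : IsApproxKernel k C c) {ε : ℝ} (hε : 0 < ε) (hε1 : ε ≤ 1) {u : Euc m → ℝ}
    (hu : LocallyIntegrable u) {x : Euc m} {δ : ℝ} (hδ : 0 ≤ δ)
    (h : ∀ y, dist x y ≤ ε → |u y - u x| ≤ δ) :
    |(∫ y, k ε x y * u y) - c * u x| ≤ C * δ := by
  rw [← hk.integral ε hε hε1 x, ← integral_mul_const, ← integral_sub (hk.integrable_mul hε x hu)
    ((hk.integrable_left hε x).mul_const _)]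
  have h1 : ∀ y, ‖k ε x y * u y - k ε x y * u x‖ ≤ ‖k ε x y‖ * δ := by
    intro y
    rw [← mul_sub, norm_mul]
    by_cases hy : k ε x y = 0
    · simp [hy]
    · exact mul_le_mul_of_nonneg_left (h y (hk.supp ε hε x y hy)) (norm_nonneg _)
  refine (norm_integral_le_of_norm_le ((hk.integrable_left hε x).norm.mul_const δ)
    (ae_of_all _ h1)).trans ?_
  rw [integral_mul_const]
  refine mul_le_mul_of_nonneg_right ?_ hδ
  rw [integral_norm_eq_lintegral_enorm (hk.integrable_left hε x).1]
  exact toReal_le_of_le_ofReal hk.nonneg (hk.lintegral_le hε x).2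

theorem aestronglyMeasurable_prod (hk : IsApproxKernel k C c) {ε : ℝ} (hε : 0 < ε) {u : Euc m → ℝ}
    (hu : AEStronglyMeasurable u) :
    AEStronglyMeasurable (fun p : Euc m × Euc m => k ε p.1 p.2 * u p.2) (volume.prod volume) :=
  (hk.cont ε hε).aestronglyMeasurable.mul hu.comp_snd

theorem aestronglyMeasurable (hk : IsApproxKernel k C c) {ε : ℝ} (hε : 0 < ε) {u : Euc m → ℝ}
    (hu : AEStronglyMeasurable u) :
    AEStronglyMeasurable fun x => ∫ y, k ε x y * u y :=
  (hk.aestronglyMeasurable_prod hε hu).integral_prod_right'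

theorem lintegral_enorm_le (hk : IsApproxKernel k C c) {ε : ℝ} (hε : 0 < ε) {u : Euc m → ℝ}
    (hu : AEStronglyMeasurable u) :
    ∫⁻ x, ‖∫ y, k ε x y * u y‖ₑ ≤ ofReal C * ∫⁻ x, ‖u x‖ₑ := by
  calc ∫⁻ x, ‖∫ y, k ε x y * u y‖ₑ ≤ ∫⁻ x, ∫⁻ y, ‖k ε x y * u y‖ₑ :=
        lintegral_mono fun x => enorm_integral_le_lintegral_enorm _
    _ = ∫⁻ y, ∫⁻ x, ‖k ε x y * u y‖ₑ :=
        lintegral_lintegral_swap (hk.aestronglyMeasurable_prod hε hu).enorm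
    _ ≤ ∫⁻ y, ofReal C * ‖u y‖ₑ := by
        refine lintegral_mono fun y => ?_
        simp_rw [enorm_mul]
        rw [lintegral_mul_const' _ _ enorm_ne_top]
        gcongr
        exact (hk.lintegral_le hε y).1
    _ = _ := lintegral_const_mul' _ _ ofReal_ne_top

/-- In `L¹` the operators with the kernels `k ε` tend to `c` times the identity. -/
theorem tendsto_lintegral (hk : IsApproxKernel k C c) {u : Euc m → ℝ} (hu : Integrable u) :
    Tendsto (fun ε => ∫⁻ x, ‖(∫ y, k ε x y * u y) - c * u x‖ₑ) (𝓝[>] 0) (𝓝 0) := by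
  rw [ENNReal.tendsto_nhds_zero]
  intro δ hδ
  wlog hδt : δ ≠ ⊤ generalizing δ
  · rw [not_not] at hδt
    simp [hδt]
  set D := C + |c| + 1 with hD
  have hD0 : 0 < D := by have := hk.nonneg; positivity
  obtain ⟨g, hgc, hgle, hgcont, hgi⟩ := hu.exists_hasCompactSupport_lintegral_sub_le
    (ε := δ / (2 * ofReal D)) (by
      refine (ENNReal.div_pos hδ.ne' ?_).ne'
      exact mul_ne_top (by simp) ofReal_ne_top)
  set S := cthickening 1 (tsupport g) with hS
  have hSc : IsCompact S := hgc.isCompact.cthickening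
  have hSfin : volume S ≠ ⊤ := hSc.measure_lt_top.ne
  -- `g` is uniformly continuous
  set κ : ℝ := δ.toReal / (2 * D * ((volume S).toReal + 1)) with hκ
  have hκ0 : 0 < κ := by
    have := toReal_pos hδ.ne' hδt
    positivity
  obtain ⟨ε₀, hε₀, huc⟩ := uniformContinuous_iff.1
    (hgcont.uniformContinuous_of_tendsto_cocompact (hgc.is_zero_at_infty)) κ hκ0
  filter_upwards [Ioo_mem_nhdsGT (lt_min hε₀ one_pos)] with ε hε
  have hε0 : 0 < ε := hε.1
  have hε1 : ε ≤ 1 := (hε.2.trans_le (min_le_right _ _)).le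
  have hug : Integrable (fun x => u x - g x) := hu.sub hgi
  have hsplit : ∀ x, (∫ y, k ε x y * u y) - c * u x =
      (∫ y, k ε x y * (u y - g y)) + (-c * (u x - g x) + ((∫ y, k ε x y * g y) - c * g x)) := by
    intro x
    have : ∫ y, k ε x y * (u y - g y) = (∫ y, k ε x y * u y) - ∫ y, k ε x y * g y := by
      rw [← integral_sub (hk.integrable_mul hε0 x hu.locallyIntegrable)
        (hk.integrable_mul hε0 x hgi.locallyIntegrable)]
      simp_rw [mul_sub]
    rw [this]; ring
  have h3 : ∀ x, ‖(∫ y, k ε x y * g y) - c * g x‖ₑ ≤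
      S.indicator (fun _ => ofReal (C * κ)) x := by
    intro x
    have hle : |(∫ y, k ε x y * g y) - c * g x| ≤ C * κ :=
      hk.abs_sub_le hε0 hε1 hgi.locallyIntegrable hκ0.le fun y hy => by
        have := huc (show dist y x < ε₀ by
          rw [dist_comm]; exact hy.trans_lt (hε.2.trans_le (min_le_left _ _)))
        exact this.le
    by_cases hx : x ∈ S
    · rw [indicator_of_mem hx, ← ofReal_norm]
      exact ofReal_le_ofReal hle
    · have hz : ∀ y, dist x y ≤ 1 → g y = 0 := by
        intro y hy
        by_contra h
        exact hx (mem_cthickening_of_dist_le x y 1 _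
          (subset_tsupport _ h) hy)
      have h1 : ∀ y, k ε x y * g y = 0 := by
        intro y
        by_cases hy : k ε x y = 0
        · simp [hy]
        · rw [hz y ((hk.supp ε hε0 x y hy).trans hε1), mul_zero]
      simp [h1, hz x (by simp)]
  calc ∫⁻ x, ‖(∫ y, k ε x y * u y) - c * u x‖ₑ
      ≤ ∫⁻ x, (‖∫ y, k ε x y * (u y - g y)‖ₑ + (‖-c * (u x - g x)‖ₑ +
          ‖(∫ y, k ε x y * g y) - c * g x‖ₑ)) := by
        refine lintegral_mono fun x => ?_
        rw [hsplit x]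
        refine (enorm_add_le _ _).trans ?_
        gcongr
        exact enorm_add_le _ _
    _ = (∫⁻ x, ‖∫ y, k ε x y * (u y - g y)‖ₑ) + ((∫⁻ x, ‖-c * (u x - g x)‖ₑ) +
          ∫⁻ x, ‖(∫ y, k ε x y * g y) - c * g x‖ₑ) := by
        rw [lintegral_add_left' (hk.aestronglyMeasurable hε0 hug.1).enorm,
          lintegral_add_left' (hug.1.const_mul _).enorm]
    _ ≤ ofReal C * (δ / (2 * ofReal D)) +
          (ofReal |c| * (δ / (2 * ofReal D)) +
            ofReal (C * κ) * volume S) := by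
        gcongr
        · exact (hk.lintegral_enorm_le hε0 hug.1).trans (by gcongr)
        · simp_rw [enorm_mul]
          rw [lintegral_const_mul' _ _ enorm_ne_top, ← ofReal_norm, norm_neg,
            norm_eq_abs]
          gcongr
        · refine (lintegral_mono h3).trans ?_
          rw [lintegral_indicator hSc.measurableSet, setLIntegral_const]
    _ ≤ ofReal D * (δ / (2 * ofReal D)) + δ / 2 := by
        rw [← add_assoc, ← add_mul, ← ofReal_add hk.nonneg (abs_nonneg c)]
        gcongr
        · rw [hD]; linarith
        · rw [← ofReal_toReal hSfin, ← ofReal_mul (by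
            have := hk.nonneg; positivity), ← ofReal_toReal hδt,
            ofReal_toReal hδt, ← ofReal_toReal (a := δ / 2) (by
              exact ENNReal.div_ne_top hδt (by simp)), ENNReal.toReal_div]
          rw [ENNReal.toReal_ofNat]
          refine ofReal_le_ofReal ?_
          set V := (volume S).toReal
          have hV : 0 ≤ V := toReal_nonneg
          have hδ0 : 0 ≤ δ.toReal := toReal_nonneg
          have hC := hk.nonneg
          have e : C * κ * V = δ.toReal / 2 * ((C / D) * (V / (V + 1))) := by
            rw [hκ]; field_simp
          rw [e]
          have e1 : C / D ≤ 1 := by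
            rw [div_le_one hD0, hD]; linarith [abs_nonneg c]
          have e2 : V / (V + 1) ≤ 1 := by
            rw [div_le_one (by positivity)]; linarith
          have e3 : (C / D) * (V / (V + 1)) ≤ 1 :=
            mul_le_one₀ e1 (by positivity) e2
          nlinarith
    _ = δ := by
        have hDt : ofReal D ≠ ⊤ := ofReal_ne_top
        have hDz : ofReal D ≠ 0 := by simpa using hD0
        rw [ENNReal.div_eq_inv_mul, ENNReal.mul_inv (Or.inl two_ne_zero) (Or.inl (by simp)),
          mul_comm (2 : ℝ≥0∞)⁻¹, mul_assoc, ← mul_assoc, ENNReal.mul_inv_cancel hDz hDt, one_mul,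
          ← ENNReal.div_eq_inv_mul, ENNReal.add_halves]

end IsApproxKernel

end Weak

/-! ### Friedrichs' lemma and the chain rule for weak derivatives -/

section Friedrichs

variable {m : ℕ}

theorem IsApproxKernel.integrable {k : ℝ → Euc m → Euc m → ℝ} {C c : ℝ}
    (hk : IsApproxKernel k C c) {ε : ℝ} (hε : 0 < ε) {u : Euc m → ℝ} (hu : Integrable u) :
    Integrable fun x => ∫ y, k ε x y * u y :=
  ⟨hk.aestronglyMeasurable hε hu.1, (hk.lintegral_enorm_le hε hu.1).trans_lt
    (mul_lt_top ofReal_lt_top hu.2)⟩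

/-- A smooth probability density supported in the unit ball. -/
noncomputable def mollifier (m : ℕ) : Euc m → ℝ :=
  ContDiffBump.normed (⟨1 / 2, 1, by norm_num, by norm_num⟩ : ContDiffBump (0 : Euc m)) volume

theorem contDiff_mollifier : ContDiff ℝ ∞ (mollifier m) := ContDiffBump.contDiff_normed _

theorem hasCompactSupport_mollifier : HasCompactSupport (mollifier m) :=
  ContDiffBump.hasCompactSupport_normed _

theorem mollifier_eq_zero {z : Euc m} (hz : 1 < ‖z‖) : mollifier m z = 0 := by
  by_contra h
  have h1 : z ∈ Function.support (mollifier m) := h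
  rw [mollifier, ContDiffBump.support_normed_eq] at h1
  have : ‖z‖ < 1 := by simpa using h1
  linarith

theorem fderiv_mollifier_eq_zero {z : Euc m} (hz : 1 < ‖z‖) : fderiv ℝ (mollifier m) z = 0 := by
  by_contra h
  have h1 : z ∈ tsupport (mollifier m) := support_fderiv_subset ℝ h
  rw [mollifier, ContDiffBump.tsupport_normed_eq] at h1
  have : ‖z‖ ≤ 1 := by simpa using h1
  linarith

/-- The mollifier at scale `ε`. -/
noncomputable def mollifierAt {m : ℕ} (ε : ℝ) (z : Euc m) : ℝ :=
  (ε ^ m)⁻¹ * mollifier m (ε⁻¹ • z)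

theorem contDiff_mollifierAt (ε : ℝ) : ContDiff ℝ ∞ (mollifierAt (m := m) ε) :=
  contDiff_const.mul (contDiff_mollifier.comp (contDiff_const_smul _))

theorem mollifierAt_eq_zero {ε : ℝ} (hε : 0 < ε) {z : Euc m} (hz : ε < ‖z‖) :
    mollifierAt ε z = 0 := by
  rw [mollifierAt, mollifier_eq_zero, mul_zero]
  rw [norm_smul, norm_inv, norm_of_nonneg hε.le, ← div_eq_inv_mul, one_lt_div hε]
  exact hz

theorem fderiv_mollifierAt (ε : ℝ) (z v : Euc m) :
    fderiv ℝ (mollifierAt ε) z v = (ε ^ m)⁻¹ * (ε⁻¹ * fderiv ℝ (mollifier m) (ε⁻¹ • z) v) := by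
  have h1 : HasFDerivAt (mollifier m) (fderiv ℝ (mollifier m) (ε⁻¹ • z)) (ε⁻¹ • z) :=
    ((contDiff_mollifier (m := m)).differentiable (by simp) _).hasFDerivAt
  have h2 : HasFDerivAt (fun z : Euc m => ε⁻¹ • z) (ε⁻¹ • ContinuousLinearMap.id ℝ (Euc m)) z :=
    (hasFDerivAt_id z).const_smul ε⁻¹
  have h3 := (h1.comp z h2).const_mul (ε ^ m)⁻¹
  have h4 : fderiv ℝ (mollifierAt ε) z = _ := h3.fderiv
  rw [h4]
  simp

theorem fderiv_mollifierAt_eq_zero {ε : ℝ} (hε : 0 < ε) {z : Euc m} (hz : ε < ‖z‖) (v : Euc m) :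
    fderiv ℝ (mollifierAt ε) z v = 0 := by
  rw [fderiv_mollifierAt, fderiv_mollifier_eq_zero]
  · simp
  rw [norm_smul, norm_inv, norm_of_nonneg hε.le, ← div_eq_inv_mul, one_lt_div hε]
  exact hz

theorem hasCompactSupport_mollifierAt {ε : ℝ} (hε : 0 < ε) :
    HasCompactSupport (mollifierAt (m := m) ε) :=
  HasCompactSupport.of_support_subset_isCompact (isCompact_closedBall 0 ε) fun z hz => by
    rw [mem_closedBall_zero_iff]
    by_contra h
    exact hz (mollifierAt_eq_zero hε (not_le.1 h))

theorem integral_mollifierAt {ε : ℝ} (hε : 0 < ε) : ∫ z : Euc m, mollifierAt ε z = 1 := by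
  unfold mollifierAt
  rw [integral_const_mul, Measure.integral_comp_smul]
  rw [show ∫ x, mollifier m x = 1 from ContDiffBump.integral_normed _]
  have : (0 : ℝ) < ε ^ m := by positivity
  simp [abs_of_pos this, this.ne']

/-- Bounds for the mollifier at scale `ε` and its derivative. -/
theorem exists_mollifierAt_le (m : ℕ) : ∃ C : ℝ, 0 ≤ C ∧ ∀ ε > 0, ∀ z v : Euc m,
    |mollifierAt ε z| ≤ C * (volume (closedBall (0 : Euc m) ε)).toReal⁻¹ ∧
    |fderiv ℝ (mollifierAt ε) z v| ≤
      C * ε⁻¹ * ‖v‖ * (volume (closedBall (0 : Euc m) ε)).toReal⁻¹ := by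
  obtain ⟨C1, hC1⟩ := (contDiff_mollifier (m := m)).continuous.bounded_above_of_compact_support
    hasCompactSupport_mollifier
  obtain ⟨C2, hC2⟩ := ((contDiff_mollifier (m := m)).continuous_fderiv
    (by simp)).bounded_above_of_compact_support (hasCompactSupport_mollifier.fderiv (𝕜 := ℝ))
  set V := (volume (closedBall (0 : Euc m) 1)).toReal with hV
  have hV0 : 0 < V := volume_closedBall_pos one_pos 0
  have hC10 : 0 ≤ C1 := (norm_nonneg _).trans (hC1 0)
  have hC20 : 0 ≤ C2 := (norm_nonneg _).trans (hC2 0)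
  refine ⟨(C1 + C2) * V, by positivity, fun ε hε z v => ?_⟩
  have hv : (volume (closedBall (0 : Euc m) ε)).toReal = ε ^ m * V := by
    rw [Measure.addHaar_closedBall' volume 0 hε.le, toReal_mul,
      toReal_ofReal (by positivity)]
    simp [hV]
  rw [hv]
  have hεm : 0 < ε ^ m := by positivity
  constructor
  · have h1 := hC1 (ε⁻¹ • z)
    rw [mollifierAt, abs_mul, abs_of_pos (inv_pos.2 hεm), ← norm_eq_abs (mollifier m _)]
    have : (C1 + C2) * V * (ε ^ m * V)⁻¹ = (ε ^ m)⁻¹ * (C1 + C2) := by field_simp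
    rw [this]
    gcongr
    linarith
  · have h1 := (fderiv ℝ (mollifier m) (ε⁻¹ • z)).le_of_opNorm_le (hC2 _) v
    rw [fderiv_mollifierAt, abs_mul, abs_mul, abs_of_pos (inv_pos.2 hεm),
      abs_of_pos (inv_pos.2 hε), ← norm_eq_abs]
    have : (C1 + C2) * V * ε⁻¹ * ‖v‖ * (ε ^ m * V)⁻¹ =
      (ε ^ m)⁻¹ * (ε⁻¹ * ((C1 + C2) * ‖v‖)) := by field_simp
    rw [this]
    gcongr
    refine h1.trans ?_
    gcongr
    linarith

/-- Convolution of `u` with the mollifier at scale `ε`. -/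
noncomputable def mollify {m : ℕ} (ε : ℝ) (u : Euc m → ℝ) (x : Euc m) : ℝ :=
  ∫ y, mollifierAt ε (x - y) * u y

theorem mollify_eq_convolution (ε : ℝ) (u : Euc m → ℝ) :
    mollify ε u = convolution u (mollifierAt ε) (ContinuousLinearMap.mul ℝ ℝ)
      volume := by
  ext x
  simp [mollify, convolution_def, mul_comm]

theorem contDiff_mollify {ε : ℝ} (hε : 0 < ε) {u : Euc m → ℝ} (hu : LocallyIntegrable u) :
    ContDiff ℝ ∞ (mollify ε u) := by
  rw [mollify_eq_convolution]
  exact (hasCompactSupport_mollifierAt hε).contDiff_convolution_right _ hu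
    (contDiff_mollifierAt ε)

theorem fderiv_mollify {ε : ℝ} (hε : 0 < ε) {u : Euc m → ℝ} (hu : LocallyIntegrable u)
    (x v : Euc m) :
    fderiv ℝ (mollify ε u) x v = ∫ y, fderiv ℝ (mollifierAt ε) (x - y) v * u y := by
  rw [mollify_eq_convolution, ((hasCompactSupport_mollifierAt hε).hasFDerivAt_convolution_right _ hu
    ((contDiff_mollifierAt ε).of_le (by simp)) x).fderiv,
    convolution_precompR_apply _ hu ((hasCompactSupport_mollifierAt hε).fderiv (𝕜 := ℝ))
      ((contDiff_mollifierAt ε).continuous_fderiv (by simp))]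
  simp [convolution_def, mul_comm]

theorem isApproxKernel_mollifierAt (m : ℕ) :
    ∃ C, IsApproxKernel (fun ε (x y : Euc m) => mollifierAt ε (x - y)) C 1 := by
  obtain ⟨C, hC0, hC⟩ := exists_mollifierAt_le m
  refine ⟨C, hC0, fun ε _ => (contDiff_mollifierAt ε).continuous.comp (by fun_prop),
    fun ε hε x y => (hC ε hε (x - y) 0).1, fun ε hε x y h => ?_, fun ε hε _ x => ?_⟩
  · by_contra h1
    exact h (mollifierAt_eq_zero hε (by rw [← dist_eq_norm]; exact not_le.1 h1))
  · rw [integral_sub_left_eq_self (mollifierAt ε) volume x, integral_mollifierAt hε]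

variable {b : Euc m → Euc m}

theorem exists_abs_divergence_le (hb : ContDiff ℝ 1 b) (hbc : HasCompactSupport b) :
    ∃ C : ℝ, ∀ x, |divergence b x| ≤ C := by
  refine (continuous_divergence hb).bounded_above_of_compact_support
    (HasCompactSupport.of_support_subset_isCompact hbc fun x hx => ?_)
  by_contra h
  have h1 : fderiv ℝ b x = 0 := by
    by_contra h2
    exact h (support_fderiv_subset ℝ h2)
  exact hx (by simp [divergence, h1])

theorem hasFDerivAt_mollifierAt_sub (ε : ℝ) (x y : Euc m) :
    HasFDerivAt (fun y => mollifierAt ε (x - y)) (-fderiv ℝ (mollifierAt ε) (x - y)) y := by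
  have h1 : HasFDerivAt (mollifierAt ε) (fderiv ℝ (mollifierAt ε) (x - y)) (x - y) :=
    ((contDiff_mollifierAt (m := m) ε).differentiable (by simp) _).hasFDerivAt
  have h2 : HasFDerivAt (fun y : Euc m => x - y) (-ContinuousLinearMap.id ℝ (Euc m)) y :=
    (hasFDerivAt_id y).const_sub x
  have h3 := h1.comp y h2
  rw [ContinuousLinearMap.comp_neg, ContinuousLinearMap.comp_id] at h3
  exact h3

theorem contDiff_mollifierAt_sub (ε : ℝ) (x : Euc m) :
    ContDiff ℝ ∞ (fun y => mollifierAt ε (x - y)) :=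
  (contDiff_mollifierAt ε).comp (contDiff_const.sub contDiff_id)

theorem hasCompactSupport_mollifierAt_sub {ε : ℝ} (hε : 0 < ε) (x : Euc m) :
    HasCompactSupport (fun y => mollifierAt ε (x - y)) :=
  (hasCompactSupport_mollifierAt hε).comp_homeomorph (Homeomorph.subLeft x)

/-- The kernel of the commutator of mollification with the derivative along `b`. -/
noncomputable def commutatorKernel {m : ℕ} (b : Euc m → Euc m) (ε : ℝ) (x y : Euc m) : ℝ :=
  fderiv ℝ (mollifierAt ε) (x - y) (b x - b y) + divergence b y * mollifierAt ε (x - y)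

/-- The commutator kernel has integral zero because it is a divergence; it is of size `ε^{-m}`
since `b` is Lipschitz. -/
theorem isApproxKernel_commutator (hb : ContDiff ℝ ∞ b) (hbc : HasCompactSupport b) :
    ∃ C, IsApproxKernel (commutatorKernel b) C 0 := by
  have hb1 : ContDiff ℝ 1 b := hb.of_le (by simp)
  obtain ⟨C, hC0, hC⟩ := exists_mollifierAt_le m
  obtain ⟨L, hL⟩ := hb1.lipschitzWith_of_hasCompactSupport hbc one_ne_zero
  obtain ⟨Cd, hCd⟩ := exists_abs_divergence_le hb1 hbc
  have hCd0 : 0 ≤ Cd := (abs_nonneg _).trans (hCd 0)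
  have hsupp : ∀ ε > 0, ∀ x y, commutatorKernel b ε x y ≠ 0 → dist x y ≤ ε := by
    intro ε hε x y h
    by_contra h1
    have h2 : ε < ‖x - y‖ := by rw [← dist_eq_norm]; exact not_le.1 h1
    exact h (by rw [commutatorKernel, fderiv_mollifierAt_eq_zero hε h2,
      mollifierAt_eq_zero hε h2]; simp)
  refine ⟨C * L + Cd * C, by positivity, fun ε _ => ?_, fun ε hε x y => ?_, hsupp,
    fun ε hε _ x => ?_⟩
  · have h1 : Continuous (fderiv ℝ (mollifierAt (m := m) ε)) :=
      (contDiff_mollifierAt ε).continuous_fderiv (by simp)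
    have h2 := continuous_divergence hb1
    have h3 : Continuous (mollifierAt (m := m) ε) := (contDiff_mollifierAt ε).continuous
    have h4 := hb.continuous
    unfold commutatorKernel
    refine Continuous.add (Continuous.clm_apply (h1.comp (by fun_prop)) (by fun_prop)) ?_
    exact (h2.comp continuous_snd).mul (h3.comp (by fun_prop))
  · by_cases h0 : commutatorKernel b ε x y = 0
    · rw [h0, abs_zero]; positivity
    have hd := hsupp ε hε x y h0
    set V := (volume (closedBall (0 : Euc m) ε)).toReal⁻¹ with hV
    have hV0 : 0 ≤ V := by positivity
    have h1 := (hC ε hε (x - y) (b x - b y)).2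
    have h2 := (hC ε hε (x - y) 0).1
    have h3 : ‖b x - b y‖ ≤ L * ε := by
      rw [← dist_eq_norm]
      exact (hL.dist_le_mul x y).trans (by gcongr)
    have h4 : C * ε⁻¹ * ‖b x - b y‖ * V ≤ C * L * V := by
      have : C * ε⁻¹ * ‖b x - b y‖ ≤ C * ε⁻¹ * (L * ε) := by gcongr
      have e : C * ε⁻¹ * (L * ε) = C * L := by field_simp
      rw [e] at this
      gcongr
    have h5 : |divergence b y * mollifierAt ε (x - y)| ≤ Cd * (C * V) := by
      rw [abs_mul]
      exact mul_le_mul (hCd y) h2 (abs_nonneg _) hCd0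
    calc |commutatorKernel b ε x y| ≤ _ := abs_add_le _ _
      _ ≤ C * L * V + Cd * (C * V) := add_le_add (h1.trans h4) h5
      _ = (C * L + Cd * C) * V := by ring
  · have hFd : ContDiff ℝ 1 fun y => mollifierAt ε (x - y) • (b x - b y) :=
      ((contDiff_mollifierAt_sub ε x).of_le (by simp)).smul (contDiff_const.sub hb1)
    have h1 := integral_divergence_eq_zero hFd
      (HasCompactSupport.smul_right (f := fun y => mollifierAt ε (x - y))
        (hasCompactSupport_mollifierAt_sub hε x))
    have h2 : ∀ y, divergence (fun y => mollifierAt ε (x - y) • (b x - b y)) y =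
        -commutatorKernel b ε x y := by
      intro y
      have hby := hb1.differentiable one_ne_zero y
      rw [divergence_smul (g := fun y => mollifierAt ε (x - y))
        (hasFDerivAt_mollifierAt_sub ε x y).differentiableAt (hby.const_sub _),
        (hasFDerivAt_mollifierAt_sub ε x y).fderiv, commutatorKernel]
      have : divergence (fun y => b x - b y) y = -divergence b y := by
        simp [divergence, fderiv_const_sub]
      rw [this]
      simp
      ring
    simp_rw [h2, integral_neg] at h1
    linarith

variable {u v : Euc m → ℝ}

/-- Friedrichs' identity: mollification commutes with the derivative along `b` up to the operator
with the kernel `commutatorKernel b`. -/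
theorem WeakDeriv.fderiv_mollify (hb : ContDiff ℝ ∞ b) (hbc : HasCompactSupport b)
    (hu : LocallyIntegrable u) (h : WeakDeriv b univ u v)
    {ε : ℝ} (hε : 0 < ε) (x : Euc m) :
    fderiv ℝ (mollify ε u) x (b x) = mollify ε v x + ∫ y, commutatorKernel b ε x y * u y := by
  obtain ⟨C, hC⟩ := isApproxKernel_commutator hb hbc
  have hb1 : ContDiff ℝ 1 b := hb.of_le (by simp)
  have h1 := h (fun y => mollifierAt ε (x - y)) ⟨contDiff_mollifierAt_sub ε x,
    hasCompactSupport_mollifierAt_sub hε x, subset_univ _⟩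
  rw [SubRiem.fderiv_mollify hε hu, mollify]
  have h2 : ∀ y, adjointDeriv b (fun y => mollifierAt ε (x - y)) y =
      fderiv ℝ (mollifierAt ε) (x - y) (b y) - divergence b y * mollifierAt ε (x - y) := by
    intro y
    rw [adjointDeriv, (hasFDerivAt_mollifierAt_sub ε x y).fderiv]
    simp
  simp_rw [mul_comm (mollifierAt ε _)]
  rw [← h1, ← integral_add]
  · refine integral_congr_ae (ae_of_all _ fun y => ?_)
    simp only [h2, commutatorKernel, map_sub]
    ring
  · refine hu.integrable_smul_right_of_hasCompactSupport (f := u) ?_ ?_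
    · exact continuous_adjointDeriv hb1 ((contDiff_mollifierAt_sub ε x).of_le (by simp))
    · exact hasCompactSupport_adjointDeriv (hasCompactSupport_mollifierAt_sub hε x)
  · exact hC.integrable_mul hε x hu

theorem integrable_mollify {ε : ℝ} (hε : 0 < ε) (hu : Integrable u) : Integrable (mollify ε u) :=
  (isApproxKernel_mollifierAt m).choose_spec.integrable hε hu

theorem tendsto_mollify (hu : Integrable u) :
    Tendsto (fun ε => ∫⁻ x, ‖mollify ε u x - u x‖ₑ) (𝓝[>] 0) (𝓝 0) := by
  simpa [mollify] using (isApproxKernel_mollifierAt m).choose_spec.tendsto_lintegral hu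

theorem WeakDeriv.integrable_fderiv_mollify (hb : ContDiff ℝ ∞ b) (hbc : HasCompactSupport b)
    (hu : Integrable u) (hv : Integrable v) (h : WeakDeriv b univ u v) {ε : ℝ} (hε : 0 < ε) :
    Integrable fun x => fderiv ℝ (mollify ε u) x (b x) := by
  obtain ⟨C, hC⟩ := isApproxKernel_commutator hb hbc
  simp_rw [h.fderiv_mollify hb hbc hu.locallyIntegrable hε]
  exact (integrable_mollify hε hv).add (hC.integrable hε hu)

/-- Friedrichs' lemma. -/
theorem WeakDeriv.tendsto_fderiv_mollify (hb : ContDiff ℝ ∞ b) (hbc : HasCompactSupport b)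
    (hu : Integrable u) (hv : Integrable v) (h : WeakDeriv b univ u v) :
    Tendsto (fun ε => ∫⁻ x, ‖fderiv ℝ (mollify ε u) x (b x) - v x‖ₑ) (𝓝[>] 0) (𝓝 0) := by
  obtain ⟨C, hC⟩ := isApproxKernel_commutator hb hbc
  have h1 := (tendsto_mollify hv).add (hC.tendsto_lintegral hu)
  rw [add_zero] at h1
  refine tendsto_of_tendsto_of_tendsto_of_le_of_le' tendsto_const_nhds h1
    (Eventually.of_forall fun _ => zero_le) ?_
  filter_upwards [self_mem_nhdsWithin] with ε (hε : 0 < ε)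
  have hm : AEMeasurable fun x => ‖mollify ε v x - v x‖ₑ :=
    ((integrable_mollify hε hv).1.sub hv.1).enorm
  rw [← lintegral_add_left' hm]
  refine lintegral_mono fun x => ?_
  simp only
  rw [h.fderiv_mollify hb hbc hu.locallyIntegrable hε, add_sub_right_comm, zero_mul, sub_zero]
  exact enorm_add_le _ _

/-- For continuous functions mollification converges uniformly. -/
theorem exists_abs_mollify_sub_le (hu : UniformContinuous u) (hui : LocallyIntegrable u) {δ : ℝ}
    (hδ : 0 < δ) :
    ∃ ε₀ > 0, ∀ ε, 0 < ε → ε < ε₀ → ∀ x, |mollify ε u x - u x| ≤ δ := by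
  obtain ⟨C, hC⟩ := isApproxKernel_mollifierAt m
  have hC0 := hC.nonneg
  obtain ⟨ε₀, hε₀, h⟩ := uniformContinuous_iff.1 hu (δ / (C + 1)) (by positivity)
  refine ⟨min ε₀ 1, by positivity, fun ε hε hlt x => ?_⟩
  have h1 := hC.abs_sub_le hε (hlt.trans_le (min_le_right _ _)).le hui (x := x)
    (δ := δ / (C + 1)) (by positivity) fun y hy => by
      have := h (show dist y x < ε₀ by
        rw [dist_comm]; exact hy.trans_lt (hlt.trans_le (min_le_left _ _)))
      exact this.le
  rw [one_mul] at h1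
  refine h1.trans ?_
  rw [mul_div_assoc', div_le_iff₀ (by positivity)]
  nlinarith

/-- The uniform version of Friedrichs' lemma. -/
theorem WeakDeriv.exists_abs_fderiv_mollify_sub_le (hb : ContDiff ℝ ∞ b)
    (hbc : HasCompactSupport b) (hu : UniformContinuous u) (hui : LocallyIntegrable u)
    (hv : UniformContinuous v) (hvi : LocallyIntegrable v) (h : WeakDeriv b univ u v) {δ : ℝ}
    (hδ : 0 < δ) :
    ∃ ε₀ > 0, ∀ ε, 0 < ε → ε < ε₀ → ∀ x, |fderiv ℝ (mollify ε u) x (b x) - v x| ≤ δ := by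
  obtain ⟨C, hC⟩ := isApproxKernel_commutator hb hbc
  have hC0 := hC.nonneg
  obtain ⟨ε₁, hε₁, h1⟩ := exists_abs_mollify_sub_le hv hvi (half_pos hδ)
  obtain ⟨ε₀, hε₀, h0⟩ := uniformContinuous_iff.1 hu (δ / 2 / (C + 1)) (by positivity)
  refine ⟨min ε₁ (min ε₀ 1), by positivity, fun ε hε hlt x => ?_⟩
  rw [lt_min_iff, lt_min_iff] at hlt
  have h2 := hC.abs_sub_le hε hlt.2.2.le hui (x := x)
    (δ := δ / 2 / (C + 1)) (by positivity) fun y hy => by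
      have := h0 (show dist y x < ε₀ by rw [dist_comm]; exact hy.trans_lt hlt.2.1)
      exact this.le
  have h3 : C * (δ / 2 / (C + 1)) ≤ δ / 2 := by
    rw [mul_div_assoc', div_le_iff₀ (by positivity)]
    nlinarith
  rw [h.fderiv_mollify hb hbc hui hε, add_sub_right_comm]
  refine (abs_add_le _ _).trans ?_
  have h4 := h1 ε hε hlt.1 x
  rw [zero_mul, sub_zero] at h2
  linarith

end Friedrichs

section ChainRule

variable {m : ℕ} {b : Euc m → Euc m} {u v : Euc m → ℝ}

theorem tendsto_integral_mul_of_L1 {α : Type*} [MeasurableSpace α] {μ : Measure α}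
    {f : α → ℝ} {F g : ℕ → α → ℝ} {g' : α → ℝ} (hf : Integrable f μ)
    (hF : ∀ n, Integrable (F n) μ)
    (hFf : Tendsto (fun n => ∫⁻ x, ‖F n x - f x‖ₑ ∂μ) atTop (𝓝 0))
    (hg : ∀ n, AEStronglyMeasurable (g n) μ) {C : ℝ} (hgC : ∀ n x, |g n x| ≤ C)
    (hgg : ∀ᵐ x ∂μ, Tendsto (fun n => g n x) atTop (𝓝 (g' x))) :
    Tendsto (fun n => ∫ x, F n x * g n x ∂μ) atTop (𝓝 (∫ x, f x * g' x ∂μ)) := by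
  have h1 : Tendsto (fun n => ∫ x, f x * g n x ∂μ) atTop
      (𝓝 (∫ x, f x * g' x ∂μ)) := by
    refine tendsto_integral_of_dominated_convergence (fun x => |f x| * C)
      (fun n => hf.1.mul (hg n)) (hf.abs.mul_const C) (fun n => ae_of_all _ fun x => ?_) ?_
    · rw [norm_mul]
      exact mul_le_mul_of_nonneg_left (hgC n x) (abs_nonneg _)
    · filter_upwards [hgg] with x hx using hx.const_mul _
  have hi : ∀ n, Integrable (fun x => (F n x - f x) * g n x) μ := fun n =>
    ((hF n).sub hf).mul_bdd (c := C) (hg n) (ae_of_all _ fun x => hgC n x)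
  have hi' : ∀ n, Integrable (fun x => f x * g n x) μ := fun n =>
    hf.mul_bdd (c := C) (hg n) (ae_of_all _ fun x => hgC n x)
  have h2 : Tendsto (fun n => ∫ x, (F n x - f x) * g n x ∂μ) atTop (𝓝 0) := by
    have h3 := ENNReal.Tendsto.const_mul (a := ofReal C) hFf (Or.inr ofReal_ne_top)
    rw [mul_zero] at h3
    rw [tendsto_zero_iff_norm_tendsto_zero, ← ENNReal.toReal_zero]
    have h4 := (ENNReal.tendsto_toReal ENNReal.zero_ne_top).comp h3
    refine squeeze_zero' (Eventually.of_forall fun _ => norm_nonneg _) ?_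
      (by simpa using h4)
    have hfin : ∀ᶠ n in atTop, ∫⁻ x, ‖F n x - f x‖ₑ ∂μ ≠ ⊤ :=
      Eventually.of_forall fun n => ((hF n).sub hf).2.ne
    filter_upwards [hfin] with n hn
    refine (norm_integral_le_lintegral_norm _).trans ?_
    refine toReal_mono (mul_ne_top ofReal_ne_top hn) ?_
    simp only
    rw [← lintegral_const_mul' _ _ ofReal_ne_top]
    refine lintegral_mono fun x => ?_
    rw [norm_mul, mul_comm, ← ofReal_norm, ← ofReal_mul ((abs_nonneg (g n x)).trans (hgC n x))]
    refine ofReal_le_ofReal ?_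
    gcongr
    exact hgC n x
  have h5 := h2.add h1
  rw [zero_add] at h5
  refine h5.congr fun n => ?_
  rw [← integral_add (hi n) (hi' n)]
  exact integral_congr_ae (ae_of_all _ fun x => by simp only; ring)

theorem enorm_pi_le_sum {ι : Type*} [Fintype ι] (z : ι → ℝ) : ‖z‖ₑ ≤ ∑ i, ‖z i‖ₑ := by
  have : ‖z‖₊ ≤ ∑ i, ‖z i‖₊ := pi_nnnorm_le_iff.2 fun i =>
    single_le_sum (f := fun i => ‖z i‖₊) (fun _ _ => zero_le) (Finset.mem_univ i)
  simpa [enorm_eq_nnnorm] using ENNReal.coe_le_coe.2 this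

theorem norm_single_one_le {ι : Type*} [Fintype ι] [DecidableEq ι] (i : ι) :
    ‖(Pi.single i 1 : ι → ℝ)‖ ≤ 1 :=
  (pi_norm_le_iff_of_nonneg zero_le_one).2 fun j => by
    by_cases hj : j = i
    · subst hj; simp
    · simp [hj]

/-- The chain rule: the mollified functions satisfy it, and Friedrichs' lemma lets one pass to the
limit in `L¹`. -/
theorem weakDeriv_comp {ι : Type*} [Fintype ι] [DecidableEq ι] (hb : ContDiff ℝ ∞ b)
    (hbc : HasCompactSupport b)
    {u v : ι → Euc m → ℝ} (hu : ∀ i, Integrable (u i)) (hv : ∀ i, Integrable (v i))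
    (h : ∀ i, WeakDeriv b univ (u i) (v i)) {F : (ι → ℝ) → ℝ} (hF : ContDiff ℝ 1 F) {C : ℝ≥0}
    (hC : ∀ z, ‖fderiv ℝ F z‖ ≤ C) :
    WeakDeriv b univ (fun x => F fun i => u i x)
      fun x => ∑ i, v i x * fderiv ℝ F (fun i => u i x) (Pi.single i 1) := by
  intro φ hφ
  have hb1 : ContDiff ℝ 1 b := hb.of_le (by simp)
  have hφ1 : ContDiff ℝ 1 φ := hφ.1.of_le (by simp)
  have hlip : LipschitzWith C F :=
    lipschitzWith_of_nnnorm_fderiv_le (hF.differentiable one_ne_zero) fun z => hC z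
  -- a sequence of mollifications that converges almost everywhere
  obtain ⟨ε, -, hε0, hεt⟩ := exists_seq_strictAnti_tendsto_nhdsWithin (0 : ℝ)
  have hUm : ∀ n i, Integrable (mollify (ε n) (u i)) := fun n i =>
    integrable_mollify (hε0 n) (hu i)
  have hUae : ∀ n, AEStronglyMeasurable fun x => fun i => mollify (ε n) (u i) x := fun n =>
    (aemeasurable_pi_lambda _ fun i => (hUm n i).1.aemeasurable).aestronglyMeasurable
  have huae : AEStronglyMeasurable fun x => fun i => u i x :=
    (aemeasurable_pi_lambda _ fun i => (hu i).1.aemeasurable).aestronglyMeasurable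
  have hsum : Tendsto (fun n => ∫⁻ x, ‖(fun i => mollify (ε n) (u i) x) - fun i => u i x‖ₑ)
      atTop (𝓝 0) := by
    have h1 : Tendsto (fun n => ∑ i, ∫⁻ x, ‖mollify (ε n) (u i) x - u i x‖ₑ)
        atTop (𝓝 (∑ i : ι, 0)) :=
      tendsto_finsetSum _ fun i _ => (tendsto_mollify (hu i)).comp hεt
    rw [Finset.sum_const_zero] at h1
    refine tendsto_of_tendsto_of_tendsto_of_le_of_le tendsto_const_nhds h1
      (fun _ => zero_le) fun n => ?_
    have hm : ∀ i, AEMeasurable fun x => ‖mollify (ε n) (u i) x - u i x‖ₑ := fun i =>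
      ((hUm n i).1.sub (hu i).1).enorm
    simp only
    rw [← lintegral_finsetSum' _ fun i _ => hm i]
    exact lintegral_mono fun x => enorm_pi_le_sum _
  obtain ⟨ns, hns, hae⟩ : ∃ ns : ℕ → ℕ, StrictMono ns ∧ ∀ᵐ x, Tendsto
      (fun n => fun i => mollify (ε (ns n)) (u i) x) atTop (𝓝 fun i => u i x) := by
    have h1 : TendstoInMeasure volume (fun n x => fun i => mollify (ε n) (u i) x) atTop
        (fun x => fun i => u i x) := by
      refine tendstoInMeasure_of_tendsto_eLpNorm (p := 1) one_ne_zero hUae huae ?_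
      simp_rw [eLpNorm_one_eq_lintegral_enorm]
      exact hsum
    exact h1.exists_seq_tendsto_ae
  have hεns := hεt.comp hns.tendsto_atTop
  set U : ℕ → ι → Euc m → ℝ := fun n i => mollify (ε (ns n)) (u i) with hU
  have hUd : ∀ n i, ContDiff ℝ 1 (U n i) := fun n i =>
    (contDiff_mollify (hε0 _) (hu i).locallyIntegrable).of_le (by simp)
  have hUpi : ∀ n, ContDiff ℝ 1 fun x => fun i => U n i x := fun n => contDiff_pi.2 (hUd n)
  have hFU : ∀ n, ContDiff ℝ 1 fun x => F fun i => U n i x := fun n => hF.comp (hUpi n)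
  have hφb : Continuous (adjointDeriv b φ) := continuous_adjointDeriv hb1 hφ1
  have hφbc : HasCompactSupport (adjointDeriv b φ) := hasCompactSupport_adjointDeriv hφ.2.1
  obtain ⟨B, hB⟩ := hφb.bounded_above_of_compact_support hφbc
  obtain ⟨B', hB'⟩ := hφ1.continuous.bounded_above_of_compact_support hφ.2.1
  have hFder : ∀ n x, fderiv ℝ (fun x => F fun i => U n i x) x (b x) =
      ∑ i, fderiv ℝ (U n i) x (b x) * fderiv ℝ F (fun i => U n i x) (Pi.single i 1) := by
    intro n x
    have h1 : HasFDerivAt (fun x => fun i => U n i x)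
        (ContinuousLinearMap.pi fun i => fderiv ℝ (U n i) x) x :=
      hasFDerivAt_pi.2 fun i => ((hUd n i).differentiable one_ne_zero x).hasFDerivAt
    have h2 : HasFDerivAt F (fderiv ℝ F fun i => U n i x) (fun i => U n i x) :=
      (hF.differentiable one_ne_zero _).hasFDerivAt
    have h3 : fderiv ℝ (fun x => F fun i => U n i x) x = _ := (h2.comp x h1).fderiv
    rw [h3]
    simp only [ContinuousLinearMap.comp_apply]
    conv_lhs => rw [← Finset.univ_sum_single
      ((ContinuousLinearMap.pi fun i => fderiv ℝ (U n i) x) (b x)), map_sum]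
    refine sum_congr rfl fun i _ => ?_
    have : (Pi.single i (((ContinuousLinearMap.pi fun i => fderiv ℝ (U n i) x) (b x)) i) : ι → ℝ) =
        (fderiv ℝ (U n i) x (b x)) • (Pi.single i 1 : ι → ℝ) := by
      ext j
      by_cases hj : j = i
      · subst hj; simp
      · simp [hj]
    rw [this, map_smul, smul_eq_mul]
  have hparts : ∀ n, ∫ x, (F fun i => U n i x) * adjointDeriv b φ x =
      ∑ i, ∫ x, fderiv ℝ (U n i) x (b x) *
        (fderiv ℝ F (fun i => U n i x) (Pi.single i 1) * φ x) := by
    intro n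
    rw [integral_mul_adjointDeriv hb1 (hFU n) hφ1 hφ.2.1, ← integral_finsetSum]
    · refine integral_congr_ae (ae_of_all _ fun x => ?_)
      simp only [hFder, sum_mul, mul_assoc]
    · intro i _
      refine Continuous.integrable_of_hasCompactSupport ?_ (hφ.2.1.mul_left.mul_left)
      have h1 := (hUd n i).continuous_fderiv one_ne_zero
      have h2 := (hF.continuous_fderiv one_ne_zero).comp (hUpi n).continuous
      exact (h1.clm_apply hb.continuous).mul ((h2.clm_apply continuous_const).mul hφ1.continuous)
  have hleft : Tendsto (fun n => ∫ x, (F fun i => U n i x) * adjointDeriv b φ x)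
      atTop (𝓝 (∫ x, (F fun i => u i x) * adjointDeriv b φ x)) := by
    have hint : ∀ w : ι → Euc m → ℝ, (∀ i, Integrable (w i)) →
        Integrable fun x => (F fun i => w i x) * adjointDeriv b φ x := by
      intro w hw
      have hwm : AEStronglyMeasurable fun x => fun i => w i x :=
        (aemeasurable_pi_lambda _ fun i => (hw i).1.aemeasurable).aestronglyMeasurable
      refine Integrable.mono' (g := fun x => |F 0| * |adjointDeriv b φ x| +
        (∑ i, C * |w i x|) * B) ?_ ((hF.continuous.comp_aestronglyMeasurable hwm).mul
          hφb.aestronglyMeasurable) (ae_of_all _ fun x => ?_)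
      · refine ((hφb.integrable_of_hasCompactSupport hφbc).abs.const_mul _).add
          (Integrable.mul_const ?_ _)
        exact integrable_finsetSum _ fun i _ => (hw i).abs.const_mul _
      · have h1 := hlip.dist_le_mul (fun i => w i x) 0
        rw [dist_eq, dist_zero_right] at h1
        have h2 : ‖fun i => w i x‖ ≤ ∑ i, |w i x| := by
          refine (pi_norm_le_iff_of_nonneg (sum_nonneg fun i _ => abs_nonneg _)).2
            fun i => ?_
          exact single_le_sum (f := fun i => |w i x|) (fun _ _ => abs_nonneg _)
            (Finset.mem_univ i)
        have h3 : |F fun i => w i x| ≤ |F 0| + C * ∑ i, |w i x| := by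
          have h4 := abs_sub_abs_le_abs_sub (F fun i => w i x) (F 0)
          have h5 : (C : ℝ) * ‖fun i => w i x‖ ≤ C * ∑ i, |w i x| := by gcongr
          linarith
        rw [norm_mul, norm_eq_abs]
        have hBx := hB x
        rw [norm_eq_abs] at hBx ⊢
        rw [← mul_sum]
        calc _ ≤ (|F 0| + C * ∑ i, |w i x|) * |adjointDeriv b φ x| := by gcongr
          _ = |F 0| * |adjointDeriv b φ x| + (C * ∑ i, |w i x|) * |adjointDeriv b φ x| := by ring
          _ ≤ _ := by gcongr
    refine tendsto_integral_of_L1 _ (hint u hu).1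
      (Eventually.of_forall fun n => hint _ fun i => hUm _ i) ?_
    have h1 := ENNReal.Tendsto.const_mul (a := C * ofReal B)
      (hsum.comp hns.tendsto_atTop) (Or.inr (mul_ne_top coe_ne_top
        ofReal_ne_top))
    rw [mul_zero] at h1
    refine tendsto_of_tendsto_of_tendsto_of_le_of_le tendsto_const_nhds h1
      (fun _ => zero_le) fun n => ?_
    simp only [Function.comp_apply]
    rw [← lintegral_const_mul' _ _ (mul_ne_top coe_ne_top ofReal_ne_top)]
    refine lintegral_mono fun x => ?_
    rw [← sub_mul, enorm_mul, mul_right_comm]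
    gcongr
    · rw [← edist_eq_enorm_sub, ← edist_eq_enorm_sub]
      exact hlip _ _
    · rw [← ofReal_norm]
      exact ofReal_le_ofReal (hB x)
  have hright : Tendsto (fun n => ∑ i, ∫ x, fderiv ℝ (U n i) x (b x) *
        (fderiv ℝ F (fun i => U n i x) (Pi.single i 1) * φ x)) atTop
      (𝓝 (∑ i, ∫ x, v i x * (fderiv ℝ F (fun i => u i x) (Pi.single i 1) * φ x))) := by
    refine tendsto_finsetSum _ fun i _ => ?_
    have hFc : Continuous fun z => fderiv ℝ F z (Pi.single i 1) :=
      (hF.continuous_fderiv one_ne_zero).clm_apply continuous_const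
    refine tendsto_integral_mul_of_L1 (C := C * B') (hv i)
      (fun n => (h i).integrable_fderiv_mollify hb hbc (hu i) (hv i) (hε0 _))
      (((h i).tendsto_fderiv_mollify hb hbc (hu i) (hv i)).comp hεns)
      (fun n => ?_) (fun n x => ?_) ?_
    · exact ((hFc.comp (hUpi n).continuous).mul hφ1.continuous).aestronglyMeasurable
    · rw [abs_mul]
      refine mul_le_mul ?_ (hB' x) (abs_nonneg _) C.2
      exact ((fderiv ℝ F _).le_of_opNorm_le (hC _) _).trans
        (mul_le_of_le_one_right C.2 (norm_single_one_le i))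
    · filter_upwards [hae] with x hx
      exact ((hFc.tendsto _).comp hx).mul_const _
  have heq := tendsto_nhds_unique hleft (hright.congr fun n => (hparts n).symm)
  rw [heq, ← integral_finsetSum]
  · refine integral_congr_ae (ae_of_all _ fun x => ?_)
    beta_reduce
    rw [sum_mul]
    exact sum_congr rfl fun i _ => (mul_assoc _ _ _).symm
  · intro i _
    refine (hv i).mul_bdd (c := C * B') ?_ (ae_of_all _ fun x => ?_)
    · have hFc : Continuous fun z => fderiv ℝ F z (Pi.single i 1) :=
        (hF.continuous_fderiv one_ne_zero).clm_apply continuous_const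
      exact (hFc.comp_aestronglyMeasurable huae).mul hφ1.continuous.aestronglyMeasurable
    · rw [norm_mul]
      refine mul_le_mul ?_ (hB' x) (norm_nonneg _) C.2
      exact ((fderiv ℝ F _).le_of_opNorm_le (hC _) _).trans
        (mul_le_of_le_one_right C.2 (norm_single_one_le i))

end ChainRule

/-! ### Local rules for weak derivatives -/

section Cutoff

theorem exists_isTestFunction_eq_one {n : ℕ} {M : Type*} [TopologicalSpace M]
    [ChartedSpace (Euc n) M] [IsManifold (𝓡 n) ∞ M] [T2Space M]
    [SecondCountableTopology M] {K W : Set M} (hK : IsCompact K) (hW : IsOpen W) (hKW : K ⊆ W) :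
    ∃ χ : M → ℝ, IsTestFunction (n := n) W χ ∧ (∀ᶠ x in 𝓝ˢ K, χ x = 1) ∧
      ∀ x, χ x ∈ Icc (0 : ℝ) 1 := by
  have : LocallyCompactSpace M := ChartedSpace.locallyCompactSpace (Euc n) M
  obtain ⟨L, hL, hKL, hLW⟩ := exists_compact_between hK hW hKW
  obtain ⟨χ, h1, h2, h3⟩ := exists_contMDiffMap_one_nhds_of_subset_interior (𝓡 n) (n := ⊤)
    hK.isClosed hKL
  have hsupp : Function.support χ ⊆ L := fun x hx => by
    by_contra h
    exact hx (h2 x h)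
  exact ⟨χ, ⟨χ.contMDiff, HasCompactSupport.of_support_subset_isCompact hL hsupp,
    (closure_minimal hsupp hL.isClosed).trans hLW⟩, h1, h3⟩

variable {m : ℕ}

theorem isTestFunction_iff_isTest {W : Set (Euc m)} {φ : Euc m → ℝ} :
    IsTestFunction (n := m) W φ ↔ IsTest W φ := by
  rw [IsTestFunction, IsTest, contMDiff_iff_contDiff]

theorem exists_isTest_eq_one {K W : Set (Euc m)} (hK : IsCompact K) (hW : IsOpen W)
    (hKW : K ⊆ W) : ∃ χ : Euc m → ℝ, IsTest W χ ∧ (∀ᶠ x in 𝓝ˢ K, χ x = 1) ∧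
      ∀ x, χ x ∈ Icc (0 : ℝ) 1 := by
  obtain ⟨χ, h1, h2⟩ := exists_isTestFunction_eq_one (n := m) hK hW hKW
  exact ⟨χ, isTestFunction_iff_isTest.1 h1, h2⟩

theorem integrable_mul_of_integrableOn {X : Type*} [TopologicalSpace X] [MeasurableSpace X]
    [BorelSpace X] {μ : Measure X} {u φ : X → ℝ} (hφ : Continuous φ)
    (hc : HasCompactSupport φ) (hu : IntegrableOn u (tsupport φ) μ) :
    Integrable (fun x => u x * φ x) μ := by
  obtain ⟨C, hC⟩ := hφ.bounded_above_of_compact_support hc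
  rw [← integrableOn_iff_integrable_of_support_subset (s := tsupport φ)]
  · exact hu.mul_bdd (c := C) hφ.measurable.aestronglyMeasurable.restrict (ae_of_all _ hC)
  · intro x hx
    exact subset_tsupport _ fun h => hx (by simp [h])

theorem contDiff_of_tsupport_subset {E F : Type*} [NormedAddCommGroup E] [NormedSpace ℝ E]
    [NormedAddCommGroup F] [NormedSpace ℝ F] {G : E → F} {ζ : E → ℝ} {O : Set E} (hO : IsOpen O)
    {k : WithTop ℕ∞} (hζ : ContDiff ℝ k ζ) (hζO : tsupport ζ ⊆ O) (hG : ContDiffOn ℝ k G O) :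
    ContDiff ℝ k fun x => ζ x • G x := by
  refine contDiff_iff_contDiffAt.2 fun x => ?_
  by_cases hx : x ∈ O
  · exact hζ.contDiffAt.smul (hG.contDiffAt (hO.mem_nhds hx))
  · have h1 : ζ =ᶠ[𝓝 x] 0 := notMem_tsupport_iff_eventuallyEq.1 fun h => hx (hζO h)
    refine (contDiffAt_const (c := (0 : F))).congr_of_eventuallyEq ?_
    filter_upwards [h1] with z hz
    simp [hz]

end Cutoff

section LocalRules

variable {m : ℕ} {b : Euc m → Euc m} {u v : Euc m → ℝ} {W : Set (Euc m)}

theorem IsTest.mono {W' : Set (Euc m)} {φ : Euc m → ℝ} (h : IsTest W φ) (hW : W ⊆ W') :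
    IsTest W' φ := ⟨h.1, h.2.1, h.2.2.trans hW⟩

theorem IsTest.integrable_mul {φ : Euc m → ℝ} (h : IsTest W φ) (hu : LocallyIntegrableOn u W) :
    Integrable fun x => u x * φ x :=
  integrable_mul_of_integrableOn h.1.continuous h.2.1
    (hu.integrableOn_compact_subset h.2.2 h.2.1)

theorem WeakDeriv.mono {W' : Set (Euc m)} (h : WeakDeriv b W u v) (hW : W' ⊆ W) :
    WeakDeriv b W' u v := fun φ hφ => h φ (hφ.mono hW)

theorem WeakDeriv.congr {u' v' : Euc m → ℝ} (h : WeakDeriv b W u v)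
    (hu : ∀ᵐ x, x ∈ W → u x = u' x) (hv : ∀ᵐ x, x ∈ W → v x = v' x) : WeakDeriv b W u' v' := by
  intro φ hφ
  have h1 : ∫ x, u' x * adjointDeriv b φ x = ∫ x, u x * adjointDeriv b φ x := by
    refine integral_congr_ae ?_
    filter_upwards [hu] with x hx
    by_cases hxs : x ∈ tsupport φ
    · rw [hx (hφ.2.2 hxs)]
    · simp [adjointDeriv_eq_zero hxs]
  have h2 : ∫ x, v' x * φ x = ∫ x, v x * φ x := by
    refine integral_congr_ae ?_
    filter_upwards [hv] with x hx
    by_cases hxs : x ∈ tsupport φ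
    · rw [hx (hφ.2.2 hxs)]
    · simp [image_eq_zero_of_notMem_tsupport hxs]
  rw [h1, h2, h φ hφ]

theorem ae_eq_of_forall_integral_mul_eq (hW : IsOpen W) (hu : LocallyIntegrableOn u W)
    (hv : LocallyIntegrableOn v W) (h : ∀ φ, IsTest W φ → ∫ x, u x * φ x = ∫ x, v x * φ x) :
    ∀ᵐ x, x ∈ W → u x = v x := by
  have h1 := hW.ae_eq_zero_of_integral_contDiff_smul_eq_zero (μ := volume)
    (f := fun x => u x - v x) (hu.sub hv) fun g hg hgc hgW => by
      have hgt : IsTest W g := ⟨hg, hgc, hgW⟩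
      have := h g hgt
      rw [← sub_eq_zero, ← integral_sub (hgt.integrable_mul hu) (hgt.integrable_mul hv)] at this
      rw [← this]
      refine integral_congr_ae (ae_of_all _ fun x => ?_)
      simp only [smul_eq_mul]
      ring
  filter_upwards [h1] with x hx hxW
  linarith [hx hxW]

theorem WeakDeriv.ae_unique {v' : Euc m → ℝ} (hW : IsOpen W) (h : WeakDeriv b W u v)
    (h' : WeakDeriv b W u v') (hv : LocallyIntegrableOn v W) (hv' : LocallyIntegrableOn v' W) :
    ∀ᵐ x, x ∈ W → v x = v' x :=
  ae_eq_of_forall_integral_mul_eq hW hv hv' fun φ hφ => (h φ hφ).symm.trans (h' φ hφ)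

theorem adjointDeriv_mul {χ ψ : Euc m → ℝ} (hχ : ContDiff ℝ 1 χ) (hψ : ContDiff ℝ 1 ψ)
    (x : Euc m) : adjointDeriv b (fun x => χ x * ψ x) x =
      χ x * adjointDeriv b ψ x - fderiv ℝ χ x (b x) * ψ x := by
  rw [adjointDeriv, adjointDeriv, fderiv_fun_mul (hχ.differentiable one_ne_zero x)
    (hψ.differentiable one_ne_zero x)]
  simp
  ring

theorem continuous_fderiv_apply_field {χ : Euc m → ℝ} (hχ : ContDiff ℝ 1 χ) (hb : Continuous b) :
    Continuous fun x => fderiv ℝ χ x (b x) :=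
  (hχ.continuous_fderiv one_ne_zero).clm_apply hb

theorem tsupport_fderiv_apply_field_subset (χ : Euc m → ℝ) :
    tsupport (fun x => fderiv ℝ χ x (b x)) ⊆ tsupport χ := by
  refine closure_minimal (fun x hx => ?_) (isClosed_tsupport χ)
  exact support_fderiv_subset ℝ (f := χ) fun h => hx (by simp [h])

theorem IsTest.fderiv_apply (hb : ContDiff ℝ ∞ b) {χ : Euc m → ℝ} (hχ : IsTest W χ) :
    IsTest W fun x => fderiv ℝ χ x (b x) :=
  have h := (tsupport_fderiv_apply_field_subset (b := b) χ)
  ⟨(hχ.1.fderiv_right (m := ∞) (by simp)).clm_apply hb,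
    IsCompact.of_isClosed_subset hχ.2.1 (isClosed_tsupport _) h, h.trans hχ.2.2⟩

theorem IsTest.adjointDeriv (hb : ContDiff ℝ ∞ b) {φ : Euc m → ℝ} (hφ : IsTest W φ) :
    IsTest W (adjointDeriv b φ) := by
  refine ⟨?_, hasCompactSupport_adjointDeriv hφ.2.1,
    (tsupport_adjointDeriv_subset φ).trans hφ.2.2⟩
  have h1 : ContDiff ℝ ∞ (divergence b) := ContDiff.sum fun i _ =>
    (EuclideanSpace.proj (𝕜 := ℝ) i).contDiff.comp
      ((hb.fderiv_right (m := ∞) (by simp)).clm_apply contDiff_const)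
  exact ((hφ.fderiv_apply hb).1.neg).sub (h1.mul hφ.1)

/-- Localization of a weak derivative by a cutoff function. -/
theorem WeakDeriv.mul_test (hb : ContDiff ℝ ∞ b) (h : WeakDeriv b W u v)
    (hu : LocallyIntegrableOn u W) (hv : LocallyIntegrableOn v W) {χ : Euc m → ℝ}
    (hχ : IsTest W χ) :
    WeakDeriv b univ (fun x => u x * χ x) (fun x => v x * χ x + u x * fderiv ℝ χ x (b x)) := by
  intro ψ hψ
  have hχψ : IsTest W fun x => χ x * ψ x :=
    ⟨hχ.1.mul hψ.1, hχ.2.1.mul_right, (tsupport_mul_subset_left).trans hχ.2.2⟩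
  have h1 := h _ hχψ
  have hi1 := (hχψ.adjointDeriv hb).integrable_mul hu
  obtain ⟨C, hC⟩ := hψ.1.continuous.bounded_above_of_compact_support hψ.2.1
  have hi2 : Integrable fun x => u x * fderiv ℝ χ x (b x) * ψ x :=
    ((hχ.fderiv_apply hb).integrable_mul hu).mul_bdd (c := C)
      hψ.1.continuous.aestronglyMeasurable (ae_of_all _ hC)
  have hi3 := hχψ.integrable_mul hv
  calc ∫ x, u x * χ x * adjointDeriv b ψ x
      = ∫ x, (u x * adjointDeriv b (fun x => χ x * ψ x) x + u x * fderiv ℝ χ x (b x) * ψ x) := by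
        refine integral_congr_ae (ae_of_all _ fun x => ?_)
        simp only
        rw [adjointDeriv_mul (hχ.1.of_le (by simp)) (hψ.1.of_le (by simp))]
        ring
    _ = ∫ x, (v x * (χ x * ψ x) + u x * fderiv ℝ χ x (b x) * ψ x) := by
        rw [integral_add hi1 hi2, integral_add hi3 hi2, h1]
    _ = _ := by
        refine integral_congr_ae (ae_of_all _ fun x => ?_)
        simp only
        ring

theorem eq_one_and_fderiv_eq_zero {K : Set (Euc m)} {χ : Euc m → ℝ}
    (hχ : ∀ᶠ x in 𝓝ˢ K, χ x = 1) {x : Euc m} (hx : x ∈ K) : χ x = 1 ∧ fderiv ℝ χ x = 0 := by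
  have h1 : ∀ᶠ y in 𝓝 x, χ y = 1 := hχ.filter_mono (nhds_le_nhdsSet hx)
  refine ⟨h1.self_of_nhds, ?_⟩
  have h2 : χ =ᶠ[𝓝 x] fun _ => (1 : ℝ) := h1
  rw [h2.fderiv_eq]
  simp

/-- The chain rule on an open set. -/
theorem weakDeriv_comp_of_local {ι : Type*} [Fintype ι] [DecidableEq ι] (hb : ContDiff ℝ ∞ b)
    (hbc : HasCompactSupport b) (hW : IsOpen W) {u v : ι → Euc m → ℝ}
    (hu : ∀ i, LocallyIntegrableOn (u i) W) (hv : ∀ i, LocallyIntegrableOn (v i) W)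
    (h : ∀ i, WeakDeriv b W (u i) (v i)) {F : (ι → ℝ) → ℝ} (hF : ContDiff ℝ 1 F) {C : ℝ≥0}
    (hC : ∀ z, ‖fderiv ℝ F z‖ ≤ C) :
    WeakDeriv b W (fun x => F fun i => u i x)
      fun x => ∑ i, v i x * fderiv ℝ F (fun i => u i x) (Pi.single i 1) := by
  intro φ hφ
  obtain ⟨χ, hχ, hχ1, -⟩ := exists_isTest_eq_one (K := tsupport φ) hφ.2.1 hW hφ.2.2
  have h1 := weakDeriv_comp hb hbc (u := fun i x => u i x * χ x)
    (v := fun i x => v i x * χ x + u i x * fderiv ℝ χ x (b x))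
    (fun i => hχ.integrable_mul (hu i))
    (fun i => (hχ.integrable_mul (hv i)).add ((hχ.fderiv_apply hb).integrable_mul (hu i)))
    (fun i => (h i).mul_test hb (hu i) (hv i) hχ) hF hC φ (hφ.mono (subset_univ _))
  convert h1 using 2
  · ext x
    by_cases hx : x ∈ tsupport φ
    · simp [(eq_one_and_fderiv_eq_zero hχ1 hx).1]
    · simp [adjointDeriv_eq_zero hx]
  · ext x
    by_cases hx : x ∈ tsupport φ
    · simp [eq_one_and_fderiv_eq_zero hχ1 hx]
    · simp [image_eq_zero_of_notMem_tsupport hx]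

/-- The chain rule for a function that is smooth near the values of continuous functions. -/
theorem weakDeriv_comp_of_continuousOn {ι : Type*} [Fintype ι] [DecidableEq ι]
    (hb : ContDiff ℝ ∞ b) (hbc : HasCompactSupport b) (hW : IsOpen W) {u v : ι → Euc m → ℝ}
    (hu : ∀ i, ContinuousOn (u i) W) (hv : ∀ i, LocallyIntegrableOn (v i) W)
    (h : ∀ i, WeakDeriv b W (u i) (v i)) {O : Set (ι → ℝ)} (hO : IsOpen O)
    (huO : ∀ x ∈ W, (fun i => u i x) ∈ O) {G : (ι → ℝ) → ℝ} (hG : ContDiffOn ℝ 1 G O) :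
    WeakDeriv b W (fun x => G fun i => u i x)
      fun x => ∑ i, v i x * fderiv ℝ G (fun i => u i x) (Pi.single i 1) := by
  intro φ hφ
  have hpi : ContinuousOn (fun x => fun i => u i x) W := continuousOn_pi.2 hu
  have hKc : IsCompact ((fun x => fun i => u i x) '' tsupport φ) :=
    (show IsCompact (tsupport φ) from hφ.2.1).image_of_continuousOn (hpi.mono hφ.2.2)
  obtain ⟨L, hL, hKL, hLO⟩ := exists_compact_between hKc hO
    (by rintro _ ⟨x, hx, rfl⟩; exact huO x (hφ.2.2 hx))
  obtain ⟨ζ, hζ1, hζ2, -⟩ := exists_contMDiffMap_one_nhds_of_subset_interior 𝓘(ℝ, ι → ℝ)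
    (n := ⊤) hKc.isClosed hKL
  have hsupp : Function.support ζ ⊆ L := fun x hx => by
    by_contra h
    exact hx (hζ2 x h)
  have hζts : tsupport ζ ⊆ L := closure_minimal hsupp hL.isClosed
  have hζc : HasCompactSupport ζ := HasCompactSupport.of_support_subset_isCompact hL hsupp
  have hζd : ContDiff ℝ 1 ζ := (contMDiff_iff_contDiff.1 ζ.contMDiff).of_le (by simp)
  have hFd : ContDiff ℝ 1 fun z => ζ z • G z :=
    contDiff_of_tsupport_subset hO hζd (hζts.trans hLO) hG
  have hFc : HasCompactSupport fun z => ζ z • G z :=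
    HasCompactSupport.smul_right (f := ζ) hζc
  obtain ⟨C, hC⟩ := (hFd.continuous_fderiv one_ne_zero).bounded_above_of_compact_support
    (hFc.fderiv (𝕜 := ℝ))
  have hC0 : 0 ≤ C := (norm_nonneg _).trans (hC 0)
  have h1 := weakDeriv_comp_of_local hb hbc hW
    (fun i => (hu i).locallyIntegrableOn hW.measurableSet) hv h hFd (C := C.toNNReal)
    (fun z => (hC z).trans (Real.le_coe_toNNReal C)) φ hφ
  have hnear : ∀ x ∈ tsupport φ, (fun z => ζ z • G z) =ᶠ[𝓝 fun i => u i x] G := by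
    intro x hx
    have : ∀ᶠ z in 𝓝 fun i => u i x, ζ z = 1 :=
      hζ1.filter_mono (nhds_le_nhdsSet (mem_image_of_mem _ hx))
    filter_upwards [this] with z hz
    simp [hz]
  convert h1 using 2
  · ext x
    by_cases hx : x ∈ tsupport φ
    · have e := (hnear x hx).self_of_nhds
      beta_reduce at e ⊢
      rw [e]
    · simp [adjointDeriv_eq_zero hx]
  · ext x
    by_cases hx : x ∈ tsupport φ
    · simp only [(hnear x hx).fderiv_eq]
    · simp [image_eq_zero_of_notMem_tsupport hx]

/-! #### The product rule -/

/-- A smooth bounded truncation of the identity. -/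
noncomputable def truncation (n : ℕ) (s : ℝ) : ℝ := (n + 1) * Real.arctan (s / (n + 1))

/-- The derivative of the truncation. -/
noncomputable def truncationDeriv (n : ℕ) (s : ℝ) : ℝ := 1 / (1 + (s / (n + 1)) ^ 2)

theorem hasDerivAt_truncation (n : ℕ) (s : ℝ) :
    HasDerivAt (truncation n) (truncationDeriv n s) s := by
  have hn : (n + 1 : ℝ) ≠ 0 := by positivity
  have h1 := ((hasDerivAt_id s).div_const ((n : ℝ) + 1)).arctan.const_mul ((n : ℝ) + 1)
  refine h1.congr_deriv ?_
  unfold truncationDeriv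
  simp only [id]
  field_simp

theorem contDiff_truncation (n : ℕ) : ContDiff ℝ 1 (truncation n) :=
  contDiff_const.mul ((contDiff_id.div_const _).arctan)

theorem truncationDeriv_mem (n : ℕ) (s : ℝ) : |truncationDeriv n s| ≤ 1 := by
  rw [truncationDeriv, abs_of_nonneg (by positivity), div_le_one (by positivity)]
  nlinarith [sq_nonneg (s / (n + 1))]

theorem abs_truncation_le_abs (n : ℕ) (s : ℝ) : |truncation n s| ≤ |s| := by
  have := Convex.norm_image_sub_le_of_norm_hasDerivWithin_le (s := univ) (f := truncation n)
    (fun x _ => (hasDerivAt_truncation n x).hasDerivWithinAt)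
    (fun x _ => truncationDeriv_mem n x) convex_univ (mem_univ 0) (mem_univ s)
  simpa [truncation] using this

theorem abs_truncation_le (n : ℕ) (s : ℝ) : |truncation n s| ≤ (n + 1) * 2 := by
  have hn : (0 : ℝ) < n + 1 := by positivity
  rw [truncation, abs_mul, abs_of_pos hn]
  gcongr
  rw [abs_le]
  have := Real.pi_lt_four
  exact ⟨by linarith [Real.neg_pi_div_two_lt_arctan (s / (n + 1))],
    by linarith [Real.arctan_lt_pi_div_two (s / (n + 1))]⟩

theorem tendsto_truncationDeriv (s : ℝ) :
    Tendsto (fun n => truncationDeriv n s) atTop (𝓝 1) := by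
  have h1 : Tendsto (fun n : ℕ => s / ((n : ℝ) + 1)) atTop (𝓝 0) := by
    have := (tendsto_one_div_add_atTop_nhds_zero_nat (𝕜 := ℝ)).const_mul s
    simpa [div_eq_mul_inv] using this
  have h2 := (((h1.pow 2).const_add 1)).inv₀ (by norm_num)
  simpa [truncationDeriv] using h2

theorem tendsto_truncation (s : ℝ) :
    Tendsto (fun n => truncation n s) atTop (𝓝 s) := by
  have h1 : HasDerivAt (fun t : ℝ => Real.arctan (s * t)) s 0 := by
    simpa using ((hasDerivAt_id (0 : ℝ)).const_mul s).arctan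
  have h2 : Tendsto (fun n : ℕ => 1 / ((n : ℝ) + 1)) atTop (𝓝[≠] 0) :=
    tendsto_nhdsWithin_iff.2 ⟨tendsto_one_div_add_atTop_nhds_zero_nat,
      .of_forall fun n => (by positivity : 1 / ((n : ℝ) + 1) ≠ 0)⟩
  refine (h1.tendsto_slope_zero.comp h2).congr fun n => ?_
  simp [truncation, div_eq_mul_inv]

theorem tendsto_integral_mul_of_dominated {f : ℕ → Euc m → ℝ} {f' g φ : Euc m → ℝ}
    (hf : ∀ n, AEStronglyMeasurable (f n) (volume.restrict W)) (hfg : ∀ n x, |f n x| ≤ |g x|)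
    (hlim : ∀ x, Tendsto (fun n => f n x) atTop (𝓝 (f' x)))
    (hg : Integrable fun x => g x * φ x) (hφ : Continuous φ) (hφW : ∀ x ∉ W, φ x = 0) :
    (∀ n, Integrable fun x => f n x * φ x) ∧
    Tendsto (fun n => ∫ x, f n x * φ x) atTop (𝓝 (∫ x, f' x * φ x)) := by
  have hbd : ∀ n x, ‖f n x * φ x‖ ≤ ‖g x * φ x‖ := fun n x => by
    rw [norm_mul, norm_mul]
    exact mul_le_mul_of_nonneg_right (hfg n x) (norm_nonneg _)
  have hset : ∀ f : Euc m → ℝ, ∫ x, f x * φ x = ∫ x in W, f x * φ x := fun f =>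
    (setIntegral_eq_integral_of_forall_compl_eq_zero fun x hx => by simp [hφW x hx]).symm
  have hm : ∀ n, AEStronglyMeasurable (fun x => f n x * φ x) (volume.restrict W) := fun n =>
    (hf n).mul hφ.aestronglyMeasurable
  refine ⟨fun n => ?_, ?_⟩
  · rw [← integrableOn_iff_integrable_of_support_subset (s := W)]
    · exact Integrable.mono hg.integrableOn (hm n) (ae_of_all _ (hbd n))
    · intro x hx
      by_contra h
      exact hx (by simp [hφW x h])
  · simp_rw [hset]
    exact tendsto_integral_of_dominated_convergence (fun x => ‖g x * φ x‖) hm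
      hg.norm.integrableOn (fun n => ae_of_all _ (hbd n))
      (ae_of_all _ fun x => (hlim x).mul_const _)

/-- The product rule for weak derivatives, by truncation. -/
theorem WeakDeriv.mul (hb : ContDiff ℝ ∞ b) (hbc : HasCompactSupport b) (hW : IsOpen W)
    {u' w w' : Euc m → ℝ} (hu : LocallyIntegrableOn u W) (hw : LocallyIntegrableOn w W)
    (hu' : LocallyIntegrableOn u' W) (hw' : LocallyIntegrableOn w' W)
    (huw : LocallyIntegrableOn (u * w) W) (huw1 : LocallyIntegrableOn (u' * w) W)
    (huw2 : LocallyIntegrableOn (u * w') W) (h : WeakDeriv b W u u') (h' : WeakDeriv b W w w') :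
    WeakDeriv b W (u * w) (u' * w + u * w') := by
  intro φ hφ
  have hF : ∀ n : ℕ, ∀ z : Fin 2 → ℝ, HasFDerivAt
      (fun z : Fin 2 → ℝ => truncation n (z 0) * truncation n (z 1))
      (truncation n (z 0) • (truncationDeriv n (z 1) • ContinuousLinearMap.proj (R := ℝ)
        (φ := fun _ : Fin 2 => ℝ) 1) + truncation n (z 1) • (truncationDeriv n (z 0) •
        ContinuousLinearMap.proj (R := ℝ) (φ := fun _ : Fin 2 => ℝ) 0)) z := by
    intro n z
    have e0 := (hasDerivAt_truncation n (z 0)).comp_hasFDerivAt z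
      (hasFDerivAt_apply (𝕜 := ℝ) (0 : Fin 2) z)
    have e1 := (hasDerivAt_truncation n (z 1)).comp_hasFDerivAt z
      (hasFDerivAt_apply (𝕜 := ℝ) (1 : Fin 2) z)
    exact e0.mul e1
  have hFd : ∀ n : ℕ, ContDiff ℝ 1 fun z : Fin 2 → ℝ =>
      truncation n (z 0) * truncation n (z 1) := fun n =>
    ((contDiff_truncation n).comp (contDiff_apply ℝ ℝ (0 : Fin 2))).mul
      ((contDiff_truncation n).comp (contDiff_apply ℝ ℝ (1 : Fin 2)))
  have hn := fun n : ℕ => weakDeriv_comp_of_local hb hbc hW (u := ![u, w]) (v := ![u', w'])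
    (by intro i; fin_cases i <;> simpa) (by intro i; fin_cases i <;> simpa)
    (by intro i; fin_cases i <;> simpa) (hFd n) (C := 2 * ((n + 1) * 2)) (fun z => by
      rw [(hF n z).fderiv]
      refine ContinuousLinearMap.opNorm_le_bound _ (by positivity) fun y => ?_
      have t0 := abs_truncation_le n (z 0)
      have t1 := abs_truncation_le n (z 1)
      have d0 := truncationDeriv_mem n (z 0)
      have d1 := truncationDeriv_mem n (z 1)
      have y0 := norm_le_pi_norm y 0
      have y1 := norm_le_pi_norm y 1
      simp only [norm_eq_abs] at y0 y1
      have p0 : |truncation n (z 0) * (truncationDeriv n (z 1) * y 1)| ≤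
          (n + 1) * 2 * (1 * ‖y‖) := by
        rw [abs_mul, abs_mul]; gcongr
      have p1 : |truncation n (z 1) * (truncationDeriv n (z 0) * y 0)| ≤
          (n + 1) * 2 * (1 * ‖y‖) := by
        rw [abs_mul, abs_mul]; gcongr
      have p2 := abs_add_le (truncation n (z 0) * (truncationDeriv n (z 1) * y 1))
        (truncation n (z 1) * (truncationDeriv n (z 0) * y 0))
      simp only [add_apply, smul_apply,
        ContinuousLinearMap.proj_apply, smul_eq_mul, norm_eq_abs]
      push_cast
      linarith) φ hφ
  have hder : ∀ n x, (∑ i, (![u', w'] i) x * fderiv ℝ (fun z : Fin 2 → ℝ =>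
      truncation n (z 0) * truncation n (z 1)) (fun i => (![u, w] i) x) (Pi.single i 1)) =
      u' x * (truncation n (w x) * truncationDeriv n (u x)) +
        w' x * (truncation n (u x) * truncationDeriv n (w x)) := by
    intro n x
    rw [Fin.sum_univ_two, (hF n _).fderiv]
    simp
  simp only [hder] at hn
  simp only [Matrix.cons_val_zero, Matrix.cons_val_one] at hn
  have hum := hu.aestronglyMeasurable
  have hwm := hw.aestronglyMeasurable
  have hum' := hu'.aestronglyMeasurable
  have hwm' := hw'.aestronglyMeasurable
  have hTm : ∀ n, Continuous (truncation n) := fun n => (contDiff_truncation n).continuous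
  have hDm : ∀ n, Continuous (truncationDeriv n) := fun n => by
    unfold truncationDeriv
    exact continuous_const.div (by fun_prop) fun x => by positivity
  have hleft := tendsto_integral_mul_of_dominated (W := W) (φ := adjointDeriv b φ)
    (f := fun n x => truncation n (u x) * truncation n (w x)) (f' := u * w) (g := u * w)
    (fun n => ((hTm n).comp_aestronglyMeasurable hum).mul ((hTm n).comp_aestronglyMeasurable hwm))
    (fun n x => by
      rw [abs_mul, Pi.mul_apply, abs_mul]
      exact mul_le_mul (abs_truncation_le_abs _ _) (abs_truncation_le_abs _ _) (abs_nonneg _)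
        (abs_nonneg _))
    (fun x => (tendsto_truncation _).mul (tendsto_truncation _))
    ((hφ.adjointDeriv hb).integrable_mul huw) (hφ.adjointDeriv hb).1.continuous
    (fun x hx => adjointDeriv_eq_zero fun h => hx (hφ.2.2 h))
  have hright : ∀ {a c a' : Euc m → ℝ}, AEStronglyMeasurable a (volume.restrict W) →
      AEStronglyMeasurable c (volume.restrict W) → AEStronglyMeasurable a' (volume.restrict W) →
      LocallyIntegrableOn (a' * c) W → _ := fun {a c a'} ha hc ha' hac =>
    tendsto_integral_mul_of_dominated (W := W) (φ := φ)
      (f := fun n x => a' x * (truncation n (c x) * truncationDeriv n (a x))) (f' := a' * c)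
      (g := a' * c)
      (fun n => ha'.mul (((hTm n).comp_aestronglyMeasurable hc).mul
        ((hDm n).comp_aestronglyMeasurable ha)))
      (fun n x => by
        rw [abs_mul, Pi.mul_apply, abs_mul, abs_mul]
        have := mul_le_mul (abs_truncation_le_abs n (c x)) (truncationDeriv_mem n (a x))
          (abs_nonneg _) (abs_nonneg _)
        rw [mul_one] at this
        gcongr)
      (fun x => by
        have := ((tendsto_truncation (c x)).mul (tendsto_truncationDeriv (a x))).const_mul (a' x)
        rwa [mul_one] at this)
      (hφ.integrable_mul hac) hφ.1.continuous
      (fun x hx => image_eq_zero_of_notMem_tsupport fun h => hx (hφ.2.2 h))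
  have hright1 := hright hum hwm hum' huw1
  have hwu : LocallyIntegrableOn (w' * u) W := mul_comm u w' ▸ huw2
  have hright2 := hright hwm hum hwm' hwu
  have hsplit := (hright1.2.add hright2.2).congr fun n =>
    (integral_add (hright1.1 n) (hright2.1 n)).symm
  have hlim := tendsto_nhds_unique hleft.2 (hsplit.congr fun n => by
    rw [hn n]
    exact integral_congr_ae (ae_of_all _ fun x => by simp only; ring))
  rw [hlim, ← integral_add (hφ.integrable_mul huw1) (hφ.integrable_mul hwu)]
  exact integral_congr_ae (ae_of_all _ fun x => by simp only [Pi.add_apply, Pi.mul_apply]; ring)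

end LocalRules

/-! ### Weak derivatives and flow lines -/

theorem ae_eq_zero_of_le_of_tendsto_lintegral {α : Type*} [MeasurableSpace α] {μ : Measure α}
    {F : α → ℝ≥0∞} {h : ℕ → α → ℝ≥0∞} (hm : ∀ n, AEMeasurable (h n) μ)
    (hF : ∀ n, ∀ᵐ x ∂μ, F x ≤ h n x)
    (hlim : Tendsto (fun n => ∫⁻ x, h n x ∂μ) atTop (𝓝 0)) : ∀ᵐ x ∂μ, F x = 0 := by
  have h1 : ∫⁻ x, ⨅ n, h n x ∂μ = 0 := by
    refine le_antisymm (ge_of_tendsto' hlim fun n => ?_) zero_le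
    exact lintegral_mono fun x => iInf_le _ n
  have h2 := (lintegral_eq_zero_iff' (AEMeasurable.iInf hm)).1 h1
  filter_upwards [h2, ae_all_iff.2 hF] with x hx hFx
  exact le_antisymm ((le_iInf hFx).trans hx.le) zero_le

namespace IsFlow

variable {m : ℕ} {K : ℝ≥0} {b : Euc m → Euc m} {Φ : ℝ → Euc m → Euc m} {u v : Euc m → ℝ}

theorem distortion_le_of_abs_le {s T : ℝ} (h : |s| ≤ T) :
    distortion (Euc m) K s ≤ distortion (Euc m) K T := by
  exact Real.exp_le_exp.2 (mul_le_mul_of_nonneg_left (mul_le_mul_of_nonneg_left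
    (h.trans (le_abs_self T)) K.2) (Nat.cast_nonneg _))

theorem quasiMeasurePreserving_uncurry (h : IsFlow K b Φ) (ν : Measure ℝ) [SFinite ν] :
    Measure.QuasiMeasurePreserving (fun p : ℝ × Euc m => Φ p.1 p.2) (ν.prod volume) volume := by
  have hm := h.continuous.measurable
  refine ⟨hm, Measure.AbsolutelyContinuous.mk fun N hN hN0 => ?_⟩
  rw [Measure.map_apply hm hN, Measure.measure_prod_null (hm hN)]
  exact ae_of_all _ fun t => (h.quasiMeasurePreserving t).preimage_null hN0

theorem aemeasurable_uncurry (h : IsFlow K b Φ) (T : ℝ) {F : Euc m → ℝ≥0∞} (hF : AEMeasurable F) :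
    AEMeasurable (fun p : ℝ × Euc m => F (Φ p.1 p.2))
      ((volume.restrict (Icc 0 T)).prod volume) :=
  hF.comp_quasiMeasurePreserving (h.quasiMeasurePreserving_uncurry _)

theorem lintegral_lintegral_flow_le (h : IsFlow K b Φ) {T : ℝ} (hT : 0 ≤ T) {F : Euc m → ℝ≥0∞}
    (hF : AEMeasurable F) :
    ∫⁻ x, ∫⁻ s in Icc 0 T, F (Φ s x) ≤
      ofReal T * ofReal (distortion (Euc m) K T) * ∫⁻ x, F x := by
  rw [lintegral_lintegral_swap (h.aemeasurable_uncurry T hF).prod_swap]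
  calc ∫⁻ s in Icc 0 T, ∫⁻ x, F (Φ s x)
      ≤ ∫⁻ _ in Icc 0 T, ofReal (distortion (Euc m) K T) * ∫⁻ x, F x := by
        refine setLIntegral_mono' measurableSet_Icc fun s hs => ?_
        refine (h.lintegral_comp_le s hF).trans ?_
        gcongr
        exact distortion_le_of_abs_le (by rw [abs_of_nonneg hs.1]; exact hs.2)
    _ = _ := by
        rw [setLIntegral_const, volume_Icc, sub_zero]
        ring

theorem aemeasurable_lintegral_flow (h : IsFlow K b Φ) (T : ℝ) {F : Euc m → ℝ≥0∞}
    (hF : AEMeasurable F) : AEMeasurable fun x => ∫⁻ s in Icc 0 T, F (Φ s x) :=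
  (h.aemeasurable_uncurry T hF).prod_swap.lintegral_prod_right'

theorem ae_integrableOn (h : IsFlow K b Φ) {T : ℝ} (hT : 0 ≤ T) (hv : Integrable v) :
    ∀ᵐ x, IntegrableOn (fun s => v (Φ s x)) (Icc 0 T) := by
  have h1 : ∀ᵐ x, AEStronglyMeasurable (fun s => v (Φ s x)) (volume.restrict (Icc 0 T)) :=
    (hv.1.comp_quasiMeasurePreserving (h.quasiMeasurePreserving_uncurry _)).prod_swap.prodMk_left
  have h2 : ∀ᵐ x, ∫⁻ s in Icc 0 T, ‖v (Φ s x)‖ₑ < ⊤ := by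
    refine ae_lt_top' (h.aemeasurable_lintegral_flow T hv.1.enorm) ?_
    refine ((h.lintegral_lintegral_flow_le hT hv.1.enorm).trans_lt ?_).ne
    exact mul_lt_top (mul_lt_top ofReal_lt_top ofReal_lt_top) hv.2
  filter_upwards [h1, h2] with x hx1 hx2 using ⟨hx1, hx2⟩

theorem hasDerivAt_comp (h : IsFlow K b Φ) {w : Euc m → ℝ} (hw : ContDiff ℝ 1 w) (x : Euc m)
    (t : ℝ) : HasDerivAt (fun t => w (Φ t x)) (fderiv ℝ w (Φ t x) (b (Φ t x))) t :=
  ((hw.differentiable one_ne_zero (Φ t x)).hasFDerivAt).comp_hasDerivAt t (h.deriv x t)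

/-- A function with a weak derivative along `b` is, on almost every flow line, almost everywhere
equal to a primitive of that derivative. -/
theorem ae_exists_isPrimitiveOn (h : IsFlow K b Φ) (hb : ContDiff ℝ ∞ b)
    (hbc : HasCompactSupport b) (hu : Integrable u) (hv : Integrable v)
    (huv : WeakDeriv b univ u v) {T : ℝ} (hT : 0 ≤ T) :
    ∀ᵐ x, ∃ U : ℝ → ℝ, IsPrimitiveOn 0 T U (fun s => v (Φ s x)) ∧
      ∀ᵐ t ∂volume.restrict (Icc 0 T), U t = u (Φ t x) := by
  obtain ⟨ε, -, hε0, hεt⟩ := exists_seq_strictAnti_tendsto_nhdsWithin (0 : ℝ)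
  set w : ℕ → Euc m → ℝ := fun n => mollify (ε n) u
  set w' : ℕ → Euc m → ℝ := fun n x => fderiv ℝ (w n) x (b x)
  have hw1 : ∀ n, ContDiff ℝ 1 (w n) := fun n =>
    (contDiff_mollify (hε0 n) hu.locallyIntegrable).of_le (by simp)
  have hwi : ∀ n, Integrable (w n) := fun n => integrable_mollify (hε0 n) hu
  have hw'i : ∀ n, Integrable (w' n) := fun n =>
    huv.integrable_fderiv_mollify hb hbc hu hv (hε0 n)
  have hw'c : ∀ n, Continuous (w' n) := fun n =>
    continuous_fderiv_apply_field (hw1 n) hb.continuous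
  set P : Euc m → ℝ → ℝ := fun x t => u x + ∫ s in (0 : ℝ)..t, v (Φ s x) with hP
  set H : ℕ → Euc m → ℝ≥0∞ := fun n x => (∫⁻ t in Icc 0 T, ‖(u - w n) (Φ t x)‖ₑ) +
    (ofReal T * ‖(u - w n) x‖ₑ +
      ofReal T * ∫⁻ t in Icc 0 T, ‖(w' n - v) (Φ t x)‖ₑ) with hH
  have hgood := h.ae_integrableOn hT hv
  have hgoodu := h.ae_integrableOn hT hu
  have hm1 : ∀ n, AEMeasurable fun x => ‖(u - w n) x‖ₑ := fun n => (hu.sub (hwi n)).1.enorm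
  have hm2 : ∀ n, AEMeasurable fun x => ‖(w' n - v) x‖ₑ := fun n => ((hw'i n).sub hv).1.enorm
  have hHm : ∀ n, AEMeasurable (H n) := fun n =>
    (h.aemeasurable_lintegral_flow T (hm1 n)).add (((hm1 n).const_mul _).add
      ((h.aemeasurable_lintegral_flow T (hm2 n)).const_mul _))
  have hzero : ∀ᵐ x, ∫⁻ t in Icc 0 T, ‖P x t - u (Φ t x)‖ₑ = 0 := by
    refine ae_eq_zero_of_le_of_tendsto_lintegral hHm (fun n => ?_) ?_
    · filter_upwards [hgood, hgoodu] with x hx hxu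
      have hpt : ∀ t ∈ Icc 0 T, ‖P x t - u (Φ t x)‖ₑ ≤ ‖(u - w n) (Φ t x)‖ₑ +
          (‖(u - w n) x‖ₑ + ∫⁻ t in Icc 0 T, ‖(w' n - v) (Φ t x)‖ₑ) := by
        intro t ht
        have hwint : IntervalIntegrable (fun s => w' n (Φ s x)) volume 0 t :=
          ((hw'c n).comp (h.continuous_left x)).intervalIntegrable _ _
        have hvint : IntervalIntegrable (fun s => v (Φ s x)) volume 0 t := by
          rw [intervalIntegrable_iff_integrableOn_Icc_of_le ht.1]
          exact hx.mono_set (Icc_subset_Icc_right ht.2)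
        have hftc : ∫ s in (0 : ℝ)..t, w' n (Φ s x) = w n (Φ t x) - w n x := by
          have := intervalIntegral.integral_eq_sub_of_hasDerivAt
            (fun s _ => h.hasDerivAt_comp (hw1 n) x s) hwint
          rwa [h.zero] at this
        have hsplit : P x t - u (Φ t x) = -(u - w n) (Φ t x) + ((u - w n) x +
            -∫ s in (0 : ℝ)..t, (w' n - v) (Φ s x)) := by
          simp only [Pi.sub_apply]
          rw [intervalIntegral.integral_sub hwint hvint, hftc]
          simp only [hP]
          ring
        rw [hsplit]
        refine (enorm_add_le _ _).trans ?_
        rw [enorm_neg]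
        gcongr
        refine (enorm_add_le _ _).trans ?_
        rw [enorm_neg]
        gcongr
        rw [integral_of_le ht.1]
        refine (enorm_integral_le_lintegral_enorm _).trans ?_
        exact lintegral_mono_set (Ioc_subset_Icc_self.trans (Icc_subset_Icc_right ht.2))
      have hum : AEMeasurable (fun t => ‖(u - w n) (Φ t x)‖ₑ) (volume.restrict (Icc 0 T)) := by
        refine AEStronglyMeasurable.enorm ?_
        exact hxu.1.sub (((hw1 n).continuous.comp (h.continuous_left x)).aestronglyMeasurable)
      refine (setLIntegral_mono' measurableSet_Icc hpt).trans ?_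
      rw [lintegral_add_left' hum, lintegral_const]
      simp only [hH, Measure.restrict_apply MeasurableSet.univ, univ_inter, volume_Icc,
        sub_zero]
      rw [add_mul, mul_comm (ofReal T), mul_comm (ofReal T)]
    · have t1 : Tendsto (fun n => ∫⁻ x, ‖(u - w n) x‖ₑ) atTop (𝓝 0) := by
        refine ((tendsto_mollify hu).comp hεt).congr fun n => ?_
        refine lintegral_congr fun x => ?_
        rw [← enorm_neg]; simp [w]
      have t2 : Tendsto (fun n => ∫⁻ x, ‖(w' n - v) x‖ₑ) atTop (𝓝 0) :=
        (huv.tendsto_fderiv_mollify hb hbc hu hv).comp hεt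
      have hD : ofReal T * ofReal (distortion (Euc m) K T) ≠ ⊤ :=
        mul_ne_top ofReal_ne_top ofReal_ne_top
      have t3 := (ENNReal.Tendsto.const_mul (a := ofReal T *
        ofReal (distortion (Euc m) K T)) t1 (Or.inr hD)).add
        ((ENNReal.Tendsto.const_mul (a := ofReal T) t1 (Or.inr ofReal_ne_top)).add
        (ENNReal.Tendsto.const_mul (a := ofReal T)
          (ENNReal.Tendsto.const_mul (a := ofReal T *
            ofReal (distortion (Euc m) K T)) t2 (Or.inr hD))
          (Or.inr ofReal_ne_top)))
      simp only [mul_zero, add_zero] at t3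
      refine tendsto_of_tendsto_of_tendsto_of_le_of_le tendsto_const_nhds t3
        (fun _ => zero_le) fun n => ?_
      simp only [hH]
      rw [lintegral_add_left' (h.aemeasurable_lintegral_flow T (hm1 n)),
        lintegral_add_left' ((hm1 n).const_mul _),
        lintegral_const_mul' _ _ ofReal_ne_top,
        lintegral_const_mul' _ _ ofReal_ne_top]
      gcongr
      · exact h.lintegral_lintegral_flow_le hT (hm1 n)
      · exact h.lintegral_lintegral_flow_le hT (hm2 n)
  filter_upwards [hgood, hgoodu, hzero] with x hx hxu hx0
  have hvint : IntervalIntegrable (fun s => v (Φ s x)) volume 0 T := by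
    rwa [intervalIntegrable_iff_integrableOn_Icc_of_le hT]
  have hprim : IsPrimitiveOn 0 T (P x) fun s => v (Φ s x) := by
    have hsub : ∀ y ∈ Icc 0 T, IntervalIntegrable (fun s => v (Φ s x)) volume 0 y := fun y hy =>
      hvint.mono_set (by
        rw [uIcc_of_le hT, uIcc_of_le hy.1]; exact Icc_subset_Icc_right hy.2)
    refine ⟨hvint, fun y hy z hz => ?_⟩
    simp only [hP]
    rw [← integral_interval_sub_left (hsub z hz) (hsub y hy)]
    ring
  refine ⟨P x, hprim, ?_⟩
  have hmeas : AEMeasurable (fun t => ‖P x t - u (Φ t x)‖ₑ) (volume.restrict (Icc 0 T)) := by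
    refine AEStronglyMeasurable.enorm (AEStronglyMeasurable.sub ?_ hxu.1)
    exact (hprim.continuousOn hT).aestronglyMeasurable measurableSet_Icc
  filter_upwards [(lintegral_eq_zero_iff' hmeas).1 hx0] with t ht
  simpa [sub_eq_zero] using ht

/-- Translation along the flow is continuous in `L¹`. -/
theorem tendsto_lintegral_comp_sub (h : IsFlow K b Φ) (hv : Integrable v) :
    Tendsto (fun s => ∫⁻ x, ‖v (Φ s x) - v x‖ₑ) (𝓝 0) (𝓝 0) := by
  obtain ⟨L, hL⟩ := h.bdd
  rw [ENNReal.tendsto_nhds_zero]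
  intro δ hδ
  set D := ofReal (distortion (Euc m) K 1) with hD
  have hDt : D ≠ ⊤ := ofReal_ne_top
  obtain ⟨δ', hδ', hle⟩ : ∃ δ' : ℝ≥0∞, δ' ≠ 0 ∧ D * δ' + (δ' + δ') ≤ δ := by
    have h1 : Tendsto (fun x : ℝ≥0∞ => D * x + (x + x)) (𝓝[>] 0)
        (𝓝 (D * 0 + (0 + 0))) := by
      refine Tendsto.mono_left ?_ nhdsWithin_le_nhds
      exact (ENNReal.Tendsto.const_mul tendsto_id (Or.inr hDt)).add
        (tendsto_id.add tendsto_id)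
    rw [mul_zero, add_zero, add_zero] at h1
    obtain ⟨x, hx1, hx2⟩ := ((h1.eventually_le_const hδ).and self_mem_nhdsWithin).exists
    exact ⟨x, (show (0 : ℝ≥0∞) < x from hx2).ne', hx1⟩
  obtain ⟨g, hgc, hgle, hgcont, hgi⟩ := hv.exists_hasCompactSupport_lintegral_sub_le hδ'
  have hg : Tendsto (fun s => ∫⁻ x, ‖g (Φ s x) - g x‖ₑ) (𝓝 0) (𝓝 0) := by
    obtain ⟨C, hC⟩ := hgcont.bounded_above_of_compact_support hgc
    set S := cthickening L (tsupport g) with hS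
    have hSc : IsCompact S := IsCompact.cthickening hgc
    have h1 := tendsto_lintegral_filter_of_dominated_convergence (μ := volume) (l := 𝓝 (0 : ℝ))
      (F := fun s x => ‖g (Φ s x) - g x‖ₑ) (f := fun _ : Euc m => 0)
      (S.indicator fun _ => ofReal (C + C))
      (Eventually.of_forall fun s => by
        have := h.continuous_right s
        exact (Continuous.enorm (by fun_prop)).measurable) ?_ ?_ (ae_of_all _ fun x => ?_)
    · simpa using h1
    · filter_upwards [ball_mem_nhds (0 : ℝ) one_pos] with s hs
      refine ae_of_all _ fun x => ?_
      have hs1 : |s| ≤ 1 := by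
        rw [mem_ball, dist_eq, sub_zero] at hs; exact hs.le
      by_cases hx : x ∈ S
      · rw [indicator_of_mem hx, ← ofReal_norm]
        refine ofReal_le_ofReal ((_root_.norm_sub_le _ _).trans ?_)
        exact add_le_add (hC _) (hC _)
      · have hd : dist x (Φ s x) ≤ L := by
          rw [dist_comm, dist_eq_norm]
          have := h.norm_sub_le hL 0 s x
          rw [h.zero, sub_zero] at this
          exact this.trans (mul_le_of_le_one_right L.2 hs1)
        have hz : ∀ y, dist x y ≤ L → g y = 0 := by
          intro y hy
          by_contra hne
          exact hx (mem_cthickening_of_dist_le x y L _ (subset_tsupport _ hne) hy)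
        simp [hz _ hd, hz x (by simp)]
    · rw [lintegral_indicator hSc.measurableSet, setLIntegral_const]
      exact mul_ne_top ofReal_ne_top hSc.measure_lt_top.ne
    · have h2 : Continuous fun s => ‖g (Φ s x) - g x‖ₑ := by
        have := h.continuous_left x
        exact Continuous.enorm (by fun_prop)
      have := h2.tendsto 0
      simpa [h.zero] using this
  filter_upwards [hg.eventually_le_const (pos_iff_ne_zero.2 hδ'),
    ball_mem_nhds (0 : ℝ) one_pos] with s hs hs1
  have hs1 : |s| ≤ 1 := by
    rw [mem_ball, dist_eq, sub_zero] at hs1; exact hs1.le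
  have hvg : AEStronglyMeasurable (fun x => v x - g x) := (hv.sub hgi).1
  have hm1 : AEMeasurable fun x => ‖v (Φ s x) - g (Φ s x)‖ₑ :=
    (hvg.comp_quasiMeasurePreserving (h.quasiMeasurePreserving s)).enorm
  have hm2 : AEMeasurable fun x => ‖g (Φ s x) - g x‖ₑ := by
    have := h.continuous_right s
    exact (Continuous.enorm (by fun_prop)).measurable.aemeasurable
  calc ∫⁻ x, ‖v (Φ s x) - v x‖ₑ
      ≤ ∫⁻ x, (‖v (Φ s x) - g (Φ s x)‖ₑ + (‖g (Φ s x) - g x‖ₑ + ‖v x - g x‖ₑ)) := by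
        refine lintegral_mono fun x => ?_
        have : v (Φ s x) - v x = (v (Φ s x) - g (Φ s x)) + ((g (Φ s x) - g x) + -(v x - g x)) := by
          ring
        rw [this]
        refine (enorm_add_le _ _).trans ?_
        gcongr
        refine (enorm_add_le _ _).trans ?_
        rw [enorm_neg]
    _ = (∫⁻ x, ‖v (Φ s x) - g (Φ s x)‖ₑ) + ((∫⁻ x, ‖g (Φ s x) - g x‖ₑ) +
          ∫⁻ x, ‖v x - g x‖ₑ) := by
        rw [lintegral_add_left' hm1, lintegral_add_left' hm2]
    _ ≤ D * δ' + (δ' + δ') := by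
        gcongr
        refine (h.lintegral_comp_le s (F := fun x => ‖v x - g x‖ₑ) hvg.enorm).trans ?_
        gcongr
        exact ofReal_le_ofReal (distortion_le_of_abs_le hs1)
    _ ≤ δ := hle

theorem abs_comp_sub_le (h : IsFlow K b Φ) {φ : Euc m → ℝ} {Kφ L : ℝ≥0}
    (hφ : LipschitzWith Kφ φ) (hL : ∀ x, ‖b x‖ ≤ L) (t : ℝ) (x : Euc m) :
    |φ (Φ t x) - φ x| ≤ Kφ * L * |t| := by
  have h1 := hφ.dist_le_mul (Φ t x) x
  have h2 := h.norm_sub_le hL 0 t x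
  rw [h.zero, sub_zero] at h2
  rw [dist_eq, dist_eq_norm] at h1
  refine h1.trans ?_
  rw [mul_assoc]
  gcongr

/-- The difference quotients of `g` along the flow are bounded in the dual of the test functions
by the `L¹` norm of `g`. -/
theorem exists_abs_integral_sub_mul_le (h : IsFlow K b Φ) {φ : Euc m → ℝ}
    (hφ : IsTest univ φ) : ∃ C : ℝ, 0 ≤ C ∧ ∀ g : Euc m → ℝ, Integrable g → ∀ t, 0 ≤ t → t ≤ 1 →
      |∫ x, (g (Φ t x) - g x) * φ x| ≤ C * t * ∫ x, |g x| := by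
  obtain ⟨L, hL⟩ := h.bdd
  have hφ1 : ContDiff ℝ 1 φ := hφ.1.of_le (by simp)
  obtain ⟨Kφ, hKφ⟩ := hφ1.lipschitzWith_of_hasCompactSupport hφ.2.1 one_ne_zero
  obtain ⟨B, hB⟩ := hφ1.continuous.bounded_above_of_compact_support hφ.2.1
  have hB0 : 0 ≤ B := (norm_nonneg _).trans (hB 0)
  -- `e^c - 1 ≤ c e^c`
  set c : ℝ := Module.finrank ℝ (Euc m) * K with hc
  have hc0 : 0 ≤ c := by positivity
  refine ⟨2 * (c * exp c) * B + Kφ * L, by positivity, fun g hg t ht ht1 => ?_⟩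
  have hdist : distortion (Euc m) K t - 1 ≤ c * exp c * t := by
    have e1 : distortion (Euc m) K t = exp (c * t) := by
      rw [distortion, abs_of_nonneg ht, hc, mul_assoc]
    have e2 : 1 - c * t ≤ exp (-(c * t)) := by
      have := Real.add_one_le_exp (-(c * t)); linarith
    have e3 : exp (c * t) * exp (-(c * t)) = 1 := by
      rw [← Real.exp_add]; simp
    have e4 : exp (c * t) ≤ exp c :=
      Real.exp_le_exp.2 (mul_le_of_le_one_right hc0 ht1)
    have e5 : exp (c * t) - 1 ≤ exp (c * t) * (c * t) := by
      nlinarith [exp_pos (c * t)]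
    rw [e1]
    refine e5.trans ?_
    have : exp (c * t) * (c * t) ≤ exp c * (c * t) := by gcongr
    linarith
  have hφm : ∀ s, Continuous fun x => φ (Φ s x) := fun s =>
    hφ1.continuous.comp (h.continuous_right s)
  have hF : Integrable fun x => g x * φ (Φ (-t) x) :=
    hg.mul_bdd (c := B) (hφm _).aestronglyMeasurable (ae_of_all _ fun x => hB _)
  have hgφ : Integrable fun x => g x * φ x :=
    hg.mul_bdd (c := B) hφ1.continuous.aestronglyMeasurable (ae_of_all _ fun x => hB _)
  have h1 := h.abs_integral_comp_sub_le t hF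
  have hgΦ : Integrable fun x => g (Φ t x) * φ x :=
    (h.integrable_comp t hg).mul_bdd (c := B) hφ1.continuous.aestronglyMeasurable
      (ae_of_all _ fun x => hB _)
  simp only [h.neg_self] at h1
  have h2 : ∫ x, |g x * φ (Φ (-t) x)| ≤ B * ∫ x, |g x| := by
    rw [← integral_const_mul]
    refine integral_mono hF.abs (hg.abs.const_mul B) fun x => ?_
    simp only [abs_mul]
    rw [mul_comm B]
    exact mul_le_mul_of_nonneg_left (hB _) (abs_nonneg _)
  have h3 : |(∫ x, g x * φ (Φ (-t) x)) - ∫ x, g x * φ x| ≤ Kφ * L * t * ∫ x, |g x| := by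
    rw [← integral_sub hF hgφ, ← integral_const_mul, ← norm_eq_abs]
    refine norm_integral_le_of_norm_le (hg.abs.const_mul _) (ae_of_all _ fun x => ?_)
    rw [← mul_sub, norm_mul, mul_comm]
    have := h.abs_comp_sub_le hKφ hL (-t) x
    rw [abs_neg, abs_of_nonneg ht] at this
    exact mul_le_mul_of_nonneg_right this (norm_nonneg _)
  have h4 : ∫ x, (g (Φ t x) - g x) * φ x =
      ((∫ x, g (Φ t x) * φ x) - ∫ x, g x * φ (Φ (-t) x)) +
        ((∫ x, g x * φ (Φ (-t) x)) - ∫ x, g x * φ x) := by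
    rw [sub_add_sub_cancel, ← integral_sub hgΦ hgφ]
    simp only [sub_mul]
  rw [h4]
  refine (abs_add_le _ _).trans ((add_le_add h1 h3).trans ?_)
  have hI : 0 ≤ ∫ x, |g x| := integral_nonneg fun x => abs_nonneg _
  have h5 : 2 * (distortion (Euc m) K t - 1) * ∫ x, |g x * φ (Φ (-t) x)| ≤
      2 * (c * exp c * t) * (B * ∫ x, |g x|) := by
    have : 0 ≤ ∫ x, |g x * φ (Φ (-t) x)| := integral_nonneg fun x => abs_nonneg _
    have : 0 ≤ c * exp c * t := by positivity
    gcongr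
  refine (add_le_add_left h5 _).trans (le_of_eq ?_)
  ring

/-- The difference quotients along the flow converge to the adjoint derivative. -/
theorem tendsto_integral_sub_mul (h : IsFlow K b Φ) (hb : ContDiff ℝ ∞ b)
    (hbc : HasCompactSupport b) {g φ : Euc m → ℝ} (hg : Integrable g) (hφ : IsTest univ φ) :
    Tendsto (fun t => t⁻¹ * ∫ x, (g (Φ t x) - g x) * φ x) (𝓝[>] 0)
      (𝓝 (∫ x, g x * adjointDeriv b φ x)) := by
  have hb1 : ContDiff ℝ 1 b := hb.of_le (by simp)
  have hφ1 : ContDiff ℝ 1 φ := hφ.1.of_le (by simp)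
  obtain ⟨C, hC0, hC⟩ := h.exists_abs_integral_sub_mul_le hφ
  have hadj := continuous_adjointDeriv hb1 hφ1
  obtain ⟨B, hB⟩ := hadj.bounded_above_of_compact_support (hasCompactSupport_adjointDeriv hφ.2.1)
  have hB0 : 0 ≤ B := (norm_nonneg _).trans (hB 0)
  obtain ⟨Bφ, hBφ⟩ := hφ1.continuous.bounded_above_of_compact_support hφ.2.1
  -- the claim for mollified functions
  have hsmooth : ∀ ε > 0, Tendsto
      (fun t => t⁻¹ * ∫ x, (mollify ε g (Φ t x) - mollify ε g x) * φ x) (𝓝[>] 0)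
      (𝓝 (∫ x, mollify ε g x * adjointDeriv b φ x)) := by
    intro ε hε
    set w := mollify ε g
    have hw : ContDiff ℝ 1 w := (contDiff_mollify hε hg.locallyIntegrable).of_le (by simp)
    have hw' := continuous_fderiv_apply_field hw hb.continuous
    have hw'c : HasCompactSupport fun x => fderiv ℝ w x (b x) :=
      HasCompactSupport.of_support_subset_isCompact hbc fun x hx =>
        subset_tsupport _ fun h0 => hx (by simp [h0])
    obtain ⟨A, hA⟩ := hw'.bounded_above_of_compact_support hw'c
    rw [integral_mul_adjointDeriv hb1 hw hφ1 hφ.2.1]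
    have h1 := tendsto_integral_filter_of_dominated_convergence (μ := volume) (l := 𝓝[>] (0 : ℝ))
      (F := fun t x => t⁻¹ * ((w (Φ t x) - w x) * φ x)) (f := fun x => fderiv ℝ w x (b x) * φ x)
      (fun x => A * |φ x|) (Eventually.of_forall fun t => by
        have := h.continuous_right t
        have := hw.continuous
        have := hφ1.continuous
        exact (by fun_prop : Continuous _).aestronglyMeasurable) ?_
      ((hφ1.continuous.integrable_of_hasCompactSupport hφ.2.1).abs.const_mul A)
      (ae_of_all _ fun x => ?_)
    · refine h1.congr fun t => ?_
      rw [integral_const_mul]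
    · filter_upwards [self_mem_nhdsWithin] with t (ht : 0 < t)
      refine ae_of_all _ fun x => ?_
      have h2 := Convex.norm_image_sub_le_of_norm_hasDerivWithin_le (s := univ)
        (f := fun t => w (Φ t x)) (fun s _ => (h.hasDerivAt_comp hw x s).hasDerivWithinAt)
        (fun s _ => hA _) convex_univ (mem_univ 0) (mem_univ t)
      rw [h.zero, sub_zero, norm_of_nonneg ht.le] at h2
      rw [norm_mul, norm_mul, norm_inv, norm_of_nonneg ht.le, ← mul_assoc]
      refine mul_le_mul_of_nonneg_right ?_ (norm_nonneg _)
      rw [inv_mul_le_iff₀ ht]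
      linarith
    · have h2 := (h.hasDerivAt_comp hw x 0).tendsto_slope_zero_right
      simp only [h.zero, zero_add, smul_eq_mul] at h2
      simpa [mul_assoc] using h2.mul_const (φ x)
  rw [Metric.tendsto_nhds]
  intro δ hδ
  have happ := tendsto_mollify hg
  set η : ℝ := δ / (2 * (C + B + 1)) with hη
  have hη0 : 0 < η := by positivity
  obtain ⟨ε, hεle, hε⟩ := ((happ.eventually_le_const (ENNReal.ofReal_pos.2 hη0)).and
    self_mem_nhdsWithin).exists
  have hε : 0 < ε := hε
  have hwi := integrable_mollify hε hg
  have hd : Integrable fun x => g x - mollify ε g x := hg.sub hwi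
  have hdη : ∫ x, |g x - mollify ε g x| ≤ η := by
    rw [show (∫ x, |g x - mollify ε g x|) = ∫ x, ‖g x - mollify ε g x‖ from rfl,
      integral_norm_eq_lintegral_enorm hd.1]
    refine toReal_le_of_le_ofReal hη0.le ((le_of_eq ?_).trans hεle)
    refine lintegral_congr fun x => ?_
    rw [← enorm_neg, neg_sub]
  have hlim := Metric.tendsto_nhds.1 (hsmooth ε hε) (δ / 2) (by positivity)
  filter_upwards [hlim, Ioc_mem_nhdsGT one_pos] with t ht ht1
  have hΦ : ∀ f : Euc m → ℝ, Integrable f → Integrable fun x => (f (Φ t x) - f x) * φ x :=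
    fun f hf => ((h.integrable_comp t hf).sub hf).mul_bdd (c := Bφ)
      hφ1.continuous.aestronglyMeasurable (ae_of_all _ hBφ)
  have hA : ∀ f : Euc m → ℝ, Integrable f → Integrable fun x => f x * adjointDeriv b φ x :=
    fun f hf => hf.mul_bdd (c := B) hadj.aestronglyMeasurable (ae_of_all _ hB)
  have e1 : ∫ x, (g (Φ t x) - g x) * φ x = (∫ x, ((g (Φ t x) - mollify ε g (Φ t x)) -
      (g x - mollify ε g x)) * φ x) + ∫ x, (mollify ε g (Φ t x) - mollify ε g x) * φ x := by
    rw [← integral_add (hΦ _ hd) (hΦ _ hwi)]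
    exact integral_congr_ae (ae_of_all _ fun x => by simp only; ring)
  have e2 : ∫ x, g x * adjointDeriv b φ x = (∫ x, (g x - mollify ε g x) * adjointDeriv b φ x) +
      ∫ x, mollify ε g x * adjointDeriv b φ x := by
    rw [← integral_add (hA _ hd) (hA _ hwi)]
    exact integral_congr_ae (ae_of_all _ fun x => by simp only; ring)
  have b1 : |t⁻¹ * ∫ x, ((g (Φ t x) - mollify ε g (Φ t x)) - (g x - mollify ε g x)) * φ x| ≤
      C * η := by
    rw [abs_mul, abs_inv, abs_of_pos ht1.1, inv_mul_le_iff₀ ht1.1]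
    refine (hC _ hd t ht1.1.le ht1.2).trans ?_
    rw [mul_comm C t, mul_assoc]
    have := ht1.1
    gcongr
  have b2 : |∫ x, (g x - mollify ε g x) * adjointDeriv b φ x| ≤ B * η := by
    rw [← norm_eq_abs]
    refine (norm_integral_le_of_norm_le (hd.abs.const_mul B) (ae_of_all _ fun x => ?_)).trans ?_
    · rw [norm_mul, mul_comm]
      exact mul_le_mul_of_nonneg_right (hB x) (norm_nonneg _)
    · rw [integral_const_mul]
      gcongr
  have b3 : (C + B) * η < δ / 2 := by
    rw [hη, mul_div_assoc', div_lt_iff₀ (by positivity)]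
    nlinarith
  rw [dist_eq] at ht ⊢
  rw [e1, e2, mul_add]
  rw [abs_lt] at ht ⊢
  rw [abs_le] at b1 b2
  constructor <;> linarith

/-- For small times the flow does not move a compact set out of a neighbourhood. -/
theorem exists_forall_mem (h : IsFlow K b Φ) {S W : Set (Euc m)} (hS : IsCompact S)
    (hW : IsOpen W) (hSW : S ⊆ W) :
    ∃ τ > 0, ∃ S', IsCompact S' ∧ S' ⊆ W ∧ ∀ t, |t| ≤ τ → ∀ x ∈ S, Φ t x ∈ S' := by
  obtain ⟨L, hL⟩ := h.bdd
  obtain ⟨r, hr, hrW⟩ := hS.exists_cthickening_subset_open hW hSW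
  refine ⟨r / (L + 1), by positivity, _, hS.cthickening, hrW, fun t ht x hx => ?_⟩
  refine mem_cthickening_of_dist_le _ x r _ hx ?_
  have := h.norm_sub_le hL 0 t x
  rw [h.zero, sub_zero] at this
  rw [dist_eq_norm]
  refine this.trans ?_
  rw [le_div_iff₀ (by positivity)] at ht
  nlinarith [abs_nonneg t]

/-- If along almost every flow line in `W` the function `u` is a primitive of `v`, then `v` is the
weak derivative of `u` along `b`. -/
theorem weakDeriv_of_ae (h : IsFlow K b Φ) (hb : ContDiff ℝ ∞ b) (hbc : HasCompactSupport b)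
    {W : Set (Euc m)} (hW : IsOpen W) (hu : LocallyIntegrableOn u W)
    (hv : LocallyIntegrableOn v W)
    (huv : ∀ᵐ x, ∀ t, 0 ≤ t → (∀ s ∈ Icc 0 t, Φ s x ∈ W) →
      u (Φ t x) - u x = ∫ s in (0 : ℝ)..t, v (Φ s x)) : WeakDeriv b W u v := by
  intro φ hφ
  have hb1 : ContDiff ℝ 1 b := hb.of_le (by simp)
  have hφu : IsTest univ φ := hφ.mono (subset_univ _)
  obtain ⟨τ, hτ, S', hS', hS'W, hτS⟩ := h.exists_forall_mem hφ.2.1 hW hφ.2.2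
  obtain ⟨χ, hχ, hχ1, -⟩ := exists_isTest_eq_one hS' hW hS'W
  obtain ⟨B, hB⟩ := hφ.1.continuous.bounded_above_of_compact_support hφ.2.1
  have hB0 : 0 ≤ B := (norm_nonneg _).trans (hB 0)
  set g : Euc m → ℝ := fun x => u x * χ x with hg
  set k : Euc m → ℝ := fun x => v x * χ x with hk
  have hgi : Integrable g := hχ.integrable_mul hu
  have hki : Integrable k := hχ.integrable_mul hv
  have hχS : ∀ x ∈ S', χ x = 1 := fun x hx => (eq_one_and_fderiv_eq_zero hχ1 hx).1
  have hφS : ∀ x, φ x ≠ 0 → x ∈ S' := fun x hx => by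
    have := hτS 0 (by simpa using hτ.le) x (subset_tsupport _ hx)
    rwa [h.zero] at this
  have e1 : ∫ x, g x * adjointDeriv b φ x = ∫ x, u x * adjointDeriv b φ x := by
    refine integral_congr_ae (ae_of_all _ fun x => ?_)
    by_cases hx : x ∈ tsupport φ
    · have : x ∈ S' := by
        have := hτS 0 (by simpa using hτ.le) x hx
        rwa [h.zero] at this
      simp [hg, hχS x this]
    · simp [adjointDeriv_eq_zero hx]
  have e2 : ∫ x, k x * φ x = ∫ x, v x * φ x := by
    refine integral_congr_ae (ae_of_all _ fun x => ?_)
    by_cases hx : φ x = 0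
    · simp [hx]
    · simp [hk, hχS x (hφS x hx)]
  rw [← e1, ← e2]
  have hlim := h.tendsto_integral_sub_mul hb hbc hgi hφu
  refine tendsto_nhds_unique hlim ?_
  have hkφ : Integrable fun x => k x * φ x :=
    hki.mul_bdd (c := B) hφ.1.continuous.aestronglyMeasurable (ae_of_all _ hB)
  have hgφ : ∀ t, Integrable fun x => (g (Φ t x) - g x) * φ x := fun t =>
    ((h.integrable_comp t hgi).sub hgi).mul_bdd (c := B) hφ.1.continuous.aestronglyMeasurable
      (ae_of_all _ hB)
  rw [Metric.tendsto_nhds]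
  intro δ hδ
  set η : ℝ := δ / (2 * (B + 1)) with hη
  have hη0 : 0 < η := by positivity
  have htr := (h.tendsto_lintegral_comp_sub hki).eventually_le_const (ENNReal.ofReal_pos.2 hη0)
  obtain ⟨τ', hτ', htr⟩ := Metric.eventually_nhds_iff_ball.1 htr
  filter_upwards [Ioo_mem_nhdsGT (lt_min hτ hτ')] with t ht
  have ht0 : 0 < t := ht.1
  have htτ : t < τ := ht.2.trans_le (min_le_left _ _)
  have htτ' : t < τ' := ht.2.trans_le (min_le_right _ _)
  have hpt : ∀ᵐ x, ‖t⁻¹ * ((g (Φ t x) - g x) * φ x) - k x * φ x‖ₑ ≤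
      ofReal (t⁻¹ * B) * ∫⁻ s in Icc 0 t, ‖k (Φ s x) - k x‖ₑ := by
    filter_upwards [huv, h.ae_integrableOn ht0.le hki] with x hx hxi
    by_cases hφx : φ x = 0
    · simp [hφx]
    have hxS : x ∈ tsupport φ := subset_tsupport _ hφx
    have hline : ∀ s ∈ Icc 0 t, Φ s x ∈ S' := fun s hs =>
      hτS s (by rw [abs_of_nonneg hs.1]; exact hs.2.trans htτ.le) x hxS
    have h1 := hx t ht0.le fun s hs => hS'W (hline s hs)
    have hki' : IntervalIntegrable (fun s => k (Φ s x)) volume 0 t := by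
      rwa [intervalIntegrable_iff_integrableOn_Icc_of_le ht0.le]
    have h2 : g (Φ t x) - g x = ∫ s in (0 : ℝ)..t, k (Φ s x) := by
      rw [hg]
      simp only
      rw [hχS _ (hline t (right_mem_Icc.2 ht0.le)), hχS x (hφS x hφx), mul_one, mul_one, h1]
      refine integral_congr fun s hs => ?_
      rw [uIcc_of_le ht0.le] at hs
      simp [hk, hχS _ (hline s hs)]
    have h3 : t⁻¹ * ((g (Φ t x) - g x) * φ x) - k x * φ x =
        (t⁻¹ * φ x) * ∫ s in (0 : ℝ)..t, (k (Φ s x) - k x) := by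
      rw [intervalIntegral.integral_sub hki' intervalIntegrable_const, h2,
        intervalIntegral.integral_const]
      simp only [sub_zero, smul_eq_mul]
      field_simp
    rw [h3, enorm_mul]
    gcongr
    · rw [← ofReal_norm, norm_mul, norm_inv, norm_of_nonneg ht0.le]
      refine ofReal_le_ofReal ?_
      gcongr
      exact hB x
    · rw [integral_of_le ht0.le]
      refine (enorm_integral_le_lintegral_enorm _).trans ?_
      exact lintegral_mono_set Ioc_subset_Icc_self
  have hm : AEMeasurable (fun p : ℝ × Euc m => ‖k (Φ p.1 p.2) - k p.2‖ₑ)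
      ((volume.restrict (Icc 0 t)).prod volume) :=
    ((hki.1.comp_quasiMeasurePreserving (h.quasiMeasurePreserving_uncurry _)).sub
      hki.1.comp_snd).enorm
  have hbound : ∫⁻ x, ‖t⁻¹ * ((g (Φ t x) - g x) * φ x) - k x * φ x‖ₑ ≤
      ofReal (B * η) := by
    calc _ ≤ ∫⁻ x, ofReal (t⁻¹ * B) * ∫⁻ s in Icc 0 t, ‖k (Φ s x) - k x‖ₑ :=
          lintegral_mono_ae hpt
      _ = ofReal (t⁻¹ * B) * ∫⁻ s in Icc 0 t, ∫⁻ x, ‖k (Φ s x) - k x‖ₑ := by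
          rw [lintegral_const_mul' _ _ ofReal_ne_top, lintegral_lintegral_swap hm.prod_swap]
      _ ≤ ofReal (t⁻¹ * B) * ∫⁻ s in Icc 0 t, ofReal η := by
          refine mul_le_mul_right (setLIntegral_mono' measurableSet_Icc fun s hs => htr s ?_) _
          rw [mem_ball, dist_eq, sub_zero, abs_of_nonneg hs.1]
          exact hs.2.trans_lt htτ'
      _ = ofReal (B * η) := by
          rw [setLIntegral_const, volume_Icc, sub_zero,
            ← ofReal_mul hη0.le, ← ofReal_mul (by positivity)]
          congr 1
          field_simp
  rw [dist_eq, ← integral_const_mul, ← integral_sub ((hgφ t).const_mul _) hkφ,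
    ← norm_eq_abs]
  refine (norm_integral_le_lintegral_norm _).trans_lt ?_
  simp only [ofReal_norm]
  refine (toReal_le_of_le_ofReal (by positivity) hbound).trans_lt ?_
  rw [hη, mul_div_assoc', div_lt_iff₀ (by positivity)]
  nlinarith

end IsFlow

/-! ### Interpolation of derivatives along a flow -/

section Interpolation

theorem integral_abs_le_rpow_mul_rpow {f : ℝ → ℝ} {α s t : ℝ} (hα : 0 < α) (hα1 : α ≤ 1)
    (hst : s < t) (hf : AEStronglyMeasurable f (volume.restrict (Ioc s t)))
    (hfi : IntegrableOn (fun x => |f x| ^ (1 / α)) (Ioc s t)) :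
    ∫ x in s..t, |f x| ≤ (t - s) ^ (1 - α) * (∫ x in s..t, |f x| ^ (1 / α)) ^ α := by
  rw [integral_of_le hst.le, integral_of_le hst.le]
  have h0 : ∀ x, 0 ≤ |f x| ^ (1 / α) := fun x => rpow_nonneg (abs_nonneg _) _
  have hI : 0 ≤ ∫ x in Ioc s t, |f x| ^ (1 / α) := integral_nonneg h0
  have hst0 : 0 < t - s := sub_pos.2 hst
  rw [integral_eq_lintegral_of_nonneg_ae (ae_of_all _ fun x => abs_nonneg _) hf.norm]
  refine toReal_le_of_le_ofReal (by positivity) ?_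
  have h1 := ENNReal.lintegral_mul_norm_pow_le (μ := volume.restrict (Ioc s t))
    (f := fun x => ofReal (|f x| ^ (1 / α))) (g := fun _ => 1)
    (hfi.1.aemeasurable.ennreal_ofReal) aemeasurable_const hα.le (sub_nonneg.2 hα1) (by ring)
  simp only [one_rpow, mul_one, lintegral_const, Measure.restrict_apply MeasurableSet.univ,
    univ_inter, Real.volume_Ioc, one_mul] at h1
  have h2 : ∀ x, ofReal (|f x| ^ (1 / α)) ^ α = ofReal |f x| := fun x => by
    rw [ofReal_rpow_of_nonneg (h0 x) hα.le, ← Real.rpow_mul (abs_nonneg _),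
      one_div_mul_cancel hα.ne', Real.rpow_one]
  simp only [h2] at h1
  refine h1.trans (le_of_eq ?_)
  rw [← ofReal_integral_eq_lintegral_ofReal hfi (ae_of_all _ h0),
    ofReal_rpow_of_nonneg hI hα.le, ofReal_rpow_of_nonneg hst0.le
      (sub_nonneg.2 hα1), ← ofReal_mul (by positivity), mul_comm]

/-- The one-dimensional interpolation inequality in terms of Lebesgue integrals. -/
theorem lintegral_rpow_le_of_isPrimitiveOn {W V Z : ℝ → ℝ} {α β M : ℝ} {g h : ℝ → ℝ}
    (hα : 0 ≤ α) (hαβ : α ≤ β)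
    (hβ : 0 < β) (hβ1 : β ≤ 1) (hM : 0 ≤ M) (hg0 : ∀ s, 0 ≤ g s) (hh0 : ∀ s, 0 ≤ h s)
    (hg : IntegrableOn g (Icc 0 2)) (hh : IntegrableOn h (Icc 0 2))
    (hV : IsPrimitiveOn 0 2 V Z) (hW : IsPrimitiveOn 0 2 W V)
    (H1 : HolderControl M α W h) (H2 : HolderControl 1 β Z g) :
    ∫⁻ x in Icc (0 : ℝ) 1, ofReal (|V x| ^ (2 / (α + β))) ≤
      ofReal (8 ^ (2 / (α + β))) * (ofReal (M ^ (1 / (α + β))) *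
        ((∫⁻ x in Icc (0 : ℝ) 2, ofReal (h x)) ^ (α / (α + β)) *
        (∫⁻ x in Icc (0 : ℝ) 2, ofReal (g x)) ^ (β / (α + β))) +
        ofReal (M ^ (2 / (α + β))) *
        (∫⁻ x in Icc (0 : ℝ) 2, ofReal (h x)) ^ (2 * α / (α + β))) := by
  have hab : 0 < α + β := by linarith
  have hgi : IntervalIntegrable g volume 0 2 := by
    rwa [intervalIntegrable_iff_integrableOn_Icc_of_le (by norm_num)]
  have hhi : IntervalIntegrable h volume 0 2 := by
    rwa [intervalIntegrable_iff_integrableOn_Icc_of_le (by norm_num)]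
  have key := integral_rpow_le_of_isPrimitiveOn hα hαβ hβ hβ1 hM hg0 hh0 hgi hhi hV hW H1 H2
  have hVc : ContinuousOn (fun x => |V x| ^ (2 / (α + β))) (Icc 0 1) :=
    (((hV.continuousOn (by norm_num)).mono (Icc_subset_Icc_right (by norm_num))).abs).rpow_const
      fun x _ => Or.inr (by positivity)
  have hVi : IntegrableOn (fun x => |V x| ^ (2 / (α + β))) (Icc 0 1) :=
    hVc.integrableOn_compact isCompact_Icc
  have hconv : ∀ f : ℝ → ℝ, IntegrableOn f (Icc 0 2) → (∀ x, 0 ≤ f x) →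
      ∫⁻ x in Icc (0 : ℝ) 2, ofReal (f x) = ofReal (∫ x in (0 : ℝ)..2, f x) := by
    intro f hf h0
    rw [← ofReal_integral_eq_lintegral_ofReal hf (ae_of_all _ h0), integral_Icc_eq_integral_Ioc,
      integral_of_le (by norm_num)]
  have hA : 0 ≤ ∫ x in (0 : ℝ)..2, h x := intervalIntegral.integral_nonneg (by norm_num)
    fun x _ => hh0 x
  have hB : 0 ≤ ∫ x in (0 : ℝ)..2, g x := intervalIntegral.integral_nonneg (by norm_num)
    fun x _ => hg0 x
  rw [hconv h hh hh0, hconv g hg hg0, ← ofReal_integral_eq_lintegral_ofReal hVi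
    (ae_of_all _ fun x => rpow_nonneg (abs_nonneg _) _), integral_Icc_eq_integral_Ioc,
    ← integral_of_le zero_le_one]
  rw [ofReal_rpow_of_nonneg hA (by positivity),
    ofReal_rpow_of_nonneg hB (by positivity),
    ofReal_rpow_of_nonneg hA (by positivity), ← ofReal_mul (by positivity),
    ← ofReal_mul (by positivity), ← ofReal_mul (by positivity),
    ← ofReal_add (by positivity) (by positivity), ← ofReal_mul (by positivity)]
  refine ofReal_le_ofReal (key.trans (le_of_eq ?_))
  rw [mul_rpow hM (by positivity), ← Real.rpow_mul hA]
  congr 4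
  ring

variable {m : ℕ} {K : ℝ≥0} {b : Euc m → Euc m} {Φ : ℝ → Euc m → Euc m} {w v z : Euc m → ℝ}

theorem ae_eq_zero_of_weakDeriv (h : WeakDeriv b univ w v) (hw : ∀ᵐ x, w x = 0)
    (hv : Integrable v) : ∀ᵐ x, v x = 0 := by
  have h1 : WeakDeriv b univ (fun _ => 0) v := h.congr (by filter_upwards [hw] with x hx _ using hx)
    (ae_of_all _ fun _ _ => rfl)
  have h2 : WeakDeriv b univ (fun _ => 0) (fun _ => 0) := fun φ _ => by simp
  have h3 := h1.ae_unique isOpen_univ h2 (hv.locallyIntegrable.locallyIntegrableOn _)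
    ((integrable_zero _ _ _).locallyIntegrable.locallyIntegrableOn _)
  filter_upwards [h3] with x hx using hx (mem_univ x)

/-- A property of almost all points holds at almost all times on almost all flow lines. -/
theorem IsFlow.ae_ae_flow (hΦ : IsFlow K b Φ) (T : ℝ) {P : Euc m → Prop} (hP : ∀ᵐ x, P x) :
    ∀ᵐ x, ∀ᵐ t ∂volume.restrict (Icc 0 T), P (Φ t x) := by
  have h1 := (hΦ.quasiMeasurePreserving_uncurry (volume.restrict (Icc 0 T))).ae hP
  have h2 := (Measure.measurePreserving_swap (μ := (volume : Measure (Euc m)))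
    (ν := volume.restrict (Icc 0 T))).quasiMeasurePreserving.ae h1
  exact Measure.ae_ae_of_ae_prod h2

/-- The interpolation inequality along a flow in integrated form; `M` and `h` control `w`
on the flow lines. -/
theorem IsFlow.lintegral_rpow_le (hΦ : IsFlow K b Φ) {S' : Set (Euc m)} (hS' : MeasurableSet S')
    {V Z : Euc m → ℝ → ℝ}
    {W : Euc m → ℝ → ℝ} {α β M : ℝ} {g h : Euc m → ℝ} (hα : 0 ≤ α) (hαβ : α ≤ β)
    (hβ : 0 < β) (hβ1 : β ≤ 1) (hM : 0 ≤ M) (hg0 : ∀ s, 0 ≤ g s) (hh0 : ∀ s, 0 ≤ h s)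
    (hg : Integrable g) (hh : Integrable h) (hv : AEMeasurable v)
    (hV : ∀ᵐ x, IsPrimitiveOn 0 2 (V x) (Z x) ∧ IsPrimitiveOn 0 2 (W x) (V x) ∧
      (∀ᵐ t ∂volume.restrict (Icc 0 2), V x t = v (Φ t x)) ∧
      HolderControl M α (W x) (fun y => h (Φ y x)) ∧ HolderControl 1 β (Z x) fun y => g (Φ y x))
    (hS : ∀ x ∉ S', ∀ t ∈ Icc (0 : ℝ) 1, v (Φ t x) = 0) :
    ∫⁻ x, ofReal (|v x| ^ (2 / (α + β))) ≤
      ofReal (distortion (Euc m) K 1) * (ofReal (8 ^ (2 / (α + β))) *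
      (ofReal (M ^ (1 / (α + β))) *
        ((ofReal 2 * ofReal (distortion (Euc m) K 2) *
          ∫⁻ x, ofReal (h x)) ^ (α / (α + β)) *
        (ofReal 2 * ofReal (distortion (Euc m) K 2) *
          ∫⁻ x, ofReal (g x)) ^ (β / (α + β))) +
        ofReal (M ^ (2 / (α + β))) *
        ((ofReal 2 * ofReal (distortion (Euc m) K 2) *
          ∫⁻ x, ofReal (h x)) ^ (2 * α / (α + β)) *
          volume S' ^ (1 - 2 * α / (α + β))))) := by
  have hab : 0 < α + β := by linarith
  set e := 2 / (α + β) with he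
  have he0 : 0 < e := by positivity
  set F : Euc m → ℝ≥0∞ := fun x => ofReal (|v x| ^ e) with hF
  have hFm : AEMeasurable F := by
    have : AEMeasurable fun x => |v x| := hv.norm
    exact (this.pow_const e).ennreal_ofReal
  set A : Euc m → ℝ≥0∞ := fun x => ∫⁻ y in Icc (0 : ℝ) 2, ofReal (h (Φ y x)) with hA
  set B : Euc m → ℝ≥0∞ := fun x => ∫⁻ y in Icc (0 : ℝ) 2, ofReal (g (Φ y x)) with hB
  have hhm : AEMeasurable fun x => ofReal (h x) := hh.1.aemeasurable.ennreal_ofReal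
  have hgm : AEMeasurable fun x => ofReal (g x) := hg.1.aemeasurable.ennreal_ofReal
  have hAm : AEMeasurable A := hΦ.aemeasurable_lintegral_flow 2 hhm
  have hBm : AEMeasurable B := hΦ.aemeasurable_lintegral_flow 2 hgm
  have hAle := hΦ.lintegral_lintegral_flow_le (T := 2) (by norm_num) hhm
  have hBle := hΦ.lintegral_lintegral_flow_le (T := 2) (by norm_num) hgm
  have hstart : ∫⁻ x, F x ≤ ofReal (distortion (Euc m) K 1) *
      ∫⁻ x, ∫⁻ t in Icc (0 : ℝ) 1, F (Φ t x) := by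
    rw [lintegral_lintegral_swap (hΦ.aemeasurable_uncurry 1 hFm).prod_swap,
      ← lintegral_const_mul' _ _ ofReal_ne_top]
    calc ∫⁻ x, F x = ∫⁻ _ in Icc (0 : ℝ) 1, ∫⁻ x, F x := by
          rw [setLIntegral_const, volume_Icc]; simp
      _ ≤ _ := by
          refine setLIntegral_mono' measurableSet_Icc fun t ht => ?_
          refine (hΦ.le_lintegral_comp t hFm).trans ?_
          gcongr
          exact distortion_le_of_abs_le (by rw [abs_of_nonneg ht.1]; exact ht.2)
  refine hstart.trans (mul_le_mul_right ?_ _)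
  have hline : ∀ᵐ x, ∫⁻ t in Icc (0 : ℝ) 1, F (Φ t x) ≤ ofReal (8 ^ e) *
      (ofReal (M ^ (1 / (α + β))) * (A x ^ (α / (α + β)) * B x ^ (β / (α + β))) +
        ofReal (M ^ e) * (A x ^ (2 * α / (α + β)) * S'.indicator 1 x)) := by
    filter_upwards [hV, hΦ.ae_integrableOn (T := 2) (by norm_num) hg,
      hΦ.ae_integrableOn (T := 2) (by norm_num) hh] with x hx hgx hhx
    by_cases hxS : x ∈ S'
    · obtain ⟨h1, h2, h3, h4, h5⟩ := hx
      have := lintegral_rpow_le_of_isPrimitiveOn hα hαβ hβ hβ1 hM (fun s => hg0 (Φ s x))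
        (fun s => hh0 (Φ s x)) hgx hhx h1 h2 h4 h5
      rw [indicator_of_mem hxS, Pi.one_apply, mul_one]
      refine (le_of_eq ?_).trans this
      refine lintegral_congr_ae ?_
      have h3' := ae_restrict_of_ae_restrict_of_subset
        (Icc_subset_Icc_right (by norm_num : (1 : ℝ) ≤ 2)) h3
      filter_upwards [h3'] with t ht
      rw [hF, ht]
    · have : ∫⁻ t in Icc (0 : ℝ) 1, F (Φ t x) = 0 := by
        rw [setLIntegral_congr_fun (g := fun _ => 0) measurableSet_Icc fun t ht => ?_]
        · simp
        · simp [hF, hS x hxS t ht, zero_rpow he0.ne']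
      rw [this]
      exact zero_le
  refine (lintegral_mono_ae hline).trans ?_
  have hp0 : 0 ≤ α / (α + β) := by positivity
  have hq0 : 0 ≤ β / (α + β) := by positivity
  have hpq : α / (α + β) + β / (α + β) = 1 := by rw [← add_div, div_self hab.ne']
  have hr0 : 0 ≤ 2 * α / (α + β) := by positivity
  have hr1 : 0 ≤ 1 - 2 * α / (α + β) := by
    rw [sub_nonneg, div_le_one hab]; linarith
  have hi1 : ∫⁻ x, A x ^ (α / (α + β)) * B x ^ (β / (α + β)) ≤
      (∫⁻ x, A x) ^ (α / (α + β)) * (∫⁻ x, B x) ^ (β / (α + β)) :=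
    ENNReal.lintegral_mul_norm_pow_le hAm hBm hp0 hq0 hpq
  have hi2 : ∫⁻ x, A x ^ (2 * α / (α + β)) * S'.indicator 1 x ≤
      (∫⁻ x, A x) ^ (2 * α / (α + β)) * volume S' ^ (1 - 2 * α / (α + β)) := by
    have e1 : ∀ x, A x ^ (2 * α / (α + β)) * S'.indicator 1 x =
        S'.indicator (fun x => A x ^ (2 * α / (α + β))) x := by
      intro x
      by_cases hx : x ∈ S' <;> simp [hx]
    simp_rw [e1]
    rw [lintegral_indicator hS']
    have := ENNReal.lintegral_mul_norm_pow_le (μ := volume.restrict S') (f := A)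
      (g := fun _ => 1) hAm.restrict aemeasurable_const hr0 hr1 (by ring)
    simp only [one_rpow, mul_one, lintegral_const,
      Measure.restrict_apply MeasurableSet.univ, univ_inter, one_mul] at this
    refine this.trans ?_
    gcongr
    exact Measure.restrict_le_self
  have hAmp : AEMeasurable fun x => A x ^ (α / (α + β)) * B x ^ (β / (α + β)) :=
    (hAm.pow_const _).mul (hBm.pow_const _)
  rw [lintegral_const_mul' _ _ ofReal_ne_top, lintegral_add_left' (hAmp.const_mul _),
    lintegral_const_mul' _ _ ofReal_ne_top, lintegral_const_mul' _ _ ofReal_ne_top]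
  gcongr
  · refine hi1.trans ?_
    gcongr
  · refine hi2.trans ?_
    gcongr

theorem eLpNorm_inv_ofReal {α : ℝ} (hα : 0 < α) (f : Euc m → ℝ) :
    eLpNorm f (ofReal α)⁻¹ volume =
      (∫⁻ x, ofReal (|f x| ^ (1 / α))) ^ α := by
  have h0 : (ofReal α)⁻¹ ≠ 0 := ENNReal.inv_ne_zero.2 ofReal_ne_top
  have ht : (ofReal α)⁻¹ ≠ ⊤ := ENNReal.inv_ne_top.2 (by simpa using hα)
  rw [eLpNorm_eq_lintegral_rpow_enorm_toReal h0 ht, toReal_inv,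
    toReal_ofReal hα.le, one_div, inv_inv]
  congr 1
  refine lintegral_congr fun x => ?_
  rw [← ofReal_norm, ofReal_rpow_of_nonneg (norm_nonneg _) (by positivity), one_div,
    norm_eq_abs]

theorem rpow_le_add_one (x : ℝ≥0∞) {r : ℝ} (hr : 0 ≤ r) (hr1 : r ≤ 1) : x ^ r ≤ x + 1 := by
  rcases le_total x 1 with h | h
  · exact (ENNReal.rpow_le_one h hr).trans le_add_self
  · calc x ^ r ≤ x ^ (1 : ℝ) := ENNReal.rpow_le_rpow_of_exponent_le h hr1
      _ = x := ENNReal.rpow_one x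
      _ ≤ _ := le_self_add

/-- The interpolation inequality for weak derivatives along one vector field, with a constant
independent of the exponents. -/
theorem IsFlow.exists_eLpNorm_le (hΦ : IsFlow K b Φ) (hb : ContDiff ℝ ∞ b)
    (hbc : HasCompactSupport b) {S : Set (Euc m)} (hS : IsCompact S) :
    ∃ C : ℝ≥0, ∀ w v z : Euc m → ℝ, Integrable w → Integrable v → Integrable z →
      (∀ x ∉ S, v x = 0) → WeakDeriv b univ w v → WeakDeriv b univ v z →
      ∀ α β : ℝ, 0 ≤ α → α ≤ β → 0 < β → β ≤ 1 →
      eLpNorm v (ofReal ((α + β) / 2))⁻¹ volume ≤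
        C * (eLpNorm w (ofReal α)⁻¹ volume ^ (1 / 2 : ℝ) *
          eLpNorm z (ofReal β)⁻¹ volume ^ (1 / 2 : ℝ) +
          eLpNorm w (ofReal α)⁻¹ volume) := by
  obtain ⟨L, hL⟩ := hΦ.bdd
  set S' := cthickening (2 * L) S with hS'
  have hS'c : IsCompact S' := hS.cthickening
  set D := ofReal (distortion (Euc m) K 1) + 1 with hD
  set c := ofReal 2 * ofReal (distortion (Euc m) K 2) with hc
  have hct : c ≠ ⊤ := mul_ne_top ofReal_ne_top ofReal_ne_top
  have hVt : volume S' ≠ ⊤ := hS'c.measure_lt_top.ne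
  set C := D * (8 * ((c + 1) * (c + 1) + (c + 1) * (volume S' + 1))) with hC
  have hDt : D ≠ ⊤ := by simp [hD]
  have hCt : C ≠ ⊤ := by
    refine mul_ne_top hDt (mul_ne_top (by simp) (ENNReal.add_ne_top.2 ⟨?_, ?_⟩))
    · exact mul_ne_top (by simp [hct]) (by simp [hct])
    · exact mul_ne_top (by simp [hct]) (by simp [hVt])
  have hC0 : C ≠ 0 := by simp [hC, hD]
  refine ⟨C.toNNReal, fun w v z hw hv hz hvS hwv hvz α β hα hαβ hβ hβ1 => ?_⟩
  rw [ENNReal.coe_toNNReal hCt]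
  have hab : 0 < α + β := by linarith
  set θ := (α + β) / 2 with hθ
  have hθ0 : 0 < θ := by positivity
  have hθ1 : θ ≤ 1 := by rw [hθ]; linarith
  set Nw := eLpNorm w (ofReal α)⁻¹ volume with hNw
  set Nz := eLpNorm z (ofReal β)⁻¹ volume with hNz
  by_cases hwt : Nw = ⊤
  · rw [hwt]; simp [mul_top, hC0]
  by_cases hw0 : Nw = 0
  · have h1 := (eLpNorm_eq_zero_iff hw.1 (ENNReal.inv_ne_zero.2 ofReal_ne_top)).1 hw0
    have h2 : v =ᵐ[volume] 0 := ae_eq_zero_of_weakDeriv hwv h1 hv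
    rw [eLpNorm_congr_ae h2]
    simp
  by_cases hzt : Nz = ⊤
  · rw [hzt, ENNReal.top_rpow_of_pos (by norm_num), mul_top, top_add, mul_top hC0]
    · exact le_top
    · simp [hw0, hwt]
  -- the data controlling `w` and `z` on the flow lines
  have hpos : ∀ {γ : ℝ}, 0 < γ → γ ≤ 1 → ∀ {f : Euc m → ℝ}, Integrable f →
      eLpNorm f (ofReal γ)⁻¹ volume < ⊤ → ∃ g : Euc m → ℝ, (∀ x, 0 ≤ g x) ∧
      Integrable g ∧ (∫⁻ x, ofReal (g x)) ^ γ = eLpNorm f (ofReal γ)⁻¹ volume ∧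
      ∀ᵐ x, HolderControl 1 γ (fun y => f (Φ y x)) fun y => g (Φ y x) := by
    intro γ hγ hγ1 f hf hft
    have hm : AEMeasurable fun x => |f x| := hf.1.aemeasurable.norm
    have hgi : Integrable fun x => |f x| ^ (1 / γ) := by
      refine ⟨(hm.pow_const _).aestronglyMeasurable, ?_⟩
      rw [hasFiniteIntegral_iff_ofReal (ae_of_all _ fun x => rpow_nonneg (abs_nonneg _) _)]
      rw [eLpNorm_inv_ofReal hγ] at hft
      exact (ENNReal.rpow_lt_top_iff_of_pos hγ).1 hft
    refine ⟨_, fun x => rpow_nonneg (abs_nonneg _) _, hgi, (eLpNorm_inv_ofReal hγ f).symm, ?_⟩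
    filter_upwards [hΦ.ae_integrableOn (T := 2) (by norm_num) hf,
      hΦ.ae_integrableOn (T := 2) (by norm_num) hgi] with x hx hgx s t hs hst ht
    have hsub : Ioc s t ⊆ Icc 0 2 := Ioc_subset_Icc_self.trans (Icc_subset_Icc hs ht)
    rw [one_mul]
    exact integral_abs_le_rpow_mul_rpow hγ hγ1 hst (hx.1.mono_set hsub) (hgx.mono_set hsub)
  obtain ⟨g, hg0, hgi, hgN, hgline⟩ := hpos hβ hβ1 hz (lt_top_iff_ne_top.2 hzt)
  rw [← hNz] at hgN
  obtain ⟨M, h, hM, hh0, hhi, hhN, hhline⟩ : ∃ (M : ℝ) (h : Euc m → ℝ), 0 ≤ M ∧ (∀ x, 0 ≤ h x) ∧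
      Integrable h ∧ ofReal M * (∫⁻ x, ofReal (h x)) ^ α = Nw ∧
      ∀ᵐ x, HolderControl M α (fun y => w (Φ y x)) fun y => h (Φ y x) := by
    rcases hα.eq_or_lt with rfl | hα0
    · have hNw' : Nw = eLpNormEssSup w volume := by
        rw [hNw, ENNReal.ofReal_zero, ENNReal.inv_zero, eLpNorm_exponent_top]
      refine ⟨Nw.toReal, fun _ => 0, toReal_nonneg, fun _ => le_rfl,
        integrable_zero _ _ _, by simp [ofReal_toReal hwt], ?_⟩
      have hle : ∀ᵐ x, ‖w x‖ₑ ≤ Nw := by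
        rw [hNw']
        exact enorm_ae_le_eLpNormEssSup w volume
      have hle2 := hΦ.ae_ae_flow 2 hle
      filter_upwards [hle2] with x hx s t hs hst ht
      have hsub : uIoc s t ⊆ Icc 0 2 := by
        rw [uIoc_of_le hst.le]
        exact Ioc_subset_Icc_self.trans (Icc_subset_Icc hs ht)
      have := intervalIntegral.norm_integral_le_of_norm_le_const_ae (a := s) (b := t)
        (f := fun y => |w (Φ y x)|) (C := Nw.toReal) (by
          have := ae_restrict_of_ae_restrict_of_subset hsub hx
          rw [ae_restrict_iff' measurableSet_uIoc] at this
          filter_upwards [this] with y hy hyt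
          rw [norm_eq_abs, abs_abs, ← norm_eq_abs, ← toReal_enorm]
          exact toReal_mono hwt (hy hyt))
      rw [abs_of_pos (sub_pos.2 hst)] at this
      simpa using (le_abs_self _).trans this
    · obtain ⟨h, h1, h2, h3, h4⟩ := hpos hα0 (hαβ.trans hβ1) hw (lt_top_iff_ne_top.2 hwt)
      exact ⟨1, h, zero_le_one, h1, h2, by rw [ENNReal.ofReal_one, one_mul, h3], h4⟩
  have hprim : ∀ᵐ x, ∃ V W : ℝ → ℝ, IsPrimitiveOn 0 2 V (fun s => z (Φ s x)) ∧
      IsPrimitiveOn 0 2 W V ∧ (∀ᵐ t ∂volume.restrict (Icc 0 2), V t = v (Φ t x)) ∧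
      (∀ᵐ t ∂volume.restrict (Icc 0 2), W t = w (Φ t x)) := by
    filter_upwards [hΦ.ae_exists_isPrimitiveOn hb hbc hv hz hvz (T := 2) (by norm_num),
      hΦ.ae_exists_isPrimitiveOn hb hbc hw hv hwv (T := 2) (by norm_num)] with x hx1 hx2
    obtain ⟨V, hV, hVv⟩ := hx1
    obtain ⟨W, hW, hWw⟩ := hx2
    refine ⟨V, W, hV, ⟨hV.intervalIntegrable (by norm_num), fun y hy t ht => ?_⟩, hVv, hWw⟩
    rw [hW.2 y hy t ht]
    refine integral_congr_ae_restrict ?_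
    have hsub : uIoc y t ⊆ Icc 0 2 :=
      uIoc_subset_uIcc.trans ((ordConnected_Icc (a := (0 : ℝ)) (b := 2)).uIcc_subset hy ht)
    filter_upwards [ae_restrict_of_ae_restrict_of_subset hsub hVv] with s hs using hs.symm
  obtain ⟨V, hV⟩ := skolem.1 hprim
  obtain ⟨W, hVW⟩ := skolem.1 hV
  have hmain := hΦ.lintegral_rpow_le (S' := S') hS'c.measurableSet (V := V)
    (Z := fun x s => z (Φ s x)) (W := W) hα hαβ hβ hβ1 hM hg0 hh0 hgi hhi hv.1.aemeasurable
    (by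
      filter_upwards [hVW, hgline, hhline] with x hx hx1 hx2
      refine ⟨hx.1, hx.2.1, hx.2.2.1, fun s t hs hst ht => ?_, hx1⟩
      refine (le_of_eq ?_).trans (hx2 s t hs hst ht)
      refine integral_congr_ae_restrict ?_
      have hsub : uIoc s t ⊆ Icc 0 2 := by
        rw [uIoc_of_le hst.le]
        exact Ioc_subset_Icc_self.trans (Icc_subset_Icc hs ht)
      filter_upwards [ae_restrict_of_ae_restrict_of_subset hsub hx.2.2.2] with y hy
      rw [hy])
    (fun x hx t ht => by
      refine hvS _ fun hmem => hx ?_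
      refine mem_cthickening_of_dist_le x _ _ _ hmem ?_
      rw [dist_comm, dist_eq_norm]
      have := hΦ.norm_sub_le hL 0 t x
      rw [hΦ.zero, sub_zero, abs_of_nonneg ht.1] at this
      refine this.trans ?_
      have := ht.2
      have := L.2
      nlinarith)
  set A := ∫⁻ x, ofReal (h x)
  set B := ∫⁻ x, ofReal (g x)
  rw [eLpNorm_inv_ofReal hθ0]
  have he : 1 / θ = 2 / (α + β) := by rw [hθ, one_div_div]
  rw [he]
  refine (ENNReal.rpow_le_rpow hmain hθ0.le).trans ?_
  have hcalc : ∀ x y : ℝ≥0∞, (x * y) ^ θ = x ^ θ * y ^ θ := fun x y =>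
    mul_rpow_of_nonneg x y hθ0.le
  have t1 : ofReal (8 ^ (2 / (α + β))) ^ θ = 8 := by
    rw [ofReal_rpow_of_nonneg (by positivity) hθ0.le, ← Real.rpow_mul (by norm_num),
      show 2 / (α + β) * θ = 1 by rw [hθ]; field_simp, Real.rpow_one]
    simp
  have t4 : ofReal (distortion (Euc m) K 1) ^ θ ≤ D :=
    rpow_le_add_one _ hθ0.le hθ1
  have e1 : α / (α + β) * θ = α * (1 / 2) := by rw [hθ]; field_simp
  have e2 : β / (α + β) * θ = β * (1 / 2) := by rw [hθ]; field_simp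
  have e3 : 1 / (α + β) * θ = 1 / 2 := by rw [hθ]; field_simp
  have e4 : 2 * α / (α + β) * θ = α := by rw [hθ]; field_simp
  have e5 : 2 / (α + β) * θ = 1 := by rw [hθ]; field_simp
  have hα1 : α ≤ 1 := hαβ.trans hβ1
  have t2 : (ofReal (M ^ (1 / (α + β))) *
      ((c * A) ^ (α / (α + β)) * (c * B) ^ (β / (α + β)))) ^ θ ≤
      (c + 1) * (c + 1) * (Nw ^ (1 / 2 : ℝ) * Nz ^ (1 / 2 : ℝ)) := by
    rw [hcalc, hcalc, ← ENNReal.rpow_mul, ← ENNReal.rpow_mul, e1, e2,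
      ← ofReal_rpow_of_nonneg hM (by positivity), ← ENNReal.rpow_mul, e3, ← hhN, ← hgN,
      mul_rpow_of_nonneg _ _ (by positivity : (0 : ℝ) ≤ α * (1 / 2)),
      mul_rpow_of_nonneg _ _ (by positivity : (0 : ℝ) ≤ β * (1 / 2)),
      mul_rpow_of_nonneg _ _ (by positivity : (0 : ℝ) ≤ 1 / 2), ← ENNReal.rpow_mul,
      ← ENNReal.rpow_mul]
    calc _ = c ^ (α * (1 / 2)) * c ^ (β * (1 / 2)) * (ofReal M ^ (1 / 2 : ℝ) *
          A ^ (α * (1 / 2)) * B ^ (β * (1 / 2))) := by ring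
      _ ≤ _ := by
        gcongr
        · exact rpow_le_add_one _ (by positivity) (by linarith)
        · exact rpow_le_add_one _ (by positivity) (by linarith)
  have t3 : (ofReal (M ^ (2 / (α + β))) *
      ((c * A) ^ (2 * α / (α + β)) * volume S' ^ (1 - 2 * α / (α + β)))) ^ θ ≤
      (c + 1) * (volume S' + 1) * Nw := by
    have hr : 0 ≤ 1 - 2 * α / (α + β) := by
      rw [sub_nonneg, div_le_one hab]; linarith
    have hr' : 1 - 2 * α / (α + β) ≤ 1 := by
      have : 0 ≤ 2 * α / (α + β) := by positivity
      linarith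
    rw [hcalc, hcalc, ← ENNReal.rpow_mul, ← ENNReal.rpow_mul, e4,
      ← ofReal_rpow_of_nonneg hM (by positivity), ← ENNReal.rpow_mul, e5, ← hhN,
      mul_rpow_of_nonneg _ _ hα, ENNReal.rpow_one]
    calc _ = c ^ α * volume S' ^ ((1 - 2 * α / (α + β)) * θ) * (ofReal M * A ^ α) := by ring
      _ ≤ _ := by
        gcongr
        · exact rpow_le_add_one _ hα hα1
        · exact rpow_le_add_one _ (by positivity) (mul_le_one₀ hr' hθ0.le hθ1)
  rw [hcalc, hcalc, t1]
  refine (mul_le_mul' t4 (mul_le_mul_right ((ENNReal.rpow_add_le_add_rpow _ _ hθ0.le hθ1).trans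
    (add_le_add t2 t3)) _)).trans ?_
  calc _ ≤ D * (8 * (((c + 1) * (c + 1) + (c + 1) * (volume S' + 1)) *
        (Nw ^ (1 / 2 : ℝ) * Nz ^ (1 / 2 : ℝ) + Nw))) := by
        gcongr
        rw [mul_add _ _ Nw]
        gcongr
        · exact le_self_add
        · exact le_add_self
    _ = _ := by rw [hC]; ring

end Interpolation

/-! ### Local Lebesgue spaces and towers of weak derivatives -/

section Towers

theorem Tower.add {ι α : Type*} {D : ι → (α → ℝ) → (α → ℝ) → Prop} {P : ℕ → (α → ℝ) → Prop}
    (hP : ∀ a u w, P a u → P a w → P a (u + w))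
    (hD : ∀ i a u w u' w', P a u → P a w → P (a + 1) u' → P (a + 1) w' → D i u u' → D i w w' →
      D i (u + w) (u' + w')) {t a : ℕ} {u w : α → ℝ} (hu : Tower D P t a u)
    (hw : Tower D P t a w) : Tower D P t a (u + w) := by
  induction t generalizing a u w with
  | zero => exact hP a u w hu hw
  | succ t ih =>
    refine ⟨hP a u w hu.1 hw.1, fun i => ?_⟩
    obtain ⟨u', hu1, hu2⟩ := hu.2 i
    obtain ⟨w', hw1, hw2⟩ := hw.2 i
    exact ⟨u' + w', hD i a u w u' w' hu.1 hw.1 hu2.base hw2.base hu1 hw1, ih hu2 hw2⟩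

variable {m : ℕ}

/-- `u ∈ L^p_loc(W)`. -/
def LpLoc (p : ℝ≥0∞) (W : Set (Euc m)) (u : Euc m → ℝ) : Prop :=
  ∀ K ⊆ W, IsCompact K → MemLp u p (volume.restrict K)

variable {W : Set (Euc m)} {u v w : Euc m → ℝ} {p q : ℝ≥0∞}

theorem LpLoc.mono_exponent (h : LpLoc q W u) (hpq : p ≤ q) : LpLoc p W u := fun K hK hKc => by
  have : IsFiniteMeasure (volume.restrict K) := ⟨by simpa using hKc.measure_lt_top⟩
  exact (h K hK hKc).mono_exponent hpq

theorem LpLoc.locallyIntegrableOn (h : LpLoc p W u) (hp : 1 ≤ p) (hW : IsOpen W) :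
    LocallyIntegrableOn u W :=
  (locallyIntegrableOn_iff hW.isLocallyClosed).2 fun K hK hKc =>
    memLp_one_iff_integrable.1 (h.mono_exponent hp K hK hKc)

theorem LpLoc.add (hu : LpLoc p W u) (hw : LpLoc p W w) : LpLoc p W (u + w) := fun K hK hKc =>
  (hu K hK hKc).add (hw K hK hKc)

theorem LpLoc.of_continuousOn (hu : ContinuousOn u W) : LpLoc p W u := fun K hK hKc => by
  have : IsFiniteMeasure (volume.restrict K) := ⟨by simpa using hKc.measure_lt_top⟩
  obtain ⟨C, hC⟩ := hKc.exists_bound_of_continuousOn (hu.mono hK)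
  refine MemLp.of_bound ((hu.mono hK).aestronglyMeasurable hKc.measurableSet) C ?_
  filter_upwards [ae_restrict_mem hKc.measurableSet] with x hx using hC x hx

theorem WeakDeriv.add {b : Euc m → Euc m} (hb : ContDiff ℝ ∞ b) {u' w' : Euc m → ℝ}
    (hu : LocallyIntegrableOn u W) (hw : LocallyIntegrableOn w W)
    (hu' : LocallyIntegrableOn u' W) (hw' : LocallyIntegrableOn w' W)
    (h : WeakDeriv b W u u') (h' : WeakDeriv b W w w') : WeakDeriv b W (u + w) (u' + w') := by
  intro φ hφ
  have h1 := hφ.adjointDeriv hb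
  simp only [Pi.add_apply, add_mul]
  rw [integral_add (h1.integrable_mul hu) (h1.integrable_mul hw),
    integral_add (hφ.integrable_mul hu') (hφ.integrable_mul hw'), h φ hφ, h' φ hφ]

/-- `w ∈ L^p`, and `w` vanishes outside `S`. -/
def MemLpIn (p : ℝ≥0∞) (S : Set (Euc m)) (w : Euc m → ℝ) : Prop :=
  MemLp w p volume ∧ ∀ x ∉ S, w x = 0

theorem MemLpIn.integrable {S : Set (Euc m)} (hS : IsCompact S) (hp : 1 ≤ p)
    (h : MemLpIn p S w) : Integrable w := by
  have : IsFiniteMeasure (volume.restrict S) := ⟨by simpa using hS.measure_lt_top⟩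
  have h1 : IntegrableOn w S :=
    memLp_one_iff_integrable.1 ((h.1.restrict S).mono_exponent hp)
  refine (integrableOn_iff_integrable_of_support_subset fun x hx => ?_).1 h1
  by_contra hxS
  exact hx (h.2 x hxS)

theorem LpLoc.memLpIn_mul_test {S : Set (Euc m)} (hu : LpLoc p W u) {χ : Euc m → ℝ}
    (hχ : IsTest W χ) (hS : tsupport χ ⊆ S) : MemLpIn p S fun x => u x * χ x := by
  obtain ⟨C, hC⟩ := hχ.1.continuous.bounded_above_of_compact_support hχ.2.1
  constructor
  · have h1 : MemLp (fun x => u x * χ x) p (volume.restrict (tsupport χ)) := by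
      have h2 := hu (tsupport χ) hχ.2.2 hχ.2.1
      refine (h2.const_mul C).of_le (h2.1.mul hχ.1.continuous.aestronglyMeasurable)
        (ae_of_all _ fun x => ?_)
      rw [norm_mul, norm_mul, mul_comm]
      exact mul_le_mul_of_nonneg_right ((hC x).trans (le_abs_self C)) (norm_nonneg _)
    have h3 : (tsupport χ).indicator (fun x => u x * χ x) = fun x => u x * χ x := by
      refine indicator_eq_self.2 fun x hx => subset_tsupport _ fun h => hx (by simp [h])
    rw [← h3]
    exact (memLp_indicator_iff_restrict (isClosed_tsupport χ).measurableSet).2 h1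
  · intro x hx
    simp only [image_eq_zero_of_notMem_tsupport fun h => hx (hS h), mul_zero]

/-- Localization of a tower of weak derivatives by a cutoff function. -/
theorem tower_mul_test {ι : Type*} {b : ι → Euc m → Euc m} (hb : ∀ i, ContDiff ℝ ∞ (b i))
    (hp : 1 ≤ p) (hW : IsOpen W) {S : Set (Euc m)} (hS : IsCompact S) {t a : ℕ} {u : Euc m → ℝ}
    (h : Tower (fun i => WeakDeriv (b i) W) (fun _ => LpLoc p W) t a u) {χ : Euc m → ℝ}
    (hχ : IsTest W χ) (hχS : tsupport χ ⊆ S) :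
    Tower (fun i => WeakDeriv (b i) univ) (fun _ => MemLpIn p S) t a (fun x => u x * χ x) := by
  induction t generalizing a u χ with
  | zero => exact LpLoc.memLpIn_mul_test h hχ hχS
  | succ t ih =>
    refine ⟨h.1.memLpIn_mul_test hχ hχS, fun i => ?_⟩
    obtain ⟨v, hv1, hv2⟩ := h.2 i
    refine ⟨_, hv1.mul_test (hb i) (h.1.locallyIntegrableOn hp hW)
      (hv2.base.locallyIntegrableOn hp hW) hχ, ?_⟩
    have h1 := ih hv2 hχ hχS
    have hL : Tower (fun i => WeakDeriv (b i) W) (fun _ => LpLoc p W) t (a + 1) u := by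
      have : ∀ (t a a' : ℕ) (u : Euc m → ℝ),
          Tower (fun i => WeakDeriv (b i) W) (fun _ => LpLoc p W) t a u →
          Tower (fun i => WeakDeriv (b i) W) (fun _ => LpLoc p W) t a' u := by
        intro t
        induction t with
        | zero => exact fun a a' u h => h
        | succ t ih =>
          exact fun a a' u h => ⟨h.1, fun i => (h.2 i).imp fun v hv => ⟨hv.1, ih _ _ _ hv.2⟩⟩
      exact this t a (a + 1) u h.of_succ
    have h2 := ih hL (hχ.fderiv_apply (hb i)) ((tsupport_fderiv_apply_field_subset χ).trans hχS)
    refine Tower.add (fun _ f g hf hg => ⟨hf.1.add hg.1, fun x hx => by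
        simp [hf.2 x hx, hg.2 x hx]⟩) (fun j _ f g f' g' hf hg hf' hg' hd hd' => ?_) h1 h2
    have hli : ∀ f, MemLpIn p S f → LocallyIntegrableOn f univ := fun f hf =>
      (hf.integrable hS hp).locallyIntegrable.locallyIntegrableOn _
    exact hd.add (hb j) (hli _ hf) (hli _ hg) (hli _ hf') (hli _ hg') hd'

theorem eLpNorm_le_mul_of_memLpIn {S : Set (Euc m)} {θ θ' : ℝ} (hθ : 0 < θ)
    (hθθ : θ ≤ θ') (hθ1 : θ' ≤ 1) (hwm : AEStronglyMeasurable w) (hw : ∀ x ∉ S, w x = 0) :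
    eLpNorm w (ofReal θ')⁻¹ volume ≤
      (volume S + 1) * eLpNorm w (ofReal θ)⁻¹ volume := by
  have hθ' : 0 < θ' := hθ.trans_le hθθ
  have hsupp : Function.support w ⊆ S := fun x hx => by
    by_contra h
    exact hx (hw x h)
  rw [← eLpNorm_restrict_eq_of_support_subset hsupp, ← eLpNorm_restrict_eq_of_support_subset
    (p := (ofReal θ)⁻¹) hsupp, mul_comm]
  have h1 := eLpNorm_le_eLpNorm_mul_rpow_measure_univ (μ := volume.restrict S) (f := w)
    (p := (ofReal θ')⁻¹) (q := (ofReal θ)⁻¹)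
    (ENNReal.inv_le_inv.2 (ofReal_le_ofReal hθθ)) hwm.restrict
  refine h1.trans ?_
  gcongr
  rw [toReal_inv, toReal_inv, toReal_ofReal hθ.le,
    toReal_ofReal hθ'.le, Measure.restrict_apply MeasurableSet.univ, univ_inter]
  simp only [one_div, inv_inv]
  exact rpow_le_add_one _ (by linarith) (by linarith)

/-- Fatou's lemma for varying exponents. -/
theorem eLpNorm_le_of_tendsto (hwm : AEStronglyMeasurable w) {θ : ℕ → ℝ} {θ' : ℝ} {R : ℝ≥0∞}
    (hθ' : 0 < θ') (hlim : Tendsto θ atTop (𝓝 θ')) (hθ : ∀ i, 0 < θ i)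
    (hR : R ≠ ⊤) (h : ∀ i, eLpNorm w (ofReal (θ i))⁻¹ volume ≤ R) :
    eLpNorm w (ofReal θ')⁻¹ volume ≤ R := by
  have hinv : Tendsto (fun i => 1 / θ i) atTop (𝓝 (1 / θ')) :=
    tendsto_const_nhds.div hlim hθ'.ne'
  have hpt : ∀ x, Tendsto (fun i => ofReal (|w x| ^ (1 / θ i))) atTop
      (𝓝 (ofReal (|w x| ^ (1 / θ')))) := fun x =>
    ENNReal.tendsto_ofReal (((Real.continuousAt_const_rpow' (by positivity)).tendsto).comp hinv)
  have hle : ∀ i, ∫⁻ x, ofReal (|w x| ^ (1 / θ i)) ≤ R ^ (1 / θ i) := by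
    intro i
    have := h i
    rw [eLpNorm_inv_ofReal (hθ i)] at this
    rwa [one_div, ENNReal.le_rpow_inv_iff (hθ i), ← one_div]
  have hRlim : Tendsto (fun i => R ^ (1 / θ i)) atTop (𝓝 (R ^ (1 / θ'))) := by
    lift R to ℝ≥0 using hR
    have h1 : Tendsto (fun i => R ^ (1 / θ i)) atTop (𝓝 (R ^ (1 / θ'))) :=
      (NNReal.continuousAt_rpow (x := R) (y := 1 / θ') (Or.inr (by positivity))).tendsto.comp
        (tendsto_const_nhds.prodMk_nhds hinv)
    have h2 := ENNReal.tendsto_coe.2 h1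
    refine (h2.congr fun i => ?_).trans (le_of_eq ?_)
    · exact ENNReal.coe_rpow_of_nonneg _ (one_div_pos.2 (hθ i)).le
    · rw [ENNReal.coe_rpow_of_nonneg _ (one_div_pos.2 hθ').le]
  rw [eLpNorm_inv_ofReal hθ', ← ENNReal.le_rpow_inv_iff hθ', ← one_div]
  have hm : AEMeasurable fun x => |w x| := hwm.aemeasurable.norm
  calc ∫⁻ x, ofReal (|w x| ^ (1 / θ'))
      = ∫⁻ x, liminf (fun i => ofReal (|w x| ^ (1 / θ i))) atTop :=
        lintegral_congr fun x => (hpt x).liminf_eq.symm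
    _ ≤ liminf (fun i => ∫⁻ x, ofReal (|w x| ^ (1 / θ i))) atTop :=
        lintegral_liminf_le' fun i => (hm.pow_const _).ennreal_ofReal
    _ ≤ liminf (fun i => R ^ (1 / θ i)) atTop :=
        liminf_le_liminf (Eventually.of_forall hle)
    _ = R ^ (1 / θ') := hRlim.liminf_eq

/-- The Gagliardo–Nirenberg inequality for compactly supported functions: the derivatives of
length `j` of a bounded function with `k` derivatives in `L^p` are in `L^{kp/j}`. -/
theorem eLpNorm_lt_top_of_family {ι : Type*} [Finite ι] {b : ι → Euc m → Euc m}
    (hb : ∀ i, ContDiff ℝ ∞ (b i)) (hbc : ∀ i, HasCompactSupport (b i)) {S : Set (Euc m)}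
    (hS : IsCompact S) {k : ℕ} (hk : 1 ≤ k) {p : ℝ} (hp : 1 ≤ p) {v : List ι → Euc m → ℝ}
    (hD : ∀ I : List ι, I.length < k → ∀ i, WeakDeriv (b i) univ (v I) (v (i :: I)))
    (hP : ∀ I : List ι, I.length ≤ k → MemLpIn (ofReal p) S (v I))
    (h0 : eLpNorm (v []) ⊤ volume < ⊤) {I : List ι} (hI : 1 ≤ I.length) (hIk : I.length ≤ k) :
    eLpNorm (v I) (ofReal (I.length / (k * p)))⁻¹ volume < ⊤ := by
  have hp0 : 0 < p := by linarith
  have hpE : 1 ≤ ofReal p := by simpa using hp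
  have hint : ∀ I : List ι, I.length ≤ k → Integrable (v I) := fun I hI =>
    (hP I hI).integrable hS hpE
  have hC : ∀ i, ∃ C : ℝ≥0, ∀ w v z : Euc m → ℝ, Integrable w → Integrable v → Integrable z →
      (∀ x ∉ S, v x = 0) → WeakDeriv (b i) univ w v → WeakDeriv (b i) univ v z →
      ∀ α β : ℝ, 0 ≤ α → α ≤ β → 0 < β → β ≤ 1 →
      eLpNorm v (ofReal ((α + β) / 2))⁻¹ volume ≤
        C * (eLpNorm w (ofReal α)⁻¹ volume ^ (1 / 2 : ℝ) *
          eLpNorm z (ofReal β)⁻¹ volume ^ (1 / 2 : ℝ) +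
          eLpNorm w (ofReal α)⁻¹ volume) := by
    intro i
    have hb1 : ContDiff ℝ 1 (b i) := (hb i).of_le (by simp)
    obtain ⟨K, hK⟩ := hb1.lipschitzWith_of_hasCompactSupport (hbc i) one_ne_zero
    obtain ⟨L, hL⟩ := (hb i).continuous.bounded_above_of_compact_support (hbc i)
    obtain ⟨Φ, hΦ⟩ := exists_isFlow hK (L := L.toNNReal)
      (fun x => (hL x).trans (Real.le_coe_toNNReal L))
    exact hΦ.exists_eLpNorm_le (hb i) (hbc i) hS
  choose Ci hCi using hC
  obtain ⟨C0, hC0⟩ := (Set.finite_range Ci).bddAbove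
  obtain ⟨V, hV⟩ : ∃ V : ℝ≥0, volume S + 1 = V :=
    ⟨(volume S + 1).toNNReal, (ENNReal.coe_toNNReal (by simp [hS.measure_lt_top.ne])).symm⟩
  set N : ℕ → ℝ → ℝ≥0∞ := fun j θ => ⨆ I ∈ {I : List ι | I.length = j},
    eLpNorm (v I) (ofReal θ)⁻¹ volume with hN
  have hle : ∀ (I : List ι) θ, eLpNorm (v I) (ofReal θ)⁻¹ volume ≤ N I.length θ :=
    fun I θ => le_iSup₂_of_le I rfl le_rfl
  have hlt := lt_top_of_interpolation N hk (q := 1 / p) (by positivity)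
    ((div_le_one hp0).2 hp) (max C0 V) ?_ ?_ ?_ ?_ ?_ hI hIk
  · refine (hle I _).trans_lt ?_
    convert hlt using 2
    field_simp
  · intro j hj α β hα _ _ hαβ hβ hβ1
    refine iSup₂_le fun I hI => ?_
    obtain ⟨i, I', rfl⟩ : ∃ i I', I = i :: I' := List.exists_cons_of_length_eq_add_one hI
    have hI' : I'.length = j := by simpa using hI
    have hi := hCi i (v I') (v (i :: I')) (v (i :: i :: I')) (hint _ (by omega))
      (hint _ (by simp; omega)) (hint _ (by simp; omega)) (hP _ (by simp; omega)).2
      (hD _ (by omega) i) (hD _ (by simp; omega) i) α β hα hαβ hβ hβ1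
    refine hi.trans ?_
    have l1 := hle I' α
    have l2 := hle (i :: i :: I') β
    simp only [List.length_cons, hI'] at l1 l2
    have hCi' : Ci i ≤ max C0 V := (hC0 ⟨i, rfl⟩).trans (le_max_left _ _)
    gcongr
  · intro j _ hj θ θ' hθ hθθ hθ1
    refine iSup₂_le fun I hI => ?_
    have hI' : I.length = j := hI
    refine (eLpNorm_le_mul_of_memLpIn hθ hθθ hθ1 (hP I (by omega)).1.1
      (hP I (by omega)).2).trans ?_
    rw [hV]
    have l1 := hle I θ
    rw [hI'] at l1
    have : V ≤ max C0 V := le_max_right _ _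
    gcongr
  · intro j _ hj θ θ' R hθ' hlim hθ hR
    refine iSup₂_le fun I hI => ?_
    have hI' : I.length = j := hI
    rcases eq_or_ne R ⊤ with rfl | hRt
    · exact le_top
    refine eLpNorm_le_of_tendsto (hP I (by omega)).1.1 hθ' hlim hθ hRt fun i => ?_
    exact (hI' ▸ hle I (θ i)).trans (hR i)
  · refine (iSup₂_le fun I hI => ?_ : N 0 0 ≤ eLpNorm (v []) ⊤ volume).trans_lt h0
    have : I = [] := List.length_eq_zero_iff.1 hI
    subst this
    simp
  · intro j _ hj
    have hfin : {I : List ι | I.length = j}.Finite := List.finite_length_eq ι j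
    refine lt_of_le_of_lt (iSup₂_le fun I hI => ?_ : _ ≤ ∑ I ∈ hfin.toFinset,
      eLpNorm (v I) (ofReal (1 / p))⁻¹ volume) ?_
    · exact single_le_sum (f := fun I => eLpNorm (v I) (ofReal (1 / p))⁻¹ volume)
        (fun _ _ => zero_le) (hfin.mem_toFinset.2 hI)
    · refine ENNReal.sum_lt_top.2 fun I hI => ?_
      have hI' : I.length = j := hfin.mem_toFinset.1 hI
      rw [one_div, ENNReal.ofReal_inv_of_pos hp0, inv_inv]
      exact (hP I (by omega)).1.2

end Towers

/-! ### Sobolev regularity of maps with horizontal components in `W^{k,p}` -/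

section Sobolev

variable {m : ℕ} {W : Set (Euc m)}

/-- The Gagliardo–Nirenberg inequality, local form: the derivatives of length `j` of a continuous
function with `k` derivatives in `L^p_loc` are in `L^{kp/j}_loc`. -/
theorem LpLoc.of_family {ι : Type*} [Finite ι] {b : ι → Euc m → Euc m}
    (hb : ∀ i, ContDiff ℝ ∞ (b i)) (hbc : ∀ i, HasCompactSupport (b i)) (hW : IsOpen W)
    {k : ℕ} (hk : 1 ≤ k) {p : ℝ} (hp : 1 ≤ p) {v : List ι → Euc m → ℝ}
    (hD : ∀ I : List ι, I.length < k → ∀ i, WeakDeriv (b i) W (v I) (v (i :: I)))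
    (hP : ∀ I : List ι, I.length ≤ k → LpLoc (ofReal p) W (v I))
    (h0 : ContinuousOn (v []) W) {I : List ι} (hI : 1 ≤ I.length) (hIk : I.length ≤ k) :
    LpLoc (ofReal (I.length / (k * p)))⁻¹ W (v I) := by
  have hpE : 1 ≤ ofReal p := by simpa using hp
  intro K hKW hK
  obtain ⟨χ, hχ, hχ1, -⟩ := exists_isTest_eq_one hK hW hKW
  have hS : IsCompact (tsupport χ) := hχ.2.1
  have hT : Tower (fun i => WeakDeriv (b i) W) (fun _ => LpLoc (ofReal p) W) k 0 (v []) :=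
    Tower.of_family v hD hP
  obtain ⟨v', hv0, hvD, hvP⟩ := (tower_mul_test hb hpE hW hS hT hχ subset_rfl).exists_family
  have hfin := eLpNorm_lt_top_of_family hb hbc hS hk hp hvD hvP
    (by rw [hv0]; exact (LpLoc.memLpIn_mul_test (LpLoc.of_continuousOn h0) hχ subset_rfl).1.2)
    hI hIk
  obtain ⟨V, hV, hKV, hVχ⟩ := eventually_nhdsSet_iff_exists.1 hχ1
  have key : ∀ I : List ι, I.length ≤ k → ∀ᵐ x, x ∈ V ∩ W → v' I x = v I x := by
    intro I
    induction I with
    | nil =>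
      refine fun _ => ae_of_all _ fun x hx => ?_
      rw [hv0]
      simp [hVχ x hx.1]
    | cons i I ih =>
      intro hI
      have hI' : I.length < k := by simpa using hI
      have h1 : WeakDeriv (b i) (V ∩ W) (v I) (v' (i :: I)) :=
        ((hvD I hI' i).mono (subset_univ _)).congr (ih hI'.le) (ae_of_all _ fun x _ => rfl)
      refine h1.ae_unique (hV.inter hW) ((hD I hI' i).mono inter_subset_right) ?_ ?_
      · exact ((hvP _ hI).integrable hS hpE).locallyIntegrable.locallyIntegrableOn _
      · exact ((hP _ hI).locallyIntegrableOn hpE hW).mono_set inter_subset_right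
  have h1 : MemLp (v' I) (ofReal (I.length / (k * p)))⁻¹ volume := ⟨(hvP I hIk).1.1, hfin⟩
  refine (memLp_congr_ae ?_).1 (h1.restrict K)
  filter_upwards [ae_restrict_of_ae (key I hIk), ae_restrict_mem hK.measurableSet] with x hx hxK
    using hx ⟨hKV hxK, hKW hxK⟩

/-- The scale of classes in which the derivatives of a continuous function with `k` derivatives in
`L^p_loc` live: those of order `0` are continuous, those of order `a` are in `L^{kp/a}_loc`. -/
def SobolevScale (k : ℕ) (p : ℝ) (W : Set (Euc m)) (a : ℕ) (u : Euc m → ℝ) : Prop :=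
  (a = 0 → ContinuousOn u W) ∧ LpLoc (ofReal (a / (k * p)))⁻¹ W u

theorem SobolevScale.zero_iff {k : ℕ} {p : ℝ} {u : Euc m → ℝ} :
    SobolevScale k p W 0 u ↔ ContinuousOn u W :=
  ⟨fun h => h.1 rfl, fun h => ⟨fun _ => h, LpLoc.of_continuousOn h⟩⟩

theorem SobolevScale.lpLoc {k : ℕ} (hk : 1 ≤ k) {p : ℝ} (hp : 1 ≤ p) {a : ℕ} (ha : a ≤ k)
    {u : Euc m → ℝ} (h : SobolevScale k p W a u) : LpLoc (ofReal p) W u := by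
  have hp0 : 0 < p := by linarith
  have hk0 : (0 : ℝ) < k := by exact_mod_cast hk
  refine h.2.mono_exponent ?_
  rw [← inv_le_inv, inv_inv, ← ENNReal.ofReal_inv_of_pos hp0]
  refine ofReal_le_ofReal ?_
  rw [inv_eq_one_div, div_le_div_iff₀ (by positivity) hp0]
  have : (a : ℝ) ≤ k := by exact_mod_cast ha
  nlinarith

theorem SobolevScale.locallyIntegrableOn (hW : IsOpen W) {k : ℕ} (hk : 1 ≤ k) {p : ℝ}
    (hp : 1 ≤ p) {a : ℕ} (ha : a ≤ k) {u : Euc m → ℝ} (h : SobolevScale k p W a u) :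
    LocallyIntegrableOn u W :=
  (h.lpLoc hk hp ha).locallyIntegrableOn (by simpa using hp) hW

theorem SobolevScale.mul {k : ℕ} {p : ℝ} (hp : 1 ≤ p) {a c : ℕ} {u w : Euc m → ℝ}
    (hu : SobolevScale k p W a u) (hw : SobolevScale k p W c w) :
    SobolevScale k p W (a + c) (u * w) := by
  refine ⟨fun h => (hu.1 (by omega)).mul (hw.1 (by omega)), fun K hKW hK => ?_⟩
  have : ENNReal.HolderTriple (ofReal (a / (k * p)))⁻¹ (ofReal (c / (k * p)))⁻¹
      (ofReal ((a + c : ℕ) / (k * p)))⁻¹ := by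
    refine ⟨?_⟩
    rw [inv_inv, inv_inv, inv_inv, ← ofReal_add (by positivity) (by positivity)]
    push_cast
    rw [add_div]
  exact (hw.2 K hKW hK).mul (hu.2 K hKW hK)

theorem calculusRules_sobolevScale {ι : Type*} {b : ι → Euc m → Euc m}
    (hb : ∀ i, ContDiff ℝ ∞ (b i)) (hbc : ∀ i, HasCompactSupport (b i)) (hW : IsOpen W)
    {k : ℕ} (hk : 1 ≤ k) {p : ℝ} (hp : 1 ≤ p) :
    CalculusRules (fun i => WeakDeriv (b i) W) (SobolevScale k p W) k where
  zero a _ := ⟨fun _ => continuousOn_const, LpLoc.of_continuousOn continuousOn_const⟩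
  add a _ u w hu hw := ⟨fun h => (hu.1 h).add (hw.1 h), hu.2.add hw.2⟩
  mul a c _ u w hu hw := hu.mul hp hw
  deriv_zero i φ _ := by simp
  deriv_add i a ha u w u' w' hu hw hu' hw' h h' :=
    h.add (hb i) (hu.locallyIntegrableOn hW hk hp (by omega))
      (hw.locallyIntegrableOn hW hk hp (by omega)) (hu'.locallyIntegrableOn hW hk hp ha)
      (hw'.locallyIntegrableOn hW hk hp ha) h'
  deriv_mul i a c hac u w u' w' hu hw hu' hw' h h' :=
    h.mul (hb i) (hbc i) hW (hu.locallyIntegrableOn hW hk hp (by omega))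
      (hw.locallyIntegrableOn hW hk hp (by omega)) (hu'.locallyIntegrableOn hW hk hp (by omega))
      (hw'.locallyIntegrableOn hW hk hp (by omega))
      ((hu.mul hp hw).locallyIntegrableOn hW hk hp (by omega))
      ((hu'.mul hp hw).locallyIntegrableOn hW hk hp (by omega))
      ((hu.mul hp hw').locallyIntegrableOn hW hk hp (by omega)) h'

theorem fderiv_comp_toLp {n : ℕ} (G : Euc n → ℝ) (z v : Fin n → ℝ) :
    fderiv ℝ (fun z : Fin n → ℝ => G (WithLp.toLp 2 z)) z v =
      fderiv ℝ G (WithLp.toLp 2 z) (WithLp.toLp 2 v) := by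
  have := (PiLp.continuousLinearEquiv 2 ℝ (fun _ : Fin n => ℝ)).symm.comp_right_fderiv
    (f := G) (x := z)
  exact congrArg (fun T : (Fin n → ℝ) →L[ℝ] ℝ => T v) this

/-- If the derivatives of all components of a continuous map are combinations, with coefficients
smooth in the components, of those of the components `f (J l)`, and these components have `k`
derivatives in `L^p_loc`, then so do all components. -/
theorem tower_lpLoc_of_horizontal {ι : Type*} [Finite ι] {b : ι → Euc m → Euc m}
    (hb : ∀ i, ContDiff ℝ ∞ (b i)) (hbc : ∀ i, HasCompactSupport (b i)) (hW : IsOpen W)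
    {k : ℕ} (hk : 1 ≤ k) {p : ℝ} (hp : 1 ≤ p) {n r : ℕ} {O : Set (Euc n)} (hO : IsOpen O)
    {f : Fin n → Euc m → ℝ} (hf : ∀ j, ContinuousOn (f j) W)
    (hfO : ∀ x ∈ W, WithLp.toLp 2 (fun j => f j x) ∈ O) (J : Fin r → Fin n)
    {G : Fin n → Fin r → Euc n → ℝ} (hG : ∀ j l, ContDiffOn ℝ ∞ (G j l) O)
    (hder : ∀ i, ∀ g : Fin r → Euc m → ℝ, (∀ l, LocallyIntegrableOn (g l) W) →
      (∀ l, WeakDeriv (b i) W (f (J l)) (g l)) → ∀ j, WeakDeriv (b i) W (f j)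
        fun x => ∑ l, G j l (WithLp.toLp 2 fun j => f j x) * g l x)
    (hbase : ∀ l, Tower (fun i => WeakDeriv (b i) W) (fun _ => LpLoc (ofReal p) W) k 0
      (f (J l))) (j : Fin n) :
    Tower (fun i => WeakDeriv (b i) W) (fun _ => LpLoc (ofReal p) W) k 0 (f j) := by
  set F : Euc m → Euc n := fun x => WithLp.toLp 2 fun j => f j x with hF
  have hFc : ContinuousOn F W :=
    (PiLp.continuous_toLp 2 _).comp_continuousOn (continuousOn_pi.2 hf)
  have hmain := CalculusRules.tower_of_horizontal (calculusRules_sobolevScale hb hbc hW hk hp) f J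
    {c | ∃ A : Euc n → ℝ, ContDiffOn ℝ ∞ A O ∧ c = A ∘ F} ?_
    (fun j => SobolevScale.zero_iff.2 (hf j)) (fun j l => G j l ∘ F)
    (fun j l => ⟨G j l, hG j l, rfl⟩) ?_ ?_ j
  · exact hmain.imp (fun _ _ _ h => h) fun l u _ hl hu => hu.lpLoc hk hp (by omega)
  · rintro c ⟨A, hA, rfl⟩
    refine ⟨SobolevScale.zero_iff.2 (hA.continuousOn.comp hFc hfO),
      fun i => (fun z => fderiv ℝ A z (WithLp.toLp 2 (Pi.single i 1))) ∘ F, fun i =>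
        ⟨_, (hA.fderiv_of_isOpen hO (m := ∞) (by simp)).clm_apply contDiffOn_const, rfl⟩, ?_⟩
    intro i g _ hg
    have hO' : IsOpen ((fun z : Fin n → ℝ => (WithLp.toLp 2 z : Euc n)) ⁻¹' O) :=
      hO.preimage (PiLp.continuous_toLp 2 _)
    have := weakDeriv_comp_of_continuousOn (hb i) (hbc i) hW hf
      (fun l => (hg l).2.locallyIntegrableOn hW hk hp hk) (fun l => (hg l).1) hO' hfO
      (G := fun z => A (WithLp.toLp 2 z)) ((hA.of_le (by simp)).comp
        (PiLp.continuousLinearEquiv 2 ℝ (fun _ : Fin n => ℝ)).symm.contDiff.contDiffOn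
        fun z hz => hz)
    refine this.congr (ae_of_all _ fun x _ => rfl) (ae_of_all _ fun x _ => ?_)
    rw [Finset.sum_apply]
    refine sum_congr rfl fun l _ => ?_
    rw [fderiv_comp_toLp, mul_comm]
    rfl
  · intro i g _ hg j
    refine (hder i g (fun l => (hg l).2.locallyIntegrableOn hW hk hp hk) (fun l => (hg l).1)
      j).congr (ae_of_all _ fun x _ => rfl) (ae_of_all _ fun x _ => ?_)
    simp [Finset.sum_apply, hF]
  · intro l
    obtain ⟨v, hv0, hvD, hvP⟩ := (hbase l).exists_family
    rw [← hv0]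
    have hc : ContinuousOn (v []) W := hv0 ▸ hf (J l)
    refine Tower.of_family v hvD fun I hI => ?_
    rcases Nat.eq_zero_or_pos I.length with h | h
    · rw [List.length_eq_zero_iff.1 h]
      exact SobolevScale.zero_iff.2 hc
    · rw [zero_add]
      exact ⟨fun h' => by omega, LpLoc.of_family hb hbc hW hk hp hvD hvP hc h hI⟩

end Sobolev

/-! ### Vector fields and curves in charts -/

section Charts

variable {n : ℕ} {M : Type*} [TopologicalSpace M]
  [ChartedSpace (Euc n) M] [IsManifold (𝓡 n) ∞ M]
  {F : Type*} [NormedAddCommGroup F] [NormedSpace ℝ F]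

theorem mdifferentiable_of_mem_maximalAtlas
    {e : OpenPartialHomeomorph M (Euc n)}
    (he : e ∈ IsManifold.maximalAtlas (𝓡 n) ∞ M) : e.MDifferentiable (𝓡 n) (𝓡 n) :=
  ⟨(contMDiffOn_of_mem_maximalAtlas he).mdifferentiableOn (by simp),
    (contMDiffOn_symm_of_mem_maximalAtlas he).mdifferentiableOn (by simp)⟩

/-- The derivative of a vector valued function at a point, as a linear map between the model
spaces. -/
noncomputable def mderiv (h : M → F) (q : M) : Euc n →L[ℝ] F := mfderiv (𝓡 n) 𝓘(ℝ, F) h q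

theorem mderiv_sum_smul {ι : Type*} [Fintype ι] (h : M → F) {q : M}
    {H : Submodule ℝ (TangentSpace (𝓡 n) q)} (c : ι → ℝ) (w : ι → H) :
    mderiv h q ((∑ i, c i • w i : H) : TangentSpace (𝓡 n) q) =
      ∑ i, c i • mderiv h q (w i).1 := by
  rw [Submodule.coe_sum]
  refine (map_sum (mderiv h q)
    (fun i => (((c i • w i : H) : TangentSpace (𝓡 n) q) : Euc n)) _).trans ?_
  exact sum_congr rfl fun i _ =>
    (mderiv h q).map_smul (c i) ((w i).1 : Euc n)

theorem SmoothFieldOn.contMDiffOn_mderiv {X : ∀ q : M, TangentSpace (𝓡 n) q} {U : Set M}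
    (hX : SmoothFieldOn X U) (hU : IsOpen U) {h : M → F}
    (hh : ContMDiffOn (𝓡 n) 𝓘(ℝ, F) ∞ h U) :
    ContMDiffOn (𝓡 n) 𝓘(ℝ, F) ∞ (fun q => mderiv h q (X q)) U := by
  have h1 := hh.contMDiffOn_tangentMapWithin (m := ∞) (by simp) hU.uniqueMDiffOn
  have h2 := h1.comp hX (fun q hq => hq)
  have h3 := (contMDiff_snd_tangentBundle_modelSpace F 𝓘(ℝ, F) (n := ∞)).comp_contMDiffOn h2
  refine h3.congr fun q hq => ?_
  change mfderiv (𝓡 n) 𝓘(ℝ, F) h q (X q) = mfderivWithin (𝓡 n) 𝓘(ℝ, F) h U q (X q)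
  rw [mfderivWithin_of_isOpen hU hq]

theorem SmoothFieldOn.contMDiffOn_dirDeriv {X : ∀ q : M, TangentSpace (𝓡 n) q} {U : Set M}
    (hX : SmoothFieldOn X U) (hU : IsOpen U) {h : M → ℝ}
    (hh : ContMDiffOn (𝓡 n) 𝓘(ℝ, ℝ) ∞ h U) :
    ContMDiffOn (𝓡 n) 𝓘(ℝ, ℝ) ∞ (dirDeriv X h) U :=
  hX.contMDiffOn_mderiv hU hh

theorem SmoothFieldOn.mono {X : ∀ q : M, TangentSpace (𝓡 n) q} {U V : Set M}
    (hX : SmoothFieldOn X U) (h : V ⊆ U) : SmoothFieldOn X V :=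
  ContMDiffOn.mono hX h

theorem IsFrameOf.mono {r : ℕ} {H : ∀ q : M, Submodule ℝ (TangentSpace (𝓡 n) q)} {U V : Set M}
    {X : Fin r → ∀ q : M, H q} (hX : IsFrameOf H U X) (h : V ⊆ U) : IsFrameOf H V X :=
  ⟨fun i => (hX.1 i).mono h, fun q hq => hX.2 q (h hq)⟩

/-- The derivative of a function along a curve. -/
theorem hasDerivWithinAt_comp_curve {γ : ℝ → M} {s : Set ℝ} {t : ℝ}
    {v : TangentSpace (𝓡 n) (γ t)}
    (hγ : HasMFDerivWithinAt 𝓘(ℝ, ℝ) (𝓡 n) γ s t ((1 : ℝ →L[ℝ] ℝ).smulRight v)) {h : M → F}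
    (hh : MDifferentiableAt (𝓡 n) 𝓘(ℝ, F) h (γ t)) :
    HasDerivWithinAt (h ∘ γ) (mderiv h (γ t) v) s t := by
  have h1 := hh.hasMFDerivAt.comp_hasMFDerivWithinAt t hγ
  have h2 : HasFDerivWithinAt (h ∘ γ)
      ((mderiv h (γ t)).comp ((1 : ℝ →L[ℝ] ℝ).smulRight (v : Euc n))) s t :=
    hasMFDerivWithinAt_iff_hasFDerivWithinAt.1 h1
  have h3 := h2.hasDerivWithinAt
  have h4 : ((mderiv h (γ t)).comp ((1 : ℝ →L[ℝ] ℝ).smulRight (v : Euc n))) 1 =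
      mderiv h (γ t) v := congrArg (mderiv h (γ t)) (one_smul ℝ (v : Euc n))
  rwa [h4] at h3

theorem hasDerivAt_comp_curve {γ : ℝ → M} {t : ℝ} {v : TangentSpace (𝓡 n) (γ t)}
    (hγ : HasMFDerivAt 𝓘(ℝ, ℝ) (𝓡 n) γ t ((1 : ℝ →L[ℝ] ℝ).smulRight v)) {h : M → F}
    (hh : MDifferentiableAt (𝓡 n) 𝓘(ℝ, F) h (γ t)) :
    HasDerivAt (h ∘ γ) (mderiv h (γ t) v) t :=
  hasDerivWithinAt_univ.1 (hasDerivWithinAt_comp_curve (hasMFDerivWithinAt_univ.2 hγ) hh)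

/-- The expression, in the chart `e`, of the vector field `X`. -/
noncomputable def pushField (e : OpenPartialHomeomorph M (Euc n))
    (X : ∀ q : M, TangentSpace (𝓡 n) q) (x : Euc n) : Euc n :=
  mderiv e (e.symm x) (X (e.symm x))

variable {e : OpenPartialHomeomorph M (Euc n)}
  (he : e ∈ IsManifold.maximalAtlas (𝓡 n) ∞ M) {X : ∀ q : M, TangentSpace (𝓡 n) q} {U : Set M}

include he in
theorem contDiffOn_pushField (hX : SmoothFieldOn X U) (hU : IsOpen U) :
    ContDiffOn ℝ ∞ (pushField e X) (e.target ∩ e.symm ⁻¹' U) := by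
  have h1 := (hX.mono (V := U ∩ e.source) inter_subset_left).contMDiffOn_mderiv
    (hU.inter e.open_source) ((contMDiffOn_of_mem_maximalAtlas he).mono inter_subset_right)
  exact (h1.comp ((contMDiffOn_symm_of_mem_maximalAtlas he).mono inter_subset_left)
    fun x hx => ⟨hx.2, e.map_target hx.1⟩).contDiffOn

include he in
theorem dirDeriv_symm_apply {h : M → ℝ} {x : Euc n} (hx : x ∈ e.target)
    (hh : MDifferentiableAt (𝓡 n) 𝓘(ℝ, ℝ) h (e.symm x)) :
    dirDeriv X h (e.symm x) = fderiv ℝ (h ∘ e.symm) x (pushField e X x) := by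
  have hm := mdifferentiable_of_mem_maximalAtlas he
  have h1 := mfderiv_comp x hh (hm.mdifferentiableAt_symm hx)
  rw [← mfderiv_eq_fderiv, h1, pushField, dirDeriv]
  have h2 := hm.symm_comp_deriv (e.map_target hx)
  rw [e.right_inv hx] at h2
  have h3 := congrArg (fun T : TangentSpace (𝓡 n) (e.symm x) →L[ℝ] TangentSpace (𝓡 n) (e.symm x) =>
    T (X (e.symm x))) h2
  exact congrArg (mfderiv (𝓡 n) 𝓘(ℝ, ℝ) h (e.symm x)) h3.symm

include he in
/-- An integral curve of the expression of a vector field in a chart, seen on the manifold. -/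
theorem hasMFDerivAt_symm_comp {γ : ℝ → Euc n} {t : ℝ} (hγ : γ t ∈ e.target)
    (h : HasDerivAt γ (pushField e X (γ t)) t) :
    HasMFDerivAt 𝓘(ℝ, ℝ) (𝓡 n) (e.symm ∘ γ) t
      ((1 : ℝ →L[ℝ] ℝ).smulRight (X ((e.symm ∘ γ) t))) := by
  have hm := mdifferentiable_of_mem_maximalAtlas he
  have h1 := (hm.mdifferentiableAt_symm hγ).hasMFDerivAt.comp t h.hasFDerivAt.hasMFDerivAt
  have h2 := hm.symm_comp_deriv (e.map_target hγ)
  rw [e.right_inv hγ] at h2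
  have h3 := congrArg (fun T : TangentSpace (𝓡 n) (e.symm (γ t)) →L[ℝ]
    TangentSpace (𝓡 n) (e.symm (γ t)) => T (X (e.symm (γ t)))) h2
  let A : Euc n →L[ℝ] Euc n := mfderiv (𝓡 n) (𝓡 n) e.symm (γ t)
  refine h1.congr_mfderiv (Eq.symm ?_)
  change ((1 : ℝ →L[ℝ] ℝ).smulRight (X (e.symm (γ t)) : Euc n)) =
    A.comp (ContinuousLinearMap.toSpanSingleton ℝ (pushField e X (γ t)))
  ext
  have h4 : A.comp (ContinuousLinearMap.toSpanSingleton ℝ (pushField e X (γ t))) 1 =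
      A (pushField e X (γ t)) := congrArg A (one_smul ℝ (pushField e X (γ t)))
  exact (one_smul ℝ (X (e.symm (γ t)) : Euc n)).trans (h3.symm.trans h4.symm)

include he in
theorem hasDerivAt_comp_of_hasMFDerivAt {γ : ℝ → M} {t : ℝ} (hγ : γ t ∈ e.source)
    (h : HasMFDerivAt 𝓘(ℝ, ℝ) (𝓡 n) γ t ((1 : ℝ →L[ℝ] ℝ).smulRight (X (γ t)))) :
    HasDerivAt (e ∘ γ) (pushField e X ((e ∘ γ) t)) t := by
  have hm := mdifferentiable_of_mem_maximalAtlas he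
  have h1 := hasDerivAt_comp_curve h (hm.mdifferentiableAt hγ)
  rw [pushField]
  simp only [Function.comp_apply]
  rwa [e.left_inv hγ]

end Charts

/-! ### Local estimates along horizontal curves -/

section Horizontal

variable {n r : ℕ} {M : Type*} [TopologicalSpace M]
  [ChartedSpace (Euc n) M] [IsManifold (𝓡 n) ∞ M]

/-- A smooth horizontal curve on `[0, 1]` of speed at most `δ`. -/
def SubRiemannian.IsHorizontalCurve (S : SubRiemannian n r M) (δ : ℝ) (γ : ℝ → M) : Prop :=
  ContMDiffOn 𝓘(ℝ, ℝ) (𝓡 n) ∞ γ (Icc 0 1) ∧ ∀ t ∈ Icc (0 : ℝ) 1, ∃ v : S.H (γ t),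
    HasMFDerivWithinAt 𝓘(ℝ, ℝ) (𝓡 n) γ (Icc 0 1) t
      ((1 : ℝ →L[ℝ] ℝ).smulRight v.1) ∧ S.g (γ t) v v ≤ δ ^ 2

variable (S : SubRiemannian n r M)

theorem SubRiemannian.exists_isHorizontalCurve {x y : M} {η : ℝ≥0} (h : S.ccDist x y < η) :
    ∃ γ, S.IsHorizontalCurve η γ ∧ γ 0 = x ∧ γ 1 = y := by
  rw [SubRiemannian.ccDist, iInf_lt_iff] at h
  obtain ⟨δ, h⟩ := h
  rw [iInf_lt_iff] at h
  obtain ⟨⟨γ, h1, h2, h3, h4⟩, h5⟩ := h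
  refine ⟨γ, ⟨h1, fun t ht => ?_⟩, h2, h3⟩
  obtain ⟨v, hv, hv'⟩ := h4 t ht
  have : (δ : ℝ) ≤ η := by exact_mod_cast h5.le
  exact ⟨v, hv, hv'.trans (by gcongr)⟩

theorem SubRiemannian.ccDist_le_of_isHorizontalCurve {η : ℝ≥0} {γ : ℝ → M}
    (h : S.IsHorizontalCurve η γ) : S.ccDist (γ 0) (γ 1) ≤ η :=
  iInf₂_le (f := fun (δ : ℝ≥0) _ => (δ : ℝ≥0∞)) η ⟨γ, h.1, rfl, rfl, h.2⟩

/-- Near each point there is a frame of the horizontal bundle in which the coefficients of a vector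
are controlled by its length. -/
theorem SubRiemannian.exists_frame_bound (p : M) : ∃ U : Set M, IsOpen U ∧ p ∈ U ∧
    ∃ X : Fin r → ∀ q : M, S.H q, IsFrameOf S.H U X ∧ ∃ C : ℝ, 0 < C ∧ ∀ q ∈ U,
      ∀ c : Fin r → ℝ, ∑ i, c i ^ 2 ≤ C * S.g q (∑ i, c i • X i q) (∑ i, c i • X i q) := by
  obtain ⟨U, hU, hp, X, hX⟩ := S.exists_frame p
  set F : Euc r → M → ℝ := fun c q => ∑ i, ∑ j, c i * c j * S.g q (X i q) (X j q) with hF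
  have hFg : ∀ (c : Euc r) q, S.g q (∑ i, c i • X i q) (∑ i, c i • X i q) = F c q := by
    intro c q
    simp only [map_sum, LinearMap.sum_apply, map_smul, LinearMap.smul_apply, smul_eq_mul, hF,
      mul_sum]
    rw [sum_comm]
    refine sum_congr rfl fun i _ => sum_congr rfl fun j _ => by ring
  have hcont : ∀ c : Euc r, ContinuousAt (fun z : Euc r × M => F z.1 z.2) (c, p) := by
    intro c
    refine tendsto_finsetSum _ fun i _ => tendsto_finsetSum _ fun j _ => ?_
    have h1 : ContinuousAt (fun q => S.g q (X i q) (X j q)) p :=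
      ((S.g_smooth U (X i) (X j) hU (hX.1 i) (hX.1 j)).continuousOn).continuousAt (hU.mem_nhds hp)
    have h2 : ContinuousAt (fun z : Euc r × M => S.g z.2 (X i z.2) (X j z.2)) (c, p) :=
      ContinuousAt.comp (f := Prod.snd) (x := (c, p)) h1 continuousAt_snd
    have h3 : ∀ i, ContinuousAt (fun z : Euc r × M => z.1 i) (c, p) := fun i =>
      ((EuclideanSpace.proj (𝕜 := ℝ) i).continuous.comp continuous_fst).continuousAt
    exact ((h3 i).mul (h3 j)).mul h2
  have hpos : ∀ c ∈ sphere (0 : Euc r) 1, 0 < F c p := by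
    intro c hc
    rw [← hFg]
    refine S.g_pos p _ fun h0 => ?_
    have := Fintype.linearIndependent_iff.1 (hX.2 p hp).1 c h0
    have h1 : c = 0 := by ext i; exact this i
    simp [h1] at hc
  have hev := (isCompact_sphere (0 : Euc r) 1).eventually_forall_of_forall_eventually
    (x₀ := ((p, 0) : M × ℝ)) (P := fun z c => z.2 < F c z.1) (by
      intro c hc
      have h1 : ContinuousAt (fun z : (M × ℝ) × Euc r => z.1.2) ((p, 0), c) :=
        (continuous_snd.comp continuous_fst).continuousAt
      have h2 : ContinuousAt (fun z : (M × ℝ) × Euc r => F z.2 z.1.1) ((p, 0), c) :=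
        ContinuousAt.comp (f := fun z : (M × ℝ) × Euc r => (z.2, z.1.1)) (x := ((p, 0), c))
          (hcont c) (by fun_prop)
      exact h1.eventually_lt h2 (hpos c hc))
  rw [nhds_prod_eq, eventually_prod_iff] at hev
  obtain ⟨A, hA, B, hB, hAB⟩ := hev
  obtain ⟨ε, hε, hB⟩ := Metric.eventually_nhds_iff.1 hB
  obtain ⟨V, hVA, hV, hpV⟩ := eventually_nhds_iff.1 hA
  have hBε : B (ε / 2) := hB (by rw [dist_eq, sub_zero, abs_of_pos (by positivity)]; linarith)
  refine ⟨U ∩ V, hU.inter hV, ⟨hp, hpV⟩, X, hX.mono inter_subset_left, 2 / ε, by positivity,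
    fun q hq c => ?_⟩
  set c' : Euc r := WithLp.toLp 2 c with hc'
  have hnorm : ∑ i, c i ^ 2 = ‖c'‖ ^ 2 := by
    rw [EuclideanSpace.norm_sq_eq]
    simp [hc']
  rw [hnorm, show S.g q (∑ i, c i • X i q) (∑ i, c i • X i q) = F c' q from hFg c' q]
  rcases eq_or_ne c' 0 with h0 | h0
  · simp [h0, hF]
  · have hn : 0 < ‖c'‖ := norm_pos_iff.2 h0
    have h1 := hAB (hVA q hq.2) hBε (‖c'‖⁻¹ • c')
      (by simp [norm_smul, hn.ne'])
    have h2 : F (‖c'‖⁻¹ • c') q = (‖c'‖⁻¹) ^ 2 * F c' q := by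
      simp only [hF, mul_sum, PiLp.smul_apply, smul_eq_mul]
      refine sum_congr rfl fun i _ => sum_congr rfl fun j _ => by ring
    simp only [h2] at h1
    have h3 : ε / 2 * ‖c'‖ ^ 2 ≤ F c' q := by
      have := mul_le_mul_of_nonneg_right h1.le (sq_nonneg ‖c'‖)
      rwa [mul_right_comm, ← mul_pow, inv_mul_cancel₀ hn.ne', one_pow, one_mul] at this
    calc ‖c'‖ ^ 2 = 2 / ε * (ε / 2 * ‖c'‖ ^ 2) := by field_simp
      _ ≤ 2 / ε * F c' q := by gcongr

/-- On compact sets the differential of a smooth function is bounded on unit horizontal vectors. -/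
theorem SubRiemannian.exists_abs_mderiv_le {O K : Set M} (hO : IsOpen O) {h : M → ℝ}
    (hh : ContMDiffOn (𝓡 n) 𝓘(ℝ, ℝ) ∞ h O) (hK : IsCompact K) (hKO : K ⊆ O) :
    ∃ C : ℝ, 0 ≤ C ∧ ∀ q ∈ K, ∀ v : S.H q, ∀ δ : ℝ, 0 ≤ δ → S.g q v v ≤ δ ^ 2 →
      |mderiv h q v.1| ≤ C * δ := by
  refine hK.induction_on (p := fun K => ∃ C : ℝ, 0 ≤ C ∧ ∀ q ∈ K, ∀ v : S.H q, ∀ δ : ℝ, 0 ≤ δ →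
    S.g q v v ≤ δ ^ 2 → |mderiv h q v.1| ≤ C * δ)
    ⟨0, le_rfl, fun q hq => hq.elim⟩ ?_ ?_ ?_
  · rintro s t hst ⟨C, hC0, hC⟩
    exact ⟨C, hC0, fun q hq => hC q (hst hq)⟩
  · rintro s t ⟨C, hC0, hC⟩ ⟨C', hC0', hC'⟩
    refine ⟨C + C', by positivity, fun q hq v δ hδ hv => ?_⟩
    have e1 : 0 ≤ C * δ := by positivity
    have e2 : 0 ≤ C' * δ := by positivity
    rcases hq with hq | hq
    · linarith [hC q hq v δ hδ hv]
    · linarith [hC' q hq v δ hδ hv]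
  · intro p hp
    obtain ⟨U, hU, hpU, X, hX, C, hC, hXC⟩ := S.exists_frame_bound p
    have hcont : ContinuousAt (fun q => ∑ i, mderiv h q (X i q).1 ^ 2) p := by
      refine tendsto_finsetSum _ fun i _ => ?_
      have h1 := (((hX.1 i).mono (V := U ∩ O) inter_subset_left).contMDiffOn_mderiv (hU.inter hO)
        (hh.mono inter_subset_right)).continuousOn.continuousAt
        ((hU.inter hO).mem_nhds ⟨hpU, hKO hp⟩)
      exact h1.pow 2
    set B := ∑ i, mderiv h p (X i p).1 ^ 2 + 1 with hB
    have hB0 : 0 ≤ B := by positivity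
    have hev := hcont.eventually_lt (continuousAt_const (y := B)) (by simp [hB])
    refine ⟨U ∩ {q | ∑ i, mderiv h q (X i q).1 ^ 2 < B},
      mem_nhdsWithin_of_mem_nhds (inter_mem (hU.mem_nhds hpU) hev), √(C * B),
      Real.sqrt_nonneg _, ?_⟩
    rintro q ⟨hqU, hqB⟩ v δ hδ hv
    obtain ⟨c, hc⟩ := (Submodule.mem_span_range_iff_exists_fun ℝ).1
      ((hX.2 q hqU).2 ▸ Submodule.mem_top : v ∈ Submodule.span ℝ (range fun i => X i q))
    have h1 : mderiv h q v.1 =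
        ∑ i, c i * mderiv h q (X i q).1 := by
      rw [← hc]
      exact mderiv_sum_smul h c fun i => X i q
    have h2 := hXC q hqU c
    rw [hc] at h2
    have h3 := Finset.sum_mul_sq_le_sq_mul_sq Finset.univ c
      fun i => mderiv h q (X i q).1
    rw [← h1] at h3
    refine abs_le_of_sq_le_sq ?_ (by positivity)
    rw [mul_pow, sq_sqrt (by positivity)]
    have hqB' : ∑ i, mderiv h q (X i q).1 ^ 2 ≤ B := le_of_lt hqB
    have h4 : 0 ≤ C * S.g q v v := (sum_nonneg fun i _ => sq_nonneg (c i)).trans h2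
    calc _ ≤ _ := h3
      _ ≤ (C * S.g q v v) * B := by gcongr
      _ ≤ (C * δ ^ 2) * B := by gcongr
      _ = C * B * δ ^ 2 := by ring

variable [T2Space M] [SecondCountableTopology M]

omit [IsManifold (𝓡 n) ∞ M] [T2Space M] [SecondCountableTopology M] in
theorem mderiv_eq_zero_of_notMem_tsupport {h : M → ℝ} {q : M} (hq : q ∉ tsupport h) :
    (mderiv h q : Euc n →L[ℝ] ℝ) = 0 := by
  have h1 : h =ᶠ[𝓝 q] fun _ => (0 : ℝ) := notMem_tsupport_iff_eventuallyEq.1 hq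
  have h2 := h1.mfderiv_eq (I := 𝓡 n) (I' := 𝓘(ℝ, ℝ))
  rw [mfderiv_const] at h2
  exact h2

/-- Short horizontal curves that start near a point stay near it. -/
theorem SubRiemannian.exists_nhds_forall_mem {O : Set M} (hO : IsOpen O) {p : M} (hp : p ∈ O) :
    ∃ V ∈ 𝓝 p, ∃ δ : ℝ, 0 < δ ∧ ∀ γ η, 0 ≤ η → η ≤ δ → S.IsHorizontalCurve η γ → γ 0 ∈ V →
      ∀ t ∈ Icc (0 : ℝ) 1, γ t ∈ O := by
  obtain ⟨χ, hχ, hχ1, -⟩ := exists_isTestFunction_eq_one (n := n) (isCompact_singleton (x := p)) hO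
    (singleton_subset_iff.2 hp)
  rw [nhdsSet_singleton] at hχ1
  obtain ⟨C, hC, hCχ⟩ := S.exists_abs_mderiv_le isOpen_univ hχ.1.contMDiffOn hχ.2.1 (subset_univ _)
  refine ⟨_, hχ1, (C + 1)⁻¹, by positivity, fun γ η hη0 hη hγ hγ0 t ht => ?_⟩
  choose! v hv hvη using hγ.2
  have hbound : ∀ t ∈ Icc (0 : ℝ) 1, ‖mderiv χ (γ t) (v t).1‖ ≤ C * η := by
    intro t ht
    by_cases hts : γ t ∈ tsupport χ
    · exact hCχ _ hts (v t) η hη0 (hvη t ht)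
    · rw [mderiv_eq_zero_of_notMem_tsupport hts]
      refine (le_of_eq ?_).trans (mul_nonneg hC hη0)
      exact norm_zero (E := ℝ)
  have h1 := (convex_Icc (0 : ℝ) 1).norm_image_sub_le_of_norm_hasDerivWithin_le
    (fun t ht => hasDerivWithinAt_comp_curve (hv t ht) (hχ.1.mdifferentiableAt (by simp))) hbound
    (show (0 : ℝ) ∈ Icc 0 1 by simp) ht
  by_contra hcon
  have h2 : χ (γ t) = 0 := image_eq_zero_of_notMem_tsupport fun h => hcon (hχ.2.2 h)
  have h3 : χ (γ 0) = 1 := hγ0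
  simp only [Function.comp_apply, h2, h3, zero_sub, norm_neg, norm_one, sub_zero,
    norm_of_nonneg ht.1] at h1
  have h4 : C * η * t < 1 := by
    calc C * η * t ≤ C * η := mul_le_of_le_one_right (by positivity) ht.2
      _ ≤ C * (C + 1)⁻¹ := by gcongr
      _ < 1 := by
          rw [← div_eq_mul_inv, div_lt_one (by positivity)]
          linarith
  linarith

theorem SubRiemannian.exists_abs_sub_le {O : Set M} (hO : IsOpen O) {h : M → ℝ}
    (hh : ContMDiffOn (𝓡 n) 𝓘(ℝ, ℝ) ∞ h O) {p : M} (hp : p ∈ O) :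
    ∃ V ∈ 𝓝 p, ∃ δ : ℝ, 0 < δ ∧ ∃ C : ℝ, 0 ≤ C ∧ ∀ γ η, 0 ≤ η → η ≤ δ →
      S.IsHorizontalCurve η γ → γ 0 ∈ V → ∀ t ∈ Icc (0 : ℝ) 1, γ t ∈ O ∧
        |h (γ t) - h (γ 0)| ≤ C * η ∧
        ∀ v : S.H (γ t), S.g (γ t) v v ≤ η ^ 2 →
          |mderiv h (γ t) v.1| ≤ C * η := by
  have : LocallyCompactSpace M := ChartedSpace.locallyCompactSpace (Euc n) M
  obtain ⟨K, hK, hpK, hKO⟩ := exists_compact_subset hO hp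
  obtain ⟨V, hV, δ, hδ, hVδ⟩ := S.exists_nhds_forall_mem isOpen_interior hpK
  obtain ⟨C, hC, hCK⟩ := S.exists_abs_mderiv_le hO hh hK hKO
  refine ⟨V, hV, δ, hδ, C, hC, fun γ η hη0 hη hγ hγ0 t ht => ?_⟩
  have hmem : ∀ t ∈ Icc (0 : ℝ) 1, γ t ∈ K := fun t ht =>
    interior_subset (hVδ γ η hη0 hη hγ hγ0 t ht)
  refine ⟨hKO (hmem t ht), ?_, fun v hv => hCK _ (hmem t ht) v η hη0 hv⟩
  choose! v hv hvη using hγ.2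
  have h1 := (convex_Icc (0 : ℝ) 1).norm_image_sub_le_of_norm_hasDerivWithin_le
    (fun t ht => hasDerivWithinAt_comp_curve (hv t ht)
      ((hh.contMDiffAt (hO.mem_nhds (hKO (hmem t ht)))).mdifferentiableAt (by simp)))
    (fun t ht => hCK _ (hmem t ht) (v t) η hη0 (hvη t ht))
    (show (0 : ℝ) ∈ Icc 0 1 by simp) ht
  refine h1.trans ?_
  rw [sub_zero, norm_of_nonneg ht.1]
  exact mul_le_of_le_one_right (by positivity) ht.2

/-- On the open set `O` the differential of `h` is, on horizontal vectors, the combination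
`∑ G l * d(k l)` of those of the functions `k l`. -/
structure SubRiemannian.IsHorizontalCombination {κ : Type*} [Fintype κ] (O : Set M) (h : M → ℝ)
    (k G : κ → M → ℝ) : Prop where
  isOpen : IsOpen O
  smooth : ContMDiffOn (𝓡 n) 𝓘(ℝ, ℝ) ∞ h O
  smooth_of : ∀ l, ContMDiffOn (𝓡 n) 𝓘(ℝ, ℝ) ∞ (k l) O
  smooth_coeff : ∀ l, ContMDiffOn (𝓡 n) 𝓘(ℝ, ℝ) ∞ (G l) O
  mderiv_eq : ∀ q ∈ O, ∀ v : S.H q, mderiv h q v.1 = ∑ l, G l q * mderiv (k l) q v.1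

variable {S}

/-- A bound by a continuous function of the length of the connecting horizontal curves passes to
the distance. -/
theorem SubRiemannian.le_of_forall_ccDist_lt {a b : M} {δ : ℝ≥0} (hab : S.ccDist a b < δ)
    {F : ℝ → ℝ} (hF : Continuous F) {c : ℝ}
    (h : ∀ η : ℝ≥0, S.ccDist a b < η → (η : ℝ) ≤ δ → c ≤ F η) : c ≤ F (S.ccDist a b).toReal := by
  have hne : S.ccDist a b ≠ ⊤ := (hab.trans coe_lt_top).ne
  have hlt : (S.ccDist a b).toReal < δ := (toReal_lt_toReal hne coe_ne_top).2 hab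
  refine ge_of_tendsto (x := 𝓝[>] (S.ccDist a b).toReal) (f := F)
    ((hF.tendsto _).mono_left nhdsWithin_le_nhds) ?_
  filter_upwards [Ioo_mem_nhdsGT hlt] with η hη
  lift η to ℝ≥0 using toReal_nonneg.trans hη.1.le
  exact h η ((toReal_lt_toReal hne coe_ne_top).1 hη.1) hη.2.le

/-- The functions `k l` determine `h` up to second order in the distance. -/
theorem SubRiemannian.IsHorizontalCombination.exists_abs_sub_sum_le {κ : Type*} [Fintype κ]
    {O : Set M} {h : M → ℝ} {k G : κ → M → ℝ} (hc : S.IsHorizontalCombination O h k G) {p : M}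
    (hp : p ∈ O) :
    ∃ V ∈ 𝓝 p, ∃ δ : ℝ≥0, 0 < δ ∧ ∃ C : ℝ, 0 ≤ C ∧ ∀ a ∈ V, ∀ b, S.ccDist a b < δ →
      |h b - h a - ∑ l, G l a * (k l b - k l a)| ≤ C * (S.ccDist a b).toReal ^ 2 := by
  obtain ⟨hO, hh, hk, hG, hd⟩ := hc
  obtain ⟨V₀, hV₀, δ₀, hδ₀, hVO⟩ := S.exists_nhds_forall_mem hO hp
  choose Vk hVk δk hδk Ck hCk hk' using fun l => S.exists_abs_sub_le hO (hk l) hp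
  choose VG hVG δG hδG CG hCG hG' using fun l => S.exists_abs_sub_le hO (hG l) hp
  obtain ⟨δ, hδ, hδ0, hδ1⟩ : ∃ δ : ℝ≥0, 0 < δ ∧ δ ≤ δ₀ ∧ ∀ l, (δ : ℝ) ≤ δk l ∧ δ ≤ δG l := by
    have hev : ∀ᶠ δ : ℝ in 𝓝[>] 0, δ ≤ δ₀ ∧ ∀ l, δ ≤ δk l ∧ δ ≤ δG l := by
      refine Eventually.and ?_ (eventually_all.2 fun l => Eventually.and ?_ ?_)
      all_goals exact mem_nhdsWithin_of_mem_nhds (Iic_mem_nhds (by simp [*]))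
    obtain ⟨δ, h1, h2⟩ := (hev.and self_mem_nhdsWithin).exists
    exact ⟨⟨δ, le_of_lt h2⟩, h2, h1⟩
  refine ⟨V₀ ∩ ⋂ l, (Vk l ∩ VG l), inter_mem hV₀ (iInter_mem.2 fun l =>
    inter_mem (hVk l) (hVG l)), δ, hδ, ∑ l, CG l * Ck l,
    sum_nonneg fun l _ => mul_nonneg (hCG l) (hCk l), fun a ha b hab => ?_⟩
  have haV : ∀ l, a ∈ Vk l ∩ VG l := fun l => mem_iInter.1 ha.2 l
  refine SubRiemannian.le_of_forall_ccDist_lt hab (F := fun η => (∑ l, CG l * Ck l) * η ^ 2)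
    (by fun_prop) fun η hη hηδ' => ?_
  obtain ⟨γ, hγ, rfl, rfl⟩ := S.exists_isHorizontalCurve hη
  have hγO : ∀ t ∈ Icc (0 : ℝ) 1, γ t ∈ O := fun t ht =>
    hVO γ η η.2 (hηδ'.trans hδ0) hγ ha.1 t ht
  choose! v hv hvη using hγ.2
  have hderiv : ∀ t ∈ Icc (0 : ℝ) 1, HasDerivWithinAt
      (fun t => h (γ t) - ∑ l, G l (γ 0) * k l (γ t))
      (∑ l, (G l (γ t) - G l (γ 0)) * mderiv (k l) (γ t) (v t).1)
      (Icc 0 1) t := by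
    intro t ht
    have e1 := hasDerivWithinAt_comp_curve (hv t ht)
      ((hh.contMDiffAt (hO.mem_nhds (hγO t ht))).mdifferentiableAt (by simp))
    have e2 := fun l => (hasDerivWithinAt_comp_curve (hv t ht)
      (((hk l).contMDiffAt (hO.mem_nhds (hγO t ht))).mdifferentiableAt (by simp))).const_mul
        (G l (γ 0))
    have e3 := e1.sub (HasDerivWithinAt.fun_sum (u := Finset.univ) fun l _ => e2 l)
    refine e3.congr_deriv ?_
    rw [hd _ (hγO t ht) (v t), ← sum_sub_distrib]
    exact sum_congr rfl fun l _ => by ring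
  have h1 := (convex_Icc (0 : ℝ) 1).norm_image_sub_le_of_norm_hasDerivWithin_le hderiv
    (C := (∑ l, CG l * Ck l) * (η : ℝ) ^ 2) (fun t ht => by
      rw [sum_mul]
      refine (norm_sum_le _ _).trans (sum_le_sum fun l _ => ?_)
      have e1 := (hG' l γ η η.2 (hηδ'.trans (hδ1 l).2) hγ (haV l).2 t ht).2.1
      have e2 := (hk' l γ η η.2 (hηδ'.trans (hδ1 l).1) hγ (haV l).1 t ht).2.2 (v t) (hvη t ht)
      rw [norm_mul]
      calc _ ≤ (CG l * η) * (Ck l * η) :=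
            mul_le_mul e1 e2 (abs_nonneg _) (mul_nonneg (hCG l) η.2)
        _ = _ := by ring)
    (show (0 : ℝ) ∈ Icc 0 1 by simp) (show (1 : ℝ) ∈ Icc 0 1 by simp)
  rw [sub_zero, norm_one, mul_one] at h1
  convert h1 using 1
  rw [norm_eq_abs]
  congr 1
  simp only [mul_sub, sum_sub_distrib]
  ring

end Horizontal

/-! ### Absolutely continuous curves -/

section AbsolutelyContinuous

variable {n r : ℕ} {N : Type*} [TopologicalSpace N]
  [ChartedSpace (Euc n) N] [IsManifold (𝓡 n) ∞ N]
  [T2Space N] [SecondCountableTopology N]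

/-- Absolute continuity for a partition `t 0 ≤ t 1 ≤ …`. -/
theorem IsAbsolutelyContinuous.exists_forall_monotone {α : Type*} {d : α → α → ℝ≥0∞} {L : ℝ}
    {σ : ℝ → α} (h : IsAbsolutelyContinuous d L σ) {ε : ℝ} (hε : 0 < ε) :
    ∃ δ : ℝ, 0 < δ ∧ ∀ (m : ℕ) (t : ℕ → ℝ), Monotone t → 0 ≤ t 0 → t m ≤ L → t m - t 0 < δ →
      ∑ i ∈ Finset.range m, d (σ (t i)) (σ (t (i + 1))) < ofReal ε := by
  obtain ⟨δ, hδ, H⟩ := h ε hε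
  refine ⟨δ, hδ, fun m t ht h0 hL hlt => ?_⟩
  have := H m (fun i => t i) (fun i => t (i + 1)) (fun i => ⟨h0.trans (ht (Nat.zero_le _)),
    ht (Nat.le_succ _), (ht i.2).trans hL⟩) ?_ ?_
  · rwa [Finset.sum_range]
  · intro i j hij
    rcases lt_or_gt_of_ne hij with hij | hij
    · exact disjoint_left.2 fun x hx hx' =>
        absurd (hx.2.trans_le (ht (show (i : ℕ) + 1 ≤ j from hij)))
        hx'.1.le.not_gt
    · exact disjoint_left.2 fun x hx hx' =>
        absurd (hx'.2.trans_le (ht (show (j : ℕ) + 1 ≤ i from hij)))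
        hx.1.le.not_gt
  · rw [Fin.sum_univ_eq_sum_range (fun i => t (i + 1) - t i), sum_range_sub]
    exact hlt

theorem intervalIntegrable_sum {κ : Type*} [Fintype κ] {f : κ → ℝ → ℝ} {a b : ℝ}
    (h : ∀ l, IntervalIntegrable (f l) volume a b) :
    IntervalIntegrable (fun s => ∑ l, f l s) volume a b := by
  have := IntervalIntegrable.sum Finset.univ fun l _ => h l
  rwa [Finset.sum_fn] at this

/-- On an absolutely continuous curve the functions `k l` determine `h` by integration. -/
theorem SubRiemannian.IsHorizontalCombination.sub_eq_integral {T : SubRiemannian n r N}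
    {κ : Type*} [Fintype κ] {O : Set N} {h : N → ℝ} {k G : κ → N → ℝ}
    (hc : T.IsHorizontalCombination O h k G) {L : ℝ} {σ : ℝ → N}
    (hσ : ContinuousOn σ (Icc 0 L)) (hAC : IsAbsolutelyContinuous T.ccDist L σ)
    (hσO : ∀ t ∈ Icc 0 L, σ t ∈ O) {w : κ → ℝ → ℝ}
    (hw : ∀ l, IntervalIntegrable (w l) volume 0 L)
    (hkw : ∀ l, ∀ t ∈ Icc 0 L, k l (σ t) - k l (σ 0) = ∫ s in 0..t, w l s) {t : ℝ}
    (ht : t ∈ Icc 0 L) :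
    h (σ t) - h (σ 0) = ∫ s in 0..t, ∑ l, G l (σ s) * w l s := by
  have hL : 0 ≤ L := ht.1.trans ht.2
  have hcG : ∀ l, ContinuousOn (fun s => G l (σ s)) (Icc 0 L) := fun l =>
    (hc.smooth_coeff l).continuousOn.comp hσ hσO
  have hwi : ∀ l, ∀ a ∈ Icc 0 L, ∀ b ∈ Icc 0 L, IntervalIntegrable (w l) volume a b := by
    intro l a ha b hb
    refine (hw l).mono_set ?_
    rw [uIcc_of_le hL]
    exact uIcc_subset_Icc ha hb
  have hGwi : ∀ l, ∀ a ∈ Icc 0 L, ∀ b ∈ Icc 0 L,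
      IntervalIntegrable (fun s => G l (σ s) * w l s) volume a b := by
    intro l a ha b hb
    exact (hwi l a ha b hb).continuousOn_mul ((hcG l).mono (uIcc_subset_Icc ha hb))
  have hsum : ∀ a ∈ Icc 0 L, ∀ b ∈ Icc 0 L,
      IntervalIntegrable (fun s => ∑ l, G l (σ s) * w l s) volume a b := by
    intro a ha b hb
    exact intervalIntegrable_sum fun l => hGwi l a ha b hb
  obtain ⟨δ₁, hδ₁, hAC1⟩ := hAC.exists_forall_monotone one_pos
  have local_claim : ∀ t₀ ∈ Icc 0 L, ∃ η > 0, ∀ a ∈ Icc 0 L, ∀ b ∈ Icc 0 L, |a - t₀| < η →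
      |b - t₀| < η → a ≤ b → h (σ b) - h (σ a) = ∫ s in a..b, ∑ l, G l (σ s) * w l s := by
    intro t₀ ht₀
    obtain ⟨V, hV, δ, hδ, C, hC, hVC⟩ := hc.exists_abs_sub_sum_le (hσO t₀ ht₀)
    obtain ⟨η, hη, hηV⟩ := mem_nhdsWithin_iff.1 (hσ t₀ ht₀ hV)
    refine ⟨min η (δ₁ / 2), by positivity, fun a ha b hb hat hbt hab => ?_⟩
    have hba : b - a < δ₁ := by
      have h1 := abs_lt.1 (hat.trans_le (min_le_right _ _))
      have h2 := abs_lt.1 (hbt.trans_le (min_le_right _ _))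
      linarith
    have hσV : ∀ s ∈ Icc a b, σ s ∈ V := by
      intro s hs
      refine hηV ⟨?_, ha.1.trans hs.1, hs.2.trans hb.2⟩
      have h1 := abs_lt.1 (hat.trans_le (min_le_left _ _))
      have h2 := abs_lt.1 (hbt.trans_le (min_le_left _ _))
      rw [mem_ball, dist_eq, abs_lt]
      constructor <;> linarith [hs.1, hs.2]
    set A := ∫ s in a..b, ∑ l, |w l s| with hA
    have hwabs : ∀ c ∈ Icc 0 L, ∀ c' ∈ Icc 0 L,
        IntervalIntegrable (fun s => ∑ l, |w l s|) volume c c' := by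
      intro c hc c' hc'
      exact intervalIntegrable_sum fun l => (hwi l c hc c' hc').abs
    have main : ∀ ε : ℝ, 0 < ε → ε ≤ δ →
        |h (σ b) - h (σ a) - ∫ s in a..b, ∑ l, G l (σ s) * w l s| ≤ ε * (C + A) := by
      intro ε hε hεδ
      obtain ⟨δ₂, hδ₂, hAC2⟩ := hAC.exists_forall_monotone hε
      have hunif : ∃ δ₃ > 0, ∀ l, ∀ s ∈ Icc 0 L, ∀ s' ∈ Icc 0 L, |s - s'| < δ₃ →
          |G l (σ s) - G l (σ s')| ≤ ε := by
        have h1 : ContinuousOn (fun s => fun l => G l (σ s)) (Icc 0 L) := continuousOn_pi.2 hcG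
        obtain ⟨δ₃, hδ₃, h2⟩ := uniformContinuousOn_iff.1
          (isCompact_Icc.uniformContinuousOn_of_continuous h1) ε hε
        refine ⟨δ₃, hδ₃, fun l s hs s' hs' hss => ?_⟩
        exact (dist_le_pi_dist (fun l => G l (σ s)) (fun l => G l (σ s')) l).trans
          (h2 s hs s' hs' hss).le
      obtain ⟨δ₃, hδ₃, hG3⟩ := hunif
      obtain ⟨m, hm⟩ := exists_nat_gt ((b - a) / min δ₂ δ₃)
      have hmin : 0 < min δ₂ δ₃ := lt_min hδ₂ hδ₃
      have hm0 : (0 : ℝ) < m := (div_nonneg (by linarith) hmin.le).trans_lt hm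
      have hstep : (b - a) / m < min δ₂ δ₃ := by
        rw [div_lt_iff₀ hmin] at hm
        rw [div_lt_iff₀ hm0]
        linarith
      set u : ℕ → ℝ := fun i => a + i * ((b - a) / m) with hu
      have hs0 : 0 ≤ (b - a) / m := div_nonneg (by linarith) hm0.le
      have humono : Monotone u := by
        intro i j hij
        have : (i : ℝ) ≤ j := by exact_mod_cast hij
        simp only [hu]
        gcongr
      have hu0 : u 0 = a := by simp [hu]
      have hum : u m = b := by simp only [hu]; field_simp; ring
      have hsucc : ∀ i, u (i + 1) - u i = (b - a) / m := fun i => by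
        simp only [hu]; push_cast; ring
      have hab' : ∀ i ≤ m, u i ∈ Icc a b := fun i hi =>
        ⟨hu0 ▸ humono (Nat.zero_le i), hum ▸ humono hi⟩
      have hmem : ∀ i ≤ m, u i ∈ Icc 0 L := fun i hi =>
        ⟨ha.1.trans (hab' i hi).1, (hab' i hi).2.trans hb.2⟩
      set d : ℕ → ℝ≥0∞ := fun i => T.ccDist (σ (u i)) (σ (u (i + 1))) with hdd
      have hdsum : ∑ i ∈ Finset.range m, d i < 1 := by
        have := hAC1 m u humono (hu0 ▸ ha.1) (hum ▸ hb.2) (by rw [hum, hu0]; exact hba)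
        simpa using this
      have hdi : ∀ i < m, d i < ofReal ε := by
        intro i hi
        have h1 := hAC2 1 (fun j => u (i + j)) (fun j j' hj => humono (by omega))
          (hmem i hi.le).1 (hmem (i + 1) hi).2 (by
            have := hsucc i
            simp only [add_zero]
            rw [this]
            exact hstep.trans_le (min_le_left _ _))
        simpa using h1
      have hterm : ∀ i ∈ Finset.range m, |h (σ (u (i + 1))) - h (σ (u i)) -
          ∫ s in u i..u (i + 1), ∑ l, G l (σ s) * w l s| ≤
            C * (ε * (d i).toReal) + ε * ∫ s in u i..u (i + 1), ∑ l, |w l s| := by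
        intro i hi
        have hi := Finset.mem_range.1 hi
        have hle : u i ≤ u (i + 1) := humono (Nat.le_succ i)
        have hi1 := hmem i hi.le
        have hi2 := hmem (i + 1) hi
        have hdε := hdi i hi
        have e1 := hVC _ (hσV _ (hab' i hi.le)) (σ (u (i + 1))) (hdε.trans_le (by
          rw [← ofReal_coe_nnreal]
          exact ofReal_le_ofReal hεδ))
        have hdr : (d i).toReal ≤ ε := toReal_le_of_le_ofReal hε.le hdε.le
        have e2 : ∀ l, k l (σ (u (i + 1))) - k l (σ (u i)) = ∫ s in u i..u (i + 1), w l s := by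
          intro l
          have h1 := hkw l _ hi1
          have h2 := hkw l _ hi2
          have h0 : (0 : ℝ) ∈ Icc 0 L := ⟨le_rfl, hL⟩
          have h3 := integral_interval_sub_left (hwi l 0 h0 _ hi2)
            (hwi l 0 h0 _ hi1)
          linarith
        have e3 : |∑ l, G l (σ (u i)) * (k l (σ (u (i + 1))) - k l (σ (u i))) -
            ∫ s in u i..u (i + 1), ∑ l, G l (σ s) * w l s| ≤
            ε * ∫ s in u i..u (i + 1), ∑ l, |w l s| := by
          have h1 : ∑ l, G l (σ (u i)) * (k l (σ (u (i + 1))) - k l (σ (u i))) =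
              ∫ s in u i..u (i + 1), ∑ l, G l (σ (u i)) * w l s := by
            rw [intervalIntegral.integral_finsetSum fun l _ => (hwi l _ hi1 _ hi2).const_mul _]
            exact sum_congr rfl fun l _ => by
              rw [e2, intervalIntegral.integral_const_mul]
          have h2 : IntervalIntegrable (fun s => ∑ l, G l (σ (u i)) * w l s) volume
              (u i) (u (i + 1)) := by
            exact intervalIntegrable_sum fun l => (hwi l _ hi1 _ hi2).const_mul _
          rw [h1, ← intervalIntegral.integral_sub h2 (hsum _ hi1 _ hi2),
            ← intervalIntegral.integral_const_mul, ← norm_eq_abs]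
          refine intervalIntegral.norm_integral_le_of_norm_le hle
            (ae_of_all _ fun s hs => ?_) ((hwabs _ hi1 _ hi2).const_mul ε)
          rw [← sum_sub_distrib, mul_sum]
          refine (norm_sum_le _ _).trans (sum_le_sum fun l _ => ?_)
          rw [← sub_mul, norm_mul]
          refine mul_le_mul_of_nonneg_right (hG3 l _ hi1 s ⟨hi1.1.trans hs.1.le,
            hs.2.trans hi2.2⟩ ?_) (abs_nonneg _)
          rw [abs_sub_comm, abs_of_nonneg (by linarith [hs.1])]
          have := hsucc i
          have := hstep.trans_le (min_le_right _ _)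
          linarith [hs.2]
        have e4 : C * (d i).toReal ^ 2 ≤ C * (ε * (d i).toReal) := by
          rw [sq]
          gcongr
        calc _ = |(h (σ (u (i + 1))) - h (σ (u i)) -
              ∑ l, G l (σ (u i)) * (k l (σ (u (i + 1))) - k l (σ (u i)))) +
              (∑ l, G l (σ (u i)) * (k l (σ (u (i + 1))) - k l (σ (u i))) -
                ∫ s in u i..u (i + 1), ∑ l, G l (σ s) * w l s)| := by
              congr 1; ring
          _ ≤ _ := (abs_add_le _ _).trans (add_le_add (e1.trans e4) e3)
      have t1 : h (σ b) - h (σ a) = ∑ i ∈ Finset.range m, (h (σ (u (i + 1))) - h (σ (u i))) := by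
        rw [sum_range_sub (fun i => h (σ (u i))), hum, hu0]
      have t2 : ∫ s in a..b, ∑ l, G l (σ s) * w l s = ∑ i ∈ Finset.range m,
          ∫ s in u i..u (i + 1), ∑ l, G l (σ s) * w l s := by
        rw [intervalIntegral.sum_integral_adjacent_intervals fun i hi =>
          hsum _ (hmem i hi.le) _ (hmem (i + 1) hi), hum, hu0]
      have t3 : A = ∑ i ∈ Finset.range m, ∫ s in u i..u (i + 1), ∑ l, |w l s| := by
        rw [intervalIntegral.sum_integral_adjacent_intervals fun i hi =>
          hwabs _ (hmem i hi.le) _ (hmem (i + 1) hi), hum, hu0]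
      have t4 : ∑ i ∈ Finset.range m, (d i).toReal ≤ 1 := by
        rw [← ENNReal.toReal_sum fun i hi => ((hdi i (Finset.mem_range.1 hi)).trans
          ofReal_lt_top).ne]
        exact toReal_le_of_le_ofReal zero_le_one (by simpa using hdsum.le)
      rw [t1, t2, ← sum_sub_distrib]
      refine (Finset.abs_sum_le_sum_abs _ _).trans ((sum_le_sum hterm).trans ?_)
      rw [Finset.sum_add_distrib, ← mul_sum, ← mul_sum, ← mul_sum, ← t3]
      have : C * (ε * ∑ i ∈ Finset.range m, (d i).toReal) ≤ C * (ε * 1) := by gcongr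
      linarith
    have hlim : |h (σ b) - h (σ a) - ∫ s in a..b, ∑ l, G l (σ s) * w l s| ≤ 0 := by
      refine ge_of_tendsto (x := 𝓝[>] (0 : ℝ)) (f := fun ε : ℝ => ε * (C + A)) ?_ ?_
      · have : Continuous fun ε : ℝ => ε * (C + A) := by fun_prop
        simpa using (this.tendsto 0).mono_left nhdsWithin_le_nhds
      · filter_upwards [Ioc_mem_nhdsGT (show (0 : ℝ) < δ from hδ)] with ε hε using
          main ε hε.1 hε.2
    have := abs_nonpos_iff.1 hlim
    linarith
  set Ψ : ℝ → ℝ := fun t => h (σ t) - ∫ s in 0..t, ∑ l, G l (σ s) * w l s with hΨ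
  have h0 : (0 : ℝ) ∈ Icc 0 L := ⟨le_rfl, hL⟩
  have hΨd : ∀ t₀ ∈ Icc 0 L, HasDerivWithinAt Ψ 0 (Icc 0 L) t₀ := by
    intro t₀ ht₀
    obtain ⟨η, hη, H⟩ := local_claim t₀ ht₀
    refine (hasDerivWithinAt_const t₀ (Icc 0 L) (Ψ t₀)).congr_of_eventuallyEq_of_mem ?_ ht₀
    filter_upwards [self_mem_nhdsWithin,
      mem_nhdsWithin_of_mem_nhds (ball_mem_nhds t₀ hη)] with s hs hs'
    have hs' : |s - t₀| < η := hs'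
    have hΨab : ∀ a ∈ Icc 0 L, ∀ b ∈ Icc 0 L,
        h (σ b) - h (σ a) = ∫ s in a..b, ∑ l, G l (σ s) * w l s → Ψ b = Ψ a := by
      intro a ha b hb hab
      have := integral_interval_sub_left (hsum 0 h0 b hb) (hsum 0 h0 a ha)
      simp only [hΨ]
      linarith
    rcases le_total s t₀ with hst | hst
    · exact (hΨab s hs t₀ ht₀ (H s hs t₀ ht₀ hs' (by simpa using hη) hst)).symm
    · exact hΨab t₀ ht₀ s hs (H t₀ ht₀ s hs (by simpa using hη) hs' hst)
  have hconst := constant_of_derivWithin_zero (fun t ht => (hΨd t ht).differentiableWithinAt)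
    (fun t ht => (hΨd t ⟨ht.1, ht.2.le⟩).derivWithin
      (uniqueDiffOn_Icc (ht.1.trans_lt ht.2) t ⟨ht.1, ht.2.le⟩)) t ht
  simp only [hΨ, integral_same] at hconst
  linarith

end AbsolutelyContinuous

/-! ### Integral curves of orthonormal frames -/

section ArcLength

variable {n r : ℕ} {M : Type*} [TopologicalSpace M]
  [ChartedSpace (Euc n) M] [IsManifold (𝓡 n) ∞ M]
  (S : SubRiemannian n r M) {U : Set M} {X : Fin r → ∀ q : M, S.H q}

/-- The expansion of a horizontal vector in an orthonormal frame. -/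
theorem SubRiemannian.IsOrthonormalFrame.exists_sum_eq {S : SubRiemannian n r M}
    {X : Fin r → ∀ q : M, S.H q} (hX : S.IsOrthonormalFrame U X) {q : M} (hq : q ∈ U)
    (v : S.H q) : ∃ c : Fin r → ℝ, ∑ i, c i • X i q = v ∧ S.g q v v = ∑ i, c i ^ 2 := by
  obtain ⟨c, hc⟩ := (Submodule.mem_span_range_iff_exists_fun ℝ).1
    ((hX.1.2 q hq).2 ▸ Submodule.mem_top : v ∈ Submodule.span ℝ (range fun i => X i q))
  refine ⟨c, hc, ?_⟩
  rw [← hc]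
  simp only [map_sum, LinearMap.sum_apply, map_smul, LinearMap.smul_apply, smul_eq_mul,
    hX.2 q hq, mul_ite, mul_one, mul_zero, Finset.sum_ite_eq, Finset.mem_univ, if_true,
    Finset.sum_ite_eq']
  exact sum_congr rfl fun i _ => (sq _).symm

theorem SubRiemannian.mderiv_sum {S : SubRiemannian n r M} {X : Fin r → ∀ q : M, S.H q}
    (h : M → ℝ) {q : M} (c : Fin r → ℝ) {v : S.H q} (hc : ∑ i, c i • X i q = v) :
    mderiv h q v.1 =
      ∑ i, c i * mderiv h q (X i q).1 := by
  rw [← hc]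
  exact mderiv_sum_smul h c fun i => X i q

/-- Near each point there is a smooth function whose differential at that point is the `i`-th
member of the coframe. -/
theorem SubRiemannian.IsOrthonormalFrame.exists_dual {S : SubRiemannian n r M}
    {X : Fin r → ∀ q : M, S.H q} (hX : S.IsOrthonormalFrame U X) {p : M} (hp : p ∈ U)
    (i : Fin r) : ∃ O : Set M, IsOpen O ∧ p ∈ O ∧ ∃ h : M → ℝ,
      ContMDiffOn (𝓡 n) 𝓘(ℝ, ℝ) ∞ h O ∧
        ∀ j, mderiv h p (X j p).1 = if j = i then 1 else 0 := by
  set e := chartAt (Euc n) p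
  have he : e ∈ IsManifold.maximalAtlas (𝓡 n) ∞ M := IsManifold.chart_mem_maximalAtlas p
  have hpe : p ∈ e.source := mem_chart_source _ p
  have hm := mdifferentiable_of_mem_maximalAtlas he
  set A : Euc n →L[ℝ] Euc n := mderiv e p with hA
  set B : Euc n →L[ℝ] Euc n := mfderiv (𝓡 n) (𝓡 n) e.symm (e p) with hB
  have hBA : ∀ v, B (A v) = v := fun v =>
    congrArg (fun T : Euc n →L[ℝ] Euc n => T v) (hm.symm_comp_deriv hpe)
  set w : Fin r → Euc n := fun j => A (X j p).1 with hw
  have hwi : LinearIndependent ℝ w := by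
    have h1 := (hX.1.2 p hp).1.map' (S.H p).subtype (Submodule.ker_subtype _)
    have h2 : LinearIndependent ℝ fun j => ((X j p).1 : Euc n) := h1
    exact h2.map' (A : Euc n →ₗ[ℝ] Euc n) (LinearMap.ker_eq_bot.2
      (Function.LeftInverse.injective hBA))
  obtain ⟨l, hl⟩ := LinearMap.exists_extend
    ((Finsupp.lapply i : (Fin r →₀ ℝ) →ₗ[ℝ] ℝ).comp hwi.repr)
  have hlw : ∀ j, l (w j) = if j = i then (1 : ℝ) else 0 := by
    intro j
    have h1 := LinearMap.congr_fun hl ⟨w j, Submodule.subset_span ⟨j, rfl⟩⟩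
    simp only [LinearMap.comp_apply, Submodule.subtype_apply, LinearEquiv.coe_coe] at h1
    rw [h1, hwi.repr_eq_single j _ rfl]
    simp [Finsupp.single_apply]
  set l' : Euc n →L[ℝ] ℝ := LinearMap.toContinuousLinearMap l
  refine ⟨e.source, e.open_source, hpe, fun q => l' (e q),
    l'.contDiff.contMDiff.comp_contMDiffOn (contMDiffOn_of_mem_maximalAtlas he), fun j => ?_⟩
  rw [← hlw j]
  have h1 := mfderiv_comp (I' := 𝓡 n) (I'' := 𝓘(ℝ, ℝ)) p
    (l'.contDiff.contMDiff.mdifferentiableAt (n := 1) one_ne_zero) (hm.mdifferentiableAt hpe)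
  have h2 : mderiv (fun q => l' (e q)) p = l'.comp A := by
    refine h1.trans ?_
    rw [mfderiv_eq_fderiv, l'.fderiv]
    rfl
  rw [h2]
  rfl

theorem ccDist_le_of_integralCurve (hX : S.IsOrthonormalFrame U X) (i : Fin r) {L : ℝ}
    {γ : ℝ → M} (hγs : ContMDiffOn 𝓘(ℝ, ℝ) (𝓡 n) ∞ γ (Icc 0 L))
    (hγ : ∀ t ∈ Icc 0 L, HasMFDerivAt 𝓘(ℝ, ℝ) (𝓡 n) γ t
      ((1 : ℝ →L[ℝ] ℝ).smulRight (X i (γ t)).1))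
    (hγU : ∀ t ∈ Icc 0 L, γ t ∈ U) {s t : ℝ} (hs : 0 ≤ s) (hst : s ≤ t) (ht : t ≤ L) :
    S.ccDist (γ s) (γ t) ≤ ofReal (t - s) := by
  have hmaps : ∀ τ ∈ Icc (0 : ℝ) 1, s + (t - s) * τ ∈ Icc 0 L := by
    intro τ hτ
    have h1 : 0 ≤ (t - s) * τ := mul_nonneg (by linarith) hτ.1
    have h2 : (t - s) * τ ≤ t - s := mul_le_of_le_one_right (by linarith) hτ.2
    constructor <;> linarith
  have hcurve : S.IsHorizontalCurve (t - s).toNNReal fun τ => γ (s + (t - s) * τ) := by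
    refine ⟨hγs.comp (ContDiff.contMDiff (by fun_prop)).contMDiffOn hmaps, fun τ hτ =>
      ⟨(t - s) • X i (γ (s + (t - s) * τ)), ?_, ?_⟩⟩
    · have h1 : HasDerivAt (fun τ => s + (t - s) * τ) (t - s) τ := by
        simpa using ((hasDerivAt_id τ).const_mul (t - s)).const_add s
      have h2 := (hγ _ (hmaps τ hτ)).comp τ h1.hasFDerivAt.hasMFDerivAt
      refine (h2.congr_mfderiv ?_).hasMFDerivWithinAt
      change (((1 : ℝ →L[ℝ] ℝ).smulRight ((X i (γ (s + (t - s) * τ)) :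
        TangentSpace (𝓡 n) (γ (s + (t - s) * τ))) : Euc n)).comp
          (ContinuousLinearMap.toSpanSingleton ℝ (t - s))) = (1 : ℝ →L[ℝ] ℝ).smulRight ((t - s) •
            ((X i (γ (s + (t - s) * τ)) : TangentSpace (𝓡 n) (γ (s + (t - s) * τ))) : Euc n))
      ext
      simp
    · rw [Real.coe_toNNReal _ (by linarith)]
      simp [hX.2 _ (hγU _ (hmaps τ hτ)), sq]
  have := S.ccDist_le_of_isHorizontalCurve hcurve
  simpa [ofReal] using this

variable [T2Space M] [SecondCountableTopology M]

theorem exists_le_ccDist_of_integralCurve (hU : IsOpen U) (hX : S.IsOrthonormalFrame U X)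
    (i : Fin r) {L : ℝ} {γ : ℝ → M}
    (hγ : ∀ t ∈ Icc 0 L, HasMFDerivAt 𝓘(ℝ, ℝ) (𝓡 n) γ t
      ((1 : ℝ →L[ℝ] ℝ).smulRight (X i (γ t)).1))
    (hγU : ∀ t ∈ Icc 0 L, γ t ∈ U) {κ : ℝ} (hκ0 : 0 < κ) (hκ : κ < 1) {t₀ : ℝ}
    (ht₀ : t₀ ∈ Icc 0 L) : ∃ ρ > 0, ∀ s ∈ Icc 0 L, ∀ t ∈ Icc 0 L, |s - t₀| < ρ → |t - t₀| < ρ →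
      s ≤ t → ofReal (κ * (t - s)) ≤ S.ccDist (γ s) (γ t) := by
  obtain ⟨O, hO, hpO, h, hh, hdual⟩ := hX.exists_dual (hγU t₀ ht₀) i
  set ε := (1 - κ) / (1 + κ) with hε
  have hε0 : 0 < ε := div_pos (by linarith) (by linarith)
  have hκε : κ * (1 + ε) = 1 - ε := by rw [hε]; field_simp; ring
  have hcont : ∀ j, ContinuousAt (fun q => mderiv h q (X j q).1) (γ t₀) :=
    fun j => (((hX.1.1 j).mono (V := U ∩ O) inter_subset_left).contMDiffOn_mderiv (hU.inter hO)
      (hh.mono inter_subset_right)).continuousOn.continuousAt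
      ((hU.inter hO).mem_nhds ⟨hγU t₀ ht₀, hpO⟩)
  have hev1 : ∀ᶠ q in 𝓝 (γ t₀), 1 - ε < mderiv h q (X i q).1 := by
    refine continuousAt_const.eventually_lt (hcont i) ?_
    rw [hdual]
    simpa using hε0
  have hev2 : ∀ᶠ q in 𝓝 (γ t₀),
      ∑ j, mderiv h q (X j q).1 ^ 2 < (1 + ε) ^ 2 := by
    refine ContinuousAt.eventually_lt (tendsto_finsetSum _ fun j _ => (hcont j).pow 2)
      continuousAt_const ?_
    simp only [hdual, ite_pow, one_pow, ne_eq, OfNat.ofNat_ne_zero, not_false_eq_true, zero_pow,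
      Finset.sum_ite_eq', Finset.mem_univ, if_true]
    nlinarith
  obtain ⟨O', hO'sub, hO', hpO'⟩ := eventually_nhds_iff.1
    (((hU.inter hO).eventually_mem ⟨hγU t₀ ht₀, hpO⟩).and (hev1.and hev2))
  obtain ⟨V, hV, δ, hδ, hVδ⟩ := S.exists_nhds_forall_mem hO' hpO'
  have hγc : ContinuousAt γ t₀ := (hγ t₀ ht₀).continuousAt
  obtain ⟨ρ, hρ, hρV⟩ := Metric.mem_nhds_iff.1
    (hγc (inter_mem hV (hO'.mem_nhds hpO')))
  refine ⟨min ρ (δ / 2), by positivity, fun s hs t ht hst₀ htt₀ hst => ?_⟩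
  have hs1 := abs_lt.1 (hst₀.trans_le (min_le_left _ _))
  have ht1 := abs_lt.1 (htt₀.trans_le (min_le_left _ _))
  have hs2 := abs_lt.1 (hst₀.trans_le (min_le_right _ _))
  have ht2 := abs_lt.1 (htt₀.trans_le (min_le_right _ _))
  have hmem : ∀ τ ∈ Icc s t, τ ∈ Icc 0 L ∧ γ τ ∈ V ∩ O' := fun τ hτ =>
    ⟨⟨hs.1.trans hτ.1, hτ.2.trans ht.2⟩, hρV (by
      rw [mem_ball, dist_eq, abs_lt]
      constructor <;> linarith [hτ.1, hτ.2])⟩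
  have hdiff : ∀ q ∈ O', MDifferentiableAt (𝓡 n) 𝓘(ℝ, ℝ) h q := fun q hq =>
    (hh.contMDiffAt (hO.mem_nhds (hO'sub q hq).1.2)).mdifferentiableAt (by simp)
  have hlow : (1 - ε) * (t - s) ≤ h (γ t) - h (γ s) := by
    have hder : ∀ τ ∈ Icc s t, HasDerivAt (h ∘ γ)
        (mderiv h (γ τ) (X i (γ τ)).1) τ := fun τ hτ =>
      hasDerivAt_comp_curve (hγ τ (hmem τ hτ).1) (hdiff _ (hmem τ hτ).2.2)
    refine (convex_Icc s t).mul_sub_le_image_sub_of_le_deriv (f := h ∘ γ)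
      (fun τ hτ => (hder τ hτ).continuousAt.continuousWithinAt)
      (fun τ hτ => (hder τ (interior_subset hτ)).differentiableAt.differentiableWithinAt)
      (fun τ hτ => ?_) s (left_mem_Icc.2 hst) t (right_mem_Icc.2 hst) hst
    rw [(hder τ (interior_subset hτ)).deriv]
    exact (hO'sub _ (hmem τ (interior_subset hτ)).2.2).2.1.le
  by_contra! hcon
  obtain ⟨η, hη1, hη2⟩ := ENNReal.lt_iff_exists_nnreal_btwn.1 hcon
  have hη : (η : ℝ) < κ * (t - s) := by
    rw [← ofReal_coe_nnreal] at hη2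
    exact (ENNReal.ofReal_lt_ofReal_iff_of_nonneg η.2).1 hη2
  have hηδ : (η : ℝ) ≤ δ := by
    have : κ * (t - s) ≤ t - s := mul_le_of_le_one_left (by linarith) hκ.le
    linarith
  obtain ⟨c, hc, hc0, hc1⟩ := S.exists_isHorizontalCurve hη1
  have hcO : ∀ τ ∈ Icc (0 : ℝ) 1, c τ ∈ O' := fun τ hτ =>
    hVδ c η η.2 hηδ hc (hc0 ▸ (hmem s (left_mem_Icc.2 hst)).2.1) τ hτ
  choose! v hv hvη using hc.2
  have hup := (convex_Icc (0 : ℝ) 1).norm_image_sub_le_of_norm_hasDerivWithin_le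
    (C := (1 + ε) * η)
    (fun τ hτ => hasDerivWithinAt_comp_curve (hv τ hτ) (hdiff _ (hcO τ hτ)))
    (fun τ hτ => by
      obtain ⟨hq, -, hq2⟩ := hO'sub _ (hcO τ hτ)
      obtain ⟨a, ha, hag⟩ := hX.exists_sum_eq hq.1 (v τ)
      rw [SubRiemannian.mderiv_sum h a ha, norm_eq_abs]
      refine abs_le_of_sq_le_sq ?_ (by positivity)
      refine (Finset.sum_mul_sq_le_sq_mul_sq _ _ _).trans ?_
      rw [← hag, mul_pow, mul_comm]
      refine mul_le_mul hq2.le (hvη τ hτ) ?_ (by positivity)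
      rw [hag]
      positivity)
    (show (0 : ℝ) ∈ Icc 0 1 by simp) (show (1 : ℝ) ∈ Icc 0 1 by simp)
  simp only [Function.comp_apply, hc0, hc1, sub_zero, norm_one, mul_one] at hup
  have h1 := (le_abs_self _).trans hup
  have h2 : (1 + ε) * (η : ℝ) < (1 + ε) * (κ * (t - s)) := by gcongr
  have h3 : (1 + ε) * (κ * (t - s)) = (1 - ε) * (t - s) := by rw [← hκε]; ring
  linarith

/-- The integral curves of the members of an orthonormal frame are parametrized by arc length. -/
theorem isArcLengthCurve_of_integralCurve (hU : IsOpen U) (hX : S.IsOrthonormalFrame U X)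
    (i : Fin r) {L : ℝ} (hL : 0 < L) {γ : ℝ → M}
    (hγs : ContMDiffOn 𝓘(ℝ, ℝ) (𝓡 n) ∞ γ (Icc 0 L))
    (hγ : ∀ t ∈ Icc 0 L, HasMFDerivAt 𝓘(ℝ, ℝ) (𝓡 n) γ t
      ((1 : ℝ →L[ℝ] ℝ).smulRight (X i (γ t)).1))
    (hγU : ∀ t ∈ Icc 0 L, γ t ∈ U) : IsArcLengthCurve S.ccDist L γ := by
  refine ⟨hL, fun a b ha hab hb => le_antisymm ?_ ?_⟩
  · refine iSup_le fun m => iSup_le fun t => iSup_le fun ht => ?_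
    calc ∑ i ∈ Finset.range m, S.ccDist (γ (t i)) (γ (t (i + 1)))
        ≤ ∑ i ∈ Finset.range m, ofReal (t (i + 1) - t i) :=
          sum_le_sum fun j _ => ccDist_le_of_integralCurve S hX i hγs hγ hγU
            (ha.trans (ht.2 j).1) (ht.1 (Nat.le_succ j)) ((ht.2 (j + 1)).2.trans hb)
      _ = ofReal (t m - t 0) := by
          rw [← ENNReal.ofReal_sum_of_nonneg fun j _ => sub_nonneg.2 (ht.1 (Nat.le_succ j)),
            sum_range_sub]
      _ ≤ ofReal (b - a) :=
          ofReal_le_ofReal (sub_le_sub (ht.2 m).2 (ht.2 0).1)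
  · have key : ∀ κ : ℝ, 0 < κ → κ < 1 →
        ofReal (κ * (b - a)) ≤ curveLength S.ccDist γ a b := by
      intro κ hκ0 hκ
      choose! ρ hρ H using fun t₀ ht₀ =>
        exists_le_ccDist_of_integralCurve S hU hX i hγ hγU hκ0 hκ (t₀ := t₀) ht₀
      obtain ⟨δ, hδ, hleb⟩ := lebesgue_number_lemma_of_metric (ι := Icc 0 L)
        (c := fun t₀ => ball (t₀ : ℝ) (ρ t₀)) (isCompact_Icc (a := (0 : ℝ)) (b := L))
        (fun _ => isOpen_ball)
        (fun t ht => mem_iUnion.2 ⟨⟨t, ht⟩, mem_ball_self (hρ t ht)⟩)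
      obtain ⟨m, hm⟩ := exists_nat_gt ((b - a) / δ)
      have hm0 : (0 : ℝ) < m := (div_nonneg (by linarith) hδ.le).trans_lt hm
      have hstep : (b - a) / m < δ := by
        rw [div_lt_iff₀ hδ] at hm
        rw [div_lt_iff₀ hm0]
        linarith
      have hs0 : 0 ≤ (b - a) / m := div_nonneg (by linarith) hm0.le
      -- the partition stays at `b` after `m` steps
      set u : ℕ → ℝ := fun j => a + (min j m : ℕ) * ((b - a) / m) with hu
      have humono : Monotone u := by
        intro j j' hjj
        have : ((min j m : ℕ) : ℝ) ≤ (min j' m : ℕ) := by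
          exact_mod_cast min_le_min_right m hjj
        simp only [hu]
        gcongr
      have hu0 : u 0 = a := by simp [hu]
      have hum : u m = b := by simp only [hu, min_self]; field_simp; ring
      have humem : ∀ j, u j ∈ Icc a b := by
        intro j
        refine ⟨hu0 ▸ humono (Nat.zero_le j), ?_⟩
        rw [← hum]
        rcases le_total j m with hj | hj
        · exact humono hj
        · simp [hu, hj]
      refine le_trans ?_ (le_iSup_of_le m (le_iSup_of_le u (le_iSup_of_le ⟨humono, humem⟩ le_rfl)))
      have hsucc : ∀ j < m, u (j + 1) - u j = (b - a) / m := by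
        intro j hj
        simp only [hu, min_eq_left hj.le, min_eq_left (show j + 1 ≤ m from hj)]
        push_cast
        ring
      calc ofReal (κ * (b - a))
          = ∑ j ∈ Finset.range m, ofReal (κ * (u (j + 1) - u j)) := by
            rw [← ENNReal.ofReal_sum_of_nonneg fun j _ => mul_nonneg hκ0.le
              (sub_nonneg.2 (humono (Nat.le_succ j))), ← mul_sum, sum_range_sub,
              hum, hu0]
        _ ≤ ∑ j ∈ Finset.range m, S.ccDist (γ (u j)) (γ (u (j + 1))) := by
            refine sum_le_sum fun j hj => ?_
            have hmem : ∀ j, u j ∈ Icc 0 L := fun j =>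
              ⟨ha.trans (humem j).1, (humem j).2.trans hb⟩
            obtain ⟨⟨t₀, ht₀⟩, hball⟩ := hleb (u j) (hmem j)
            have h1 := hball (mem_ball_self hδ)
            have h2 := hball (show u (j + 1) ∈ ball (u j) δ by
              rw [mem_ball, dist_eq, hsucc j (Finset.mem_range.1 hj),
                abs_of_nonneg hs0]
              exact hstep)
            exact H t₀ ht₀ _ (hmem j) _ (hmem _) h1 h2 (humono (Nat.le_succ j))
    refine le_of_tendsto (x := 𝓝[<] (1 : ℝ)) (f := fun κ : ℝ => ofReal (κ * (b - a))) ?_ ?_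
    · have : Continuous fun κ : ℝ => ofReal (κ * (b - a)) :=
        ENNReal.continuous_ofReal.comp (by fun_prop)
      simpa using (this.tendsto 1).mono_left nhdsWithin_le_nhds
    · filter_upwards [Ioo_mem_nhdsLT (show (0 : ℝ) < 1 by norm_num)] with κ hκ using
        key κ hκ.1 hκ.2

end ArcLength

/-! ### Horizontal coordinates -/

section HorizontalCoordinates

theorem contDiff_det {κ : Type*} [Fintype κ] [DecidableEq κ] {E : Type*} [NormedAddCommGroup E]
    [NormedSpace ℝ E] {A : E → Matrix κ κ ℝ} (hA : ∀ i j, ContDiff ℝ ∞ fun x => A x i j) :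
    ContDiff ℝ ∞ fun x => (A x).det := by
  simp only [Matrix.det_apply']
  exact ContDiff.sum fun σ _ => contDiff_const.mul (contDiff_prod fun i _ => hA _ _)

theorem contDiffOn_matrix_inv {κ : Type*} [Fintype κ] [DecidableEq κ] (i j : κ) :
    ContDiffOn ℝ ∞ (fun A : κ → κ → ℝ => (Matrix.of A)⁻¹ i j) {A | IsUnit (Matrix.of A)} := by
  have hent : ∀ i j, ContDiff ℝ ∞ fun A : κ → κ → ℝ => A i j := fun i j => by fun_prop
  have h1 : ContDiff ℝ ∞ fun A : κ → κ → ℝ => (Matrix.of A).det := contDiff_det fun i j => hent i j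
  have h2 : ContDiff ℝ ∞ fun A : κ → κ → ℝ => (Matrix.of A).adjugate i j := by
    simp only [Matrix.adjugate_apply]
    refine contDiff_det fun a c => ?_
    simp only [Matrix.updateRow_apply, Matrix.of_apply]
    split_ifs
    · exact contDiff_const
    · exact hent a c
  refine (ContDiffOn.mul (h1.contDiffOn.inv fun A hA => ?_) h2.contDiffOn).congr fun A hA => ?_
  · exact ((Matrix.isUnit_iff_isUnit_det _).1 hA).ne_zero
  · rw [Matrix.inv_def, Ring.inverse_eq_inv', Matrix.smul_apply, smul_eq_mul]
    rfl

variable {n r : ℕ} {N : Type*} [TopologicalSpace N]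
  [ChartedSpace (Euc n) N] [IsManifold (𝓡 n) ∞ N] [Nonempty N]

theorem contMDiffOn_coord {y : OpenPartialHomeomorph N (Euc n)}
    (hy : y ∈ IsManifold.maximalAtlas (𝓡 n) ∞ N) (j : Fin n) :
    ContMDiffOn (𝓡 n) 𝓘(ℝ, ℝ) ∞ (fun q => y q j) y.source :=
  ((EuclideanSpace.proj (𝕜 := ℝ) j).contDiff.contMDiff).comp_contMDiffOn
    (contMDiffOn_of_mem_maximalAtlas hy)

/-- In horizontal coordinates the differentials of all coordinates are, on horizontal vectors,
combinations with smooth coefficients of those of the first `r`. -/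
theorem SubRiemannian.IsHorizontalCoordinates.exists_coeff {T : SubRiemannian n r N}
    {y : OpenPartialHomeomorph N (Euc n)}
    (hy : y ∈ IsManifold.maximalAtlas (𝓡 n) ∞ N) {X : Fin r → ∀ q : N, T.H q}
    (hX : T.IsHorizontalCoordinates y X) :
    ∃ G : Fin n → Fin r → N → ℝ,
      ∀ j, T.IsHorizontalCombination y.source (fun q => y q j)
        (fun l q => y q (Fin.castLE T.rank_le l)) (G j) := by
  set D : Fin r → Fin n → N → ℝ := fun i j q =>
    mderiv (fun q => y q j) q (X i q).1 with hD
  have hDs : ∀ i j, ContMDiffOn (𝓡 n) 𝓘(ℝ, ℝ) ∞ (D i j) y.source := fun i j =>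
    (hX.1.1 i).contMDiffOn_mderiv y.open_source (contMDiffOn_coord hy j)
  set A : N → Matrix (Fin r) (Fin r) ℝ := fun q =>
    Matrix.of fun i j => D i (Fin.castLE T.rank_le j) q with hA
  have hAu : ∀ q ∈ y.source, IsUnit (A q) := hX.2
  refine ⟨fun j l q => ∑ i, (A q)⁻¹ l i * D i j q, fun j => ⟨y.open_source, contMDiffOn_coord hy j,
    fun l => contMDiffOn_coord hy _, fun l => ?_, fun q hq v => ?_⟩⟩
  · refine contMDiffOn_finsetSum fun i _ => ContMDiffOn.mul ?_ (hDs i j)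
    have h1 : ContMDiffOn (𝓡 n) 𝓘(ℝ, Fin r → Fin r → ℝ) ∞
        (fun q => fun i j => D i (Fin.castLE T.rank_le j) q) y.source :=
      contMDiffOn_pi_space.2 fun i => contMDiffOn_pi_space.2 fun j => hDs i _
    exact (contDiffOn_matrix_inv l i).contMDiffOn.comp h1 hAu
  · obtain ⟨c, hc⟩ := (Submodule.mem_span_range_iff_exists_fun ℝ).1
      ((hX.1.2 q hq).2 ▸ Submodule.mem_top : v ∈ Submodule.span ℝ (range fun i => X i q))
    have h1 : ∀ j, mderiv (fun q => y q j) q v.1 = ∑ i, c i * D i j q :=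
      fun j => SubRiemannian.mderiv_sum _ c hc
    have h2 : ∀ l : Fin r, mderiv (fun q => y q (Fin.castLE T.rank_le l)) q
        v.1 = Matrix.vecMul c (A q) l := fun l => by
      rw [h1]
      simp [Matrix.vecMul, dotProduct, hA]
    have h3 : ∑ l, (∑ i, (A q)⁻¹ l i * D i j q) * Matrix.vecMul c (A q) l =
        ∑ i, Matrix.vecMul (Matrix.vecMul c (A q)) (A q)⁻¹ i * D i j q := by
      simp only [sum_mul]
      rw [sum_comm]
      refine sum_congr rfl fun i _ => ?_
      rw [Matrix.vecMul, dotProduct, sum_mul]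
      exact sum_congr rfl fun l _ => by ring
    simp only [h2]
    rw [h3, Matrix.vecMul_vecMul, Matrix.mul_nonsing_inv _ ((Matrix.isUnit_iff_isUnit_det _).1
      (hAu q hq)), Matrix.vecMul_one, h1]

end HorizontalCoordinates

/-! ### Smooth volumes in charts -/

section ChartDensity

variable {m : ℕ} {M : Type*} [TopologicalSpace M]
  [ChartedSpace (Euc m) M] [MeasurableSpace M] [BorelSpace M]
  {μ : Measure M} {e : OpenPartialHomeomorph M (Euc m)}
  {dens : Euc m → ℝ}

/-- The volume `μ` has the smooth positive density `dens` in the chart `e`. -/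
structure IsChartDensity (μ : Measure M) (e : OpenPartialHomeomorph M (Euc m))
    (dens : Euc m → ℝ) : Prop where
  contDiffOn : ContDiffOn ℝ ∞ dens e.target
  pos : ∀ x ∈ e.target, 0 < dens x
  map_eq : (μ.restrict e.source).map e =
    (volume.restrict e.target).withDensity fun x => ofReal (dens x)

namespace IsChartDensity

variable (h : IsChartDensity μ e dens)
include h

theorem aemeasurable : AEMeasurable (fun x => ofReal (dens x))
    (volume.restrict e.target) :=
  (h.contDiffOn.continuousOn.aemeasurable e.open_target.measurableSet).ennreal_ofReal

omit h in
theorem aemeasurable_chart : AEMeasurable e (μ.restrict e.source) :=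
  e.continuousOn.aemeasurable e.open_source.measurableSet

omit h [ChartedSpace (Euc m) M] in
theorem aemeasurable_symm : AEMeasurable e.symm (volume.restrict e.target) :=
  e.continuousOn_symm.aemeasurable e.open_target.measurableSet

theorem aemeasurable_symm' : AEMeasurable e.symm
    ((volume.restrict e.target).withDensity fun x => ofReal (dens x)) :=
  aemeasurable_symm.mono_ac (withDensity_absolutelyContinuous _ _)

theorem map_symm : ((volume.restrict e.target).withDensity
    fun x => ofReal (dens x)).map e.symm = μ.restrict e.source := by
  have h1 := h.aemeasurable_symm'
  rw [← h.map_eq] at h1 ⊢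
  rw [AEMeasurable.map_map_of_aemeasurable h1 aemeasurable_chart]
  have : (e.symm ∘ e) =ᵐ[μ.restrict e.source] id := by
    filter_upwards [ae_restrict_mem e.open_source.measurableSet] with q hq using e.left_inv hq
  rw [Measure.map_congr this, Measure.map_id]

theorem integral_eq {u : M → ℝ} (hu : AEStronglyMeasurable u (μ.restrict e.source)) :
    ∫ q in e.source, u q ∂μ = ∫ x in e.target, dens x * u (e.symm x) := by
  rw [← h.map_symm] at hu ⊢
  rw [integral_map h.aemeasurable_symm' hu, integral_withDensity_eq_integral_toReal_smul₀
    h.aemeasurable (ae_of_all _ fun x => ofReal_lt_top)]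
  refine setIntegral_congr_fun e.open_target.measurableSet fun x hx => ?_
  simp [toReal_ofReal (h.pos x hx).le]

omit h in
theorem withDensity_le_of_le {K : Set (Euc m)} (hK : MeasurableSet K) {c : ℝ≥0} {f g : Euc m → ℝ≥0∞}
    (hfg : ∀ x ∈ K, f x ≤ c * g x) :
    (volume.restrict K).withDensity f ≤ (c : ℝ≥0∞) • (volume.restrict K).withDensity g := by
  rw [← withDensity_smul' _ _ coe_ne_top]
  refine withDensity_mono ?_
  filter_upwards [ae_restrict_mem hK] with x hx using hfg x hx

theorem restrict_withDensity {K : Set (Euc m)} (hK : IsCompact K) (hKe : K ⊆ e.target) :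
    ((volume.restrict e.target).withDensity fun x => ofReal (dens x)).restrict K =
      (volume.restrict K).withDensity fun x => ofReal (dens x) := by
  rw [MeasureTheory.restrict_withDensity hK.measurableSet, Measure.restrict_restrict
    hK.measurableSet, inter_eq_left.2 hKe]

theorem exists_restrict_le {K : Set (Euc m)} (hK : IsCompact K) (hKe : K ⊆ e.target) :
    ∃ c : ℝ≥0, volume.restrict K ≤ (c : ℝ≥0∞) •
      (volume.restrict e.target).withDensity fun x => ofReal (dens x) := by
  obtain ⟨C, hC⟩ := hK.exists_bound_of_continuousOn (f := fun x => (dens x)⁻¹)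
    ((h.contDiffOn.continuousOn.mono hKe).inv₀ fun x hx => (h.pos x (hKe hx)).ne')
  refine ⟨C.toNNReal, ?_⟩
  calc volume.restrict K = (volume.restrict K).withDensity 1 := by simp
    _ ≤ (C.toNNReal : ℝ≥0∞) • (volume.restrict K).withDensity fun x => ofReal (dens x) := by
        refine withDensity_le_of_le hK.measurableSet fun x hx => ?_
        have h1 := h.pos x (hKe hx)
        have h2 := hC x hx
        rw [norm_of_nonneg (by positivity)] at h2
        change (1 : ℝ≥0∞) ≤ ofReal C * ofReal (dens x)
        rw [← ENNReal.ofReal_mul' h1.le, ENNReal.one_le_ofReal]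
        calc (1 : ℝ) = (dens x)⁻¹ * dens x := (inv_mul_cancel₀ h1.ne').symm
          _ ≤ C * dens x := by gcongr
    _ ≤ _ := by
        rw [← h.restrict_withDensity hK hKe]
        gcongr
        exact Measure.restrict_le_self

theorem exists_le_restrict {K : Set (Euc m)} (hK : IsCompact K) (hKe : K ⊆ e.target) :
    ∃ c : ℝ≥0, ((volume.restrict e.target).withDensity fun x =>
      ofReal (dens x)).restrict K ≤ (c : ℝ≥0∞) • volume.restrict K := by
  obtain ⟨C, hC⟩ := hK.exists_bound_of_continuousOn (h.contDiffOn.continuousOn.mono hKe)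
  refine ⟨C.toNNReal, ?_⟩
  rw [h.restrict_withDensity hK hKe]
  calc _ ≤ (C.toNNReal : ℝ≥0∞) • (volume.restrict K).withDensity 1 := by
        refine withDensity_le_of_le hK.measurableSet fun x hx => ?_
        change ofReal (dens x) ≤ ofReal C * 1
        rw [mul_one]
        exact ofReal_le_ofReal ((le_abs_self _).trans (hC x hx))
    _ = _ := by simp

theorem memLp_comp_symm {K : Set (Euc m)} (hK : IsCompact K) (hKe : K ⊆ e.target) {u : M → ℝ}
    {p : ℝ≥0∞} (hu : MemLp u p (μ.restrict e.source)) :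
    MemLp (u ∘ e.symm) p (volume.restrict K) := by
  obtain ⟨c, hc⟩ := h.exists_restrict_le hK hKe
  rw [← h.map_symm] at hu
  exact ((memLp_map_measure_iff hu.1 h.aemeasurable_symm').1 hu).of_measure_le_smul
    coe_ne_top hc

theorem memLp_comp {K : Set (Euc m)} (hK : IsCompact K) (hKe : K ⊆ e.target) {w : Euc m → ℝ}
    {p : ℝ≥0∞} (hw : MemLp w p (volume.restrict K)) :
    MemLp (K.indicator w ∘ e) p (μ.restrict e.source) := by
  obtain ⟨c, hc⟩ := h.exists_le_restrict hK hKe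
  have h1 := (memLp_indicator_iff_restrict hK.measurableSet).2
    (hw.of_measure_le_smul coe_ne_top hc)
  rw [← h.map_eq] at h1
  exact (memLp_map_measure_iff h1.1 aemeasurable_chart).1 h1

theorem exists_lintegral_comp_symm_le {K : Set (Euc m)} (hK : IsCompact K) (hKe : K ⊆ e.target) :
    ∃ c : ℝ≥0, ∀ g : M → ℝ≥0∞, Measurable g → ∫⁻ x in K, g (e.symm x) ≤ c * ∫⁻ q, g q ∂μ := by
  obtain ⟨c, hc⟩ := h.exists_restrict_le hK hKe
  refine ⟨c, fun g hg => ?_⟩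
  calc ∫⁻ x in K, g (e.symm x) ≤ ∫⁻ x, g (e.symm x) ∂((c : ℝ≥0∞) •
        (volume.restrict e.target).withDensity fun x => ofReal (dens x)) :=
        lintegral_mono' hc le_rfl
    _ = c * ∫⁻ q in e.source, g q ∂μ := by
        rw [lintegral_smul_measure, ← h.map_symm, lintegral_map' hg.aemeasurable
          h.aemeasurable_symm', smul_eq_mul]
    _ ≤ c * ∫⁻ q, g q ∂μ := by
        gcongr
        exact Measure.restrict_le_self

end IsChartDensity

theorem IsSmoothVolume.exists_isChartDensity [IsManifold (𝓡 m) ∞ M]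
    (hμ : IsSmoothVolume (n := m) μ) (he : e ∈ IsManifold.maximalAtlas (𝓡 m) ∞ M) :
    ∃ dens, IsChartDensity μ e dens := by
  obtain ⟨dens, h1, h2, h3⟩ := hμ e he
  exact ⟨dens, h1, h2, h3⟩

end ChartDensity

/-! ### Exceptional families of flow lines -/

section Modulus

theorem contDiff_of_hasDerivAt {E : Type*} [NormedAddCommGroup E] [NormedSpace ℝ E] {b : E → E}
    (hb : ContDiff ℝ ∞ b) {γ : ℝ → E} (hγ : ∀ t, HasDerivAt γ (b (γ t)) t) : ContDiff ℝ ∞ γ := by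
  have hd : Differentiable ℝ γ := fun t => (hγ t).differentiableAt
  have hderiv : deriv γ = b ∘ γ := funext fun t => (hγ t).deriv
  rw [contDiff_infty]
  intro k
  induction k with
  | zero => exact contDiff_zero.2 hd.continuous
  | succ k ih =>
    push_cast
    refine contDiff_succ_iff_deriv.2 ⟨hd, by simp, ?_⟩
    rw [hderiv]
    exact (hb.of_le (by exact_mod_cast le_top)).comp ih

theorem lintegral_le_rpow_mul_measure {α : Type*} [MeasurableSpace α] (ν : Measure α) {Q : ℝ}
    (hQ : 1 ≤ Q) {g : α → ℝ≥0∞} (hg : AEMeasurable g ν) :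
    ∫⁻ x, g x ∂ν ≤ (∫⁻ x, g x ^ Q ∂ν) ^ (1 / Q) * ν univ ^ (1 - 1 / Q) := by
  have := eLpNorm'_le_eLpNorm'_mul_rpow_measure_univ (μ := ν) (f := g) (p := 1) (q := Q)
    one_pos hQ hg.aestronglyMeasurable
  simpa [eLpNorm'] using this

variable {m s n r : ℕ} {M N : Type*}
  [TopologicalSpace M] [ChartedSpace (Euc m) M] [IsManifold (𝓡 m) ∞ M]
  [T2Space M] [SecondCountableTopology M] [MeasurableSpace M] [BorelSpace M]
  [TopologicalSpace N] [ChartedSpace (Euc n) N] [IsManifold (𝓡 n) ∞ N]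
  {S : SubRiemannian m s M} {T : SubRiemannian n r N} {μ : Measure M} {Q : ℝ} {f : M → N}
  {e : OpenPartialHomeomorph M (Euc m)} {dens : Euc m → ℝ}

/-- A map that is absolutely continuous on curves is absolutely continuous on almost every flow
line of a member of an orthonormal frame. -/
theorem IsACC.ae_isAbsolutelyContinuous (hf : IsACC S T μ Q f) (hQ : 1 ≤ Q)
    (he : e ∈ IsManifold.maximalAtlas (𝓡 m) ∞ M) (hd : IsChartDensity μ e dens)
    {U : Set M} (hU : IsOpen U) {X : Fin s → ∀ q : M, S.H q} (hX : S.IsOrthonormalFrame U X)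
    (i : Fin s) {K : ℝ≥0} {b : Euc m → Euc m} {Φ : ℝ → Euc m → Euc m} (hΦ : IsFlow K b Φ)
    (hb : ContDiff ℝ ∞ b) {W K₀ : Set (Euc m)} (hW : IsOpen W) (hK₀ : IsCompact K₀)
    (hK₀e : K₀ ⊆ e.target) (hWK : W ⊆ K₀) (hWU : ∀ x ∈ W, e.symm x ∈ U)
    (hbW : ∀ x ∈ W, b x = pushField e (fun q => (X i q).1) x) :
    ∀ᵐ x, ∀ t, 0 < t → (∀ s ∈ Icc 0 t, Φ s x ∈ W) →
      IsAbsolutelyContinuous T.ccDist t (fun s => f (e.symm (Φ s x))) := by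
  suffices H : ∀ k : ℕ, ∀ᵐ x, ∀ t : ℝ, 0 < t → t ≤ k → (∀ s ∈ Icc 0 t, Φ s x ∈ W) →
      IsAbsolutelyContinuous T.ccDist t (fun s => f (e.symm (Φ s x))) by
    filter_upwards [ae_all_iff.2 H] with x hx t ht
    obtain ⟨k, hk⟩ := exists_nat_ge t
    exact hx k t ht hk
  intro k
  obtain ⟨c, hc⟩ := hd.exists_lintegral_comp_symm_le hK₀ hK₀e
  -- a measurable extension of the inverse chart
  obtain ⟨σ, hσm, hσ⟩ : ∃ σ : Euc m → M, Measurable σ ∧ ∀ x ∈ W, σ x = e.symm x := by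
    classical
    rcases W.eq_empty_or_nonempty with rfl | ⟨x₀, -⟩
    · rcases isEmpty_or_nonempty M with hM | ⟨⟨q⟩⟩
      · exact ⟨e.symm, measurable_of_subsingleton_codomain _, by simp⟩
      · exact ⟨fun _ => q, measurable_const, by simp⟩
    · exact ⟨W.piecewise e.symm fun _ => e.symm x₀,
        (e.continuousOn_symm.mono (hWK.trans hK₀e)).measurable_piecewise continuousOn_const
          hW.measurableSet, fun x hx => by simp [hx]⟩
  set C : ℝ≥0∞ := ofReal k * ofReal (IsFlow.distortion (Euc m) K k) with hC
  set A : Set (Euc m) := {x | ¬ ∀ t : ℝ, 0 < t → t ≤ k → (∀ s ∈ Icc 0 t, Φ s x ∈ W) →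
      IsAbsolutelyContinuous T.ccDist t (fun s => f (e.symm (Φ s x)))} with hA
  have hbound : ∀ ε : ℝ≥0∞, 0 < ε → volume A ≤
      C * ((c * ε) ^ (1 / Q) * volume K₀ ^ (1 - 1 / Q)) := by
    intro ε hε
    have h1 := hε
    rw [← (hf : modulus μ Q _ = 0), modulus, iInf_lt_iff] at h1
    obtain ⟨ρ, h1⟩ := h1
    rw [iInf_lt_iff] at h1
    obtain ⟨⟨hρ, hadm⟩, hρε⟩ := h1
    set F : Euc m → ℝ≥0∞ := W.indicator fun x => ρ (σ x) with hF
    have hFm : Measurable F := (hρ.comp hσm).indicator hW.measurableSet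
    have hAsub : A ⊆ {x | 1 ≤ ∫⁻ t in Icc 0 (k : ℝ), F (Φ t x)} := by
      intro x hx
      simp only [hA, mem_ofPred_eq, not_forall] at hx
      obtain ⟨t, ht, htk, hxW, hxAC⟩ := hx
      have hcurve : IsArcLengthCurve S.ccDist t (fun s => e.symm (Φ s x)) := by
        refine isArcLengthCurve_of_integralCurve S hU hX i ht ?_ (fun s hs => ?_)
          fun s hs => hWU _ (hxW s hs)
        · exact (contMDiffOn_symm_of_mem_maximalAtlas he).comp
            (contDiff_of_hasDerivAt hb (hΦ.deriv x)).contMDiff.contMDiffOn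
            fun s hs => hK₀e (hWK (hxW s hs))
        · refine hasMFDerivAt_symm_comp (X := fun q => (X i q).1) he
            (γ := fun s => Φ s x) (hK₀e (hWK (hxW s hs))) ?_
          rw [← hbW _ (hxW s hs)]
          exact hΦ.deriv x s
      have h2 := hadm (t, fun s => e.symm (Φ s x)) ⟨hcurve, hxAC⟩
      refine h2.trans ?_
      calc ∫⁻ s in Icc 0 t, ρ (e.symm (Φ s x)) = ∫⁻ s in Icc 0 t, F (Φ s x) := by
            refine setLIntegral_congr_fun measurableSet_Icc fun s hs => ?_
            simp only [hF]
            rw [indicator_of_mem (hxW s hs), hσ _ (hxW s hs)]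
        _ ≤ _ := lintegral_mono_set (Icc_subset_Icc_right htk)
    calc volume A ≤ volume {x | 1 ≤ ∫⁻ t in Icc 0 (k : ℝ), F (Φ t x)} := measure_mono hAsub
      _ ≤ ∫⁻ x, ∫⁻ t in Icc 0 (k : ℝ), F (Φ t x) := by
          simpa using mul_meas_ge_le_lintegral₀ (hΦ.aemeasurable_lintegral_flow k
            hFm.aemeasurable) 1
      _ ≤ C * ∫⁻ x, F x := hΦ.lintegral_lintegral_flow_le (Nat.cast_nonneg k) hFm.aemeasurable
      _ ≤ C * ((c * ε) ^ (1 / Q) * volume K₀ ^ (1 - 1 / Q)) := by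
          gcongr
          calc ∫⁻ x, F x = ∫⁻ x in K₀, F x := by
                rw [← lintegral_indicator hK₀.measurableSet]
                refine lintegral_congr fun x => ?_
                by_cases hx : x ∈ K₀
                · rw [indicator_of_mem hx]
                · rw [indicator_of_notMem hx]
                  exact indicator_of_notMem (fun hxW => hx (hWK hxW)) _
            _ ≤ (∫⁻ x in K₀, F x ^ Q) ^ (1 / Q) * (volume.restrict K₀) univ ^ (1 - 1 / Q) :=
                lintegral_le_rpow_mul_measure _ hQ hFm.aemeasurable
            _ ≤ (c * ε) ^ (1 / Q) * volume K₀ ^ (1 - 1 / Q) := by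
                rw [Measure.restrict_apply_univ]
                gcongr
                calc ∫⁻ x in K₀, F x ^ Q ≤ ∫⁻ x in K₀, ρ (e.symm x) ^ Q := by
                      refine lintegral_mono fun x => ?_
                      by_cases hx : x ∈ W
                      · simp only [hF]
                        rw [indicator_of_mem hx, hσ x hx]
                      · simp only [hF]
                        rw [indicator_of_notMem hx, ENNReal.zero_rpow_of_pos (by linarith)]
                        exact zero_le
                  _ ≤ c * ∫⁻ q, ρ q ^ Q ∂μ := hc _ (hρ.pow_const Q)
                  _ ≤ c * ε := by gcongr
  have hlim : Tendsto (fun ε : ℝ≥0∞ => C * ((c * ε) ^ (1 / Q) * volume K₀ ^ (1 - 1 / Q)))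
      (𝓝[>] 0) (𝓝 0) := by
    have hQ0 : 0 < 1 / Q := by positivity
    have h1 : Tendsto (fun ε : ℝ≥0∞ => (c * ε) ^ (1 / Q)) (𝓝 0) (𝓝 0) := by
      have h2 : Tendsto (fun ε : ℝ≥0∞ => (c : ℝ≥0∞) * ε) (𝓝 0) (𝓝 0) := by
        simpa using ENNReal.Tendsto.const_mul (a := (c : ℝ≥0∞)) (tendsto_id (x := 𝓝 0))
          (Or.inr coe_ne_top)
      have h3 := ((ENNReal.continuous_rpow_const (y := 1 / Q)).tendsto 0).comp h2
      rwa [ENNReal.zero_rpow_of_pos hQ0] at h3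
    have hVt : volume K₀ ^ (1 - 1 / Q) ≠ ⊤ := by
      refine ENNReal.rpow_ne_top_of_nonneg ?_ hK₀.measure_lt_top.ne
      rw [sub_nonneg, div_le_one (by linarith)]
      exact hQ
    have h4 := ENNReal.Tendsto.mul_const (b := volume K₀ ^ (1 - 1 / Q)) h1 (Or.inr hVt)
    rw [zero_mul] at h4
    have h5 := ENNReal.Tendsto.const_mul (a := C) h4
      (Or.inr (mul_ne_top ofReal_ne_top ofReal_ne_top))
    rw [mul_zero] at h5
    exact h5.mono_left nhdsWithin_le_nhds
  have hA0 : volume A = 0 := le_antisymm (ge_of_tendsto hlim (by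
    filter_upwards [self_mem_nhdsWithin] with ε hε using hbound ε hε)) zero_le
  exact hA0

end Modulus

/-! ### Derivatives of all coordinates from those of the horizontal ones -/

section WeakLines

variable {m : ℕ}

theorem exists_compact_exhaustion {W : Set (Euc m)} (hW : IsOpen W) :
    ∃ C : ℕ → Set (Euc m), (∀ k, IsCompact (C k) ∧ C k ⊆ W) ∧
      ∀ P ⊆ W, IsCompact P → ∃ k, P ⊆ C k := by
  have : LocallyCompactSpace W := hW.locallyCompactSpace
  let E := CompactExhaustion.choice W
  refine ⟨fun k => Subtype.val '' E k, fun k => ⟨(E.isCompact k).image continuous_subtype_val,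
    by rintro _ ⟨x, -, rfl⟩; exact x.2⟩, fun P hP hPc => ?_⟩
  have h1 : IsCompact (Subtype.val ⁻¹' P : Set W) := by
    rw [Subtype.isCompact_iff, Subtype.image_preimage_coe, inter_eq_right.2 hP]
    exact hPc
  obtain ⟨k, hk⟩ := E.exists_superset_of_isCompact h1
  exact ⟨k, fun x hx => ⟨⟨x, hP hx⟩, hk hx, rfl⟩⟩

/-- A continuous function with a weak derivative along `b` is, on almost every flow line, a
primitive of that derivative. -/
theorem WeakDeriv.ae_sub_eq_integral {K : ℝ≥0} {b : Euc m → Euc m} {Φ : ℝ → Euc m → Euc m}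
    (hΦ : IsFlow K b Φ) (hb : ContDiff ℝ ∞ b) (hbc : HasCompactSupport b) {W : Set (Euc m)}
    (hW : IsOpen W) {u v : Euc m → ℝ} (hu : ContinuousOn u W) (hv : LocallyIntegrableOn v W)
    (h : WeakDeriv b W u v) :
    ∀ᵐ x, ∀ t, 0 ≤ t → (∀ s ∈ Icc 0 t, Φ s x ∈ W) →
      IntervalIntegrable (fun s => v (Φ s x)) volume 0 t ∧
        u (Φ t x) - u x = ∫ s in 0..t, v (Φ s x) := by
  obtain ⟨C, hC, hCW⟩ := exists_compact_exhaustion hW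
  choose χ hχ hχ1 _ using fun k => exists_isTest_eq_one (hC k).1 hW (hC k).2
  have hul : LocallyIntegrableOn u W := hu.locallyIntegrableOn hW.measurableSet
  have hprim := fun k k' : ℕ => hΦ.ae_exists_isPrimitiveOn hb hbc ((hχ k).integrable_mul hul)
    (((hχ k).integrable_mul hv).add (((hχ k).fderiv_apply hb).integrable_mul hul))
    (h.mul_test hb hul hv (hχ k)) (T := (k' : ℝ) + 1) (by positivity)
  filter_upwards [ae_all_iff.2 fun k => ae_all_iff.2 (hprim k)] with x hx t ht hxW
  have hline : Continuous fun s => Φ s x := hΦ.continuous_left x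
  obtain ⟨k, hk⟩ := hCW _ (image_subset_iff.2 hxW) (isCompact_Icc.image hline)
  obtain ⟨k', hk'⟩ := exists_nat_ge t
  obtain ⟨V, hV, hVu⟩ := hx k k'
  have hcont : Continuous fun x => u x * χ k x := by
    refine ContinuousOn.continuous_of_tsupport_subset (hu.mul (hχ k).1.continuous.continuousOn) hW
      ((tsupport_mul_subset_right).trans (hχ k).2.2)
  have hEq : EqOn V (fun s => u (Φ s x) * χ k (Φ s x)) (Icc 0 ((k' : ℝ) + 1)) :=
    Measure.eqOn_Icc_of_ae_eq (μ := volume) (by positivity) hVu (hV.continuousOn (by positivity))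
      (hcont.comp hline).continuousOn
  have h1 : ∀ s ∈ Icc 0 t, χ k (Φ s x) = 1 ∧ fderiv ℝ (χ k) (Φ s x) = 0 := fun s hs =>
    eq_one_and_fderiv_eq_zero (hχ1 k) (hk ⟨s, hs, rfl⟩)
  have ht' : t ∈ Icc 0 ((k' : ℝ) + 1) := ⟨ht, by linarith⟩
  have h0' : (0 : ℝ) ∈ Icc 0 ((k' : ℝ) + 1) := ⟨le_rfl, by positivity⟩
  have hvv : ∀ s ∈ uIoc 0 t, v (Φ s x) * χ k (Φ s x) +
      u (Φ s x) * fderiv ℝ (χ k) (Φ s x) (b (Φ s x)) = v (Φ s x) := by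
    intro s hs
    rw [uIoc_of_le ht] at hs
    obtain ⟨e1, e2⟩ := h1 s (Ioc_subset_Icc_self hs)
    simp [e1, e2]
  have hP := hV.mono le_rfl ht ht'.2
  refine ⟨(hP.1).congr fun s hs => hvv s hs, ?_⟩
  have h2 := hP.2 0 (left_mem_Icc.2 ht) t (right_mem_Icc.2 ht)
  rw [hEq ht', hEq h0'] at h2
  have h3 := (h1 0 (left_mem_Icc.2 ht)).1
  rw [hΦ.zero] at h3
  simp only [(h1 t (right_mem_Icc.2 ht)).1, h3, mul_one, hΦ.zero] at h2
  rw [h2]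
  exact intervalIntegral.integral_congr_ae (ae_of_all _ fun s hs => hvv s hs)

end WeakLines

section FlowBox

variable {m s : ℕ} {M : Type*} [TopologicalSpace M]
  [ChartedSpace (Euc m) M] [IsManifold (𝓡 m) ∞ M]

/-- A chart `e`, a relatively compact open set `W` in its target, and smooth compactly supported
fields `b i` on the model space that on `W` are the expressions in the chart of the members of the
frame `X` on `U`. -/
structure FlowBox (S : SubRiemannian m s M) (U : Set M) (X : Fin s → ∀ q : M, S.H q)
    (e : OpenPartialHomeomorph M (Euc m)) (W K₀ : Set (Euc m))
    (b : Fin s → Euc m → Euc m) : Prop where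
  mem_atlas : e ∈ IsManifold.maximalAtlas (𝓡 m) ∞ M
  isOpen : IsOpen W
  isCompact : IsCompact K₀
  subset : W ⊆ K₀
  subset_target : K₀ ⊆ e.target
  maps : ∀ x ∈ K₀, e.symm x ∈ U
  contDiff : ∀ i, ContDiff ℝ ∞ (b i)
  hasCompactSupport : ∀ i, HasCompactSupport (b i)
  eq_pushField : ∀ i, ∀ x ∈ W, b i x = pushField e (fun q => (X i q).1) x

theorem exists_flowBox (S : SubRiemannian m s M) {U : Set M} (hU : IsOpen U)
    {X : Fin s → ∀ q : M, S.H q} (hX : IsFrameOf S.H U X) {p : M} (hp : p ∈ U) :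
    ∃ e W K₀ b, FlowBox S U X e W K₀ b ∧ p ∈ e.source ∧ e p ∈ W := by
  set e := chartAt (Euc m) p
  have he : e ∈ IsManifold.maximalAtlas (𝓡 m) ∞ M := IsManifold.chart_mem_maximalAtlas p
  have hpe : p ∈ e.source := mem_chart_source _ p
  have hO : IsOpen (e.target ∩ e.symm ⁻¹' U) := e.isOpen_inter_preimage_symm hU
  have hpO : e p ∈ e.target ∩ e.symm ⁻¹' U :=
    ⟨e.map_source hpe, by rw [mem_preimage, e.left_inv hpe]; exact hp⟩
  obtain ⟨K₀, hK₀, hpK, hKO⟩ := exists_compact_subset hO hpO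
  obtain ⟨χ, hχ, hχ1, -⟩ := exists_isTest_eq_one hK₀ hO hKO
  refine ⟨e, interior K₀, K₀, fun i x =>
    χ x • pushField e (fun q => (X i q).1) x, ?_, hpe, hpK⟩
  exact {
    mem_atlas := he
    isOpen := isOpen_interior
    isCompact := hK₀
    subset := interior_subset
    subset_target := fun x hx => (hKO hx).1
    maps := fun x hx => (hKO hx).2
    contDiff := fun i => contDiff_of_tsupport_subset hO hχ.1 hχ.2.2
      (contDiffOn_pushField he (hX.1 i) hU)
    hasCompactSupport := fun i => hχ.2.1.smul_right
    eq_pushField := fun i x hx => by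
      rw [(eq_one_and_fderiv_eq_zero hχ1 (interior_subset hx)).1, one_smul] }

variable {S : SubRiemannian m s M} {U : Set M} {X : Fin s → ∀ q : M, S.H q}
  {e : OpenPartialHomeomorph M (Euc m)} {W K₀ : Set (Euc m)}
  {b : Fin s → Euc m → Euc m}

theorem FlowBox.exists_isFlow (B : FlowBox S U X e W K₀ b) (i : Fin s) :
    ∃ K Φ, IsFlow K (b i) Φ := by
  have hb1 : ContDiff ℝ 1 (b i) := (B.contDiff i).of_le (by simp)
  obtain ⟨K, hK⟩ := hb1.lipschitzWith_of_hasCompactSupport (B.hasCompactSupport i) one_ne_zero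
  obtain ⟨L, hL⟩ := (B.contDiff i).continuous.bounded_above_of_compact_support
    (B.hasCompactSupport i)
  exact ⟨K, SubRiem.exists_isFlow hK (L := L.toNNReal)
    (fun x => (hL x).trans (Real.le_coe_toNNReal L))⟩

theorem FlowBox.continuousOn_symm (B : FlowBox S U X e W K₀ b) : ContinuousOn e.symm W :=
  e.continuousOn_symm.mono (B.subset.trans B.subset_target)

variable [T2Space M] [SecondCountableTopology M] [MeasurableSpace M] [BorelSpace M]
  {n r : ℕ} {N : Type*}
  [TopologicalSpace N] [ChartedSpace (Euc n) N] [IsManifold (𝓡 n) ∞ N]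
  [T2Space N] [SecondCountableTopology N]
  {T : SubRiemannian n r N} {μ : Measure M} {Q : ℝ} {f : M → N}

/-- On almost every flow line, formulas for the derivatives of the functions `k l ∘ f` lead to one
for `h ∘ f`. -/
theorem FlowBox.ae_sub_eq_integral (B : FlowBox S U X e W K₀ b) (hU : IsOpen U)
    (hX : S.IsOrthonormalFrame U X) (hμ : IsSmoothVolume (n := m) μ) (hQ : 1 ≤ Q)
    (hfc : Continuous f) (hf : IsACC S T μ Q f) {O : Set N}
    (hfO : ∀ x ∈ W, f (e.symm x) ∈ O) {κ : Type*} [Fintype κ] {h : N → ℝ} {k G : κ → N → ℝ}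
    (hc : T.IsHorizontalCombination O h k G) {i : Fin s} {K : ℝ≥0}
    {Φ : ℝ → Euc m → Euc m} (hΦ : IsFlow K (b i) Φ) {g : κ → Euc m → ℝ}
    (hline : ∀ l, ∀ᵐ x, ∀ t, 0 ≤ t → (∀ s ∈ Icc 0 t, Φ s x ∈ W) →
      IntervalIntegrable (fun s => g l (Φ s x)) volume 0 t ∧
        k l (f (e.symm (Φ t x))) - k l (f (e.symm x)) = ∫ s in 0..t, g l (Φ s x)) :
    ∀ᵐ x, ∀ t, 0 ≤ t → (∀ s ∈ Icc 0 t, Φ s x ∈ W) →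
      h (f (e.symm (Φ t x))) - h (f (e.symm x)) =
        ∫ s in 0..t, ∑ l, G l (f (e.symm (Φ s x))) * g l (Φ s x) := by
  obtain ⟨dens, hdens⟩ := hμ.exists_isChartDensity B.mem_atlas
  filter_upwards [hf.ae_isAbsolutelyContinuous hQ B.mem_atlas hdens hU hX i hΦ (B.contDiff i)
    B.isOpen B.isCompact B.subset_target B.subset (fun x hx => B.maps x (B.subset hx))
    (B.eq_pushField i), ae_all_iff.2 hline] with x hAC hx t ht hxW
  rcases ht.eq_or_lt with rfl | ht'
  · simp [hΦ.zero]
  have hline : Continuous fun s => Φ s x := hΦ.continuous_left x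
  have hsub : ∀ t' ∈ Icc 0 t, ∀ s ∈ Icc 0 t', Φ s x ∈ W := fun t' ht' s hs =>
    hxW s ⟨hs.1, hs.2.trans ht'.2⟩
  have := hc.sub_eq_integral (σ := fun s => f (e.symm (Φ s x)))
    (hfc.comp_continuousOn (B.continuousOn_symm.comp hline.continuousOn hxW)) (hAC t ht' hxW)
    (fun s hs => hfO _ (hxW s hs)) (w := fun l s => g l (Φ s x))
    (fun l => (hx l t ht hxW).1) (fun l t' ht' => by
      have := (hx l t' ht'.1 (hsub t' ht')).2
      simpa [hΦ.zero] using this) (right_mem_Icc.2 ht)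
  simpa [hΦ.zero] using this

/-- The weak derivatives of all coordinates of `f` are combinations of those of the horizontal
ones. -/
theorem FlowBox.weakDeriv_of_horizontal (B : FlowBox S U X e W K₀ b) (hU : IsOpen U)
    (hX : S.IsOrthonormalFrame U X) (hμ : IsSmoothVolume (n := m) μ) (hQ : 1 ≤ Q)
    (hfc : Continuous f) (hf : IsACC S T μ Q f) {O : Set N}
    (hfO : ∀ x ∈ W, f (e.symm x) ∈ O) {κ : Type*} [Fintype κ] {h : N → ℝ} {k G : κ → N → ℝ}
    (hc : T.IsHorizontalCombination O h k G) {i : Fin s}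
    {g : κ → Euc m → ℝ} (hg : ∀ l, LocallyIntegrableOn (g l) W)
    (hkg : ∀ l, WeakDeriv (b i) W (fun x => k l (f (e.symm x))) (g l)) :
    WeakDeriv (b i) W (fun x => h (f (e.symm x)))
      fun x => ∑ l, G l (f (e.symm x)) * g l x := by
  obtain ⟨K, Φ, hΦ⟩ := B.exists_isFlow i
  have hcomp : ∀ {u : N → ℝ}, ContMDiffOn (𝓡 n) 𝓘(ℝ, ℝ) ∞ u O →
      ContinuousOn (fun x => u (f (e.symm x))) W := fun hu =>
    hu.continuousOn.comp (hfc.comp_continuousOn B.continuousOn_symm) hfO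
  refine hΦ.weakDeriv_of_ae (B.contDiff i) (B.hasCompactSupport i) B.isOpen
    ((hcomp hc.smooth).locallyIntegrableOn B.isOpen.measurableSet) ?_
    (B.ae_sub_eq_integral hU hX hμ hQ hfc hf hfO hc hΦ fun l =>
      (hkg l).ae_sub_eq_integral hΦ (B.contDiff i) (B.hasCompactSupport i) B.isOpen
        (hcomp (hc.smooth_of l)) (hg l))
  rw [locallyIntegrableOn_iff B.isOpen.isLocallyClosed]
  intro C hCW hC
  exact integrable_finsetSum _ fun l _ =>
    ((hg l).integrableOn_compact_subset hCW hC).continuousOn_mul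
    ((hcomp (hc.smooth_coeff l)).mono hCW) hC

end FlowBox

/-! ### Derivatives along flows -/

section FlowDerivatives

variable {m s : ℕ} {M : Type*} [TopologicalSpace M]
  [ChartedSpace (Euc m) M] [IsManifold (𝓡 m) ∞ M]
  {S : SubRiemannian m s M} {U : Set M} {X : Fin s → ∀ q : M, S.H q}
  {e : OpenPartialHomeomorph M (Euc m)} {W K₀ : Set (Euc m)}
  {b : Fin s → Euc m → Euc m} {i : Fin s} {K : ℝ≥0} {Φ : ℝ → Euc m → Euc m}

theorem FlowBox.hasDerivAlong_iff (B : FlowBox S U X e W K₀ b) (hΦ : IsFlow K (b i) Φ)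
    {u : M → ℝ} {x : Euc m} (hx : x ∈ W) {c : ℝ} :
    HasDerivAlong (fun q => (X i q).1) u (e.symm x) c ↔
      HasDerivAt (fun t => u (e.symm (Φ t x))) c 0 := by
  have hcont : Continuous fun t => Φ t x := hΦ.continuous_left x
  have hev : ∀ᶠ t in 𝓝 (0 : ℝ), Φ t x ∈ W :=
    hcont.continuousAt.eventually_mem (B.isOpen.mem_nhds (by rwa [hΦ.zero]))
  constructor
  · intro h
    refine h (fun t => e.symm (Φ t x)) (by simp [hΦ.zero]) ?_
    filter_upwards [hev] with t ht
    refine hasMFDerivAt_symm_comp (X := fun q => (X i q).1) B.mem_atlas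
      (γ := fun t => Φ t x) (B.subset_target (B.subset ht)) ?_
    rw [← B.eq_pushField i _ ht]
    exact hΦ.deriv x t
  · intro h γ hγ0 hγ
    have hγc : ContinuousAt γ 0 := hγ.self_of_nhds.continuousAt
    have hxt : x ∈ e.target := B.subset_target (B.subset hx)
    have h1 : ∀ᶠ t in 𝓝 (0 : ℝ), γ t ∈ e.source ∩ e ⁻¹' W := by
      refine hγc.eventually_mem ((e.isOpen_inter_preimage B.isOpen).mem_nhds ?_)
      rw [hγ0]
      exact ⟨e.map_target hxt, by rw [mem_preimage, e.right_inv hxt]; exact hx⟩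
    have h2 := ODE_solution_unique_of_eventually (v := fun _ => b i) (s := fun _ => univ)
      (t₀ := (0 : ℝ)) (f := fun t => e (γ t)) (g := fun t => Φ t x)
      (Eventually.of_forall fun _ => hΦ.lip.lipschitzOnWith) (by
        filter_upwards [h1, hγ] with t ht ht'
        refine ⟨?_, mem_univ _⟩
        rw [B.eq_pushField i _ ht.2]
        exact hasDerivAt_comp_of_hasMFDerivAt (X := fun q => (X i q).1)
          B.mem_atlas ht.1 ht')
      (Eventually.of_forall fun t => ⟨hΦ.deriv x t, mem_univ _⟩)
      (by rw [hγ0, hΦ.zero, e.right_inv hxt])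
    refine h.congr_of_eventuallyEq ?_
    filter_upwards [h1, h2] with t ht ht'
    simp only [Function.comp_apply]
    rw [← ht', e.left_inv ht.1]

theorem FlowBox.hasDerivAt_flow (B : FlowBox S U X e W K₀ b) (hΦ : IsFlow K (b i) Φ)
    {u v : M → ℝ} (h : ∀ p ∈ U,
      HasDerivAlong (fun q => (X i q).1) u p (v p)) {x : Euc m} {t : ℝ}
    (ht : Φ t x ∈ W) :
    HasDerivAt (fun t => u (e.symm (Φ t x))) (v (e.symm (Φ t x))) t := by
  have h1 := (B.hasDerivAlong_iff hΦ ht).1 (h _ (B.maps _ (B.subset ht)))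
  rw [← sub_self t] at h1
  have h2 := h1.comp_sub_const t t
  simpa only [← hΦ.add, sub_add_cancel] using h2

theorem FlowBox.continuousOn_comp_symm (B : FlowBox S U X e W K₀ b) {u : M → ℝ}
    (hu : ContinuousOn u U) : ContinuousOn (fun x => u (e.symm x)) W :=
  hu.comp B.continuousOn_symm fun x hx => B.maps x (B.subset hx)

theorem FlowBox.sub_eq_integral_of_hasDerivAlong (B : FlowBox S U X e W K₀ b)
    (hΦ : IsFlow K (b i) Φ) {u v : M → ℝ} (h : ∀ p ∈ U,
      HasDerivAlong (fun q => (X i q).1) u p (v p))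
    (hv : ContinuousOn v U) {x : Euc m} {t : ℝ} (ht : 0 ≤ t) (hxW : ∀ s ∈ Icc 0 t, Φ s x ∈ W) :
    IntervalIntegrable (fun s => v (e.symm (Φ s x))) volume 0 t ∧
      u (e.symm (Φ t x)) - u (e.symm x) = ∫ s in 0..t, v (e.symm (Φ s x)) := by
  have hcont : Continuous fun t => Φ t x := hΦ.continuous_left x
  have h1 : IntervalIntegrable (fun s => v (e.symm (Φ s x))) volume 0 t := by
    refine ContinuousOn.intervalIntegrable ?_
    rw [uIcc_of_le ht]
    exact (B.continuousOn_comp_symm hv).comp hcont.continuousOn hxW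
  refine ⟨h1, ?_⟩
  rw [intervalIntegral.integral_eq_sub_of_hasDerivAt (f := fun t => u (e.symm (Φ t x)))
    (fun s hs => B.hasDerivAt_flow hΦ h (hxW s (by rwa [uIcc_of_le ht] at hs))) h1, hΦ.zero]

/-- By continuity, an integral formula on almost every flow line holds on all of them. -/
theorem IsFlow.sub_eq_integral_of_ae {b : Euc m → Euc m} (hΦ : IsFlow K b Φ) (hW : IsOpen W)
    {u v : Euc m → ℝ} (hu : ContinuousOn u W) (hv : ContinuousOn v W)
    (h : ∀ᵐ x, ∀ t, 0 ≤ t → (∀ s ∈ Icc 0 t, Φ s x ∈ W) →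
      u (Φ t x) - u x = ∫ s in 0..t, v (Φ s x)) {x : Euc m} {t : ℝ} (ht : 0 ≤ t)
    (hxW : ∀ s ∈ Icc 0 t, Φ s x ∈ W) : u (Φ t x) - u x = ∫ s in 0..t, v (Φ s x) := by
  have hline : Continuous fun s => Φ s x := hΦ.continuous_left x
  obtain ⟨C, hC, hPC, hCW⟩ := exists_compact_between (isCompact_Icc.image hline) hW
    (image_subset_iff.2 hxW)
  obtain ⟨χ, hχ, hχ1, -⟩ := exists_isTest_eq_one hC hW hCW
  have hcut : ∀ {w : Euc m → ℝ}, ContinuousOn w W → Continuous fun x => w x * χ x := fun hw =>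
    ContinuousOn.continuous_of_tsupport_subset (hw.mul hχ.1.continuous.continuousOn) hW
      ((tsupport_mul_subset_right).trans hχ.2.2)
  set E : Euc m → ℝ := fun x => u (Φ t x) * χ (Φ t x) - u x * χ x -
    ∫ s in 0..t, v (Φ s x) * χ (Φ s x) with hE
  have hEc : Continuous E := by
    refine (((hcut hu).comp (hΦ.continuous_right t)).sub (hcut hu)).sub ?_
    exact intervalIntegral.continuous_parametric_intervalIntegral_of_continuous'
      (f := fun x s => v (Φ s x) * χ (Φ s x))
      ((hcut hv).comp (hΦ.continuous.comp continuous_swap)) 0 t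
  have hEeq : ∀ x', (∀ s ∈ Icc 0 t, Φ s x' ∈ C) →
      E x' = u (Φ t x') - u x' - ∫ s in 0..t, v (Φ s x') := by
    intro x' hx'
    have h1 : ∀ s ∈ Icc 0 t, χ (Φ s x') = 1 := fun s hs =>
      (eq_one_and_fderiv_eq_zero hχ1 (hx' s hs)).1
    have h2 := h1 0 (left_mem_Icc.2 ht)
    rw [hΦ.zero] at h2
    simp only [hE, h1 t (right_mem_Icc.2 ht), h2, mul_one]
    congr 1
    refine integral_congr fun s hs => ?_
    rw [uIcc_of_le ht] at hs
    simp [h1 s hs]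
  have hev : ∀ᶠ x' in 𝓝 x, ∀ s ∈ Icc 0 t, Φ s x' ∈ interior C := by
    refine isCompact_Icc.eventually_forall_of_forall_eventually fun s hs => ?_
    have h1 : ContinuousAt (fun z : Euc m × ℝ => Φ z.2 z.1) (x, s) :=
      (hΦ.continuous.comp continuous_swap).continuousAt
    exact h1.eventually_mem (isOpen_interior.mem_nhds (hPC ⟨s, hs, rfl⟩))
  have hzero : E x = 0 := by
    by_contra hne
    have h1 : ∀ᶠ x' in 𝓝 x, E x' ≠ 0 := hEc.continuousAt.eventually_ne hne
    obtain ⟨x', hx', h2, h3⟩ := (Measure.dense_of_ae h).inter_nhds_nonempty (hev.and h1)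
    refine h3 ?_
    rw [hEeq x' fun s hs => interior_subset (h2 s hs), sub_eq_zero]
    exact hx' t ht fun s hs => hCW (interior_subset (h2 s hs))
  rw [hEeq x fun s hs => interior_subset (hPC ⟨s, hs, rfl⟩), sub_eq_zero] at hzero
  exact hzero

theorem FlowBox.hasDerivAlong_of_sub_eq_integral (B : FlowBox S U X e W K₀ b)
    (hΦ : IsFlow K (b i) Φ) {u : M → ℝ} {v : Euc m → ℝ} (hv : ContinuousOn v W)
    (h : ∀ x t, 0 ≤ t → (∀ s ∈ Icc 0 t, Φ s x ∈ W) →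
      u (e.symm (Φ t x)) - u (e.symm x) = ∫ s in 0..t, v (Φ s x)) {x : Euc m} (hx : x ∈ W) :
    HasDerivAlong (fun q => (X i q).1) u (e.symm x) (v x) := by
  rw [B.hasDerivAlong_iff hΦ hx]
  obtain ⟨τ, hτ, S', -, hS'W, hτS⟩ := hΦ.exists_forall_mem (isCompact_singleton (x := x)) B.isOpen
    (singleton_subset_iff.2 hx)
  -- the formula on the flow line that starts at time `-τ`
  set x' := Φ (-τ) x with hx'
  have hshift : ∀ s, Φ s x' = Φ (s - τ) x := fun s => by rw [hx', ← hΦ.add, sub_eq_add_neg]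
  have hmem : ∀ s ∈ Icc 0 (2 * τ), Φ s x' ∈ W := fun s hs => by
    rw [hshift]
    exact hS'W (hτS _ (abs_le.2 ⟨by linarith [hs.1], by linarith [hs.2]⟩) x rfl)
  have hline : Continuous fun s => Φ s x' := hΦ.continuous_left x'
  have hopen : IsOpen ((fun s => Φ s x') ⁻¹' W) := B.isOpen.preimage hline
  have hcontv : ContinuousOn (fun s => v (Φ s x')) ((fun s => Φ s x') ⁻¹' W) :=
    hv.comp hline.continuousOn fun s hs => hs
  have hτW : τ ∈ (fun s => Φ s x') ⁻¹' W := hmem τ ⟨hτ.le, by linarith⟩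
  have h1 : HasDerivAt (fun t => ∫ s in 0..t, v (Φ s x')) (v (Φ τ x')) τ := by
    refine intervalIntegral.integral_hasDerivAt_right ?_
      (hcontv.stronglyMeasurableAtFilter hopen τ hτW) (hcontv.continuousAt (hopen.mem_nhds hτW))
    refine ContinuousOn.intervalIntegrable (hcontv.mono fun s hs => ?_)
    rw [uIcc_of_le hτ.le] at hs
    exact hmem s ⟨hs.1, by linarith [hs.2]⟩
  have h2 : HasDerivAt (fun t => u (e.symm (Φ t x'))) (v (Φ τ x')) τ := by
    refine (h1.const_add (u (e.symm x'))).congr_of_eventuallyEq ?_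
    filter_upwards [Ioo_mem_nhds hτ (show τ < 2 * τ by linarith)] with t ht
    have := h x' t ht.1.le fun s hs => hmem s ⟨hs.1, hs.2.trans ht.2.le⟩
    linarith
  have h3 : Φ τ x' = x := by rw [hshift, sub_self, hΦ.zero]
  rw [h3, show τ = 0 + τ by ring] at h2
  have h4 := h2.comp_add_const 0 τ
  simpa only [hshift, add_sub_cancel_right] using h4

variable [T2Space M] [SecondCountableTopology M] [MeasurableSpace M] [BorelSpace M]
  {n r : ℕ} {N : Type*}
  [TopologicalSpace N] [ChartedSpace (Euc n) N] [IsManifold (𝓡 n) ∞ N]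
  [T2Space N] [SecondCountableTopology N]
  {T : SubRiemannian n r N} {μ : Measure M} {Q : ℝ} {f : M → N}

/-- The continuous flow derivatives of all coordinates of `f` are combinations of those of the
horizontal ones. -/
theorem IsACC.hasDerivAlong_of_horizontal (hU : IsOpen U) (hX : S.IsOrthonormalFrame U X)
    (hμ : IsSmoothVolume (n := m) μ) (hQ : 1 ≤ Q)
    (hfc : Continuous f) (hf : IsACC S T μ Q f) {O : Set N}
    (hfO : ∀ q ∈ U, f q ∈ O) {κ : Type*} [Fintype κ] {h : N → ℝ} {k G : κ → N → ℝ}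
    (hc : T.IsHorizontalCombination O h k G) {i : Fin s} {g : κ → M → ℝ}
    (hg : ∀ l, ContinuousOn (g l) U)
    (hkg : ∀ l, ∀ p ∈ U, HasDerivAlong (fun q => (X i q).1)
      (fun q => k l (f q)) p (g l p)) {p : M} (hp : p ∈ U) :
    HasDerivAlong (fun q => (X i q).1) (fun q => h (f q)) p
      (∑ l, G l (f p) * g l p) := by
  obtain ⟨e, W, K₀, b, B, hpe, hpW⟩ := exists_flowBox S hU hX.1 hp
  obtain ⟨K, Φ, hΦ⟩ := B.exists_isFlow i
  have hfO' : ∀ x ∈ W, f (e.symm x) ∈ O := fun x hx => hfO _ (B.maps x (B.subset hx))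
  have hcomp : ∀ {u : N → ℝ}, ContMDiffOn (𝓡 n) 𝓘(ℝ, ℝ) ∞ u O →
      ContinuousOn (fun q => u (f q)) U := fun hu =>
    hu.continuousOn.comp hfc.continuousOn hfO
  have hv : ContinuousOn (fun x => ∑ l, G l (f (e.symm x)) * g l (e.symm x)) W :=
    continuousOn_finsetSum _ fun l _ => (B.continuousOn_comp_symm (hcomp (hc.smooth_coeff l))).mul
      (B.continuousOn_comp_symm (hg l))
  have hae := B.ae_sub_eq_integral hU hX hμ hQ hfc hf hfO' hc hΦ
    (g := fun l x => g l (e.symm x)) fun l => ae_of_all _ fun x t ht hxW =>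
      B.sub_eq_integral_of_hasDerivAlong hΦ (hkg l) (hg l) ht hxW
  have := B.hasDerivAlong_of_sub_eq_integral hΦ (u := fun q => h (f q)) hv
    (fun x t ht hxW => hΦ.sub_eq_integral_of_ae B.isOpen
      (B.continuousOn_comp_symm (hcomp hc.smooth)) hv hae ht hxW) hpW
  simpa only [e.left_inv hpe] using this

omit [T2Space M] [SecondCountableTopology M] [MeasurableSpace M] [BorelSpace M] in
theorem FlowBox.weakDeriv_of_hasDerivAlong (B : FlowBox S U X e W K₀ b) {i : Fin s} {u v : M → ℝ}
    (hu : ContinuousOn u U) (hv : ContinuousOn v U)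
    (h : ∀ p ∈ U, HasDerivAlong (fun q => (X i q).1) u p (v p)) :
    WeakDeriv (b i) W (fun x => u (e.symm x)) (fun x => v (e.symm x)) := by
  obtain ⟨K, Φ, hΦ⟩ := B.exists_isFlow i
  exact hΦ.weakDeriv_of_ae (B.contDiff i) (B.hasCompactSupport i) B.isOpen
    ((B.continuousOn_comp_symm hu).locallyIntegrableOn B.isOpen.measurableSet)
    ((B.continuousOn_comp_symm hv).locallyIntegrableOn B.isOpen.measurableSet)
    (ae_of_all _ fun x t ht hxW => (B.sub_eq_integral_of_hasDerivAlong hΦ h hv ht hxW).2)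

end FlowDerivatives

/-! ### Lipschitz estimates for the Carnot–Carathéodory distance -/

section Lipschitz

variable {m s : ℕ} {M : Type*} [TopologicalSpace M]
  [ChartedSpace (Euc m) M] [IsManifold (𝓡 m) ∞ M]
  {S : SubRiemannian m s M} {U : Set M} {X : Fin s → ∀ q : M, S.H q}
  {e : OpenPartialHomeomorph M (Euc m)} {W K₀ : Set (Euc m)}
  {b : Fin s → Euc m → Euc m}

theorem FlowBox.mderiv_comp_chart (B : FlowBox S U X e W K₀ b) {g : Euc m → ℝ}
    (hg : ContDiff ℝ ∞ g) {q : M} (hq : q ∈ e.source) (hqW : e q ∈ W) (i : Fin s) :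
    mderiv (g ∘ e) q (X i q).1 = fderiv ℝ g (e q) (b i (e q)) := by
  have h1 : MDifferentiableAt (𝓡 m) 𝓘(ℝ, ℝ) (g ∘ e) q :=
    MDifferentiableAt.comp q ((hg.differentiable (by simp)).differentiableAt.mdifferentiableAt)
      ((mdifferentiable_of_mem_maximalAtlas B.mem_atlas).mdifferentiableAt hq)
  have h2 := dirDeriv_symm_apply B.mem_atlas (X := fun q => (X i q).1)
    (h := g ∘ e) (e.map_source hq) (by rwa [e.left_inv hq])
  rw [e.left_inv hq] at h2
  refine Eq.trans h2 ?_
  rw [B.eq_pushField i _ hqW]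
  have h3 : (g ∘ e) ∘ e.symm =ᶠ[𝓝 (e q)] g := by
    filter_upwards [e.open_target.mem_nhds (e.map_source hq)] with x hx
    simp [e.right_inv hx]
  rw [h3.fderiv_eq]

variable [T2Space M] [SecondCountableTopology M]

/-- A continuous function with continuous horizontal derivatives is locally Lipschitz for the
Carnot–Carathéodory distance. -/
theorem SubRiemannian.IsOrthonormalFrame.exists_abs_sub_le_ccDist
    (hX : S.IsOrthonormalFrame U X) (hU : IsOpen U) {u : M → ℝ}
    {v : Fin s → M → ℝ} (hu : ContinuousOn u U) (hv : ∀ i, ContinuousOn (v i) U)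
    (h : ∀ i, ∀ p ∈ U, HasDerivAlong (fun q => (X i q).1) u p (v i p))
    {p : M} (hp : p ∈ U) :
    ∃ V ∈ 𝓝 p, ∃ δ : ℝ≥0, 0 < δ ∧ ∃ C : ℝ, 0 ≤ C ∧ ∀ a ∈ V, ∀ b, S.ccDist a b < δ →
      |u b - u a| ≤ C * (S.ccDist a b).toReal := by
  obtain ⟨e, W, K₀, b, B, hpe, hpW⟩ := exists_flowBox S hU hX.1 hp
  obtain ⟨C₀, hC₀, hpC, hCW⟩ := exists_compact_subset B.isOpen hpW
  obtain ⟨χ, hχ, hχ1, -⟩ := exists_isTest_eq_one hC₀ B.isOpen hCW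
  have hcut : ∀ {w ζ : Euc m → ℝ}, ContinuousOn w W → IsTest W ζ → Continuous fun x => w x * ζ x :=
    fun hw hζ => ContinuousOn.continuous_of_tsupport_subset (hw.mul hζ.1.continuous.continuousOn)
      B.isOpen (tsupport_mul_subset_right.trans hζ.2.2)
  set w : Euc m → ℝ := fun x => u (e.symm x) * χ x with hw
  set w' : Fin s → Euc m → ℝ := fun i x =>
    v i (e.symm x) * χ x + u (e.symm x) * fderiv ℝ χ x (b i x) with hw'
  have hub := B.continuousOn_comp_symm hu
  have hvb := fun i => B.continuousOn_comp_symm (hv i)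
  have hχb := fun i => hχ.fderiv_apply (B.contDiff i)
  have hwc : Continuous w := hcut hub hχ
  have hwc' : ∀ i, Continuous (w' i) := fun i => (hcut (hvb i) hχ).add (hcut hub (hχb i))
  have hws : HasCompactSupport w := hχ.2.1.mul_left
  have hws' : ∀ i, HasCompactSupport (w' i) := fun i =>
    (hχ.2.1.mul_left).add ((hχb i).2.1.mul_left)
  have hD : ∀ i, WeakDeriv (b i) univ w (w' i) := fun i =>
    (B.weakDeriv_of_hasDerivAlong hu (hv i) (h i)).mul_test (B.contDiff i)
      (hub.locallyIntegrableOn B.isOpen.measurableSet)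
      ((hvb i).locallyIntegrableOn B.isOpen.measurableSet) hχ
  have hbd : ∀ i, ∃ A : ℝ, ∀ x, ‖w' i x‖ ≤ A := fun i =>
    (hws' i).exists_bound_of_continuous (hwc' i)
  choose A hA using hbd
  obtain ⟨V, hV, δ, hδ, hVδ⟩ := S.exists_nhds_forall_mem (e.isOpen_inter_preimage isOpen_interior)
    (show p ∈ e.source ∩ e ⁻¹' interior C₀ from ⟨hpe, hpC⟩)
  have hC : ∀ i, 0 ≤ A i + 1 := fun i => by linarith [(norm_nonneg _).trans (hA i 0)]
  have hC' : 0 ≤ ∑ i, (A i + 1) := sum_nonneg fun i _ => hC i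
  refine ⟨V, hV, ⟨δ, hδ.le⟩, hδ, ∑ i, (A i + 1), hC', fun a ha c hac => ?_⟩
  refine SubRiemannian.le_of_forall_ccDist_lt hac (F := fun η => (∑ i, (A i + 1)) * η)
    (by fun_prop) fun η hη hηδ => ?_
  obtain ⟨γ, hγ, rfl, rfl⟩ := S.exists_isHorizontalCurve hη
  have hmem := hVδ γ η η.2 hηδ hγ ha
  choose! z hz hzη using hγ.2
  -- the estimate for the mollified functions passes to the limit
  refine le_of_forall_pos_le_add fun τ hτ => ?_
  obtain ⟨ε, hε, hε1, hε2⟩ : ∃ ε : ℝ, 0 < ε ∧ (∀ x, |mollify ε w x - w x| ≤ τ / 2) ∧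
      ∀ i x, |fderiv ℝ (mollify ε w) x (b i x) - w' i x| ≤ 1 := by
    obtain ⟨ε₀, hε₀, h0⟩ := exists_abs_mollify_sub_le
      (hws.uniformContinuous_of_continuous hwc) hwc.locallyIntegrable (half_pos hτ)
    choose ε₁ hε₁ h1 using fun i => (hD i).exists_abs_fderiv_mollify_sub_le (B.contDiff i)
      (B.hasCompactSupport i) (hws.uniformContinuous_of_continuous hwc) hwc.locallyIntegrable
      ((hws' i).uniformContinuous_of_continuous (hwc' i)) (hwc' i).locallyIntegrable one_pos
    have hev : ∀ᶠ ε : ℝ in 𝓝[>] 0, 0 < ε ∧ ε < ε₀ ∧ ∀ i, ε < ε₁ i :=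
      Eventually.and self_mem_nhdsWithin (Eventually.and
        (mem_nhdsWithin_of_mem_nhds (Iio_mem_nhds hε₀)) (eventually_all.2 fun i =>
          mem_nhdsWithin_of_mem_nhds (Iio_mem_nhds (hε₁ i))))
    obtain ⟨ε, hε, h2, h3⟩ := hev.exists
    exact ⟨ε, hε, h0 ε hε h2, fun i => h1 i ε hε (h3 i)⟩
  have hmol : ContDiff ℝ ∞ (mollify ε w) := contDiff_mollify hε hwc.locallyIntegrable
  have h1 := (convex_Icc (0 : ℝ) 1).norm_image_sub_le_of_norm_hasDerivWithin_le
    (f := (mollify ε w ∘ e) ∘ γ) (C := (∑ i, (A i + 1)) * η)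
    (fun t ht => hasDerivWithinAt_comp_curve (hz t ht) (MDifferentiableAt.comp (γ t)
      ((hmol.differentiable (by simp)).differentiableAt.mdifferentiableAt)
      ((mdifferentiable_of_mem_maximalAtlas B.mem_atlas).mdifferentiableAt (hmem t ht).1)))
    (fun t ht => ?_) (show (0 : ℝ) ∈ Icc 0 1 by simp) (show (1 : ℝ) ∈ Icc 0 1 by simp)
  · rw [sub_zero, norm_one, mul_one, norm_eq_abs] at h1
    have hval : ∀ t ∈ Icc (0 : ℝ) 1, w (e (γ t)) = u (γ t) := fun t ht => by
      simp only [hw]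
      rw [e.left_inv (hmem t ht).1,
        (eq_one_and_fderiv_eq_zero hχ1 (interior_subset (hmem t ht).2)).1, mul_one]
    have e0 := hε1 (e (γ 0))
    have e1 := hε1 (e (γ 1))
    rw [hval 0 (by simp)] at e0
    rw [hval 1 (by simp)] at e1
    simp only [Function.comp_apply] at h1
    rw [abs_le] at *
    constructor <;> linarith
  · obtain ⟨c, hc, hcg⟩ := hX.exists_sum_eq (B.maps _ (B.subset (hCW (interior_subset
      (hmem t ht).2))) |> fun h => by rwa [e.left_inv (hmem t ht).1] at h) (z t)
    have h2 := SubRiemannian.mderiv_sum (mollify ε w ∘ e) c hc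
    refine (congrArg norm h2).trans_le ((norm_sum_le _ _).trans ?_)
    rw [sum_mul]
    refine sum_le_sum fun i _ => ?_
    have hxW : e (γ t) ∈ W := hCW (interior_subset (hmem t ht).2)
    rw [B.mderiv_comp_chart hmol (hmem t ht).1 hxW i, norm_mul, mul_comm]
    have h3 : |c i| ≤ η := by
      refine abs_le_of_sq_le_sq ?_ η.2
      calc c i ^ 2 ≤ ∑ j, c j ^ 2 :=
            single_le_sum (f := fun j => c j ^ 2) (fun j _ => sq_nonneg _)
              (Finset.mem_univ i)
        _ ≤ _ := hcg ▸ hzη t ht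
    refine mul_le_mul ?_ h3 (abs_nonneg _) (hC i)
    have h4 := hε2 i (e (γ t))
    have h5 := hA i (e (γ t))
    rw [norm_eq_abs] at *
    rw [abs_le] at *
    constructor <;> linarith

/-- `u` is Hölder continuous of exponent `α` on the set `K` for the Carnot–Carathéodory
distance. -/
def SubRiemannian.IsHolderOn (S : SubRiemannian m s M) (α : ℝ) (K : Set M) (u : M → ℝ) : Prop :=
  ∃ C : ℝ≥0, ∀ p ∈ K, ∀ q ∈ K, ofReal |u p - u q| ≤ C * S.ccDist p q ^ α

theorem SubRiemannian.IsOrthonormalFrame.isHolderOn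
    (hX : S.IsOrthonormalFrame U X) (hU : IsOpen U) {u : M → ℝ}
    {v : Fin s → M → ℝ} (hu : ContinuousOn u U) (hv : ∀ i, ContinuousOn (v i) U)
    (h : ∀ i, ∀ p ∈ U, HasDerivAlong (fun q => (X i q).1) u p (v i p))
    {K : Set M} (hK : IsCompact K) (hKU : K ⊆ U) {α : ℝ} (hα : α ∈ Ioo (0 : ℝ) 1) :
    S.IsHolderOn α K u := by
  obtain ⟨δ, hδ, C, hC, hCK⟩ : ∃ δ : ℝ≥0, 0 < δ ∧ ∃ C : ℝ, 0 ≤ C ∧ ∀ a ∈ K, ∀ b,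
      S.ccDist a b < δ → |u b - u a| ≤ C * (S.ccDist a b).toReal := by
    refine hK.induction_on (p := fun K => ∃ δ : ℝ≥0, 0 < δ ∧ ∃ C : ℝ, 0 ≤ C ∧ ∀ a ∈ K, ∀ b,
      S.ccDist a b < δ → |u b - u a| ≤ C * (S.ccDist a b).toReal)
      ⟨1, one_pos, 0, le_rfl, fun q hq => hq.elim⟩ ?_ ?_ ?_
    · rintro s t hst ⟨δ, hδ, C, hC0, hC⟩
      exact ⟨δ, hδ, C, hC0, fun q hq => hC q (hst hq)⟩
    · rintro s t ⟨δ, hδ, C, hC0, hC⟩ ⟨δ', hδ', C', hC0', hC'⟩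
      refine ⟨min δ δ', lt_min hδ hδ', max C C', hC0.trans (le_max_left _ _), ?_⟩
      rintro a (ha | ha) b hab
      · refine (hC a ha b (hab.trans_le (by simp))).trans ?_
        gcongr
        exact le_max_left _ _
      · refine (hC' a ha b (hab.trans_le (by simp))).trans ?_
        gcongr
        exact le_max_right _ _
    · intro p hp
      obtain ⟨V, hV, h⟩ := hX.exists_abs_sub_le_ccDist hU hu hv h (hKU hp)
      exact ⟨V, mem_nhdsWithin_of_mem_nhds hV, h⟩
  obtain ⟨A, hA⟩ := hK.exists_bound_of_continuousOn (hu.mono hKU)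
  have hδ' : (0 : ℝ) < δ := hδ
  refine ⟨toNNReal (C * (δ : ℝ) ^ (1 - α) + 2 * |A| * (δ : ℝ) ^ (-α) + 1),
    fun p hp q hq => ?_⟩
  have hpos : 0 < C * (δ : ℝ) ^ (1 - α) + 2 * |A| * (δ : ℝ) ^ (-α) + 1 := by positivity
  rcases eq_or_ne (S.ccDist p q) ⊤ with htop | hne
  · rw [htop, ENNReal.top_rpow_of_pos hα.1, mul_top]
    · exact le_top
    · simpa using hpos
  set d := (S.ccDist p q).toReal with hd
  have hd0 : 0 ≤ d := toReal_nonneg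
  have h1 : S.ccDist p q ^ α = ofReal (d ^ α) := by
    rw [← ofReal_rpow_of_nonneg hd0 hα.1.le, hd, ofReal_toReal hne]
  rw [h1, show ((toNNReal (C * (δ : ℝ) ^ (1 - α) + 2 * |A| * (δ : ℝ) ^ (-α) + 1) : ℝ≥0) : ℝ≥0∞)
    = ofReal (C * (δ : ℝ) ^ (1 - α) + 2 * |A| * (δ : ℝ) ^ (-α) + 1) from rfl,
    ← ofReal_mul hpos.le]
  refine ofReal_le_ofReal ?_
  have hdα : 0 ≤ d ^ α := by positivity
  have hn1 : 0 ≤ C * (δ : ℝ) ^ (1 - α) := by positivity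
  have hn2 : 0 ≤ 2 * |A| * (δ : ℝ) ^ (-α) := by positivity
  rcases lt_or_ge d δ with hlt | hge
  · have h2 := hCK p hp q (by
      rw [← toReal_lt_toReal hne coe_ne_top]
      exact hlt)
    rw [abs_sub_comm] at h2
    have h3 : d ≤ (δ : ℝ) ^ (1 - α) * d ^ α := by
      rcases hd0.eq_or_lt with h0 | h0
      · rw [← h0]
        positivity
      · calc d = d ^ (1 - α) * d ^ α := by
              rw [← rpow_add h0, sub_add_cancel, Real.rpow_one]
          _ ≤ _ := by
              gcongr
              linarith [hα.2]
    have h4 := mul_le_mul_of_nonneg_left h3 hC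
    nlinarith
  · have h2 : |u p - u q| ≤ 2 * |A| := by
      have e1 := hA p hp
      have e2 := hA q hq
      have e3 := le_abs_self A
      rw [norm_eq_abs] at e1 e2
      linarith [abs_sub (u p) (u q)]
    have h3 : 1 ≤ (δ : ℝ) ^ (-α) * d ^ α := by
      rw [Real.rpow_neg hδ'.le, ← div_eq_inv_mul, one_le_div (by positivity)]
      exact Real.rpow_le_rpow hδ'.le hge hα.1.le
    have h4 : 2 * |A| ≤ 2 * |A| * ((δ : ℝ) ^ (-α) * d ^ α) :=
      le_mul_of_one_le_right (by positivity) h3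
    nlinarith

end Lipschitz

/-! ### Hölder regularity of maps with horizontal components in `C^{k,α}` -/

section Holder

variable {m s : ℕ} {M : Type*} [TopologicalSpace M]
  [ChartedSpace (Euc m) M] [IsManifold (𝓡 m) ∞ M]
  {S : SubRiemannian m s M} {U K : Set M} {α : ℝ} {u w : M → ℝ}

theorem SubRiemannian.IsHolderOn.add (hu : S.IsHolderOn α K u) (hw : S.IsHolderOn α K w) :
    S.IsHolderOn α K (u + w) := by
  obtain ⟨A, hA⟩ := hu
  obtain ⟨B, hB⟩ := hw
  refine ⟨A + B, fun p hp q hq => ?_⟩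
  calc ofReal |(u + w) p - (u + w) q|
      ≤ ofReal (|u p - u q| + |w p - w q|) := by
        refine ofReal_le_ofReal ((le_of_eq ?_).trans (abs_add_le _ _))
        congr 1
        simp only [Pi.add_apply]
        ring
    _ = ofReal |u p - u q| + ofReal |w p - w q| :=
        ofReal_add (abs_nonneg _) (abs_nonneg _)
    _ ≤ A * S.ccDist p q ^ α + B * S.ccDist p q ^ α :=
        add_le_add (hA p hp q hq) (hB p hp q hq)
    _ = _ := by rw [ENNReal.coe_add, add_mul]

theorem SubRiemannian.IsHolderOn.mul (hu : S.IsHolderOn α K u) (hw : S.IsHolderOn α K w)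
    {a b : ℝ≥0} (ha : ∀ p ∈ K, |u p| ≤ a) (hb : ∀ p ∈ K, |w p| ≤ b) :
    S.IsHolderOn α K (u * w) := by
  obtain ⟨A, hA⟩ := hu
  obtain ⟨B, hB⟩ := hw
  refine ⟨a * B + b * A, fun p hp q hq => ?_⟩
  calc ofReal |(u * w) p - (u * w) q|
      ≤ ofReal (a * |w p - w q| + b * |u p - u q|) := by
        refine ofReal_le_ofReal ?_
        have h1 : (u * w) p - (u * w) q = u p * (w p - w q) + w q * (u p - u q) := by
          simp only [Pi.mul_apply]
          ring
        rw [h1]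
        refine (abs_add_le _ _).trans ?_
        rw [abs_mul, abs_mul]
        gcongr
        exacts [ha p hp, hb q hq]
    _ = a * ofReal |w p - w q| + b * ofReal |u p - u q| := by
        rw [ofReal_add (by positivity) (by positivity), ofReal_mul a.coe_nonneg,
          ofReal_mul b.coe_nonneg, ofReal_coe_nnreal, ofReal_coe_nnreal]
    _ ≤ a * (B * S.ccDist p q ^ α) + b * (A * S.ccDist p q ^ α) := by
        gcongr
        exacts [hB p hp q hq, hA p hp q hq]
    _ = _ := by
        push_cast
        ring

/-- The functions that are continuous on `U` and Hölder continuous on its compact subsets. -/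
def SubRiemannian.HolderLoc (S : SubRiemannian m s M) (α : ℝ) (U : Set M) (u : M → ℝ) : Prop :=
  ContinuousOn u U ∧ ∀ K, IsCompact K → K ⊆ U → S.IsHolderOn α K u

theorem _root_.ContinuousOn.exists_nnreal_bound (hu : ContinuousOn u U) (hK : IsCompact K)
    (hKU : K ⊆ U) : ∃ a : ℝ≥0, ∀ p ∈ K, |u p| ≤ a := by
  obtain ⟨A, hA⟩ := hK.exists_bound_of_continuousOn (hu.mono hKU)
  exact ⟨toNNReal A, fun p hp => (hA p hp).trans (Real.le_coe_toNNReal A)⟩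

variable {X : Fin s → ∀ q : M, S.H q}

theorem calculusRules_holderLoc (k : ℕ) :
    CalculusRules (fun i u u' => ∀ p ∈ U,
      HasDerivAlong (fun q => (X i q).1) u p (u' p))
      (fun _ => S.HolderLoc α U) k where
  zero _ _ := ⟨continuousOn_const, fun K _ _ => ⟨0, fun p _ q _ => by simp⟩⟩
  add _ _ u w hu hw := ⟨hu.1.add hw.1, fun K hK hKU => (hu.2 K hK hKU).add (hw.2 K hK hKU)⟩
  mul _ _ _ u w hu hw := by
    refine ⟨hu.1.mul hw.1, fun K hK hKU => ?_⟩
    obtain ⟨a, ha⟩ := hu.1.exists_nnreal_bound hK hKU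
    obtain ⟨b, hb⟩ := hw.1.exists_nnreal_bound hK hKU
    exact (hu.2 K hK hKU).mul (hw.2 K hK hKU) ha hb
  deriv_zero i p _ γ _ _ := hasDerivAt_const 0 (0 : ℝ)
  deriv_add i _ _ u w u' w' _ _ _ _ h h' p hp γ hγ0 hγ := (h p hp γ hγ0 hγ).add (h' p hp γ hγ0 hγ)
  deriv_mul i _ _ _ u w u' w' _ _ _ _ h h' p hp γ hγ0 hγ := by
    have := (h p hp γ hγ0 hγ).mul (h' p hp γ hγ0 hγ)
    simp only [Function.comp_apply, hγ0] at this
    exact this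

/-- The chain rule along flows. -/
theorem hasDerivAlong_comp {Y : ∀ q : M, TangentSpace (𝓡 m) q} {n : ℕ} {F : M → Euc n} {p : M}
    {g : Fin n → ℝ} (h : ∀ j, HasDerivAlong Y (fun q => F q j) p (g j)) {A : Euc n → ℝ}
    (hA : DifferentiableAt ℝ A (F p)) :
    HasDerivAlong Y (A ∘ F) p (∑ j, fderiv ℝ A (F p) (EuclideanSpace.single j 1) * g j) := by
  intro γ hγ0 hγ
  have h1 : HasDerivAt (fun t => F (γ t)) (WithLp.toLp 2 g : Euc n) 0 := by
    have h2 : HasDerivAt (fun t => (fun j => F (γ t) j : Fin n → ℝ)) g 0 :=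
      hasDerivAt_pi.2 fun j => h j γ hγ0 hγ
    exact ((PiLp.continuousLinearEquiv 2 ℝ (fun _ : Fin n => ℝ)).symm : (Fin n → ℝ) →L[ℝ]
      Euc n).hasFDerivAt.comp_hasDerivAt 0 h2
  have h3 : HasFDerivAt A (fderiv ℝ A (F p)) (F (γ 0)) := by
    rw [hγ0]
    exact hA.hasFDerivAt
  have h4 := h3.comp_hasDerivAt 0 h1
  refine h4.congr_deriv ?_
  have h5 : (WithLp.toLp 2 g : Euc n) = ∑ j, g j • EuclideanSpace.single j (1 : ℝ) := by
    ext i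
    simp [Finset.sum_apply, Pi.single_apply]
  rw [h5, map_sum]
  refine sum_congr rfl fun j _ => ?_
  rw [map_smul, smul_eq_mul, mul_comm]

variable [T2Space M] [SecondCountableTopology M]

theorem SubRiemannian.IsOrthonormalFrame.holderLoc (hX : S.IsOrthonormalFrame U X)
    (hU : IsOpen U) (hα : α ∈ Ioo (0 : ℝ) 1) {v : Fin s → M → ℝ} (hu : ContinuousOn u U)
    (hv : ∀ i, ContinuousOn (v i) U)
    (h : ∀ i, ∀ p ∈ U, HasDerivAlong (fun q => (X i q).1) u p (v i p)) :
    S.HolderLoc α U u :=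
  ⟨hu, fun _ hK hKU => hX.isHolderOn hU hu hv h hK hKU hα⟩

variable [MeasurableSpace M] [BorelSpace M] {n r : ℕ} {N : Type*}
  [TopologicalSpace N] [ChartedSpace (Euc n) N] [IsManifold (𝓡 n) ∞ N]
  [T2Space N] [SecondCountableTopology N] [Nonempty N]
  {T : SubRiemannian n r N} {μ : Measure M} {Q : ℝ} {f : M → N}

theorem IsACC.memHolderLoc (hμ : IsSmoothVolume (n := m) μ) (hQ : 1 ≤ Q)
    (hfc : Continuous f) (hf : IsACC S T μ Q f)
    {y : OpenPartialHomeomorph N (Euc n)}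
    (hy : y ∈ IsManifold.maximalAtlas (𝓡 n) ∞ N) {Y : Fin r → ∀ q : N, T.H q}
    (hY : T.IsHorizontalCoordinates y Y) {Ω : Set M} (hfΩ : MapsTo f Ω y.source) {k : ℕ}
    (hk : 1 ≤ k) (hα : α ∈ Ioo (0 : ℝ) 1)
    (h : ∀ j : Fin r, S.MemHolderLoc k α Ω (fun q => y (f q) (Fin.castLE T.rank_le j)))
    (j : Fin n) : S.MemHolderLoc k α Ω (fun q => y (f q) j) := by
  intro U X hU hUΩ hX
  obtain ⟨G, hG⟩ := hY.exists_coeff hy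
  have hfO : ∀ q ∈ U, f q ∈ y.source := fun q hq => hfΩ (hUΩ hq)
  choose v hv0 hvD hvc hvK using fun l => h l U X hU hUΩ hX
  set D : Fin s → (M → ℝ) → (M → ℝ) → Prop := fun i u u' => ∀ p ∈ U,
    HasDerivAlong (fun q => (X i q).1) u p (u' p) with hD
  set F : M → Euc n := fun q => y (f q) with hF
  have hFc : ContinuousOn F U := y.continuousOn.comp hfc.continuousOn hfO
  have hFO : ∀ q ∈ U, F q ∈ y.target := fun q hq => y.map_source (hfO q hq)
  have hFj : ∀ j, ContinuousOn (fun q => F q j) U := fun j =>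
    (EuclideanSpace.proj (𝕜 := ℝ) j).continuous.comp_continuousOn hFc
  have hGy : ∀ j l, ContDiffOn ℝ ∞ (G j l ∘ y.symm) y.target := fun j l =>
    (((hG j).smooth_coeff l).comp (contMDiffOn_symm_of_mem_maximalAtlas hy) fun x hx =>
      y.map_target hx).contDiffOn
  have hder : ∀ i, ∀ g : Fin r → M → ℝ, (∀ l, ContinuousOn (g l) U) →
      (∀ l, D i (fun q => F q (Fin.castLE T.rank_le l)) (g l)) →
      ∀ j, D i (fun q => F q j) (∑ l, ((G j l ∘ y.symm) ∘ F) * g l) := by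
    intro i g hgc hg j p hp
    have := hf.hasDerivAlong_of_horizontal hU hX hμ hQ hfc hfO (hG j) hgc hg hp
    simpa [Finset.sum_apply, hF, y.left_inv (hfO p hp)] using this
  -- first derivatives of all coordinates, which make these locally Lipschitz
  have hg0 : ∀ i l, ContinuousOn (v l [i]) U := fun i l => hvc l [i] (by simpa using hk)
  have hD0 : ∀ i j, D i (fun q => F q j) (∑ l, ((G j l ∘ y.symm) ∘ F) * v l [i]) := fun i j =>
    hder i (fun l => v l [i]) (hg0 i) (fun l p hp => by
      have := hvD l [] hk i p hp
      rwa [hv0] at this) j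
  have hcomp : ∀ {A : Euc n → ℝ}, ContDiffOn ℝ ∞ A y.target → ContinuousOn (A ∘ F) U :=
    fun hA => hA.continuousOn.comp hFc hFO
  have hD0c : ∀ i j, ContinuousOn (∑ l, ((G j l ∘ y.symm) ∘ F) * v l [i]) U := fun i j => by
    rw [show (∑ l, ((G j l ∘ y.symm) ∘ F) * v l [i]) =
      fun q => ∑ l, ((G j l ∘ y.symm) ∘ F) q * v l [i] q by ext q; simp [Finset.sum_apply]]
    exact continuousOn_finsetSum _ fun l _ => (hcomp (hGy j l)).mul (hg0 i l)
  have hchain : ∀ {A : Euc n → ℝ}, ContDiffOn ℝ ∞ A y.target → ∀ i (g : Fin n → M → ℝ),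
      (∀ j, D i (fun q => F q j) (g j)) → D i (A ∘ F)
        (∑ j, ((fun z => fderiv ℝ A z (EuclideanSpace.single j 1)) ∘ F) * g j) := by
    intro A hA i g hg p hp
    have := hasDerivAlong_comp (F := F) (fun j => hg j p hp)
      ((hA.contDiffAt (y.open_target.mem_nhds (hFO p hp))).differentiableAt (by simp))
    simpa [Finset.sum_apply] using this
  have hfd : ∀ {A : Euc n → ℝ}, ContDiffOn ℝ ∞ A y.target → ∀ j,
      ContDiffOn ℝ ∞ (fun z => fderiv ℝ A z (EuclideanSpace.single j 1)) y.target := fun hA j =>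
    (hA.fderiv_of_isOpen y.open_target (m := ∞) (by simp)).clm_apply contDiffOn_const
  have hT := CalculusRules.tower_of_horizontal (calculusRules_holderLoc (S := S) (U := U) (α := α)
    (X := X) k) (fun j q => F q j) (Fin.castLE T.rank_le)
    {c | ∃ A : Euc n → ℝ, ContDiffOn ℝ ∞ A y.target ∧ c = A ∘ F} ?_
    (fun j => hX.holderLoc hU hα (hFj j) (fun i => hD0c i j) fun i => hD0 i j)
    (fun j l => (G j l ∘ y.symm) ∘ F) (fun j l => ⟨_, hGy j l, rfl⟩)
    (fun i g _ hg => hder i g (fun l => (hg l).2.1) fun l => (hg l).1) ?_ j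
  · obtain ⟨V, hV0, hVD, hVP⟩ := hT.exists_family
    refine ⟨V, hV0, hVD, fun I hI => (hVP I hI).1, fun K hK hKU => ?_⟩
    have hb : ∀ I : List (Fin s), ∃ c : ℝ≥0, I.length ≤ k → (∀ p ∈ K, |V I p| ≤ c) ∧
        ∀ p ∈ K, ∀ q ∈ K, ofReal |V I p - V I q| ≤ c * S.ccDist p q ^ α := by
      intro I
      by_cases hI : I.length ≤ k
      · obtain ⟨a, ha⟩ := (hVP I hI).1.exists_nnreal_bound hK hKU
        obtain ⟨c, hc⟩ := (hVP I hI).2 K hK hKU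
        refine ⟨a + c, fun _ => ⟨fun p hp => (ha p hp).trans (by simp), fun p hp q hq =>
          (hc p hp q hq).trans ?_⟩⟩
        gcongr
        simp
      · exact ⟨0, fun h => absurd h hI⟩
    choose c hc using hb
    have hfin := List.finite_length_le (Fin s) k
    have hle : ∀ I : List (Fin s), I.length ≤ k → c I ≤ ∑ J ∈ hfin.toFinset, c J := fun I hI =>
      single_le_sum (f := c) (fun _ _ => zero_le) (hfin.mem_toFinset.2 hI)
    refine ⟨∑ J ∈ hfin.toFinset, c J, fun I hI p hp => ?_, fun I hI p hp q hq => ?_⟩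
    · exact ((hc I (by omega)).1 p hp).trans (by exact_mod_cast hle I (by omega))
    · refine ((hc I hI.le).2 p hp q hq).trans ?_
      gcongr
      exact hle I hI.le
  · rintro _ ⟨A, hA, rfl⟩
    refine ⟨hX.holderLoc hU hα (hcomp hA) (fun i => ?_) fun i => hchain hA i _ (hD0 i), fun j => _,
      fun j => ⟨_, hfd hA j, rfl⟩, fun i g _ hg => hchain hA i g fun j => (hg j).1⟩
    rw [show (∑ j, ((fun z => fderiv ℝ A z (EuclideanSpace.single j 1)) ∘ F) *
      (∑ l, ((G j l ∘ y.symm) ∘ F) * v l [i])) = fun q => ∑ j,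
        ((fun z => fderiv ℝ A z (EuclideanSpace.single j 1)) ∘ F) q *
      (∑ l, ((G j l ∘ y.symm) ∘ F) * v l [i]) q by ext q; simp [Finset.sum_apply]]
    exact continuousOn_finsetSum _ fun j _ => (hcomp (hfd hA j)).mul (hD0c i j)
  · intro l
    rw [show (fun q => F q (Fin.castLE T.rank_le l)) = v l [] from (hv0 l).symm]
    refine Tower.of_family (v l) (fun I hI i => hvD l I hI i) fun I hI => ?_
    rcases hI.lt_or_eq with hlt | heq
    · exact hX.holderLoc hU hα (hvc l I hI) (v := fun i => v l (i :: I))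
        (fun i => hvc l (i :: I) (by simpa using hlt)) fun i => hvD l I hlt i
    · refine ⟨hvc l I hI, fun K hK hKU => ?_⟩
      obtain ⟨C, -, hC⟩ := hvK l K hK hKU
      exact ⟨C, hC I heq⟩

end Holder

/-! ### Weak derivatives on the manifold and in charts -/

theorem Tower.map {ι α β : Type*} {D : ι → (α → ℝ) → (α → ℝ) → Prop} {P : ℕ → (α → ℝ) → Prop}
    {D' : ι → (β → ℝ) → (β → ℝ) → Prop} {P' : ℕ → (β → ℝ) → Prop} (Λ : (α → ℝ) → β → ℝ)
    (hD : ∀ i l u u', P l u → P (l + 1) u' → D i u u' → D' i (Λ u) (Λ u'))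
    (hP : ∀ l u, P l u → P' l (Λ u)) {t a : ℕ} {u : α → ℝ} (h : Tower D P t a u) :
    Tower D' P' t a (Λ u) := by
  induction t generalizing a u with
  | zero => exact hP a u h
  | succ t ih =>
    refine ⟨hP a u h.1, fun i => ?_⟩
    obtain ⟨u', h1, h2⟩ := h.2 i
    exact ⟨Λ u', hD i a u u' h.1 h2.base h1, ih h2⟩

theorem _root_.ContMDiffOn.isTestFunction_indicator_comp {n : ℕ} {M M' : Type*}
    [TopologicalSpace M] [ChartedSpace (Euc n) M]
    [IsManifold (𝓡 n) ∞ M] [T2Space M] [TopologicalSpace M']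
    [ChartedSpace (Euc n) M'] [IsManifold (𝓡 n) ∞ M']
    {e : OpenPartialHomeomorph M M'} (he : ContMDiffOn (𝓡 n) (𝓡 n) ∞ e e.source) {V : Set M'}
    {φ : M' → ℝ} (hφ : IsTestFunction (n := n) V φ) (hV : V ⊆ e.target) :
    IsTestFunction (n := n) (e.source ∩ e ⁻¹' V) (e.source.indicator (φ ∘ e)) := by
  have hL : IsCompact (e.symm '' tsupport φ) :=
    hφ.2.1.image_of_continuousOn (e.continuousOn_symm.mono (hφ.2.2.trans hV))
  have hsupp : Function.support (e.source.indicator (φ ∘ e)) ⊆ e.symm '' tsupport φ := by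
    intro q hq
    rw [Function.mem_support, indicator_apply_ne_zero] at hq
    exact ⟨e q, subset_tsupport _ hq.2, e.left_inv hq.1⟩
  have hts : tsupport (e.source.indicator (φ ∘ e)) ⊆ e.source ∩ e ⁻¹' V := by
    refine (closure_minimal hsupp hL.isClosed).trans ?_
    rintro _ ⟨x, hx, rfl⟩
    have hxt := hV (hφ.2.2 hx)
    exact ⟨e.map_target hxt, by rw [mem_preimage, e.right_inv hxt]; exact hφ.2.2 hx⟩
  refine ⟨contMDiff_of_tsupport fun q hq => ?_, HasCompactSupport.of_support_subset_isCompact hL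
    hsupp, hts⟩
  have hqs := (hts hq).1
  refine (hφ.1.contMDiffAt.comp q (he.contMDiffAt (e.open_source.mem_nhds hqs))
    ).congr_of_eventuallyEq ?_
  filter_upwards [e.open_source.mem_nhds hqs] with q' hq' using indicator_of_mem hq' _

section Transfer

variable {m s : ℕ} {M : Type*} [TopologicalSpace M]
  [ChartedSpace (Euc m) M]

/-- The function on the manifold, zero outside of the chart domain, with expression `a` in the
chart `e`. -/
noncomputable def chartLift (e : OpenPartialHomeomorph M (Euc m))
    (a : Euc m → ℝ) : M → ℝ :=
  e.source.indicator (a ∘ e)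

variable {e : OpenPartialHomeomorph M (Euc m)} {W : Set (Euc m)}

theorem chartLift_symm_apply (a : Euc m → ℝ) {x : Euc m} (hx : x ∈ e.target) :
    chartLift e a (e.symm x) = a x := by
  rw [chartLift, indicator_of_mem (e.map_target hx), Function.comp_apply, e.right_inv hx]

theorem chartLift_eq_zero {a : Euc m → ℝ} (ha : ∀ x ∉ W, a x = 0) {q : M}
    (hq : q ∉ e.source ∩ e ⁻¹' W) : chartLift e a q = 0 := by
  by_cases h : q ∈ e.source
  · rw [chartLift, indicator_of_mem h]
    exact ha _ fun h' => hq ⟨h, h'⟩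
  · exact indicator_of_notMem h _

theorem IsTest.eq_zero {φ : Euc m → ℝ} (hφ : IsTest W φ) : ∀ x ∉ W, φ x = 0 :=
  fun _ hx => image_eq_zero_of_notMem_tsupport fun h => hx (hφ.2.2 h)

variable [MeasurableSpace M] [BorelSpace M] {μ : Measure M} {dens : Euc m → ℝ}

theorem IsChartDensity.integral_eq_of_forall_notMem (hden : IsChartDensity μ e dens)
    (hW : IsOpen W) (hWe : W ⊆ e.target) {F : M → ℝ} (hF : ∀ q ∉ e.source ∩ e ⁻¹' W, F q = 0)
    (hFm : AEStronglyMeasurable F (μ.restrict (e.source ∩ e ⁻¹' W))) :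
    ∫ q, F q ∂μ = ∫ x in W, dens x * F (e.symm x) := by
  have hind : (e.source ∩ e ⁻¹' W).indicator F = F := indicator_eq_self.2 fun q hq => by
    by_contra h
    exact hq (hF q h)
  have hmeas : AEStronglyMeasurable F μ := by
    rw [← hind]
    exact (aestronglyMeasurable_indicator_iff (e.isOpen_inter_preimage hW).measurableSet).2 hFm
  rw [← setIntegral_eq_integral_of_forall_compl_eq_zero (s := e.source) fun q hq => hF q
    fun h => hq h.1, hden.integral_eq hmeas.restrict]
  refine (setIntegral_eq_of_subset_of_forall_sdiff_eq_zero e.open_target.measurableSet hWe ?_)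
  rintro x ⟨hx, hxW⟩
  rw [hF, mul_zero]
  rintro ⟨-, h⟩
  rw [mem_preimage, e.right_inv hx] at h
  exact hxW h

theorem IsChartDensity.integral_mul_eq (hden : IsChartDensity μ e dens)
    (hW : IsOpen W) (hWe : W ⊆ e.target) {F G : M → ℝ}
    (hFG : ∀ q ∉ e.source ∩ e ⁻¹' W, F q * G q = 0)
    (hF : AEStronglyMeasurable F (μ.restrict (e.source ∩ e ⁻¹' W)))
    (hG : AEStronglyMeasurable G (μ.restrict (e.source ∩ e ⁻¹' W))) :
    ∫ q, F q * G q ∂μ = ∫ x in W, dens x * (F (e.symm x) * G (e.symm x)) :=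
  hden.integral_eq_of_forall_notMem hW hWe hFG (hF.mul hG)

theorem IsChartDensity.aestronglyMeasurable_chartLift (hden : IsChartDensity μ e dens)
    {a : Euc m → ℝ} (ha : AEStronglyMeasurable a volume) :
    AEStronglyMeasurable (chartLift e a) μ := by
  rw [chartLift, aestronglyMeasurable_indicator_iff e.open_source.measurableSet]
  refine AEStronglyMeasurable.comp_aemeasurable ?_ aemeasurable_chart
  rw [hden.map_eq]
  exact ha.restrict.mono_ac (withDensity_absolutelyContinuous _ _)

theorem IsChartDensity.memLp_chartLift (hden : IsChartDensity μ e dens) {K : Set (Euc m)}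
    (hK : IsCompact K) (hKe : K ⊆ e.target) {a : Euc m → ℝ} {p : ℝ≥0∞} (ha : MemLpIn p K a) :
    MemLp (chartLift e a) p μ := by
  have h1 : K.indicator a = a := indicator_eq_self.2 fun x hx => by
    by_contra h
    exact hx (ha.2 x h)
  have h2 := hden.memLp_comp hK hKe (ha.1.restrict K)
  rw [h1] at h2
  exact (memLp_indicator_iff_restrict e.open_source.measurableSet).2 h2

variable [IsManifold (𝓡 m) ∞ M] [T2Space M]
  {S : SubRiemannian m s M} {U : Set M} {X : Fin s → ∀ q : M, S.H q} {K₀ : Set (Euc m)}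
  {b : Fin s → Euc m → Euc m} {i : Fin s}

omit [MeasurableSpace M] [BorelSpace M] in
theorem isTestFunction_chartLift (he : e ∈ IsManifold.maximalAtlas (𝓡 m) ∞ M) {φ : Euc m → ℝ}
    (hφ : IsTest W φ) (hW : W ⊆ e.target) :
    IsTestFunction (n := m) (e.source ∩ e ⁻¹' W) (chartLift e φ) :=
  (contMDiffOn_of_mem_maximalAtlas he).isTestFunction_indicator_comp
    (isTestFunction_iff_isTest.2 hφ) hW

omit [MeasurableSpace M] [BorelSpace M] [T2Space M] in
theorem isTest_comp_symm (he : e ∈ IsManifold.maximalAtlas (𝓡 m) ∞ M) {w : M → ℝ}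
    (hw : IsTestFunction (n := m) (e.source ∩ e ⁻¹' W) w) :
    IsTest W (e.target.indicator (w ∘ e.symm)) := by
  have h1 : ContMDiffOn (𝓡 m) (𝓡 m) ∞ e.symm e.symm.source :=
    contMDiffOn_symm_of_mem_maximalAtlas he
  have h2 := h1.isTestFunction_indicator_comp (V := e.source ∩ e ⁻¹' W) hw fun q hq => hq.1
  have h3 := isTestFunction_iff_isTest.1 h2
  refine h3.mono ?_
  rintro x ⟨hx, -, h⟩
  rw [mem_preimage] at h
  rwa [← e.right_inv hx]

omit [MeasurableSpace M] [BorelSpace M] [T2Space M] in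
theorem FlowBox.target (B : FlowBox S U X e W K₀ b) : W ⊆ e.target :=
  B.subset.trans B.subset_target

omit [MeasurableSpace M] [BorelSpace M] [T2Space M] in
theorem FlowBox.dirDeriv_symm_apply (B : FlowBox S U X e W K₀ b) {w : M → ℝ} {w' : Euc m → ℝ}
    (hw : ContMDiff (𝓡 m) 𝓘(ℝ, ℝ) ∞ w) (hww : ∀ x ∈ e.target, w (e.symm x) = w' x) {x : Euc m}
    (hx : x ∈ W) (i : Fin s) :
    dirDeriv (fun q => (X i q).1) w (e.symm x) = fderiv ℝ w' x (b i x) := by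
  have h1 : w ∘ e.symm =ᶠ[𝓝 x] w' := by
    filter_upwards [e.open_target.mem_nhds (B.target hx)] with z hz using hww z hz
  rw [SubRiem.dirDeriv_symm_apply B.mem_atlas (B.target hx) (hw.mdifferentiableAt (by simp)),
    h1.fderiv_eq, B.eq_pushField i x hx]

omit [T2Space M] [MeasurableSpace M] [BorelSpace M] in
theorem FlowBox.preimage_subset (B : FlowBox S U X e W K₀ b) : e.source ∩ e ⁻¹' W ⊆ U :=
  fun q hq => by
    have := B.maps _ (B.subset hq.2)
    rwa [e.left_inv hq.1] at this

omit [T2Space M] [MeasurableSpace M] [BorelSpace M] in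
theorem FlowBox.continuousOn_dirDeriv (B : FlowBox S U X e W K₀ b) (hX : IsFrameOf S.H U X)
    {w : M → ℝ} (hw : ContMDiff (𝓡 m) 𝓘(ℝ, ℝ) ∞ w) (i : Fin s) :
    ContinuousOn (dirDeriv (fun q => (X i q).1) w) (e.source ∩ e ⁻¹' W) := by
  exact (((hX.1 i).mono B.preimage_subset).contMDiffOn_dirDeriv (e.isOpen_inter_preimage B.isOpen)
    hw.contMDiffOn).continuousOn

/-- Distributional derivatives on the manifold, seen in a chart. -/
theorem FlowBox.weakDeriv_of_hasWeakDeriv (B : FlowBox S U X e W K₀ b) (hX : IsFrameOf S.H U X)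
    (hden : IsChartDensity μ e dens) {u v : M → ℝ}
    (hu : AEStronglyMeasurable u (μ.restrict (e.source ∩ e ⁻¹' W)))
    (hv : AEStronglyMeasurable v (μ.restrict (e.source ∩ e ⁻¹' W)))
    (h : HasWeakDeriv μ (e.source ∩ e ⁻¹' W) (fun q => (X i q).1) u v) :
    WeakDeriv (b i) W (fun x => u (e.symm x)) (fun x => v (e.symm x)) := by
  have hUo : IsOpen (e.source ∩ e ⁻¹' W) := e.isOpen_inter_preimage B.isOpen
  -- dividing by the density turns Lebesgue measure into the volume
  have hdiv : ∀ {ζ : Euc m → ℝ}, IsTest W ζ → IsTest W fun x => ζ x • (dens x)⁻¹ := by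
    intro ζ hζ
    refine ⟨contDiff_of_tsupport_subset e.open_target hζ.1 (hζ.2.2.trans B.target)
      (hden.contDiffOn.inv fun x hx => (hden.pos x hx).ne'), hζ.2.1.smul_right, ?_⟩
    exact (tsupport_smul_subset_left _ _).trans hζ.2.2
  have hint : ∀ {ζ : Euc m → ℝ}, IsTest W ζ → ∀ {w : M → ℝ},
      AEStronglyMeasurable w (μ.restrict (e.source ∩ e ⁻¹' W)) →
      ∫ q, w q * chartLift e (fun x => ζ x • (dens x)⁻¹) q ∂μ = ∫ x, w (e.symm x) * ζ x := by
    intro ζ hζ w hw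
    rw [hden.integral_mul_eq B.isOpen B.target (fun q hq => by
        rw [chartLift_eq_zero (hdiv hζ).eq_zero hq, mul_zero]) hw
      (isTestFunction_chartLift B.mem_atlas (hdiv hζ)
        B.target).1.continuous.aestronglyMeasurable.restrict,
      ← setIntegral_eq_integral_of_forall_compl_eq_zero (s := W)
        (f := fun x => w (e.symm x) * ζ x) fun x hx => by rw [hζ.eq_zero x hx, mul_zero]]
    refine setIntegral_congr_fun B.isOpen.measurableSet fun x hx => ?_
    have := (hden.pos x (B.target hx)).ne'
    simp only [chartLift_symm_apply _ (B.target hx), smul_eq_mul]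
    field_simp
  intro φ hφ
  have hφ' := hφ.adjointDeriv (B.contDiff i)
  rw [← hint hφ' hu, ← hint hφ hv]
  refine h _ _ (isTestFunction_chartLift B.mem_atlas (hdiv hφ) B.target)
    (isTestFunction_chartLift B.mem_atlas (hdiv hφ') B.target) fun w hw => ?_
  have hw' := isTest_comp_symm B.mem_atlas hw
  have e1 := hint hφ' hw.1.continuous.aestronglyMeasurable.restrict
  have e2 := hint hφ ((B.continuousOn_dirDeriv hX hw.1 i).aestronglyMeasurable hUo.measurableSet)
  simp only [mul_comm (chartLift e _ _)]
  rw [e1, e2]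
  have e3 := integral_mul_adjointDeriv ((B.contDiff i).of_le (by simp)) (hw'.1.of_le (by simp))
    (hφ.1.of_le (by simp)) hφ.2.1
  convert e3 using 1
  · refine integral_congr_ae (ae_of_all _ fun x => ?_)
    by_cases hx : x ∈ W
    · simp [indicator_of_mem (B.target hx)]
    · simp [hφ'.eq_zero x hx]
  · refine integral_congr_ae (ae_of_all _ fun x => ?_)
    by_cases hx : x ∈ W
    · simp only
      rw [B.dirDeriv_symm_apply hw.1 (fun z hz => ?_) hx]
      simp [indicator_of_mem hz]
    · simp [hφ.eq_zero x hx]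

/-- Weak derivatives of compactly supported functions in a chart are distributional derivatives
on the manifold. -/
theorem FlowBox.hasWeakDeriv_chartLift (B : FlowBox S U X e W K₀ b) (hX : IsFrameOf S.H U X)
    (hden : IsChartDensity μ e dens) {K : Set (Euc m)} (hK : IsCompact K) (hKW : K ⊆ W)
    {a a' : Euc m → ℝ} (ha : AEStronglyMeasurable a volume) (haK : ∀ x ∉ K, a x = 0)
    (ha' : AEStronglyMeasurable a' volume) (haK' : ∀ x ∉ K, a' x = 0)
    (h : WeakDeriv (b i) univ a a') :
    HasWeakDeriv μ U (fun q => (X i q).1) (chartLift e a)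
      (chartLift e a') := by
  intro φ ψ hφ hψ hφψ
  obtain ⟨ζ, hζ, hζ1, -⟩ := exists_isTest_eq_one hK B.isOpen hKW
  obtain ⟨W₀, hW₀, hKW₀, hζW₀⟩ := eventually_nhdsSet_iff_exists.1 hζ1
  set W₁ := W₀ ∩ W with hW₁def
  have hW₁ : IsOpen W₁ := hW₀.inter B.isOpen
  have hW₁W : W₁ ⊆ W := inter_subset_right
  have hlow : ∀ {w : M → ℝ}, ContMDiff (𝓡 m) 𝓘(ℝ, ℝ) ∞ w →
      ContDiffOn ℝ ∞ (fun x => dens x * w (e.symm x)) e.target := fun hw =>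
    hden.contDiffOn.mul (hw.comp_contMDiffOn
      (contMDiffOn_symm_of_mem_maximalAtlas B.mem_atlas)).contDiffOn
  set φ' : Euc m → ℝ := fun x => ζ x • (dens x * φ (e.symm x)) with hφ'
  have hφt : IsTest W φ' :=
    ⟨contDiff_of_tsupport_subset e.open_target hζ.1 (hζ.2.2.trans B.target) (hlow hφ.1),
      hζ.2.1.smul_right, (tsupport_smul_subset_left _ _).trans hζ.2.2⟩
  have hφ1 : ∀ x ∈ W₁, φ' x = dens x * φ (e.symm x) := fun x hx => by
    simp [hφ', hζW₀ x hx.1]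
  -- the adjoint on the manifold is that of the chart, up to the density
  have hadj : ∀ᵐ x, x ∈ W₁ → dens x * ψ (e.symm x) = adjointDeriv (b i) φ' x := by
    refine ae_eq_of_forall_integral_mul_eq hW₁
      (((hlow hψ.1).continuousOn.mono (hW₁W.trans B.target)).locallyIntegrableOn
        hW₁.measurableSet)
      ((hφt.adjointDeriv (B.contDiff i)).1.continuous.continuousOn.locallyIntegrableOn
        hW₁.measurableSet) fun η hη => ?_
    have hηW := hη.mono hW₁W
    have hηM := isTestFunction_chartLift B.mem_atlas hηW B.target
    have hηU : IsTestFunction (n := m) U (chartLift e η) := ⟨hηM.1, hηM.2.1,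
      hηM.2.2.trans B.preimage_subset⟩
    have h1 := hφψ _ hηU
    rw [hden.integral_mul_eq B.isOpen B.target (fun q hq => by
        rw [chartLift_eq_zero hηW.eq_zero hq, mul_zero])
        hψ.1.continuous.aestronglyMeasurable.restrict
        hηM.1.continuous.aestronglyMeasurable.restrict,
      hden.integral_mul_eq B.isOpen B.target (fun q hq => by
        have : dirDeriv (fun q => (X i q).1) (chartLift e η) q = 0 := by
          have h0 := mderiv_eq_zero_of_notMem_tsupport (n := m) fun hq' => hq (hηM.2.2 hq')
          exact congrArg (fun A : Euc m →L[ℝ] ℝ => A (X i q).1) h0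
        rw [this, mul_zero])
        hφ.1.continuous.aestronglyMeasurable.restrict
        ((B.continuousOn_dirDeriv hX hηM.1 i).aestronglyMeasurable
          (e.isOpen_inter_preimage B.isOpen).measurableSet)] at h1
    have h2 := integral_mul_adjointDeriv ((B.contDiff i).of_le (by simp)) (hη.1.of_le (by simp))
      (hφt.1.of_le (by simp)) hφt.2.1
    simp only [mul_comm (adjointDeriv (b i) φ' _)]
    rw [h2]
    rw [← setIntegral_eq_integral_of_forall_compl_eq_zero (s := W)
        (f := fun x => dens x * ψ (e.symm x) * η x) fun x hx => by
        rw [hηW.eq_zero x hx, mul_zero],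
      ← setIntegral_eq_integral_of_forall_compl_eq_zero (s := W)
        (f := fun x => fderiv ℝ η x (b i x) * φ' x) fun x hx => by
        rw [hφt.eq_zero x hx, mul_zero]]
    refine Eq.trans ?_ (h1.trans ?_)
    · refine setIntegral_congr_fun B.isOpen.measurableSet fun x hx => ?_
      simp only [chartLift_symm_apply _ (B.target hx)]
      ring
    · refine setIntegral_congr_fun B.isOpen.measurableSet fun x hx => ?_
      rw [B.dirDeriv_symm_apply hηM.1 (fun z hz => chartLift_symm_apply _ hz) hx]
      by_cases hx1 : x ∈ W₁
      · rw [hφ1 x hx1]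
        ring
      · have : fderiv ℝ η x (b i x) = 0 := (hη.fderiv_apply (B.contDiff i)).eq_zero x hx1
        rw [this]
        ring
  have hint : ∀ {c : Euc m → ℝ}, AEStronglyMeasurable c volume → (∀ x ∉ K, c x = 0) →
      ∀ {w : M → ℝ}, Continuous w →
      ∫ q, chartLift e c q * w q ∂μ = ∫ x, c x * (dens x * w (e.symm x)) := by
    intro c hc hcK w hw
    have hcW : ∀ x ∉ W, c x = 0 := fun x hx => hcK x fun h => hx (hKW h)
    rw [hden.integral_mul_eq B.isOpen B.target (fun q hq => by
        rw [chartLift_eq_zero hcW hq, zero_mul])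
        (hden.aestronglyMeasurable_chartLift hc).restrict hw.aestronglyMeasurable.restrict,
      ← setIntegral_eq_integral_of_forall_compl_eq_zero (s := W)
        (f := fun x => c x * (dens x * w (e.symm x))) fun x hx => by rw [hcW x hx, zero_mul]]
    refine setIntegral_congr_fun B.isOpen.measurableSet fun x hx => ?_
    simp only [chartLift_symm_apply _ (B.target hx)]
    ring
  rw [hint ha haK hψ.1.continuous, hint ha' haK' hφ.1.continuous]
  calc ∫ x, a x * (dens x * ψ (e.symm x)) = ∫ x, a x * adjointDeriv (b i) φ' x := by
        refine integral_congr_ae ?_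
        filter_upwards [hadj] with x hx
        by_cases hxK : x ∈ K
        · rw [hx ⟨hKW₀ hxK, hKW hxK⟩]
        · simp [haK x hxK]
    _ = ∫ x, a' x * φ' x := h φ' (hφt.mono (subset_univ _))
    _ = _ := by
        refine integral_congr_ae (ae_of_all _ fun x => ?_)
        by_cases hxK : x ∈ K
        · simp only [hφ1 x ⟨hKW₀ hxK, hKW hxK⟩]
        · simp [haK' x hxK]

end Transfer

/-! ### Sobolev regularity of maps with horizontal components in `W^{k,p}`: the global statement -/

theorem Tower.congr_base {ι α : Type*} {D : ι → (α → ℝ) → (α → ℝ) → Prop}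
    {P : ℕ → (α → ℝ) → Prop} {t a : ℕ} {u w : α → ℝ} (h : Tower D P t a u)
    (hD : ∀ i u', D i u u' → D i w u') (hP : P a u → P a w) : Tower D P t a w := by
  cases t with
  | zero => exact hP h
  | succ t =>
    refine ⟨hP h.1, fun i => ?_⟩
    obtain ⟨u', h1, h2⟩ := h.2 i
    exact ⟨u', hD i u' h1, h2⟩

theorem Tower.of_zero {ι α : Type*} {D : ι → (α → ℝ) → (α → ℝ) → Prop}
    {P : ℕ → (α → ℝ) → Prop} (hD : ∀ i, D i 0 0) (hP : ∀ a, P a 0) {t a : ℕ} :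
    Tower D P t a 0 := by
  induction t generalizing a with
  | zero => exact hP a
  | succ t ih => exact ⟨hP a, fun i => ⟨0, hD i, ih⟩⟩

section GlobalSobolev

variable {m s : ℕ} {M : Type*} [TopologicalSpace M]
  [ChartedSpace (Euc m) M] [IsManifold (𝓡 m) ∞ M]
  [MeasurableSpace M] [BorelSpace M] {μ : Measure M}
  {S : SubRiemannian m s M} {U : Set M} {X : Fin s → ∀ q : M, S.H q}
  {e : OpenPartialHomeomorph M (Euc m)} {W K₀ : Set (Euc m)}
  {b : Fin s → Euc m → Euc m} {dens : Euc m → ℝ}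

theorem HasWeakDeriv.add {Y : ∀ q : M, TangentSpace (𝓡 m) q} {u w u' w' : M → ℝ}
    (h : HasWeakDeriv μ U Y u u') (h' : HasWeakDeriv μ U Y w w') (hu : Integrable u μ)
    (hw : Integrable w μ) (hu' : Integrable u' μ) (hw' : Integrable w' μ) :
    HasWeakDeriv μ U Y (u + w) (u' + w') := by
  intro φ ψ hφ hψ hφψ
  have hi : ∀ {g ζ : M → ℝ}, Integrable g μ → IsTestFunction (n := m) U ζ →
      Integrable (fun q => g q * ζ q) μ := fun hg hζ =>
    integrable_mul_of_integrableOn hζ.1.continuous hζ.2.1 hg.integrableOn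
  simp only [Pi.add_apply, add_mul]
  rw [integral_add (hi hu hψ) (hi hw hψ), integral_add (hi hu' hφ) (hi hw' hφ),
    h φ ψ hφ hψ hφψ, h' φ ψ hφ hψ hφψ]

/-- The class of the functions with `k` distributional derivatives in `L^p ∩ L^1`; the
integrability makes distributional derivatives additive. -/
def SobolevTower (μ : Measure M) (k : ℕ) (p : ℝ) (U : Set M) (X : Fin s → ∀ q : M, S.H q)
    (u : M → ℝ) : Prop :=
  Tower (fun i => HasWeakDeriv μ U fun q => (X i q).1)
    (fun _ v => MemLp v (ofReal p) μ ∧ Integrable v μ) k 0 u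

theorem SobolevTower.memSobolev {k : ℕ} {p : ℝ} {u : M → ℝ} (h : SobolevTower μ k p U X u) :
    S.MemSobolev μ k p U X u := by
  obtain ⟨v, hv0, hvD, hvP⟩ := h.exists_family
  exact ⟨v, hv0, hvD, fun I hI => (hvP I hI).1.restrict U⟩

theorem SobolevTower.sum {k : ℕ} {p : ℝ} {κ : Type*} (t : Finset κ) {u : κ → M → ℝ}
    (h : ∀ a ∈ t, SobolevTower μ k p U X (u a)) : SobolevTower μ k p U X (∑ a ∈ t, u a) := by
  classical
  induction t using Finset.induction_on with
  | empty =>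
    exact Tower.of_zero (fun i φ ψ _ _ _ => by simp) fun _ => ⟨MemLp.zero, integrable_zero _ _ _⟩
  | insert a t hat ih =>
    rw [Finset.sum_insert hat]
    exact Tower.add (fun _ u w hu hw => ⟨hu.1.add hw.1, hu.2.add hw.2⟩)
      (fun i _ u w u' w' hu hw hu' hw' h h' => HasWeakDeriv.add h h' hu.2 hw.2 hu'.2 hw'.2)
      (h a (Finset.mem_insert_self a t)) (ih fun c hc => h c (Finset.mem_insert_of_mem hc))

theorem FlowBox.mono (B : FlowBox S U X e W K₀ b) {W' : Set (Euc m)} (hW' : IsOpen W')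
    (h : W' ⊆ W) : FlowBox S U X e W' K₀ b where
  mem_atlas := B.mem_atlas
  isOpen := hW'
  isCompact := B.isCompact
  subset := h.trans B.subset
  subset_target := B.subset_target
  maps := B.maps
  contDiff := B.contDiff
  hasCompactSupport := B.hasCompactSupport
  eq_pushField i x hx := B.eq_pushField i x (h hx)

theorem IsChartDensity.lpLoc_comp_symm (hden : IsChartDensity μ e dens) (hW : IsOpen W)
    (hWe : W ⊆ e.target) {u : M → ℝ} {p : ℝ≥0∞}
    (hu : MemLp u p (μ.restrict (e.source ∩ e ⁻¹' W))) :
    LpLoc p W fun x => u (e.symm x) := by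
  intro K hKW hK
  have h1 := (memLp_indicator_iff_restrict (e.isOpen_inter_preimage hW).measurableSet).2 hu
  have h2 := hden.memLp_comp_symm hK (hKW.trans hWe) (h1.restrict e.source)
  refine (memLp_congr_ae ?_).1 h2
  filter_upwards [ae_restrict_mem hK.measurableSet] with x hx
  have hxt := hWe (hKW hx)
  exact indicator_of_mem (s := e.source ∩ e ⁻¹' W) ⟨e.map_target hxt, by
    rw [mem_preimage, e.right_inv hxt]; exact hKW hx⟩ u

variable [T2Space M] [SecondCountableTopology M] {n r : ℕ} {N : Type*}
  [TopologicalSpace N] [ChartedSpace (Euc n) N] [IsManifold (𝓡 n) ∞ N]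
  [T2Space N] [SecondCountableTopology N] [Nonempty N]
  {T : SubRiemannian n r N} {Q : ℝ} {f : M → N}

/-- The weak derivatives on the manifold of a function that has them in a flow box. -/
theorem FlowBox.sobolevTower (B : FlowBox S U X e W K₀ b) (hX : IsFrameOf S.H U X)
    (hden : IsChartDensity μ e dens) {k : ℕ} {p : ℝ} (hp : 1 ≤ p) {u : M → ℝ}
    (h : Tower (fun i => WeakDeriv (b i) W) (fun _ => LpLoc (ofReal p) W) k 0
      fun x => u (e.symm x)) {φ : M → ℝ} (hφ : IsTestFunction (n := m) (e.source ∩ e ⁻¹' W) φ) :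
    SobolevTower μ k p U X fun q => u q * φ q := by
  have hpE : 1 ≤ ofReal p := by simpa using hp
  have hφ' := isTest_comp_symm B.mem_atlas hφ
  have hK : IsCompact (tsupport (e.target.indicator (φ ∘ e.symm))) := hφ'.2.1
  have h1 := tower_mul_test B.contDiff hpE B.isOpen hK h hφ' subset_rfl
  have h2 := Tower.map
    (D' := fun i => HasWeakDeriv μ U fun q => (X i q).1)
    (P' := fun _ v => MemLp v (ofReal p) μ ∧ Integrable v μ) (chartLift e)
    (fun i _ w w' hw hw' hD => B.hasWeakDeriv_chartLift hX hden hK hφ'.2.2 hw.1.1 hw.2 hw'.1.1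
      hw'.2 hD)
    (fun _ w hw => ⟨hden.memLp_chartLift hK (hφ'.2.2.trans B.target) hw,
      memLp_one_iff_integrable.1 (hden.memLp_chartLift hK (hφ'.2.2.trans B.target)
        ⟨memLp_one_iff_integrable.2 (hw.integrable hK hpE), hw.2⟩)⟩) h1
  rw [SobolevTower]
  convert h2 using 1
  ext q
  by_cases hq : q ∈ e.source
  · simp [chartLift, hq, e.map_source hq]
  · have : φ q = 0 := image_eq_zero_of_notMem_tsupport fun h => hq (hφ.2.2 h).1
    simp [chartLift, hq, this]

variable (hμ : IsSmoothVolume (n := m) μ) (hQ : 1 ≤ Q)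
  (hfc : Continuous f) (hf : IsACC S T μ Q f)
  {y : OpenPartialHomeomorph N (Euc n)}
  (hy : y ∈ IsManifold.maximalAtlas (𝓡 n) ∞ N) {Y : Fin r → ∀ q : N, T.H q}
  (hY : T.IsHorizontalCoordinates y Y) {Ω : Set M} (hfΩ : MapsTo f Ω y.source) {k : ℕ}
  (hk : 1 ≤ k) {p : ℝ} (hp : 1 ≤ p)
  (h : ∀ j : Fin r, S.MemSobolevLoc μ k p Ω (fun q => y (f q) (Fin.castLE T.rank_le j)))
include hμ hQ hfc hf hy hY hfΩ hk hp h

/-- Near each point all coordinates of `f` are in the Sobolev class. -/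
theorem IsACC.exists_sobolevTower (j : Fin n) (hU : IsOpen U) (hUΩ : U ⊆ Ω)
    (hX : S.IsOrthonormalFrame U X) {q₀ : M}
    (hq₀ : q₀ ∈ U) :
    ∃ V : Set M, IsOpen V ∧ q₀ ∈ V ∧ ∀ φ, IsTestFunction (n := m) V φ →
      SobolevTower μ k p U X fun q => y (f q) j * φ q := by
  obtain ⟨e, W, K₀, b, B, hqe, hqW⟩ := exists_flowBox S hU hX.1 hq₀
  obtain ⟨dens, hden⟩ := hμ.exists_isChartDensity B.mem_atlas
  obtain ⟨C, hC, hqC, hCW⟩ := exists_compact_subset B.isOpen hqW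
  have B₁ := B.mono isOpen_interior (interior_subset.trans hCW)
  have hUW : IsOpen (e.source ∩ e ⁻¹' W) := e.isOpen_inter_preimage B.isOpen
  have hXW : S.IsOrthonormalFrame (e.source ∩ e ⁻¹' W) X :=
    ⟨hX.1.mono B.preimage_subset, fun q hq => hX.2 q (B.preimage_subset hq)⟩
  obtain ⟨χ, hχ, hχ1, -⟩ := exists_isTestFunction_eq_one (n := m)
    (hC.image_of_continuousOn (e.continuousOn_symm.mono (hCW.trans B.target))) hUW (by
      rintro _ ⟨x, hx, rfl⟩
      have hxt := B.target (hCW hx)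
      exact ⟨e.map_target hxt, by rw [mem_preimage, e.right_inv hxt]; exact hCW hx⟩)
  obtain ⟨G, hG⟩ := hY.exists_coeff hy
  have hfO : ∀ x ∈ interior C, f (e.symm x) ∈ y.source := fun x hx =>
    hfΩ (hUΩ (B₁.maps x (B₁.subset hx)))
  have hFc : ContinuousOn (fun x => y (f (e.symm x))) (interior C) :=
    y.continuousOn.comp (hfc.comp_continuousOn (e.continuousOn_symm.mono B₁.target)) hfO
  have hbase : ∀ l : Fin r, Tower (fun i => WeakDeriv (b i) (interior C))
      (fun _ => LpLoc (ofReal p) (interior C)) k 0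
      fun x => y (f (e.symm x)) (Fin.castLE T.rank_le l) := by
    intro l
    obtain ⟨v, hv0, hvD, hvP⟩ := h l _ X hUW (B.preimage_subset.trans hUΩ) hXW χ hχ
    have h1 := Tower.map (D' := fun i => WeakDeriv (b i) W)
      (P' := fun _ => LpLoc (ofReal p) W) (fun u x => u (e.symm x))
      (fun i _ u u' hu hu' hD => B.weakDeriv_of_hasWeakDeriv hX.1 hden hu.1 hu'.1 hD)
      (fun _ u hu => hden.lpLoc_comp_symm B.isOpen B.target hu)
      (Tower.of_family (a := 0) (P := fun _ u => MemLp u (ofReal p)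
        (μ.restrict (e.source ∩ e ⁻¹' W))) v hvD hvP)
    have hsub : interior C ⊆ W := interior_subset.trans hCW
    have h2 := h1.imp (D' := fun i => WeakDeriv (b i) (interior C))
      (P' := fun _ => LpLoc (ofReal p) (interior C))
      (fun i u u' hD => hD.mono hsub) fun _ u _ _ hu K hK => hu K (hK.trans hsub)
    have heq : ∀ x ∈ interior C, v [] (e.symm x) =
        y (f (e.symm x)) (Fin.castLE T.rank_le l) := by
      intro x hx
      have h3 : χ (e.symm x) = 1 := hχ1.self_of_nhdsSet _ ⟨x, interior_subset hx, rfl⟩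
      simp [hv0, h3]
    refine h2.congr_base (fun i u' hD => hD.congr (ae_of_all _ heq) (ae_of_all _ fun _ _ => rfl))
      fun hP K hK hKc => ?_
    refine (memLp_congr_ae ?_).1 (hP K hK hKc)
    filter_upwards [ae_restrict_mem hKc.measurableSet] with x hx using heq x (hK hx)
  have hall := tower_lpLoc_of_horizontal B₁.contDiff B₁.hasCompactSupport B₁.isOpen hk hp
    y.open_target (f := fun j x => y (f (e.symm x)) j)
    (fun j => (EuclideanSpace.proj (𝕜 := ℝ) j).continuous.comp_continuousOn hFc)
    (fun x hx => y.map_source (hfO x hx)) (Fin.castLE T.rank_le)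
    (G := fun j l => G j l ∘ y.symm) (fun j l =>
      (((hG j).smooth_coeff l).comp (contMDiffOn_symm_of_mem_maximalAtlas hy) fun x hx =>
        y.map_target hx).contDiffOn)
    (fun i g hg hD j => by
      have := B₁.weakDeriv_of_horizontal hU hX hμ hQ hfc hf hfO (hG j) hg hD
      refine this.congr (ae_of_all _ fun _ _ => rfl) (ae_of_all _ fun x hx => ?_)
      refine sum_congr rfl fun l _ => ?_
      rw [Function.comp_apply]
      congr 2
      exact (y.left_inv (hfO x hx)).symm) hbase j
  exact ⟨e.source ∩ e ⁻¹' interior C, e.isOpen_inter_preimage isOpen_interior, ⟨hqe, hqC⟩,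
    fun φ hφ => B₁.sobolevTower hX.1 hden hp hall hφ⟩

theorem IsACC.memSobolevLoc (j : Fin n) :
    S.MemSobolevLoc μ k p Ω (fun q => y (f q) j) := by
  intro U X hU hUΩ hX φ hφ
  have : LocallyCompactSpace M := ChartedSpace.locallyCompactSpace (Euc m) M
  choose V hV hqV hVφ using fun q₀ : U =>
    hf.exists_sobolevTower hμ hQ hfc hy hY hfΩ hk hp h j hU hUΩ hX q₀.2
  obtain ⟨t, ht⟩ := hφ.2.1.elim_finite_subcover V hV fun q hq =>
    mem_iUnion.2 ⟨⟨q, hφ.2.2 hq⟩, hqV _⟩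
  obtain ⟨ρ, hρ⟩ := SmoothPartitionOfUnity.exists_isSubordinate (𝓡 m) (isClosed_tsupport φ)
    (fun a : t => V a) (fun a => hV a) fun q hq => by simpa using ht hq
  have hsum : (fun q => y (f q) j * φ q) = ∑ a : t, fun q => y (f q) j * (ρ a q * φ q) := by
    ext q
    rw [Finset.sum_apply, ← mul_sum, ← sum_mul]
    by_cases hq : q ∈ tsupport φ
    · have := ρ.sum_eq_one hq
      rw [finsum_eq_sum_of_fintype] at this
      rw [this, one_mul]
    · simp [image_eq_zero_of_notMem_tsupport hq]
  rw [hsum]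
  have htest : ∀ a : t, IsTestFunction (n := m) (V a) fun q => ρ a q * φ q := fun a =>
    ⟨(ρ a).contMDiff.mul hφ.1, hφ.2.1.mul_left, (tsupport_mul_subset_left).trans (hρ a)⟩
  exact (SobolevTower.sum (Finset.univ : Finset t)
    (u := fun a q => y (f q) j * (ρ a q * φ q)) fun a _ => hVφ a _ (htest a)).memSobolev

end GlobalSobolev

end SubRiem

theorem mainTheorem10 {m s n r : ℕ} {M N : Type*}
    [TopologicalSpace M] [ChartedSpace (EuclideanSpace ℝ (Fin m)) M] [IsManifold (𝓡 m) ∞ M]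
    [T2Space M] [SecondCountableTopology M] [ConnectedSpace M] [MeasurableSpace M] [BorelSpace M]
    [TopologicalSpace N] [ChartedSpace (EuclideanSpace ℝ (Fin n)) N] [IsManifold (𝓡 n) ∞ N]
    [T2Space N] [SecondCountableTopology N] [ConnectedSpace N]
    (S : SubRiem.SubRiemannian m s M) (T : SubRiem.SubRiemannian n r N)
    (μ : Measure M) (hμ : SubRiem.IsSmoothVolume (n := m) μ)
    (Q : ℝ) (hQ : 1 ≤ Q)
    (f : M → N) (hfc : Continuous f) (hf : SubRiem.IsACC S T μ Q f)
    (y : OpenPartialHomeomorph N (EuclideanSpace ℝ (Fin n)))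
    (hy : y ∈ IsManifold.maximalAtlas (𝓡 n) ∞ N)
    (X : Fin r → ∀ q : N, T.H q) (hX : T.IsHorizontalCoordinates y X)
    (Ω : Set M) (hΩ : IsOpen Ω) (hfΩ : MapsTo f Ω y.source)
    (k : ℕ) (hk : 1 ≤ k) :
    (∀ α : ℝ, α ∈ Ioo (0 : ℝ) 1 →
      (∀ j : Fin r, S.MemHolderLoc k α Ω (fun q => y (f q) (Fin.castLE T.rank_le j))) →
      ∀ j : Fin n, S.MemHolderLoc k α Ω (fun q => y (f q) j)) ∧
    (∀ p : ℝ, 1 ≤ p →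
      (∀ j : Fin r, S.MemSobolevLoc μ k p Ω (fun q => y (f q) (Fin.castLE T.rank_le j))) →
      ∀ j : Fin n, S.MemSobolevLoc μ k p Ω (fun q => y (f q) j)) := by
  exact ⟨fun α hα h j => hf.memHolderLoc hμ hQ hfc hy hX hfΩ hk hα h j,
    fun p hp h j => hf.memSobolevLoc hμ hQ hfc hy hX hfΩ hk hp h j⟩
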